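/- **Setting.** Let $k\in(1/3,1)$, $\zeta>0$, $\varepsilon>0$, $\tau=\zeta\varepsilon$. Let $\mathcal A_\varepsilon$ be the set of $u:\varepsilon\mathbb Z^2\to\{-1,0,1\}$ with $Z_u:=\{u=0\}$ finite, and put $I_u:=\{u=1\}$. For $u,w\in\mathcal A_\varepsilon$ and $\gamma>0$ let $$\mathcal E_\varepsilon(u)=\sum_{\{p,q\}:\,|p-q|=\varepsilon}\varepsilon\bigl(1-u(p)u(q)-k(1-(u(p)u(q))^2)\bigr),\qquad \mathcal F^{\tau,\gamma}_\varepsilon(u,w)=\mathcal E_\varepsilon(u)+\frac1\tau\Bigl(\sum_{p\in I_u\triangle I_w}\varepsilon^2 d_1(p,\partial I_w)+\varepsilon^\gamma\,\bigl|\#Z_u-\#Z_w\bigr|\Bigr)$$ (values in $[0,+\infty]$, every pair of nearest neighbours counted once), where $d_1(p,\partial I)$ is the $\ell^1$-distance of $p$ from $I$ if $p\notin I$, and from $\varepsilon\mathbb Z^2\setminus I$ if $p\in I$. A *minimizer* of $\mathcal F^{\tau,\gamma}_\varepsilon(\cdot,w)$ is one over $\mathcal A_\varepsilon$. For $I\subset\varepsilon\mathbb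 Z^2$, $\partial^+I$ (resp. $\partial^-I$) is the set of sites outside (resp. in) $I$ with a nearest neighbour in (resp. outside) $I$, and $\mathbb O(I)$ is the set of $p\in\partial^+I$ with exactly two nearest neighbours in $I$. A *staircase set* is a nonempty finite connected set that is horizontally and vertically convex; its *external slices* $\mathscr P_1,\dots,\mathscr P_4$ are its lowest row, leftmost column, highest row and rightmost column, and $\tilde{\mathscr P}_1,\dots,\tilde{\mathscr P}_4$ are the rows/columns of $I$ next to these. A *discrete octagon* is $A\cap\varepsilon\mathbb Z^2$, where $A\subset\mathbb R^2$ is a convex octagon with nonempty interior and with sides, possibly of length zero, parallel to $e_1,e_2,e_1\pm e_2$. A *quasi-octagon* is a staircase set $I=\tilde I\cup\bigcup_i\mathscr P_i$ with $\tilde I$ a discrete octagon, such that any two nearest neighbours $p,q\in\partial^-I$ lie in a common $\mathscr P_i$ or in a common $\tilde{\mathscr P}_i$. Given $\overline R,\overline c>0$, a set $I\subset\varepsilon\mathbb Z^2$ satisfies $(\mathrm H)$ if it is a staircase set contained in a ball of radius $\overline R$ and $\#\mathscr P_i\ge\overline c/\varepsilon$ for $i=1,\dots,4$. **Proposition.**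 Let $k\in(1/3,1)$, $\zeta,\overline R,\overline c>0$ and $\gamma=2$. (i) If $\zeta<\frac1{4k}$, there is $\bar\varepsilon>0$, depending only on $k,\zeta,\overline R,\overline c$, such that for every $0<\varepsilon\le\bar\varepsilon$, every $u_j\in\mathcal A_\varepsilon$ with $I_{u_j}$ satisfying $(\mathrm H)$ and every minimizer $u_{j+1}$ of $\mathcal F^{\tau,2}_\varepsilon(\cdot,u_j)$ one has $\#Z_{u_{j+1}}=\#Z_{u_j}$. In particular $u_{j+1}$ is also a minimizer of $\mathcal F^{\tau,\gamma'}_\varepsilon(\cdot,u_j)$ for every $\gamma'\in(0,2)$, so that what holds for all minimizers in the case $\gamma'<2$ applies to it. (ii) If $\zeta=\frac1{4k}$ and $\mu<\frac14$, there is $\bar\varepsilon>0$, depending only on $k,\mu,\overline R,\overline c$, such that for every $0<\varepsilon\le\bar\varepsilon$ and every $u_j\in\mathcal A_\varepsilon$ such that $I_{u_j}$ is a quasi-octagon satisfying $(\mathrm H)$ with $$\#\partial^+I_{u_j}>\#Z_{u_j}+8\varepsilon^{\mu-1},$$ every minimizer $u_{j+1}$ of $\mathcal F^{\tau,2}_\varepsilon(\cdot,u_j)$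 has the following properties: $I_{u_{j+1}}$ is a quasi-octagon; $\#Z_{u_{j+1}}\ge\#Z_{u_j}$; there is a minimizer $\tilde u_{j+1}$ of $\mathcal F^{\tau,2}_\varepsilon(\cdot,u_j)$ with $\#Z_{\tilde u_{j+1}}=\#Z_{u_j}$ and $I_{\tilde u_{j+1}}=I_{u_{j+1}}$; and if moreover $\mathbb O(I_{u_j})\subset Z_{u_j}$, then $\#Z_{u_{j+1}}=\#Z_{u_j}$. -/

import Mathlib

open Set
open scoped ENNReal

namespace Surfactant

/-! Lattice sites. The point `ε z` of `ε ℤ²` is represented by its integer coordinates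
`z : ℤ × ℤ`; the spacing `ε` enters through the energies and the distances. -/

/-- The nearest-neighbour graph of the square lattice. -/
def grid : SimpleGraph (ℤ × ℤ) where
  Adj p q := |p.1 - q.1| + |p.2 - q.2| = 1
  symm := ⟨fun p q h => by rw [abs_sub_comm q.1, abs_sub_comm q.2]; exact h⟩
  loopless := ⟨fun p h => by simp at h⟩

/-- A spin configuration with values in `{-1, 0, 1}`. -/
abbrev Config := ℤ × ℤ → SignType

/-- The phase-one set `{u = 1}`. -/
def phaseOne (u : Config) : Set (ℤ × ℤ) := {p | u p = 1}

/-- The surfactant set `{u = 0}`. -/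
def surfactant (u : Config) : Set (ℤ × ℤ) := {p | u p = 0}

/-- Admissible configurations: the surfactant set is finite. -/
def Admissible (u : Config) : Prop := (surfactant u).Finite

/-- The energy of one bond whose end points carry the spins `a` and `b`; it is nonnegative
for `0 < ε` and `k < 1`. -/
noncomputable def bondEnergy (ε k : ℝ) (a b : SignType) : ℝ :=
  ε * (1 - (a : ℝ) * (b : ℝ) - k * (1 - ((a : ℝ) * (b : ℝ)) ^ 2))

/-- The energy: the sum of the bond energies, every bond (unordered pair of nearest neighbours)
being counted once, through its left or lower end point. -/
noncomputable def energy (ε k : ℝ) (u : Config) : ℝ≥0∞ :=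
  ∑' p : ℤ × ℤ, (ENNReal.ofReal (bondEnergy ε k (u p) (u (p + (1, 0)))) +
    ENNReal.ofReal (bondEnergy ε k (u p) (u (p + (0, 1)))))

/-- The `ℓ¹` distance of the sites `ε p` and `ε q`. -/
noncomputable def latticeDist (ε : ℝ) (p q : ℤ × ℤ) : ℝ≥0∞ :=
  ENNReal.ofReal (ε * ((|p.1 - q.1| + |p.2 - q.2| : ℤ) : ℝ))

open Classical in
/-- The discrete `ℓ¹` distance of a site from the discrete boundary of `I`. -/
noncomputable def bdryDist (ε : ℝ) (p : ℤ × ℤ) (I : Set (ℤ × ℤ)) : ℝ≥0∞ :=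
  if p ∈ I then ⨅ q ∈ Iᶜ, latticeDist ε p q else ⨅ q ∈ I, latticeDist ε p q

/-- The dissipation of the phase-one sets. -/
noncomputable def dissOne (ε : ℝ) (I J : Set (ℤ × ℤ)) : ℝ≥0∞ :=
  ∑' p : ↥(symmDiff I J), ENNReal.ofReal (ε ^ 2) * bdryDist ε p J

/-- The dissipation of the surfactant (for finite sets): the change of the mass. -/
noncomputable def dissZero (Z W : Set (ℤ × ℤ)) : ℝ≥0∞ :=
  ENNReal.ofReal |(Z.ncard : ℝ) - (W.ncard : ℝ)|

/-- The total dissipation. -/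
noncomputable def dissipation (ε γ : ℝ) (u w : Config) : ℝ≥0∞ :=
  dissOne ε (phaseOne u) (phaseOne w) +
    ENNReal.ofReal (ε ^ γ) * dissZero (surfactant u) (surfactant w)

/-- The functional minimized at each time step, with time step `τ = ζ ε`. -/
noncomputable def totalEnergy (ε k ζ γ : ℝ) (u w : Config) : ℝ≥0∞ :=
  energy ε k u + ENNReal.ofReal (1 / (ζ * ε)) * dissipation ε γ u w

/-- `u` minimizes the total energy with previous state `w` among admissible configurations. -/
def IsMinimizer (ε k ζ γ : ℝ) (w u : Config) : Prop :=
  Admissible u ∧ ∀ v : Config, Admissible v → totalEnergy ε k ζ γ u w ≤ totalEnergy ε k ζ γ v w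

/-- The exterior boundary: the sites outside `I` with a nearest neighbour in `I`. -/
def outerBdry (I : Set (ℤ × ℤ)) : Set (ℤ × ℤ) := {p | p ∉ I ∧ ∃ q ∈ I, grid.Adj p q}

/-- The interior boundary: the sites of `I` with a nearest neighbour outside `I`. -/
def innerBdry (I : Set (ℤ × ℤ)) : Set (ℤ × ℤ) := {p | p ∈ I ∧ ∃ q, q ∉ I ∧ grid.Adj p q}

/-- The sites of the exterior boundary with exactly two nearest neighbours in `I`. -/
def outerCorners (I : Set (ℤ × ℤ)) : Set (ℤ × ℤ) :=
  {p | p ∈ outerBdry I ∧ (grid.neighborSet p ∩ I).ncard = 2}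

/-- Staircase sets: (nonempty, finite) connected sets that are horizontally and vertically
convex. -/
structure IsStaircase (I : Set (ℤ × ℤ)) : Prop where
  finite : I.Finite
  connected : (grid.induce I).Connected
  horizontal : ∀ x₁ x₂ x₃ y : ℤ, x₁ ≤ x₂ → x₂ ≤ x₃ → (x₁, y) ∈ I → (x₃, y) ∈ I → (x₂, y) ∈ I
  vertical : ∀ x y₁ y₂ y₃ : ℤ, y₁ ≤ y₂ → y₂ ≤ y₃ → (x, y₁) ∈ I → (x, y₃) ∈ I → (x, y₂) ∈ I

/-- The external slices of `I`, in the order lowest, leftmost, highest, rightmost. -/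
def extSlice (I : Set (ℤ × ℤ)) : Fin 4 → Set (ℤ × ℤ) :=
  ![{p | p ∈ I ∧ ∀ q ∈ I, p.2 ≤ q.2}, {p | p ∈ I ∧ ∀ q ∈ I, p.1 ≤ q.1},
    {p | p ∈ I ∧ ∀ q ∈ I, q.2 ≤ p.2}, {p | p ∈ I ∧ ∀ q ∈ I, q.1 ≤ p.1}]

/-- The slices of `I` next to the external ones, in the same order. -/
def secondSlice (I : Set (ℤ × ℤ)) : Fin 4 → Set (ℤ × ℤ) :=
  ![{p | p ∈ I ∧ ∃ q ∈ extSlice I 0, p.2 = q.2 + 1}, {p | p ∈ I ∧ ∃ q ∈ extSlice I 1, p.1 = q.1 + 1},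
    {p | p ∈ I ∧ ∃ q ∈ extSlice I 2, p.2 = q.2 - 1}, {p | p ∈ I ∧ ∃ q ∈ extSlice I 3, p.1 = q.1 - 1}]

/-- Octagons in the plane: convex regions with nonempty interior bounded by sides (possibly
of length zero) parallel to `e₁`, `e₂`, `e₁ + e₂`, `e₁ - e₂`. -/
def IsOctagon (A : Set (ℝ × ℝ)) : Prop :=
  (interior A).Nonempty ∧ ∃ a a' b b' c c' d d' : ℝ,
    A = {x | x.1 ∈ Icc a a' ∧ x.2 ∈ Icc b b' ∧ x.1 + x.2 ∈ Icc c c' ∧ x.1 - x.2 ∈ Icc d d'}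

/-- Discrete octagons: the lattice points of an octagon. Octagons are invariant under dilations,
so the spacing is irrelevant. -/
def IsDiscreteOctagon (I : Set (ℤ × ℤ)) : Prop :=
  ∃ A : Set (ℝ × ℝ), IsOctagon A ∧ I = {p | ((p.1 : ℝ), (p.2 : ℝ)) ∈ A}

/-- Quasi-octagons: staircase sets that consist of a discrete octagon and of the external slices,
the external slices being attached in such a way that two consecutive sites of the interior
boundary always lie in a common external slice or in a common slice next to an external one
(so that all other steps of the boundary are diagonal). -/
structure IsQuasiOctagon (I : Set (ℤ × ℤ)) : Prop where
  staircase : IsStaircase I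
  decomposition : ∃ J : Set (ℤ × ℤ), IsDiscreteOctagon J ∧ I = J ∪ ⋃ i, extSlice I i
  flat : ∀ p ∈ innerBdry I, ∀ q ∈ innerBdry I, (q = p + (1, 0) ∨ q = p + (0, 1)) →
    ∃ i, {p, q} ⊆ extSlice I i ∨ {p, q} ⊆ secondSlice I i

/-- The regularity assumption with constants `R` and `c` at the spacing `ε`. -/
def AssumptionH (R c ε : ℝ) (I : Set (ℤ × ℤ)) : Prop :=
  IsStaircase I ∧
  (∃ x y : ℝ, ∀ p ∈ I, (ε * p.1 - x) ^ 2 + (ε * p.2 - y) ^ 2 ≤ R ^ 2) ∧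
  ∀ i, c / ε ≤ ((extSlice I i).ncard : ℝ)

end Surfactant

namespace Surfactant

/-- The spin configuration with phase-one set `I` and surfactant `Z \ I`. -/
def spin (I Z : Finset (ℤ × ℤ)) : Config := fun p => if p ∈ I then 1 else if p ∈ Z then 0 else -1

/-- The bond energy per unit length. -/
noncomputable def bnd (k : ℝ) (a b : SignType) : ℝ :=
  if a = 0 ∨ b = 0 then 1 - k else if a = b then 0 else 2

lemma bondEnergy_eq (ε k : ℝ) (a b : SignType) : bondEnergy ε k a b = ε * bnd k a b := by
  cases a <;> cases b <;> simp [bondEnergy, bnd] <;> norm_num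

lemma bnd_nonneg {k : ℝ} (hk : k < 1) (a b : SignType) : 0 ≤ bnd k a b := by
  unfold bnd; split_ifs <;> linarith

lemma bnd_le_two {k : ℝ} (hk : 0 < k) (a b : SignType) : bnd k a b ≤ 2 := by
  unfold bnd; split_ifs <;> linarith

lemma bnd_comm (k : ℝ) (a b : SignType) : bnd k a b = bnd k b a := by
  unfold bnd; simp only [or_comm, eq_comm]

@[simp] lemma bnd_zero_left (k : ℝ) (b : SignType) : bnd k 0 b = 1 - k := by simp [bnd]
@[simp] lemma bnd_zero_right (k : ℝ) (b : SignType) : bnd k b 0 = 1 - k := by simp [bnd]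
@[simp] lemma bnd_one_one (k : ℝ) : bnd k 1 1 = 0 := by simp [bnd]
@[simp] lemma bnd_neg_neg (k : ℝ) : bnd k (-1) (-1) = 0 := by simp [bnd]
@[simp] lemma bnd_one_neg (k : ℝ) : bnd k 1 (-1) = 2 := by simp [bnd]
@[simp] lemma bnd_neg_one (k : ℝ) : bnd k (-1) 1 = 2 := by simp [bnd]

lemma phaseOne_spin (I Z : Finset (ℤ × ℤ)) : phaseOne (spin I Z) = ↑I := by
  ext p; simp only [phaseOne, spin, Set.mem_ofPred_eq, Finset.mem_coe]
  split_ifs <;> simp_all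

lemma surfactant_spin {I Z : Finset (ℤ × ℤ)} (h : Disjoint I Z) :
    surfactant (spin I Z) = ↑Z := by
  ext p; simp only [surfactant, spin, Set.mem_ofPred_eq, Finset.mem_coe]
  have : p ∈ I → p ∉ Z := fun h1 => Finset.disjoint_left.1 h h1
  split_ifs <;> simp_all

lemma spin_eq_one {I Z : Finset (ℤ × ℤ)} {p : ℤ × ℤ} : spin I Z p = 1 ↔ p ∈ I := by
  unfold spin; split_ifs <;> simp_all

lemma spin_eq_zero {I Z : Finset (ℤ × ℤ)} (h : Disjoint I Z) {p : ℤ × ℤ} :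
    spin I Z p = 0 ↔ p ∈ Z := by
  have : p ∈ I → p ∉ Z := fun h1 => Finset.disjoint_left.1 h h1
  unfold spin; split_ifs <;> simp_all

lemma spin_eq_neg {I Z : Finset (ℤ × ℤ)} {p : ℤ × ℤ} :
    spin I Z p = -1 ↔ p ∉ I ∧ p ∉ Z := by
  unfold spin; split_ifs <;> simp_all

/-- Configurations equal to `-1` outside a finite set. -/
def FinSupp (u : Config) : Prop := {p | u p ≠ -1}.Finite

lemma finSupp_spin (I Z : Finset (ℤ × ℤ)) : FinSupp (spin I Z) := by
  refine (I ∪ Z).finite_toSet.subset fun p hp => ?_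
  simp only [Set.mem_ofPred_eq, ne_eq, spin_eq_neg] at hp
  simp only [Finset.coe_union, Set.mem_union, Finset.mem_coe]; tauto

lemma eq_spin {u : Config} (h1 : (phaseOne u).Finite) (h0 : (surfactant u).Finite) :
    ∃ I Z : Finset (ℤ × ℤ), Disjoint I Z ∧ u = spin I Z := by
  refine ⟨h1.toFinset, h0.toFinset, ?_, ?_⟩
  · rw [Finset.disjoint_left]; intro p hp hq
    simp [phaseOne, surfactant] at hp hq; simp [hp] at hq
  · ext p
    simp only [spin, Set.Finite.mem_toFinset, phaseOne, surfactant, Set.mem_ofPred_eq]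
    rcases h : u p <;> simp

/-- The bond energies attached to the site `p`: its right and its upper bond. -/
noncomputable def bondSum (k : ℝ) (u : Config) (p : ℤ × ℤ) : ℝ :=
  bnd k (u p) (u (p + (1, 0))) + bnd k (u p) (u (p + (0, 1)))

/-- The energy per unit length. -/
noncomputable def en (k : ℝ) (u : Config) : ℝ := ∑ᶠ p, bondSum k u p

lemma bondSum_nonneg {k : ℝ} (hk : k < 1) (u : Config) (p : ℤ × ℤ) : 0 ≤ bondSum k u p :=
  add_nonneg (bnd_nonneg hk _ _) (bnd_nonneg hk _ _)

/-- A finite set of sites carrying all bonds of `u`. -/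
lemma FinSupp.exists_box {u : Config} (hu : FinSupp u) :
    ∃ B : Finset (ℤ × ℤ), ∀ p ∉ B, u p = -1 ∧ u (p + (1, 0)) = -1 ∧ u (p + (0, 1)) = -1 := by
  classical
  refine ⟨hu.toFinset ∪ hu.toFinset.image (· - (1, 0)) ∪ hu.toFinset.image (· - (0, 1)), ?_⟩
  intro p hp
  have hm : ∀ q, q ∈ hu.toFinset ↔ u q ≠ -1 := fun q => hu.mem_toFinset
  simp only [Finset.mem_union, Finset.mem_image, hm, not_or, not_exists, not_and] at hp
  refine ⟨not_not.1 hp.1.1, ?_, ?_⟩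
  · by_contra h; exact hp.1.2 _ h (by simp)
  · by_contra h; exact hp.2 _ h (by simp)

lemma bondSum_eq_zero {k : ℝ} {u : Config} {p : ℤ × ℤ}
    (h : u p = -1 ∧ u (p + (1, 0)) = -1 ∧ u (p + (0, 1)) = -1) : bondSum k u p = 0 := by
  simp [bondSum, h.1, h.2.1, h.2.2]

lemma en_eq_sum {k : ℝ} {u : Config} {B : Finset (ℤ × ℤ)}
    (hB : ∀ p ∉ B, u p = -1 ∧ u (p + (1, 0)) = -1 ∧ u (p + (0, 1)) = -1) :
    en k u = ∑ p ∈ B, bondSum k u p := by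
  refine finsum_eq_sum_of_support_subset _ fun p hp => ?_
  by_contra h
  exact hp (bondSum_eq_zero (hB p h))

lemma support_bondSum {k : ℝ} {u : Config} (hu : FinSupp u) :
    (Function.support (bondSum k u)).Finite := by
  obtain ⟨B, hB⟩ := hu.exists_box
  refine B.finite_toSet.subset fun p hp => ?_
  by_contra h
  exact hp (bondSum_eq_zero (hB p h))

lemma en_nonneg {k : ℝ} (hk : k < 1) (u : Config) : 0 ≤ en k u :=
  finsum_nonneg fun p => bondSum_nonneg hk u p

lemma energy_eq {ε k : ℝ} (hε : 0 < ε) (hk : k < 1) {u : Config} (hu : FinSupp u) :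
    energy ε k u = ENNReal.ofReal (ε * en k u) := by
  obtain ⟨B, hB⟩ := hu.exists_box
  have hterm : ∀ p, ENNReal.ofReal (bondEnergy ε k (u p) (u (p + (1, 0)))) +
      ENNReal.ofReal (bondEnergy ε k (u p) (u (p + (0, 1)))) =
      ENNReal.ofReal (ε * bondSum k u p) := by
    intro p
    rw [bondEnergy_eq, bondEnergy_eq, ← ENNReal.ofReal_add, ← mul_add]; rfl
    · exact mul_nonneg hε.le (bnd_nonneg hk _ _)
    · exact mul_nonneg hε.le (bnd_nonneg hk _ _)
  unfold energy
  simp_rw [hterm]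
  rw [tsum_eq_sum (s := B), en_eq_sum hB, Finset.mul_sum, ENNReal.ofReal_sum_of_nonneg]
  · intro p _; exact mul_nonneg hε.le (bondSum_nonneg hk u p)
  · intro p hp; rw [bondSum_eq_zero (hB p hp)]; simp

/-- The `ℓ¹` distance on the lattice. -/
def dist1 (p q : ℤ × ℤ) : ℕ := (p.1 - q.1).natAbs + (p.2 - q.2).natAbs

lemma latticeDist_eq (ε : ℝ) (p q : ℤ × ℤ) :
    latticeDist ε p q = ENNReal.ofReal (ε * (dist1 p q : ℝ)) := by
  unfold latticeDist dist1
  congr 2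
  push_cast [← Int.natCast_natAbs]
  simp

/-- The number of steps from `p` to the other side of the boundary of `J`. -/
noncomputable def dep (J : Finset (ℤ × ℤ)) (p : ℤ × ℤ) : ℕ :=
  sInf {n | ∃ q, (q ∈ J ↔ p ∉ J) ∧ dist1 p q = n}

lemma exists_other {J : Finset (ℤ × ℤ)} (hJ : J.Nonempty) (p : ℤ × ℤ) :
    ∃ q, (q ∈ J ↔ p ∉ J) := by
  by_cases h : p ∈ J
  · obtain ⟨q, hq⟩ := Infinite.exists_notMem_finset J
    exact ⟨q, by tauto⟩
  · obtain ⟨q, hq⟩ := hJ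
    exact ⟨q, by tauto⟩

lemma dep_spec {J : Finset (ℤ × ℤ)} (hJ : J.Nonempty) (p : ℤ × ℤ) :
    ∃ q, (q ∈ J ↔ p ∉ J) ∧ dist1 p q = dep J p := by
  obtain ⟨q, hq⟩ := exists_other hJ p
  exact Nat.sInf_mem (s := {n | ∃ q, (q ∈ J ↔ p ∉ J) ∧ dist1 p q = n}) ⟨_, q, hq, rfl⟩

lemma dep_le {J : Finset (ℤ × ℤ)} {p q : ℤ × ℤ} (h : q ∈ J ↔ p ∉ J) : dep J p ≤ dist1 p q :=
  Nat.sInf_le ⟨q, h, rfl⟩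

lemma dep_pos {J : Finset (ℤ × ℤ)} (hJ : J.Nonempty) (p : ℤ × ℤ) : 0 < dep J p := by
  obtain ⟨q, hq, hd⟩ := dep_spec hJ p
  rcases Nat.eq_zero_or_pos (dep J p) with h | h
  · rw [h] at hd
    have : p = q := by
      unfold dist1 at hd
      ext <;> omega
    subst this; tauto
  · exact h

lemma bdryDist_eq {ε : ℝ} (hε : 0 < ε) {J : Finset (ℤ × ℤ)} (hJ : J.Nonempty) (p : ℤ × ℤ) :
    bdryDist ε p ↑J = ENNReal.ofReal (ε * dep J p) := by
  obtain ⟨q, hq, hd⟩ := dep_spec hJ p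
  have hle : ∀ r, (r ∈ J ↔ p ∉ J) → ENNReal.ofReal (ε * dep J p) ≤ latticeDist ε p r := by
    intro r hr
    rw [latticeDist_eq]
    apply ENNReal.ofReal_le_ofReal
    have : (dep J p : ℝ) ≤ dist1 p r := by exact_mod_cast dep_le hr
    gcongr
  have hq' : latticeDist ε p q = ENNReal.ofReal (ε * dep J p) := by rw [latticeDist_eq, hd]
  unfold bdryDist
  by_cases h : p ∈ J
  · rw [if_pos (by simpa using h)]
    apply le_antisymm
    · rw [← hq']; exact iInf₂_le q (by simp; tauto)
    · refine le_iInf₂ fun r hr => hle r ?_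
      simp at hr; tauto
  · rw [if_neg (by simpa using h)]
    apply le_antisymm
    · rw [← hq']; exact iInf₂_le q (by simp; tauto)
    · refine le_iInf₂ fun r hr => hle r ?_
      simp at hr; tauto

/-- The rescaled dissipation of phase one. -/
noncomputable def diss (J I : Finset (ℤ × ℤ)) : ℕ := ∑ p ∈ symmDiff I J, dep J p

lemma dissOne_eq {ε : ℝ} (hε : 0 < ε) {J : Finset (ℤ × ℤ)} (hJ : J.Nonempty)
    (I : Finset (ℤ × ℤ)) : dissOne ε ↑I ↑J = ENNReal.ofReal (ε ^ 3 * diss J I) := by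
  unfold dissOne
  have hc : (symmDiff (↑I : Set (ℤ × ℤ)) ↑J) = ↑(symmDiff I J) := by
    rw [Finset.coe_symmDiff]
  rw [hc, Finset.tsum_subtype' (symmDiff I J)
    (fun p => ENNReal.ofReal (ε ^ 2) * bdryDist ε p ↑J)]
  have : ∀ p ∈ symmDiff I J, ENNReal.ofReal (ε ^ 2) * bdryDist ε p ↑J
      = ENNReal.ofReal (ε ^ 3 * dep J p) := by
    intro p _
    rw [bdryDist_eq hε hJ, ← ENNReal.ofReal_mul (by positivity)]
    congr 1; ring
  rw [Finset.sum_congr rfl this, ← ENNReal.ofReal_sum_of_nonneg (fun p _ => by positivity),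
    ← Finset.mul_sum]
  unfold diss; push_cast; rfl

/-- The functional per unit length, for the previous state with phase-one set `J` and `n`
surfactant sites. -/
noncomputable def fn (k κ ε : ℝ) (J : Finset (ℤ × ℤ)) (n : ℕ) (I Z : Finset (ℤ × ℤ)) : ℝ :=
  en k (spin I Z) + κ * ε * diss J I + κ * |(Z.card : ℝ) - n|

lemma totalEnergy_spin {ε k ζ γ : ℝ} (hε : 0 < ε) (hk : k < 1) (hζ : 0 < ζ)
    {I Z J W : Finset (ℤ × ℤ)} (hJ : J.Nonempty) (hIZ : Disjoint I Z) (hJW : Disjoint J W) :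
    totalEnergy ε k ζ γ (spin I Z) (spin J W) =
      ENNReal.ofReal (ε * (en k (spin I Z) + 1 / ζ * ε * diss J I) +
        1 / (ζ * ε) * (ε ^ γ * |(Z.card : ℝ) - W.card|)) := by
  unfold totalEnergy dissipation
  rw [energy_eq hε hk (finSupp_spin I Z), phaseOne_spin, phaseOne_spin, dissOne_eq hε hJ,
    surfactant_spin hIZ, surfactant_spin hJW, dissZero, Set.ncard_coe_finset,
    Set.ncard_coe_finset]
  have h1 : 0 ≤ en k (spin I Z) := en_nonneg hk _
  have h2 : 0 ≤ ε ^ γ := Real.rpow_nonneg hε.le γ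
  rw [← ENNReal.ofReal_mul h2, ← ENNReal.ofReal_add (by positivity) (by positivity),
    ← ENNReal.ofReal_mul (by positivity), ← ENNReal.ofReal_add (by positivity) (by positivity)]
  congr 1
  field_simp
  ring

lemma totalEnergy_two {ε k ζ : ℝ} (hε : 0 < ε) (hk : k < 1) (hζ : 0 < ζ)
    {I Z J W : Finset (ℤ × ℤ)} (hJ : J.Nonempty) (hIZ : Disjoint I Z) (hJW : Disjoint J W) :
    totalEnergy ε k ζ 2 (spin I Z) (spin J W) =
      ENNReal.ofReal (ε * fn k (1 / ζ) ε J W.card I Z) := by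
  rw [totalEnergy_spin hε hk hζ hJ hIZ hJW, fn]
  congr 1
  rw [Real.rpow_two]
  field_simp

lemma fn_nonneg {k κ ε : ℝ} (hk : k < 1) (hκ : 0 ≤ κ) (hε : 0 ≤ ε) (J : Finset (ℤ × ℤ)) (n : ℕ)
    (I Z : Finset (ℤ × ℤ)) : 0 ≤ fn k κ ε J n I Z := by
  have := en_nonneg hk (spin I Z)
  unfold fn; positivity

/-- Minimality among finite pairs. -/
def IsMin (k κ ε : ℝ) (J : Finset (ℤ × ℤ)) (n : ℕ) (I Z : Finset (ℤ × ℤ)) : Prop :=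
  Disjoint I Z ∧ ∀ I' Z' : Finset (ℤ × ℤ), Disjoint I' Z' → fn k κ ε J n I Z ≤ fn k κ ε J n I' Z'

lemma finite_of_dissOne {ε : ℝ} (hε : 0 < ε) {I : Set (ℤ × ℤ)} {J : Finset (ℤ × ℤ)}
    (hJ : J.Nonempty) (h : dissOne ε I ↑J ≠ ∞) : I.Finite := by
  have hs : (symmDiff I (↑J : Set (ℤ × ℤ))).Finite := by
    have h0 : ENNReal.ofReal (ε ^ 3) ≠ 0 := by
      simp only [ne_eq, ENNReal.ofReal_eq_zero, not_le]; positivity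
    have := ENNReal.finite_const_le_of_tsum_ne_top h h0
    have huniv : {p : ↥(symmDiff I (↑J : Set (ℤ × ℤ))) |
        ENNReal.ofReal (ε ^ 3) ≤ ENNReal.ofReal (ε ^ 2) * bdryDist ε p ↑J} = Set.univ := by
      ext p
      simp only [Set.mem_ofPred_eq, Set.mem_univ, iff_true]
      rw [bdryDist_eq hε hJ, ← ENNReal.ofReal_mul (by positivity)]
      apply ENNReal.ofReal_le_ofReal
      have : (1 : ℝ) ≤ dep J p := by exact_mod_cast dep_pos hJ p
      calc ε ^ 3 = ε ^ 2 * (ε * 1) := by ring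
        _ ≤ _ := by gcongr
    rw [huniv] at this
    exact Set.finite_univ_iff.1 this
  refine (hs.union J.finite_toSet).subset fun p hp => ?_
  by_cases hpJ : p ∈ (↑J : Set (ℤ × ℤ))
  · exact Or.inr hpJ
  · exact Or.inl (Or.inl ⟨hp, hpJ⟩)

lemma IsMinimizer.exists_isMin {ε k ζ : ℝ} (hε : 0 < ε) (hk : k < 1) (hζ : 0 < ζ)
    {J W : Finset (ℤ × ℤ)} (hJ : J.Nonempty) (hJW : Disjoint J W) {u : Config}
    (hu : IsMinimizer ε k ζ 2 (spin J W) u) :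
    ∃ I Z : Finset (ℤ × ℤ), u = spin I Z ∧ IsMin k (1 / ζ) ε J W.card I Z := by
  have hadm : ∀ {I Z : Finset (ℤ × ℤ)}, Disjoint I Z → Admissible (spin I Z) := by
    intro I Z h; unfold Admissible; rw [surfactant_spin h]; exact Z.finite_toSet
  have hfin : dissOne ε (phaseOne u) ↑J ≠ ∞ := by
    intro htop
    have h1 := hu.2 _ (hadm hJW)
    rw [totalEnergy_two hε hk hζ hJ hJW hJW] at h1
    have h2 : totalEnergy ε k ζ 2 u (spin J W) = ∞ := by
      unfold totalEnergy dissipation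
      rw [phaseOne_spin, htop, top_add, ENNReal.mul_top, add_top]
      simp only [ne_eq, ENNReal.ofReal_eq_zero, not_le]; positivity
    rw [h2] at h1
    exact absurd h1 (by simp)
  obtain ⟨I, Z, hIZ, rfl⟩ := eq_spin (finite_of_dissOne hε hJ hfin) hu.1
  refine ⟨I, Z, rfl, hIZ, fun I' Z' h' => ?_⟩
  have h1 := hu.2 _ (hadm h')
  rw [totalEnergy_two hε hk hζ hJ hIZ hJW, totalEnergy_two hε hk hζ hJ h' hJW,
    ENNReal.ofReal_le_ofReal_iff
      (mul_nonneg hε.le (fn_nonneg hk (by positivity) hε.le _ _ _ _))] at h1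
  exact le_of_mul_le_mul_left h1 hε

lemma IsMinimizer.of_fn_le {ε k ζ : ℝ} (hε : 0 < ε) (hk : k < 1) (hζ : 0 < ζ)
    {J W I Z I' Z' : Finset (ℤ × ℤ)} (hJ : J.Nonempty) (hJW : Disjoint J W) (hIZ : Disjoint I Z)
    (hIZ' : Disjoint I' Z') (hu : IsMinimizer ε k ζ 2 (spin J W) (spin I Z))
    (h : fn k (1 / ζ) ε J W.card I' Z' ≤ fn k (1 / ζ) ε J W.card I Z) :
    IsMinimizer ε k ζ 2 (spin J W) (spin I' Z') := by
  refine ⟨by unfold Admissible; rw [surfactant_spin hIZ']; exact Z'.finite_toSet,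
    fun v hv => le_trans ?_ (hu.2 v hv)⟩
  rw [totalEnergy_two hε hk hζ hJ hIZ hJW, totalEnergy_two hε hk hζ hJ hIZ' hJW]
  exact ENNReal.ofReal_le_ofReal (mul_le_mul_of_nonneg_left h hε.le)

/-- If the surfactant is conserved, minimality does not depend on its exponent. -/
lemma IsMinimizer.of_exponent {ε k ζ γ : ℝ} (hε : 0 < ε) (hε1 : ε ≤ 1) (hγ : γ < 2)
    {w u : Config} (hu : IsMinimizer ε k ζ 2 w u)
    (h : (surfactant u).ncard = (surfactant w).ncard) : IsMinimizer ε k ζ γ w u := by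
  refine ⟨hu.1, fun v hv => ?_⟩
  have h1 : totalEnergy ε k ζ γ u w = totalEnergy ε k ζ 2 u w := by
    simp [totalEnergy, dissipation, dissZero, h]
  rw [h1]
  refine (hu.2 v hv).trans ?_
  unfold totalEnergy dissipation
  gcongr _ + _ * (_ + ENNReal.ofReal ?_ * _)
  exact Real.rpow_le_rpow_of_exponent_ge hε hε1 hγ.le

lemma adj_iff {p q : ℤ × ℤ} : grid.Adj p q ↔
    q = p + (1, 0) ∨ q = p - (1, 0) ∨ q = p + (0, 1) ∨ q = p - (0, 1) := by
  obtain ⟨a, b⟩ := p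
  obtain ⟨c, d⟩ := q
  simp only [grid, Prod.mk_add_mk, Prod.mk_sub_mk, Prod.mk.injEq]
  constructor
  · intro h
    rcases abs_cases (a - c) with h1 | h1 <;> rcases abs_cases (b - d) with h2 | h2 <;> omega
  · rintro (⟨rfl, rfl⟩ | ⟨rfl, rfl⟩ | ⟨rfl, rfl⟩ | ⟨rfl, rfl⟩) <;> simp

lemma adj_iff_dist1 {p q : ℤ × ℤ} : grid.Adj p q ↔ dist1 p q = 1 := by
  unfold dist1
  change |p.1 - q.1| + |p.2 - q.2| = 1 ↔ _
  rw [Int.abs_eq_natAbs, Int.abs_eq_natAbs]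
  omega

lemma dist1_triangle (p q r : ℤ × ℤ) : dist1 p r ≤ dist1 p q + dist1 q r := by
  unfold dist1; omega

/-- The energy of the four bonds at `p` when `p` carries the spin `a`. -/
noncomputable def star (k : ℝ) (u : Config) (p : ℤ × ℤ) (a : SignType) : ℝ :=
  bnd k a (u (p + (1, 0))) + bnd k a (u (p - (1, 0))) + bnd k a (u (p + (0, 1))) +
    bnd k a (u (p - (0, 1)))

lemma FinSupp.update {u : Config} (hu : FinSupp u) (q : ℤ × ℤ) (a : SignType) :
    FinSupp (Function.update u q a) := by
  refine (hu.union (Set.finite_singleton q)).subset fun p hp => ?_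
  by_cases h : p = q
  · exact Or.inr h
  · left
    have hp' : Function.update u q a p ≠ -1 := hp
    rwa [Function.update_of_ne h] at hp'

lemma en_update {k : ℝ} {u : Config} (hu : FinSupp u) (q : ℤ × ℤ) (a : SignType) :
    en k (Function.update u q a) - en k u = star k u q a - star k u q (u q) := by
  unfold en
  rw [← finsum_sub_distrib (support_bondSum (hu.update q a)) (support_bondSum hu)]
  have e1 : ∀ x y : ℤ, (x, y) - ((1, 0) : ℤ × ℤ) = (x - 1, y) := by intros; simp
  have e2 : ∀ x y : ℤ, (x, y) - ((0, 1) : ℤ × ℤ) = (x, y - 1) := by intros; simp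
  have e3 : ∀ x y : ℤ, (x, y) + ((1, 0) : ℤ × ℤ) = (x + 1, y) := by intros; simp
  have e4 : ∀ x y : ℤ, (x, y) + ((0, 1) : ℤ × ℤ) = (x, y + 1) := by intros; simp
  obtain ⟨x, y⟩ := q
  rw [finsum_eq_sum_of_support_subset (s := {(x, y), (x - 1, y), (x, y - 1)})]
  · rw [Finset.sum_insert (by simp only [Finset.mem_insert, Finset.mem_singleton, Prod.mk.injEq]; omega),
      Finset.sum_insert (by simp only [Finset.mem_singleton, Prod.mk.injEq]; omega),
      Finset.sum_singleton]
    simp only [bondSum, star, e1, e2, e3, e4, Function.update_apply, Prod.mk.injEq]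
    have o1 : ∀ t : ℤ, t + 1 ≠ t := by intro t; omega
    have o2 : ∀ t : ℤ, t - 1 ≠ t := by intro t; omega
    simp only [o1, o2, and_true, and_false, if_true, if_false,
      sub_add_cancel]
    rw [bnd_comm k (u (x - 1, y)) a, bnd_comm k (u (x - 1, y)) (u (x, y)),
      bnd_comm k (u (x, y - 1)) a, bnd_comm k (u (x, y - 1)) (u (x, y))]
    ring
  · intro p hp
    by_contra hn
    obtain ⟨x', y'⟩ := p
    simp only [Finset.coe_insert, Finset.coe_singleton, Set.mem_insert_iff,
      Set.mem_singleton_iff, Prod.mk.injEq, not_or] at hn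
    apply hp
    simp only [bondSum, e3, e4]
    rw [Function.update_of_ne, Function.update_of_ne, Function.update_of_ne, sub_self] <;>
      · simp only [ne_eq, Prod.mk.injEq]; omega

lemma update_insert_right {I Z : Finset (ℤ × ℤ)} {p : ℤ × ℤ} (hp : p ∉ I) :
    Function.update (spin I Z) p 0 = spin I (insert p Z) := by
  ext q
  by_cases h : q = p
  · subst h; simp [spin, hp]
  · simp [spin, h]

lemma update_erase_right {I Z : Finset (ℤ × ℤ)} {p : ℤ × ℤ} (hp : p ∉ I) :
    Function.update (spin I Z) p (-1) = spin I (Z.erase p) := by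
  ext q
  by_cases h : q = p
  · subst h; simp [spin, hp]
  · simp [spin, h]

lemma update_insert_left {I Z : Finset (ℤ × ℤ)} (p : ℤ × ℤ) :
    Function.update (spin I Z) p 1 = spin (insert p I) (Z.erase p) := by
  ext q
  by_cases h : q = p
  · subst h; simp [spin]
  · simp [spin, h]

lemma update_erase_left {I Z : Finset (ℤ × ℤ)} (p : ℤ × ℤ) :
    Function.update (spin I Z) p 0 = spin (I.erase p) (insert p Z) := by
  ext q
  by_cases h : q = p
  · subst h; simp [spin]
  · simp [spin, h]

lemma en_translate {k : ℝ} (u : Config) (t : ℤ × ℤ) : en k (fun p => u (p - t)) = en k u := by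
  unfold en
  rw [← finsum_comp_equiv (Equiv.subRight t) (f := bondSum k u)]
  apply finsum_congr
  intro p
  simp only [bondSum, Equiv.subRight_apply]
  rw [sub_add_eq_add_sub, sub_add_eq_add_sub]

/-- A finite cloud of surfactant can be added far away. -/
lemma exists_far {k : ℝ} (I Z Q : Finset (ℤ × ℤ)) :
    ∃ Q' : Finset (ℤ × ℤ), Q'.card = Q.card ∧ Disjoint I Q' ∧ Disjoint Z Q' ∧
      en k (spin I (Z ∪ Q')) = en k (spin I Z) + en k (spin ∅ Q) := by
  obtain ⟨B, hB⟩ := (finSupp_spin I Z).exists_box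
  obtain ⟨C, hC⟩ := (finSupp_spin ∅ Q).exists_box
  obtain ⟨t, ht⟩ := Infinite.exists_notMem_finset
    ((B ×ˢ C).image fun x : (ℤ × ℤ) × (ℤ × ℤ) => x.1 - x.2)
  have ht' : ∀ p ∈ B, p - t ∉ C := by
    intro p hp hq
    exact ht (Finset.mem_image.2 ⟨(p, p - t), Finset.mem_product.2 ⟨hp, hq⟩, by simp⟩)
  have hmem : ∀ p, p ∈ Q.image (· + t) ↔ p - t ∈ Q := by
    intro p
    simp only [Finset.mem_image]
    exact ⟨by rintro ⟨a, ha, rfl⟩; simpa using ha, fun h => ⟨_, h, by simp⟩⟩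
  have hq : ∀ p, spin ∅ (Q.image (· + t)) p = spin ∅ Q (p - t) := by
    intro p; simp only [spin, hmem]; simp
  have hout : ∀ p, spin ∅ (Q.image (· + t)) p = -1 → spin I (Z ∪ Q.image (· + t)) p = spin I Z p := by
    intro p hp
    rw [spin_eq_neg] at hp
    unfold spin
    simp only [Finset.mem_union, hp.2, or_false]
  have hin : ∀ p, spin I Z p = -1 →
      spin I (Z ∪ Q.image (· + t)) p = spin ∅ (Q.image (· + t)) p := by
    intro p hp
    rw [spin_eq_neg] at hp
    unfold spin
    simp [hp.1, hp.2]
  have hdis : ∀ p, p ∈ Q.image (· + t) → spin I Z p = -1 := by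
    intro p hp
    rw [hmem] at hp
    have : p ∉ B := by
      intro hpB
      have := (hC _ (ht' p hpB)).1
      rw [spin_eq_neg] at this
      exact this.2 hp
    exact (hB p this).1
  refine ⟨Q.image (· + t), Finset.card_image_of_injective _ (add_left_injective t), ?_, ?_, ?_⟩
  · rw [Finset.disjoint_left]; intro p hp hq'
    exact (spin_eq_neg.1 (hdis p hq')).1 hp
  · rw [Finset.disjoint_left]; intro p hp hq'
    exact (spin_eq_neg.1 (hdis p hq')).2 hp
  · have h2 : en k (spin ∅ Q) = en k (spin ∅ (Q.image (· + t))) := by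
      rw [← en_translate (spin ∅ Q) t]
      congr 1; ext p; rw [hq]
    rw [h2]
    unfold en
    rw [← finsum_add_distrib (support_bondSum (finSupp_spin _ _))
      (support_bondSum (finSupp_spin _ _))]
    apply finsum_congr
    intro p
    by_cases hp : p ∈ B
    · have h3 := hC _ (ht' p hp)
      rw [sub_add_eq_add_sub, sub_add_eq_add_sub, ← hq, ← hq, ← hq] at h3
      rw [bondSum_eq_zero h3, add_zero]
      unfold bondSum
      rw [hout _ h3.1, hout _ h3.2.1, hout _ h3.2.2]
    · have h3 := hB _ hp
      rw [bondSum_eq_zero h3, zero_add]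
      unfold bondSum
      rw [hin _ h3.1, hin _ h3.2.1, hin _ h3.2.2]

lemma sum_indicator_le (B T : Finset (ℤ × ℤ)) (e : ℤ × ℤ) :
    ∑ p ∈ B, (if p + e ∈ T then (1 : ℝ) else 0) ≤ T.card := by
  rw [Finset.sum_boole]
  have : (B.filter fun p => p + e ∈ T).card ≤ T.card := by
    apply Finset.card_le_card_of_injOn (· + e)
    · intro p hp; simp only [Finset.coe_filter, Set.mem_ofPred_eq] at hp; exact hp.2
    · exact (add_left_injective e).injOn
  exact_mod_cast this

/-- Energy comparison when the spins of a set `V` are switched to `a`, the surfactant of `V`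
being evaluated separately. -/
lemma en_flip_le {k : ℝ} (hk : 0 < k) (hk' : k < 1) {u v q : Config} (hu : FinSupp u)
    (hv : FinSupp v) (hq : FinSupp q) {a : SignType} (ha : a ≠ 0) {V T : Finset (ℤ × ℤ)}
    (hvV : ∀ p ∈ V, v p = a) (hvu : ∀ p ∉ V, v p = u p)
    (hqV : ∀ p, q p = if p ∈ V ∧ u p = 0 then 0 else -1)
    (hT : ∀ p ∈ V, ∀ p', grid.Adj p p' → p' ∉ V → u p' ≠ a → (u p' = 0 → u p = 0) → p ∈ T) :
    en k v + en k q ≤ en k u + 8 * T.card := by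
  have key : ∀ p p', grid.Adj p p' → bnd k (v p) (v p') + bnd k (q p) (q p') ≤
      bnd k (u p) (u p') + 2 * ((if p ∈ T then (1 : ℝ) else 0) + if p' ∈ T then 1 else 0) := by
    have half : ∀ p p', p ∈ V → p' ∉ V → grid.Adj p p' →
        bnd k (v p) (v p') + bnd k (q p) (q p') ≤ bnd k (u p) (u p') +
          2 * (if p ∈ T then (1 : ℝ) else 0) := by
      intro p p' hp hp' hadj
      rw [hvV p hp, hvu p' hp', hqV p, hqV p']
      have h2 := hT p hp p' hadj hp'
      by_cases hpT : p ∈ T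
      · rw [if_pos hpT]
        have h5 := bnd_le_two hk a (u p')
        by_cases h0 : u p = 0
        · simp only [hp, h0, true_and, if_true, bnd_zero_left]; linarith
        · simp only [hp, h0, hp', and_false, false_and, if_false, bnd_neg_neg]
          have := bnd_nonneg hk' (u p) (u p'); linarith
      · rw [if_neg hpT]
        have h3 : u p' = a ∨ (u p' = 0 ∧ u p ≠ 0) := by tauto
        rcases h3 with h3 | ⟨h3, h4⟩
        · have : bnd k a a = 0 := by simp [bnd, ha]
          rw [h3, this]
          by_cases h0 : u p = 0
          · simp [hp, h0]
          · simp only [hp, h0, hp', and_false, false_and, if_false, bnd_neg_neg]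
            have := bnd_nonneg hk' (u p) a; linarith
        · simp [h3, h4, hp']
    intro p p' hadj
    by_cases hp : p ∈ V <;> by_cases hp' : p' ∈ V
    · have : bnd k a a = 0 := by simp [bnd, ha]
      rw [hvV p hp, hvV p' hp', this, hqV p, hqV p']
      have h1 : bnd k (if p ∈ V ∧ u p = 0 then (0 : SignType) else -1)
          (if p' ∈ V ∧ u p' = 0 then (0 : SignType) else -1) ≤ bnd k (u p) (u p') := by
        by_cases h0 : u p = 0 <;> by_cases h0' : u p' = 0 <;> simp [hp, hp', h0, h0']
        exact bnd_nonneg hk' _ _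
      have h2 : (0 : ℝ) ≤ if p ∈ T then (1 : ℝ) else 0 := by split_ifs <;> norm_num
      have h3 : (0 : ℝ) ≤ if p' ∈ T then (1 : ℝ) else 0 := by split_ifs <;> norm_num
      linarith
    · have := half p p' hp hp' hadj
      have h3 : (0 : ℝ) ≤ if p' ∈ T then (1 : ℝ) else 0 := by split_ifs <;> norm_num
      linarith
    · have := half p' p hp' hp hadj.symm
      rw [bnd_comm k (v p), bnd_comm k (q p), bnd_comm k (u p)]
      have h3 : (0 : ℝ) ≤ if p ∈ T then (1 : ℝ) else 0 := by split_ifs <;> norm_num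
      linarith
    · rw [hvu p hp, hvu p' hp', hqV p, hqV p']
      have h2 : (0 : ℝ) ≤ if p ∈ T then (1 : ℝ) else 0 := by split_ifs <;> norm_num
      have h3 : (0 : ℝ) ≤ if p' ∈ T then (1 : ℝ) else 0 := by split_ifs <;> norm_num
      simp only [hp, hp', false_and, if_false, bnd_neg_neg]
      linarith
  obtain ⟨B1, hB1⟩ := hu.exists_box
  obtain ⟨B2, hB2⟩ := hv.exists_box
  obtain ⟨B3, hB3⟩ := hq.exists_box
  rw [en_eq_sum (B := B1 ∪ B2 ∪ B3) fun p hp => hB1 p fun h => hp (by simp [h]),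
    en_eq_sum (B := B1 ∪ B2 ∪ B3) fun p hp => hB2 p fun h => hp (by simp [h]),
    en_eq_sum (B := B1 ∪ B2 ∪ B3) fun p hp => hB3 p fun h => hp (by simp [h]),
    ← Finset.sum_add_distrib]
  set B := B1 ∪ B2 ∪ B3
  have h0 := sum_indicator_le B T 0
  have h1 := sum_indicator_le B T (1, 0)
  have h2 := sum_indicator_le B T (0, 1)
  simp only [add_zero] at h0
  have hs : ∑ p ∈ B, (bondSum k v p + bondSum k q p) ≤ ∑ p ∈ B, (bondSum k u p +
      (4 * (if p ∈ T then (1 : ℝ) else 0) + 2 * (if p + (1, 0) ∈ T then (1 : ℝ) else 0)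
        + 2 * (if p + (0, 1) ∈ T then (1 : ℝ) else 0))) := by
    apply Finset.sum_le_sum
    intro p _
    have k1 := key p (p + (1, 0)) (adj_iff.2 (by simp))
    have k2 := key p (p + (0, 1)) (adj_iff.2 (by simp))
    unfold bondSum
    linarith
  simp only [Finset.sum_add_distrib, ← Finset.mul_sum] at hs ⊢
  linarith

lemma en_spin_empty_le {k : ℝ} (hk' : k < 1) (I Z : Finset (ℤ × ℤ)) (h : Disjoint I Z) :
    en k (spin ∅ Z) ≤ en k (spin I Z) := by
  obtain ⟨B1, hB1⟩ := (finSupp_spin ∅ Z).exists_box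
  obtain ⟨B2, hB2⟩ := (finSupp_spin I Z).exists_box
  rw [en_eq_sum (B := B1 ∪ B2) fun p hp => hB1 p fun h => hp (by simp [h]),
    en_eq_sum (B := B1 ∪ B2) fun p hp => hB2 p fun h => hp (by simp [h])]
  apply Finset.sum_le_sum
  intro p _
  have key : ∀ p p', bnd k (spin ∅ Z p) (spin ∅ Z p') ≤ bnd k (spin I Z p) (spin I Z p') := by
    intro p p'
    by_cases h1 : p ∈ Z
    · rw [(spin_eq_zero h).2 h1, (spin_eq_zero (by simp)).2 h1]; simp
    by_cases h2 : p' ∈ Z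
    · rw [(spin_eq_zero h).2 h2, (spin_eq_zero (by simp)).2 h2]; simp
    rw [spin_eq_neg.2 ⟨by simp, h1⟩, spin_eq_neg.2 ⟨by simp, h2⟩, bnd_neg_neg]
    exact bnd_nonneg hk' _ _
  exact add_le_add (key _ _) (key _ _)

lemma en_spin_le (k : ℝ) (I : Finset (ℤ × ℤ)) :
    en k (spin I ∅) ≤ 8 * I.card := by
  obtain ⟨B, hB⟩ := (finSupp_spin I ∅).exists_box
  rw [en_eq_sum hB]
  have h0 := sum_indicator_le B I 0
  have h1 := sum_indicator_le B I (1, 0)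
  have h2 := sum_indicator_le B I (0, 1)
  simp only [add_zero] at h0
  have key : ∀ p p', bnd k (spin I ∅ p) (spin I ∅ p') ≤
      2 * (if p ∈ I then (1 : ℝ) else 0) + 2 * (if p' ∈ I then (1 : ℝ) else 0) := by
    intro p p'
    by_cases h1 : p ∈ I <;> by_cases h2 : p' ∈ I <;> simp [spin, h1, h2]
  have hs : ∑ p ∈ B, bondSum k (spin I ∅) p ≤ ∑ p ∈ B,
      (4 * (if p ∈ I then (1 : ℝ) else 0) + 2 * (if p + (1, 0) ∈ I then (1 : ℝ) else 0)
        + 2 * (if p + (0, 1) ∈ I then (1 : ℝ) else 0)) := by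
    apply Finset.sum_le_sum
    intro p _
    have k1 := key p (p + (1, 0))
    have k2 := key p (p + (0, 1))
    unfold bondSum
    linarith
  rw [Finset.sum_add_distrib, Finset.sum_add_distrib,
    ← Finset.mul_sum, ← Finset.mul_sum, ← Finset.mul_sum] at hs
  linarith

lemma dep_le_succ {J : Finset (ℤ × ℤ)} (hJ : J.Nonempty) {p q : ℤ × ℤ} (h : grid.Adj p q)
    (hpq : p ∈ J ↔ q ∈ J) : dep J p ≤ dep J q + 1 := by
  obtain ⟨r, hr, hd⟩ := dep_spec hJ q
  have h1 : dep J p ≤ dist1 p r := dep_le (by tauto)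
  have h2 := dist1_triangle p q r
  rw [adj_iff_dist1] at h
  omega

lemma dep_eq_one {J : Finset (ℤ × ℤ)} (hJ : J.Nonempty) {p q : ℤ × ℤ} (h : grid.Adj p q)
    (hpq : q ∈ J ↔ p ∉ J) : dep J p = 1 := by
  have h1 : dep J p ≤ dist1 p q := dep_le hpq
  rw [adj_iff_dist1] at h
  have := dep_pos hJ p
  omega

lemma diss_union_add {J I V : Finset (ℤ × ℤ)} {s : ℕ} (hV : ∀ p ∈ V, p ∈ J ∧ p ∉ I ∧ s ≤ dep J p) :
    diss J (I ∪ V) + s * V.card ≤ diss J I := by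
  unfold diss
  have h1 : V ⊆ symmDiff I J := fun p hp => by
    rw [Finset.mem_symmDiff]; exact Or.inr ⟨(hV p hp).1, (hV p hp).2.1⟩
  have h2 : symmDiff (I ∪ V) J = symmDiff I J \ V := by
    ext p
    have := hV p
    simp only [Finset.mem_symmDiff, Finset.mem_union, Finset.mem_sdiff]
    tauto
  rw [h2, ← Finset.sum_sdiff h1]
  have : s * V.card ≤ ∑ p ∈ V, dep J p := by
    rw [mul_comm]
    exact Finset.card_nsmul_le_sum V _ s fun p hp => (hV p hp).2.2
  omega

lemma diss_sdiff_add {J I V : Finset (ℤ × ℤ)} {s : ℕ} (hV : ∀ p ∈ V, p ∉ J ∧ p ∈ I ∧ s ≤ dep J p) :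
    diss J (I \ V) + s * V.card ≤ diss J I := by
  unfold diss
  have h1 : V ⊆ symmDiff I J := fun p hp => by
    rw [Finset.mem_symmDiff]; exact Or.inl ⟨(hV p hp).2.1, (hV p hp).1⟩
  have h2 : symmDiff (I \ V) J = symmDiff I J \ V := by
    ext p
    have := hV p
    simp only [Finset.mem_symmDiff, Finset.mem_sdiff]
    tauto
  rw [h2, ← Finset.sum_sdiff h1]
  have : s * V.card ≤ ∑ p ∈ V, dep J p := by
    rw [mul_comm]
    exact Finset.card_nsmul_le_sum V _ s fun p hp => (hV p hp).2.2
  omega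

/-- Sites of `J` missing in `I`, at depth at least `s`. -/
noncomputable def lost (J I : Finset (ℤ × ℤ)) (s : ℕ) : Finset (ℤ × ℤ) :=
  (J \ I).filter fun p => s ≤ dep J p

lemma mem_lost {J I : Finset (ℤ × ℤ)} {s : ℕ} {p : ℤ × ℤ} :
    p ∈ lost J I s ↔ p ∈ J ∧ p ∉ I ∧ s ≤ dep J p := by
  simp [lost, and_assoc]

/-- Sites of `I` outside `J`, at distance at least `s`. -/
noncomputable def gained (J I : Finset (ℤ × ℤ)) (s : ℕ) : Finset (ℤ × ℤ) :=
  (I \ J).filter fun p => s ≤ dep J p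

lemma mem_gained {J I : Finset (ℤ × ℤ)} {s : ℕ} {p : ℤ × ℤ} :
    p ∈ gained J I s ↔ p ∉ J ∧ p ∈ I ∧ s ≤ dep J p := by
  simp [gained]; tauto

lemma IsMin.lost_le {k κ ε : ℝ} (hk : 0 < k) (hk' : k < 1) (hκ : 0 < κ) (hε : 0 < ε)
    {J I Z : Finset (ℤ × ℤ)} {n : ℕ} (hJ : J.Nonempty) (h : IsMin k κ ε J n I Z) {s : ℕ}
    (hs : 1 ≤ s) : κ * ε * s * (lost J I s).card ≤
      8 * ((lost J I s).card - (lost J I (s + 1)).card) := by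
  set V := lost J I s with hVdef
  have hIZ := h.1
  set T := V.filter fun p => dep J p = s with hTdef
  have hTcard : T.card + (lost J I (s + 1)).card = V.card := by
    rw [hTdef, ← Finset.card_filter_add_card_filter_not (s := V) (fun p => dep J p = s)]
    congr 2
    ext p
    simp only [Finset.mem_filter, hVdef, mem_lost]
    have := dep_pos hJ p
    constructor
    · rintro ⟨h1, h2, h3⟩; exact ⟨⟨h1, h2, by omega⟩, by omega⟩
    · rintro ⟨⟨h1, h2, h3⟩, h4⟩; exact ⟨h1, h2, by omega⟩
  obtain ⟨Q', hQc, hQI, hQZ, hQe⟩ := exists_far (k := k) (I ∪ V) (Z \ V) (Z ∩ V)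
  have hflip := en_flip_le hk hk' (u := spin I Z) (v := spin (I ∪ V) (Z \ V))
    (q := spin ∅ (Z ∩ V)) (finSupp_spin _ _) (finSupp_spin _ _) (finSupp_spin _ _) (a := 1)
    (by simp) (V := V) (T := T) (fun p hp => spin_eq_one.2 (by simp [hp]))
    (fun p hp => by simp [spin, hp])
    (fun p => by simp only [spin_eq_zero hIZ]; simp [spin, and_comm]) ?_
  · have hmin := h.2 (I ∪ V) ((Z \ V) ∪ Q') (by
      rw [Finset.disjoint_union_right]
      refine ⟨?_, hQI⟩
      rw [Finset.disjoint_left] at hIZ ⊢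
      intro p hp hq
      simp only [Finset.mem_union, Finset.mem_sdiff] at hp hq
      rcases hp with hp | hp
      · exact hIZ hp hq.1
      · exact hq.2 hp)
    have hcard : ((Z \ V) ∪ Q').card = Z.card := by
      rw [Finset.card_union_of_disjoint hQZ, hQc, Finset.card_sdiff_add_card_inter]
    have hdiss := diss_union_add (J := J) (I := I) (V := V) (s := s) (fun p hp => mem_lost.1 hp)
    unfold fn at hmin
    rw [hcard, hQe] at hmin
    have hd' : (diss J (I ∪ V) : ℝ) + s * V.card ≤ diss J I := by exact_mod_cast hdiss
    have hT' : (T.card : ℝ) + (lost J I (s + 1)).card = V.card := by exact_mod_cast hTcard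
    have := mul_le_mul_of_nonneg_left hd' (mul_pos hκ hε).le
    nlinarith
  · intro p hp p' hadj hp' h1 h2
    rw [ne_eq, spin_eq_one] at h1
    rw [hTdef, Finset.mem_filter]
    refine ⟨hp, ?_⟩
    have hp2 := mem_lost.1 hp
    rw [hVdef, mem_lost] at hp'
    by_cases hpJ : p' ∈ J
    · have := dep_le_succ hJ hadj (by tauto)
      have : ¬ s ≤ dep J p' := by tauto
      omega
    · have := dep_eq_one hJ hadj (by tauto)
      omega

lemma IsMin.gained_le {k κ ε : ℝ} (hk : 0 < k) (hk' : k < 1) (hκ : 0 < κ) (hε : 0 < ε)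
    {J I Z : Finset (ℤ × ℤ)} {n : ℕ} (hJ : J.Nonempty) (h : IsMin k κ ε J n I Z) {s : ℕ}
    (hs : 1 ≤ s) : κ * ε * s * (gained J I s).card ≤
      8 * ((gained J I s).card - (gained J I (s + 1)).card) := by
  set V := gained J I s with hVdef
  have hIZ := h.1
  have hIZ' := Finset.disjoint_left.1 hIZ
  set T := V.filter fun p => dep J p = s with hTdef
  have hTcard : T.card + (gained J I (s + 1)).card = V.card := by
    rw [hTdef, ← Finset.card_filter_add_card_filter_not (s := V) (fun p => dep J p = s)]
    congr 2
    ext p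
    simp only [Finset.mem_filter, hVdef, mem_gained]
    have := dep_pos hJ p
    constructor
    · rintro ⟨h1, h2, h3⟩; exact ⟨⟨h1, h2, by omega⟩, by omega⟩
    · rintro ⟨⟨h1, h2, h3⟩, h4⟩; exact ⟨h1, h2, by omega⟩
  have hflip := en_flip_le hk hk' (u := spin I Z) (v := spin (I \ V) Z)
    (q := spin ∅ ∅) (finSupp_spin _ _) (finSupp_spin _ _) (finSupp_spin _ _) (a := -1)
    (by simp) (V := V) (T := T)
    (fun p hp => spin_eq_neg.2 ⟨by simp [hp], hIZ' (mem_gained.1 hp).2.1⟩)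
    (fun p hp => by simp [spin, hp])
    (fun p => by
      simp only [spin_eq_zero hIZ]
      rw [if_neg fun h => hIZ' (mem_gained.1 h.1).2.1 h.2]; simp [spin]) ?_
  · have hmin := h.2 (I \ V) Z (hIZ.mono_left Finset.sdiff_subset)
    have hdiss := diss_sdiff_add (J := J) (I := I) (V := V) (s := s) (fun p hp => mem_gained.1 hp)
    unfold fn at hmin
    have hd' : (diss J (I \ V) : ℝ) + s * V.card ≤ diss J I := by exact_mod_cast hdiss
    have hT' : (T.card : ℝ) + (gained J I (s + 1)).card = V.card := by exact_mod_cast hTcard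
    have := mul_le_mul_of_nonneg_left hd' (mul_pos hκ hε).le
    have h0 := en_nonneg hk' (spin ∅ ∅)
    nlinarith
  · intro p hp p' hadj hp' h1 h2
    rw [ne_eq, spin_eq_neg] at h1
    rw [hTdef, Finset.mem_filter]
    refine ⟨hp, ?_⟩
    have hp2 := mem_gained.1 hp
    rw [spin_eq_zero hIZ, spin_eq_zero hIZ] at h2
    have hpZ := hIZ' hp2.2.1
    rw [hVdef, mem_gained] at hp'
    by_cases hpJ : p' ∈ J
    · have := dep_eq_one hJ hadj (by tauto)
      omega
    · have := dep_le_succ hJ hadj (by tauto)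
      have : ¬ s ≤ dep J p' := by tauto
      omega

lemma IsMin.diss_le {k κ ε : ℝ} (hk' : k < 1)
    {J I Z : Finset (ℤ × ℤ)} {n : ℕ} (h : IsMin k κ ε J n I Z) :
    κ * ε * diss J I ≤ 8 * J.card := by
  obtain ⟨Q', hQc, hQI, hQZ, hQe⟩ := exists_far (k := k) J ∅ Z
  have hmin := h.2 J (∅ ∪ Q') (by simpa using hQI)
  unfold fn at hmin
  rw [hQe, Finset.empty_union, hQc] at hmin
  have h0 : diss J J = 0 := by simp [diss]
  have h1 := en_spin_empty_le hk' I Z h.1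
  have h2 := en_spin_le k J
  rw [h0] at hmin
  push_cast at hmin
  linarith

lemma decay_aux {f : ℕ → ℕ} {a A : ℝ} (ha : 0 ≤ a) {s : ℕ} (hs : 1 ≤ s)
    (h : ∀ t, 1 ≤ t → a * t * (f t : ℝ) ≤ 8 * (f t - f (t + 1))) (hA : (f s : ℝ) ≤ A)
    (hsmall : A * Real.exp (-(a * s ^ 2 / 8)) < 1) : f (2 * s) = 0 := by
  have step : ∀ j : ℕ, (f (s + j) : ℝ) ≤ A * Real.exp (-(a * s / 8)) ^ j := by
    intro j
    induction j with
    | zero => simpa using hA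
    | succ j ih =>
      have h1 := h (s + j) (by omega)
      have h2 : a * s * (f (s + j) : ℝ) ≤ a * ((s + j : ℕ) : ℝ) * f (s + j) := by
        gcongr; omega
      have h3 : (f (s + (j + 1)) : ℝ) ≤ (1 - a * s / 8) * f (s + j) := by
        rw [← add_assoc]; linarith
      have h4 : 1 - a * s / 8 ≤ Real.exp (-(a * s / 8)) := by
        have := Real.add_one_le_exp (-(a * s / 8)); linarith
      calc (f (s + (j + 1)) : ℝ) ≤ (1 - a * s / 8) * f (s + j) := h3
        _ ≤ Real.exp (-(a * s / 8)) * f (s + j) := by gcongr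
        _ ≤ Real.exp (-(a * s / 8)) * (A * Real.exp (-(a * s / 8)) ^ j) := by gcongr
        _ = _ := by ring
  have h1 := step s
  rw [← Real.exp_nat_mul, ← two_mul] at h1
  have h2 : (s : ℝ) * -(a * s / 8) = -(a * s ^ 2 / 8) := by ring
  rw [h2] at h1
  have : (f (2 * s) : ℝ) < 1 := h1.trans_lt hsmall
  have : f (2 * s) < 1 := by exact_mod_cast this
  omega

/-- A minimizer agrees with the previous phase-one set away from its boundary. -/
lemma IsMin.mem_iff {k κ ε A : ℝ} (hk : 0 < k) (hk' : k < 1) (hκ : 0 < κ) (hε : 0 < ε)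
    {J I Z : Finset (ℤ × ℤ)} {n : ℕ} (hJ : J.Nonempty) (h : IsMin k κ ε J n I Z) {s : ℕ}
    (hs : 1 ≤ s) (hA : (J.card : ℝ) ≤ A) (hA' : 8 * (J.card : ℝ) ≤ κ * ε * A)
    (hsmall : A * Real.exp (-(κ * ε * s ^ 2 / 8)) < 1) {p : ℤ × ℤ} (hp : 2 * s ≤ dep J p) :
    p ∈ I ↔ p ∈ J := by
  have hκε := mul_pos hκ hε
  have hl : (lost J I (2 * s)).card = 0 := by
    refine decay_aux (f := fun t => (lost J I t).card) hκε.le hs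
      (fun t ht => h.lost_le hk hk' hκ hε hJ ht) (le_trans ?_ hA) hsmall
    exact_mod_cast Finset.card_le_card fun p hp => (mem_lost.1 hp).1
  have hg : (gained J I (2 * s)).card = 0 := by
    refine decay_aux (f := fun t => (gained J I t).card) hκε.le hs
      (fun t ht => h.gained_le hk hk' hκ hε hJ ht) ?_ hsmall
    have h1 := h.diss_le hk'
    have h2 := diss_sdiff_add (J := J) (I := I) (V := gained J I s) (s := s)
      (fun p hp => mem_gained.1 hp)
    have h3 : (gained J I s).card ≤ diss J I := by nlinarith
    have h4 : ((gained J I s).card : ℝ) ≤ diss J I := by exact_mod_cast h3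
    have h5 : κ * ε * diss J I ≤ κ * ε * A := h1.trans hA'
    exact h4.trans (le_of_mul_le_mul_left h5 hκε)
  rw [Finset.card_eq_zero] at hl hg
  constructor
  · intro hpI
    by_contra hpJ
    have : p ∈ gained J I (2 * s) := mem_gained.2 ⟨hpJ, hpI, hp⟩
    rw [hg] at this; simp at this
  · intro hpJ
    by_contra hpI
    have : p ∈ lost J I (2 * s) := mem_lost.2 ⟨hpJ, hpI, hp⟩
    rw [hl] at this; simp at this

/-- The number of nearest neighbours of `q` with spin `a`. -/
def nb (u : Config) (q : ℤ × ℤ) (a : SignType) : ℕ :=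
  (if u (q + (1, 0)) = a then 1 else 0) + (if u (q - (1, 0)) = a then 1 else 0) +
    (if u (q + (0, 1)) = a then 1 else 0) + (if u (q - (0, 1)) = a then 1 else 0)

lemma nb_add (u : Config) (q : ℤ × ℤ) : nb u q 1 + nb u q 0 + nb u q (-1) = 4 := by
  have h : ∀ b : SignType, (if b = 1 then 1 else 0) + (if b = 0 then 1 else 0) +
    (if b = -1 then 1 else 0) = 1 := by decide
  have h1 := h (u (q + (1, 0)))
  have h2 := h (u (q - (1, 0)))
  have h3 := h (u (q + (0, 1)))
  have h4 := h (u (q - (0, 1)))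
  unfold nb
  omega

lemma star_one (k : ℝ) (u : Config) (q : ℤ × ℤ) :
    star k u q 1 = 2 * nb u q (-1) + (1 - k) * nb u q 0 := by
  have h : ∀ b : SignType, bnd k 1 b = 2 * (if b = -1 then (1 : ℝ) else 0) +
      (1 - k) * (if b = 0 then (1 : ℝ) else 0) := by
    intro b; cases b <;> simp [bnd]
  unfold star nb
  simp only [h]
  push_cast
  ring

lemma star_neg (k : ℝ) (u : Config) (q : ℤ × ℤ) :
    star k u q (-1) = 2 * nb u q 1 + (1 - k) * nb u q 0 := by
  have h : ∀ b : SignType, bnd k (-1) b = 2 * (if b = 1 then (1 : ℝ) else 0) +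
      (1 - k) * (if b = 0 then (1 : ℝ) else 0) := by
    intro b; cases b <;> simp [bnd]
  unfold star nb
  simp only [h]
  push_cast
  ring

lemma star_zero (k : ℝ) (u : Config) (q : ℤ × ℤ) : star k u q 0 = 4 * (1 - k) := by
  unfold star; simp only [bnd_zero_left]; ring

lemma exists_adj_of_nb {u : Config} {q : ℤ × ℤ} {a : SignType} (h : 0 < nb u q a) :
    ∃ p, grid.Adj q p ∧ u p = a := by
  by_contra! hn
  have h1 := hn (q + (1, 0)) (adj_iff.2 (by simp))
  have h2 := hn (q - (1, 0)) (adj_iff.2 (by simp))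
  have h3 := hn (q + (0, 1)) (adj_iff.2 (by simp))
  have h4 := hn (q - (0, 1)) (adj_iff.2 (by simp))
  simp [nb, h1, h2, h3, h4] at h

lemma nb_pos {u : Config} {q p : ℤ × ℤ} {a : SignType} (h : grid.Adj q p) (hp : u p = a) :
    0 < nb u q a := by
  unfold nb
  rcases adj_iff.1 h with rfl | rfl | rfl | rfl <;> simp [hp]

lemma en_insert_surfactant {k : ℝ} {I Z : Finset (ℤ × ℤ)} {q : ℤ × ℤ} (hI : q ∉ I)
    (hZ : q ∉ Z) : en k (spin I (insert q Z)) = en k (spin I Z) + 4 * (1 - k) -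
      (2 * nb (spin I Z) q 1 + (1 - k) * nb (spin I Z) q 0) := by
  have h := en_update (k := k) (finSupp_spin I Z) q 0
  rw [update_insert_right hI, spin_eq_neg.2 ⟨hI, hZ⟩, star_zero, star_neg] at h
  linarith

lemma en_erase_surfactant {k : ℝ} {I Z : Finset (ℤ × ℤ)} {q : ℤ × ℤ} (hI : q ∉ I)
    (hZ : q ∈ Z) : en k (spin I (Z.erase q)) = en k (spin I Z) - 4 * (1 - k) +
      (2 * nb (spin I Z) q 1 + (1 - k) * nb (spin I Z) q 0) := by
  have h := en_update (k := k) (finSupp_spin I Z) q (-1)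
  have h0 : spin I Z q = 0 := by simp [spin, hI, hZ]
  rw [update_erase_right hI, h0, star_zero, star_neg] at h
  linarith

lemma en_surfactant_to_phase {k : ℝ} {I Z : Finset (ℤ × ℤ)} {q : ℤ × ℤ} (hI : q ∉ I)
    (hZ : q ∈ Z) : en k (spin (insert q I) (Z.erase q)) = en k (spin I Z) - 4 * (1 - k) +
      (2 * nb (spin I Z) q (-1) + (1 - k) * nb (spin I Z) q 0) := by
  have h := en_update (k := k) (finSupp_spin I Z) q 1
  have h0 : spin I Z q = 0 := by simp [spin, hI, hZ]
  rw [update_insert_left, h0, star_zero, star_one] at h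
  linarith

lemma en_phase_to_surfactant {k : ℝ} {I Z : Finset (ℤ × ℤ)} {q : ℤ × ℤ} (hI : q ∈ I) :
    en k (spin (I.erase q) (insert q Z)) = en k (spin I Z) + 4 * (1 - k) -
      (2 * nb (spin I Z) q (-1) + (1 - k) * nb (spin I Z) q 0) := by
  have h := en_update (k := k) (finSupp_spin I Z) q 0
  rw [update_erase_left, spin_eq_one.2 hI, star_zero, star_one] at h
  linarith

lemma diss_insert_le (J I : Finset (ℤ × ℤ)) (q : ℤ × ℤ) :
    diss J (insert q I) ≤ diss J I + if q ∈ J then 0 else dep J q := by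
  unfold diss
  split_ifs with h
  · refine (Finset.sum_le_sum_of_subset ?_).trans (le_add_right le_rfl)
    intro p hp
    simp only [Finset.mem_symmDiff, Finset.mem_insert] at hp ⊢
    rcases hp with ⟨rfl | hp, h2⟩ | hp
    · exact absurd h h2
    · exact Or.inl ⟨hp, h2⟩
    · exact Or.inr ⟨hp.1, fun h' => hp.2 (Or.inr h')⟩
  · calc _ ≤ ∑ p ∈ symmDiff I J ∪ {q}, dep J p := by
          apply Finset.sum_le_sum_of_subset
          intro p hp
          simp only [Finset.mem_symmDiff, Finset.mem_insert, Finset.mem_union,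
            Finset.mem_singleton] at hp ⊢
          tauto
      _ ≤ _ := by
          have := Finset.sum_union_inter (s₁ := symmDiff I J) (s₂ := {q}) (f := dep J)
          rw [Finset.sum_singleton] at this
          omega

lemma diss_erase_le (J I : Finset (ℤ × ℤ)) (q : ℤ × ℤ) :
    diss J (I.erase q) ≤ diss J I + if q ∈ J then dep J q else 0 := by
  unfold diss
  split_ifs with h
  · calc _ ≤ ∑ p ∈ symmDiff I J ∪ {q}, dep J p := by
          apply Finset.sum_le_sum_of_subset
          intro p hp
          simp only [Finset.mem_symmDiff, Finset.mem_erase, Finset.mem_union,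
            Finset.mem_singleton] at hp ⊢
          tauto
      _ ≤ _ := by
          have := Finset.sum_union_inter (s₁ := symmDiff I J) (s₂ := {q}) (f := dep J)
          rw [Finset.sum_singleton] at this
          omega
  · refine (Finset.sum_le_sum_of_subset ?_).trans (le_add_right le_rfl)
    intro p hp
    simp only [Finset.mem_symmDiff, Finset.mem_erase] at hp ⊢
    by_cases hpq : p = q
    · subst hpq; tauto
    · tauto

/-- If a minimizer has too much surfactant, then every surfactant site has two neighbours in
each phase. -/
lemma IsMin.nb_eq_two {k κ ε : ℝ} (hk : 1 / 3 < k) (hk' : k < 1) (hκ : 4 * k ≤ κ) (hε : 0 < ε)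
    {J I Z : Finset (ℤ × ℤ)} {n D : ℕ} (hJ : J.Nonempty) (h : IsMin k κ ε J n I Z)
    (hdeep : ∀ p, D ≤ dep J p → (p ∈ I ↔ p ∈ J)) (hD1 : 1 ≤ D) (hD : κ * ε * D < 1) (hn : n < Z.card)
    {z : ℤ × ℤ} (hz : z ∈ Z) :
    nb (spin I Z) z 1 = 2 ∧ nb (spin I Z) z (-1) = 2 ∧ κ = 4 * k := by
  have hzI : z ∉ I := fun hzI => Finset.disjoint_left.1 h.1 hzI hz
  have hκ0 : 0 < κ := by linarith
  have hcard : |((Z.erase z).card : ℝ) - n| = |(Z.card : ℝ) - n| - 1 := by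
    rw [Finset.card_erase_of_mem hz, Nat.cast_sub (by omega)]
    have : (n : ℝ) + 1 ≤ Z.card := by exact_mod_cast hn
    rw [abs_of_nonneg (by push_cast; linarith), abs_of_nonneg (by linarith)]
    push_cast; ring
  have m1 := h.2 I (Z.erase z) (h.1.mono_right (Finset.erase_subset _ _))
  have m2 := h.2 (insert z I) (Z.erase z) (by
    rw [Finset.disjoint_insert_left]
    exact ⟨Finset.notMem_erase _ _, h.1.mono_right (Finset.erase_subset _ _)⟩)
  unfold fn at m1 m2
  rw [hcard, en_erase_surfactant hzI hz] at m1
  rw [hcard, en_surfactant_to_phase hzI hz] at m2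
  have hsum := nb_add (spin I Z) z
  set i := nb (spin I Z) z 1
  set s := nb (spin I Z) z 0
  set m := nb (spin I Z) z (-1)
  have hsum' : (i : ℝ) + s + m = 4 := by exact_mod_cast hsum
  have hs : (s : ℝ) = 4 - i - m := by linarith
  have hi2 : 2 ≤ i := by
    by_contra hi
    have hi1 : (i : ℝ) ≤ 1 := by exact_mod_cast (by omega : i ≤ 1)
    rw [hs] at m1
    nlinarith
  have hd : (diss J (insert z I) : ℝ) ≤ diss J I + D := by
    have h1 := diss_insert_le J I z
    have h2 : (if z ∈ J then 0 else dep J z) ≤ D := by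
      split_ifs with hzJ
      · exact Nat.zero_le _
      · obtain ⟨p, hp, hpu⟩ := exists_adj_of_nb (u := spin I Z) (q := z) (a := 1) (by omega)
        rw [spin_eq_one] at hpu
        by_cases hpJ : p ∈ J
        · have e1 := dep_eq_one hJ hp (by tauto)
          omega
        · have e1 := dep_le_succ hJ hp (by tauto)
          have e2 := hdeep p
          by_contra hlt
          exact hpJ ((e2 (by omega)).1 hpu)
    exact_mod_cast h1.trans (by omega)
  have hd' := mul_le_mul_of_nonneg_left hd (mul_pos hκ0 hε).le
  have hm2 : 2 ≤ m := by
    by_contra hm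
    have hm1 : (m : ℝ) ≤ 1 := by exact_mod_cast (by omega : m ≤ 1)
    have hi2' : (2 : ℝ) ≤ i := by exact_mod_cast hi2
    rw [hs] at m2
    nlinarith
  have e1 : i = 2 := by omega
  have e2 : m = 2 := by omega
  have e3 : s = 0 := by omega
  refine ⟨e1, e2, ?_⟩
  rw [e1, e3] at m1
  push_cast at m1
  linarith

/-- A minimizer does not have too little surfactant. -/
lemma IsMin.le_card {k κ ε : ℝ} (hk : 1 / 3 < k) (hk' : k < 1) (hκ : 4 * k ≤ κ) (hε : 0 < ε)
    {J I Z : Finset (ℤ × ℤ)} {n D : ℕ} (hJ : J.Nonempty) (h : IsMin k κ ε J n I Z)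
    (hdeep : ∀ p, D ≤ dep J p → (p ∈ I ↔ p ∈ J)) (hD1 : 1 ≤ D) (hD : κ * ε * D < 6 * k - 2)
    (hI : I.Nonempty) : n ≤ Z.card := by
  by_contra! hn
  have hκ0 : 0 < κ := by linarith
  have hcard : ∀ q ∉ Z, |((insert q Z).card : ℝ) - n| = |(Z.card : ℝ) - n| - 1 := by
    intro q hq
    rw [Finset.card_insert_of_notMem hq]
    have : (Z.card : ℝ) + 1 ≤ n := by exact_mod_cast hn
    rw [abs_of_nonpos (by push_cast; linarith), abs_of_nonpos (by linarith)]
    push_cast; ring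
  have hout : ∀ p ∈ I, ∀ q ∉ I, grid.Adj q p → q ∈ Z := by
    intro p hp q hq hadj
    by_contra hqZ
    have m1 := h.2 I (insert q Z) (by rw [Finset.disjoint_insert_right]; exact ⟨hq, h.1⟩)
    unfold fn at m1
    rw [hcard q hqZ, en_insert_surfactant hq hqZ] at m1
    have hp1 := nb_pos (u := spin I Z) hadj (spin_eq_one.2 hp)
    have : (1 : ℝ) ≤ nb (spin I Z) q 1 := by exact_mod_cast hp1
    have hs0 : (0 : ℝ) ≤ (1 - k) * nb (spin I Z) q 0 := by
      apply mul_nonneg (by linarith); positivity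
    nlinarith
  obtain ⟨p, hp, hmax⟩ := I.exists_max_image (fun p => p.2 - p.1) hI
  have hup : p + (0, 1) ∉ I := by
    intro hc; have := hmax _ hc
    simp at this
  have hleft : p - (1, 0) ∉ I := by
    intro hc; have := hmax _ hc
    simp at this
  have hpZ : p ∉ Z := fun hpZ => Finset.disjoint_left.1 h.1 hp hpZ
  have hu0 : spin I Z (p + (0, 1)) = 0 :=
    (spin_eq_zero h.1).2 (hout p hp _ hup (adj_iff.2 (by simp)))
  have hl0 : spin I Z (p - (1, 0)) = 0 :=
    (spin_eq_zero h.1).2 (hout p hp _ hleft (adj_iff.2 (by simp)))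
  have hnb : 2 ≤ nb (spin I Z) p 0 := by
    unfold nb; rw [hu0, hl0]; simp only [if_true]; omega
  have hnb' : (2 : ℝ) ≤ nb (spin I Z) p 0 := by exact_mod_cast hnb
  have m1 := h.2 (I.erase p) (insert p Z) (by
    rw [Finset.disjoint_insert_right]
    exact ⟨Finset.notMem_erase _ _, h.1.mono_left (Finset.erase_subset _ _)⟩)
  unfold fn at m1
  rw [hcard p hpZ, en_phase_to_surfactant hp] at m1
  have hd : (diss J (I.erase p) : ℝ) ≤ diss J I + D := by
    have h1 := diss_erase_le J I p
    have h2 : (if p ∈ J then dep J p else 0) ≤ D := by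
      split_ifs with hpJ
      · have hadj : grid.Adj p (p + (0, 1)) := adj_iff.2 (by simp)
        by_cases hqJ : p + (0, 1) ∈ J
        · have e1 := dep_le_succ hJ hadj (by tauto)
          by_contra hlt
          exact hup ((hdeep _ (by omega)).2 hqJ)
        · have e1 := dep_eq_one hJ hadj (by tauto)
          omega
      · exact Nat.zero_le _
    exact_mod_cast h1.trans (by omega)
  have hd' := mul_le_mul_of_nonneg_left hd (mul_pos hκ0 hε).le
  have hs0 : (0 : ℝ) ≤ nb (spin I Z) p (-1) := by positivity
  nlinarith

/-- In the critical case excess surfactant can be removed from a minimizer. -/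
lemma IsMin.subset {k ε : ℝ} (hk : 1 / 3 < k) (hk' : k < 1) (hε : 0 < ε)
    {J I Z : Finset (ℤ × ℤ)} {n D : ℕ} (hJ : J.Nonempty) (h : IsMin k (4 * k) ε J n I Z)
    (hdeep : ∀ p, D ≤ dep J p → (p ∈ I ↔ p ∈ J)) (hD1 : 1 ≤ D) (hD : 4 * k * ε * D < 1)
    {Z' : Finset (ℤ × ℤ)} (hZ : Z' ⊆ Z) (hn : n ≤ Z'.card) : IsMin k (4 * k) ε J n I Z' := by
  induction hm : (Z \ Z').card generalizing Z with
  | zero =>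
    have : Z = Z' := by
      rw [Finset.card_eq_zero, Finset.sdiff_eq_empty_iff_subset] at hm
      exact Finset.Subset.antisymm hm hZ
    exact this ▸ h
  | succ m ih =>
    obtain ⟨z, hz⟩ : (Z \ Z').Nonempty := Finset.card_pos.1 (by omega)
    rw [Finset.mem_sdiff] at hz
    have hsub : Z' ⊆ Z.erase z := fun p hp => Finset.mem_erase.2 ⟨fun e => hz.2 (e ▸ hp), hZ hp⟩
    have hlt : n < Z.card := by
      have h1 := Finset.card_le_card hsub
      have h2 := Finset.card_erase_lt_of_mem hz.1
      omega
    obtain ⟨e1, e2, -⟩ := h.nb_eq_two hk hk' le_rfl hε hJ hdeep hD1 hD hlt hz.1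
    have e3 : nb (spin I Z) z 0 = 0 := by have := nb_add (spin I Z) z; omega
    have hzI : z ∉ I := fun hzI => Finset.disjoint_left.1 h.1 hzI hz.1
    refine ih (Z := Z.erase z) ⟨h.1.mono_right (Finset.erase_subset _ _), fun I' Z'' h' => ?_⟩
      hsub ?_
    · refine le_trans (le_of_eq ?_) (h.2 I' Z'' h')
      unfold fn
      rw [en_erase_surfactant hzI hz.1, e1, e3, Finset.card_erase_of_mem hz.1,
        Nat.cast_sub (by omega)]
      have : (n : ℝ) + 1 ≤ Z.card := by exact_mod_cast hlt
      rw [abs_of_nonneg (by push_cast; linarith), abs_of_nonneg (by linarith)]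
      push_cast; ring
    · have e4 : Z.erase z \ Z' = (Z \ Z').erase z := by
        ext p; simp only [Finset.mem_sdiff, Finset.mem_erase]; tauto
      rw [e4, Finset.card_erase_of_mem (by simp [hz]), hm]; rfl

lemma IsStaircase.row {J : Finset (ℤ × ℤ)} (h : IsStaircase (↑J : Set (ℤ × ℤ))) (x₁ x₂ x₃ y : ℤ)
    (h₁ : x₁ ≤ x₂) (h₂ : x₂ ≤ x₃) (h₃ : (x₁, y) ∈ J) (h₄ : (x₃, y) ∈ J) : (x₂, y) ∈ J :=
  h.horizontal x₁ x₂ x₃ y h₁ h₂ h₃ h₄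

lemma IsStaircase.col {J : Finset (ℤ × ℤ)} (h : IsStaircase (↑J : Set (ℤ × ℤ))) (x y₁ y₂ y₃ : ℤ)
    (h₁ : y₁ ≤ y₂) (h₂ : y₂ ≤ y₃) (h₃ : (x, y₁) ∈ J) (h₄ : (x, y₃) ∈ J) : (x, y₂) ∈ J :=
  h.vertical x y₁ y₂ y₃ h₁ h₂ h₃ h₄

lemma exists_crossing {I : Set (ℤ × ℤ)} (h : (grid.induce I).Connected) {P : ℤ × ℤ → Prop}
    {a b : ℤ × ℤ} (ha : a ∈ I) (hb : b ∈ I) (hPa : P a) (hPb : ¬ P b) :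
    ∃ p ∈ I, ∃ q ∈ I, P p ∧ ¬ P q ∧ grid.Adj p q := by
  obtain ⟨w⟩ := h.preconnected ⟨a, ha⟩ ⟨b, hb⟩
  obtain ⟨d, -, h1, h2⟩ := w.exists_boundary_dart {x | P x.1} hPa hPb
  exact ⟨d.fst.1, d.fst.2, d.snd.1, d.snd.2, h1, h2, d.adj⟩

lemma adj_cases {p q : ℤ × ℤ} (h : grid.Adj p q) :
    (q.1 = p.1 + 1 ∧ q.2 = p.2) ∨ (q.1 = p.1 - 1 ∧ q.2 = p.2) ∨ (q.1 = p.1 ∧ q.2 = p.2 + 1) ∨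
      (q.1 = p.1 ∧ q.2 = p.2 - 1) := by
  rcases adj_iff.1 h with rfl | rfl | rfl | rfl <;> simp

lemma adj_mk {a b c d : ℤ} (h : (c = a + 1 ∧ d = b) ∨ (c = a - 1 ∧ d = b) ∨ (c = a ∧ d = b + 1) ∨
    (c = a ∧ d = b - 1)) : grid.Adj (a, b) (c, d) := by
  rw [adj_iff]; simp only [Prod.mk_add_mk, Prod.mk_sub_mk, Prod.mk.injEq, add_zero, sub_zero]
  exact h

/-- A site outside a staircase set sees no site of it in one of the four quadrants. -/
lemma IsStaircase.quadrant {I : Set (ℤ × ℤ)} (h : IsStaircase I) {p : ℤ × ℤ} (hp : p ∉ I) :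
    (∀ q ∈ I, ¬ (q.1 ≤ p.1 ∧ q.2 ≤ p.2)) ∨ (∀ q ∈ I, ¬ (p.1 ≤ q.1 ∧ q.2 ≤ p.2)) ∨
    (∀ q ∈ I, ¬ (p.1 ≤ q.1 ∧ p.2 ≤ q.2)) ∨ (∀ q ∈ I, ¬ (q.1 ≤ p.1 ∧ p.2 ≤ q.2)) := by
  by_contra! hn
  obtain ⟨⟨a, ha, ha1, ha2⟩, ⟨b, hb, hb1, hb2⟩, ⟨c, hc, hc1, hc2⟩, ⟨d, hd, hd1, hd2⟩⟩ := hn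
  obtain ⟨x, y⟩ := p
  simp only at *
  have hH : (∀ t, t ≤ x → (t, y) ∉ I) ∨ (∀ t, x ≤ t → (t, y) ∉ I) := by
    by_contra! hn
    obtain ⟨⟨t, ht, h1⟩, ⟨s, hs, h2⟩⟩ := hn
    exact hp (h.horizontal t x s y ht hs h1 h2)
  have hV : (∀ t, t ≤ y → (x, t) ∉ I) ∨ (∀ t, y ≤ t → (x, t) ∉ I) := by
    by_contra! hn
    obtain ⟨⟨t, ht, h1⟩, ⟨s, hs, h2⟩⟩ := hn
    exact hp (h.vertical x t y s ht hs h1 h2)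
  have fin : ∀ (s t : ℤ), (s = 1 ∨ s = -1) → (t = 1 ∨ t = -1) → ∀ u ∈ I, ∀ v ∈ I,
      0 ≤ s * (u.1 - x) → 0 ≤ t * (u.2 - y) → s * (v.1 - x) ≤ 0 → t * (v.2 - y) ≤ 0 →
      (∀ r, 0 ≤ s * (r - x) → (r, y) ∉ I) → (∀ r, 0 ≤ t * (r - y) → (x, r) ∉ I) → False := by
    intro s t hs ht u hu v hv h1 h2 h3 h4 h5 h6
    have hPu : 0 < s * (u.1 - x) ∧ 0 < t * (u.2 - y) := by
      constructor
      · refine lt_of_le_of_ne h1 fun e => ?_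
        have : u.1 = x := by rcases hs with rfl | rfl <;> omega
        exact h6 u.2 h2 (this ▸ hu)
      · refine lt_of_le_of_ne h2 fun e => ?_
        have : u.2 = y := by rcases ht with rfl | rfl <;> omega
        exact h5 u.1 h1 (this ▸ hu)
    obtain ⟨p, hp, q, hq, hPp, hPq, hadj⟩ := exists_crossing h.connected
      (P := fun w => 0 < s * (w.1 - x) ∧ 0 < t * (w.2 - y)) hu hv hPu (by omega)
    obtain ⟨p1, p2⟩ := p
    obtain ⟨q1, q2⟩ := q
    have hadj := adj_cases hadj
    simp only at hadj hPp hPq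
    have k5 := h5 q1
    have k6 := h6 q2
    by_cases e1 : q2 = y
    · subst e1
      refine k5 ?_ hq
      rcases hs with rfl | rfl <;> rcases ht with rfl | rfl <;> omega
    · by_cases e2 : q1 = x
      · subst e2
        refine k6 ?_ hq
        rcases hs with rfl | rfl <;> rcases ht with rfl | rfl <;> omega
      · rcases hs with rfl | rfl <;> rcases ht with rfl | rfl <;> omega
  rcases hH with hH | hH <;> rcases hV with hV | hV
  · exact fin (-1) (-1) (by simp) (by simp) a ha c hc (by omega) (by omega) (by omega) (by omega)
      (fun r hr => hH r (by omega)) (fun r hr => hV r (by omega))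
  · exact fin (-1) 1 (by simp) (by simp) d hd b hb (by omega) (by omega) (by omega) (by omega)
      (fun r hr => hH r (by omega)) (fun r hr => hV r (by omega))
  · exact fin 1 (-1) (by simp) (by simp) b hb d hd (by omega) (by omega) (by omega) (by omega)
      (fun r hr => hH r (by omega)) (fun r hr => hV r (by omega))
  · exact fin 1 1 (by simp) (by simp) c hc a ha (by omega) (by omega) (by omega) (by omega)
      (fun r hr => hH r (by omega)) (fun r hr => hV r (by omega))

/-- Reflection at the diagonal. -/
def swapped (I : Finset (ℤ × ℤ)) : Finset (ℤ × ℤ) := I.map (Equiv.prodComm ℤ ℤ).toEmbedding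

@[simp] lemma mem_swapped {I : Finset (ℤ × ℤ)} {p : ℤ × ℤ} : p ∈ swapped I ↔ (p.2, p.1) ∈ I := by
  unfold swapped
  rw [Finset.mem_map_equiv]
  rfl

@[simp] lemma card_swapped (I : Finset (ℤ × ℤ)) : (swapped I).card = I.card := by
  simp [swapped]

lemma disjoint_swapped {I Z : Finset (ℤ × ℤ)} (h : Disjoint I Z) :
    Disjoint (swapped I) (swapped Z) := by
  rw [Finset.disjoint_left] at h ⊢
  intro p hp hq
  exact h (mem_swapped.1 hp) (mem_swapped.1 hq)

lemma connected_of_crossing {I : Set (ℤ × ℤ)} (hne : I.Nonempty)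
    (h : ∀ P : ℤ × ℤ → Prop, ∀ a ∈ I, ∀ b ∈ I, P a → ¬ P b →
      ∃ p ∈ I, ∃ q ∈ I, P p ∧ ¬ P q ∧ grid.Adj p q) : (grid.induce I).Connected := by
  have : Nonempty I := hne.to_subtype
  refine ⟨fun a b => ?_⟩
  by_contra hn
  obtain ⟨p, hp, q, hq, h1, h2, h3⟩ := h
    (fun p => ∃ hp : p ∈ I, (grid.induce I).Reachable a ⟨p, hp⟩) a a.2 b b.2 ⟨a.2, .refl a⟩
    (fun ⟨_, h⟩ => hn h)
  obtain ⟨hp', h1⟩ := h1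
  exact h2 ⟨hq, h1.trans (SimpleGraph.Adj.reachable (by exact h3))⟩

lemma IsStaircase.swapped {I : Finset (ℤ × ℤ)} (h : IsStaircase (↑I : Set (ℤ × ℤ))) :
    IsStaircase (↑(swapped I) : Set (ℤ × ℤ)) := by
  refine ⟨Finset.finite_toSet _, ?_, ?_, ?_⟩
  · obtain ⟨p, hp⟩ := h.connected.nonempty
    refine connected_of_crossing ⟨(p.2, p.1), ?_⟩ ?_
    · simpa using hp
    · intro P a ha b hb hPa hPb
      obtain ⟨p, hp, q, hq, h1, h2, h3⟩ := exists_crossing h.connected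
        (P := fun p => P (p.2, p.1)) (a := (a.2, a.1)) (b := (b.2, b.1)) (by simpa using ha)
        (by simpa using hb) hPa hPb
      refine ⟨(p.2, p.1), by simpa using hp, (q.2, q.1), by simpa using hq, h1, h2, ?_⟩
      have := adj_cases h3
      exact adj_mk (by omega)
  · intro x₁ x₂ x₃ y h1 h2 h3 h4
    simp only [Finset.mem_coe, mem_swapped] at *
    exact h.vertical y x₁ x₂ x₃ h1 h2 h3 h4
  · intro x y₁ y₂ y₃ h1 h2 h3 h4
    simp only [Finset.mem_coe, mem_swapped] at *
    exact h.horizontal y₁ y₂ y₃ x h1 h2 h3 h4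

/-- The exterior boundary as a finset. -/
def obd (J : Finset (ℤ × ℤ)) : Finset (ℤ × ℤ) :=
  (J.image (· - (1, 0)) ∪ J.image (· + (1, 0)) ∪ J.image (· - (0, 1)) ∪ J.image (· + (0, 1))) \ J

lemma mem_obd {J : Finset (ℤ × ℤ)} {p : ℤ × ℤ} : p ∈ obd J ↔
    p ∉ J ∧ (p + (1, 0) ∈ J ∨ p - (1, 0) ∈ J ∨ p + (0, 1) ∈ J ∨ p - (0, 1) ∈ J) := by
  have h1 : ∀ e : ℤ × ℤ, p ∈ J.image (· - e) ↔ p + e ∈ J := by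
    intro e
    simp only [Finset.mem_image]
    exact ⟨by rintro ⟨a, ha, rfl⟩; simpa using ha, fun h => ⟨_, h, by simp⟩⟩
  have h2 : ∀ e : ℤ × ℤ, p ∈ J.image (· + e) ↔ p - e ∈ J := by
    intro e
    simp only [Finset.mem_image]
    exact ⟨by rintro ⟨a, ha, rfl⟩; simpa using ha, fun h => ⟨_, h, by simp⟩⟩
  unfold obd
  simp only [Finset.mem_sdiff, Finset.mem_union, h1, h2]
  tauto

lemma mem_obd_iff_adj {J : Finset (ℤ × ℤ)} {p : ℤ × ℤ} : p ∈ obd J ↔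
    p ∉ J ∧ ∃ q ∈ J, grid.Adj p q := by
  rw [mem_obd]
  refine and_congr_right fun _ => ⟨?_, ?_⟩
  · rintro (h | h | h | h)
    exacts [⟨_, h, adj_iff.2 (by simp)⟩, ⟨_, h, adj_iff.2 (by simp)⟩, ⟨_, h, adj_iff.2 (by simp)⟩,
      ⟨_, h, adj_iff.2 (by simp)⟩]
  · rintro ⟨q, hq, h⟩
    rcases adj_iff.1 h with rfl | rfl | rfl | rfl <;> tauto

lemma coe_obd (J : Finset (ℤ × ℤ)) : (↑(obd J) : Set (ℤ × ℤ)) = outerBdry ↑J := by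
  ext p
  rw [Finset.mem_coe, mem_obd_iff_adj]; rfl

/-- Sites of the exterior boundary with a horizontal and a vertical neighbour in `J`. -/
def ocr (J : Finset (ℤ × ℤ)) : Finset (ℤ × ℤ) :=
  (obd J).filter fun p => (p + (1, 0) ∈ J ∨ p - (1, 0) ∈ J) ∧ (p + (0, 1) ∈ J ∨ p - (0, 1) ∈ J)

lemma mem_ocr {J : Finset (ℤ × ℤ)} {p : ℤ × ℤ} : p ∈ ocr J ↔
    p ∉ J ∧ (p + (1, 0) ∈ J ∨ p - (1, 0) ∈ J) ∧ (p + (0, 1) ∈ J ∨ p - (0, 1) ∈ J) := by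
  unfold ocr
  rw [Finset.mem_filter, mem_obd]
  tauto

/-- Sites lying in the bounding box of `J`. -/
def InBox (J : Finset (ℤ × ℤ)) (p : ℤ × ℤ) : Prop :=
  (∃ b ∈ J, b.1 ≤ p.1) ∧ (∃ b ∈ J, p.1 ≤ b.1) ∧ (∃ b ∈ J, b.2 ≤ p.2) ∧ (∃ b ∈ J, p.2 ≤ b.2)

lemma reach_horizontal {J : Finset (ℤ × ℤ)} (hJ : IsStaircase (↑J : Set (ℤ × ℤ)))
    {Z : ℤ × ℤ → Prop} (hc : ∀ p ∈ ocr J, Z p)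
    (hcl : ∀ p ∈ obd J, InBox J p → ¬ Z p → ∀ p' ∈ obd J, InBox J p' → grid.Adj p p' → ¬ Z p')
    {s t : ℤ} (hs : s = 1 ∨ s = -1) (ht : t = 1 ∨ t = -1) (N : ℕ) {x y : ℤ} (hp : (x, y) ∉ J)
    (hpJ : (x + s, y) ∈ J) (hbox : InBox J (x, y)) {b : ℤ × ℤ} (hb : b ∈ J)
    (hb1 : s * (b.1 - x) ≤ 0) (hb2 : 0 < t * (b.2 - y)) (hN : t * (b.2 - y) ≤ N) : Z (x, y) := by
  have hH := hJ.row
  induction N generalizing y with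
  | zero => omega
  | succ N ih =>
    by_contra hZ
    have hobd : ∀ y', (x, y') ∉ J → (x + s, y') ∈ J → (x, y') ∈ obd J := by
      intro y' h1 h2
      rw [mem_obd]
      refine ⟨h1, ?_⟩
      rcases hs with rfl | rfl
      · left; simpa using h2
      · right; left; simpa [sub_eq_add_neg] using h2
    have hup : (x, y + t) ∉ J := by
      intro hin
      refine hZ (hc _ ?_)
      rw [mem_ocr]
      refine ⟨hp, ?_, ?_⟩
      · rcases hs with rfl | rfl
        · left; simpa using hpJ
        · right; simpa [sub_eq_add_neg] using hpJ
      · rcases ht with rfl | rfl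
        · left; simpa using hin
        · right; simpa [sub_eq_add_neg] using hin
    have hdiag : (x + s, y + t) ∈ J := by
      by_contra hdiag
      obtain ⟨⟨c1, c2⟩, hc', ⟨d1, d2⟩, hd', h1, h2, h3⟩ := exists_crossing hJ.connected
        (P := fun w => s * (w.1 - x) ≤ 0 ∧ 0 < t * (w.2 - y)) hb hpJ ⟨hb1, hb2⟩ (by simp)
      have h3 := adj_cases h3
      simp only [Finset.mem_coe] at *
      by_cases e : d2 = y
      · subst e
        refine hp ?_
        have : s * (d1 - x) ≤ 0 := by rcases hs with rfl | rfl <;> rcases ht with rfl | rfl <;> omega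
        rcases hs with rfl | rfl
        · exact hH d1 x (x + 1) d2 (by omega) (by omega) hd' hpJ
        · exact hH (x + -1) x d1 d2 (by omega) (by omega) hpJ hd'
      · have e1 : d1 = x + s := by
          rcases hs with rfl | rfl <;> rcases ht with rfl | rfl <;> omega
        subst e1
        have hV := hJ.col
        refine hdiag ?_
        rcases ht with rfl | rfl
        · exact hV (x + s) y (y + 1) d2 (by omega) (by omega) hpJ hd'
        · exact hV (x + s) d2 (y + -1) y (by omega) (by omega) hd' hpJ
    have hbox' : InBox J (x, y + t) :=
      ⟨hbox.1, hbox.2.1, ⟨_, hdiag, le_rfl⟩, ⟨_, hdiag, le_rfl⟩⟩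
    refine hcl (x, y) (hobd y hp hpJ) hbox hZ (x, y + t) (hobd _ hup hdiag) hbox' ?_ ?_
    · exact adj_mk (by omega)
    · refine ih hup hdiag hbox' ?_ ?_
      · by_contra hle
        have e : b.2 = y + t := by rcases ht with rfl | rfl <;> omega
        refine hup ?_
        have hb' : (b.1, y + t) ∈ J := by rw [← e]; exact hb
        rcases hs with rfl | rfl
        · exact hH b.1 x (x + 1) _ (by omega) (by omega) hb' hdiag
        · exact hH (x + -1) x b.1 _ (by omega) (by omega) hdiag hb'
      · rcases ht with rfl | rfl <;> push_cast at hN <;> omega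

lemma reach_horizontal' {J : Finset (ℤ × ℤ)} (hJ : IsStaircase (↑J : Set (ℤ × ℤ)))
    {Z : ℤ × ℤ → Prop} (hc : ∀ p ∈ ocr J, Z p)
    (hcl : ∀ p ∈ obd J, InBox J p → ¬ Z p → ∀ p' ∈ obd J, InBox J p' → grid.Adj p p' → ¬ Z p')
    {p : ℤ × ℤ} (hp : p ∉ J) (hpJ : p + (1, 0) ∈ J ∨ p - (1, 0) ∈ J) (hbox : InBox J p) : Z p := by
  have hH := hJ.row
  obtain ⟨x, y⟩ := p
  obtain ⟨s, hs, hpJ, b, hb, hb1⟩ : ∃ s : ℤ, (s = 1 ∨ s = -1) ∧ (x + s, y) ∈ J ∧ ∃ b ∈ J,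
      s * (b.1 - x) ≤ 0 := by
    obtain ⟨⟨b, hb, hb1⟩, ⟨b', hb', hb1'⟩, -⟩ := hbox
    rcases hpJ with h | h
    · exact ⟨1, by simp, by simpa using h, b, hb, by simp only at hb1; omega⟩
    · exact ⟨-1, by simp, by simpa [sub_eq_add_neg] using h, b', hb', by simp only at hb1'; omega⟩
  have hne : b.2 ≠ y := by
    intro e
    have hb' : (b.1, y) ∈ J := by rw [← e]; exact hb
    refine hp ?_
    rcases hs with rfl | rfl
    · exact hH b.1 x (x + 1) _ (by omega) (by omega) hb' hpJ
    · exact hH (x + -1) x b.1 _ (by omega) (by omega) hpJ hb'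
  rcases lt_or_gt_of_ne hne with hlt | hlt
  · exact reach_horizontal hJ hc hcl hs (t := -1) (by simp) (y - b.2).toNat hp hpJ hbox hb hb1
      (by omega) (by omega)
  · exact reach_horizontal hJ hc hcl hs (t := 1) (by simp) (b.2 - y).toNat hp hpJ hbox hb hb1
      (by omega) (by omega)

lemma mem_obd_swapped {J : Finset (ℤ × ℤ)} {p : ℤ × ℤ} :
    p ∈ obd (swapped J) ↔ (p.2, p.1) ∈ obd J := by
  obtain ⟨x, y⟩ := p
  simp only [mem_obd, mem_swapped, Prod.mk_add_mk, Prod.mk_sub_mk]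
  tauto

lemma mem_ocr_swapped {J : Finset (ℤ × ℤ)} {p : ℤ × ℤ} :
    p ∈ ocr (swapped J) ↔ (p.2, p.1) ∈ ocr J := by
  obtain ⟨x, y⟩ := p
  simp only [mem_ocr, mem_swapped, Prod.mk_add_mk, Prod.mk_sub_mk]
  tauto

lemma inBox_swapped {J : Finset (ℤ × ℤ)} {p : ℤ × ℤ} :
    InBox (swapped J) p ↔ InBox J (p.2, p.1) := by
  have h1 : ∀ P : ℤ × ℤ → Prop, (∃ b ∈ swapped J, P b) ↔ ∃ b ∈ J, P (b.2, b.1) := by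
    intro P
    exact ⟨fun ⟨b, hb, h⟩ => ⟨_, mem_swapped.1 hb, h⟩, fun ⟨b, hb, h⟩ =>
      ⟨(b.2, b.1), mem_swapped.2 hb, h⟩⟩
  unfold InBox
  rw [h1, h1, h1, h1]
  tauto

/-- In the bounding box the exterior boundary is connected to the corners. -/
lemma mem_of_obd {J : Finset (ℤ × ℤ)} (hJ : IsStaircase (↑J : Set (ℤ × ℤ)))
    {Z : ℤ × ℤ → Prop} (hc : ∀ p ∈ ocr J, Z p)
    (hcl : ∀ p ∈ obd J, InBox J p → ¬ Z p → ∀ p' ∈ obd J, InBox J p' → grid.Adj p p' → ¬ Z p')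
    {p : ℤ × ℤ} (hp : p ∈ obd J) (hbox : InBox J p) : Z p := by
  rw [mem_obd] at hp
  by_cases hh : p + (1, 0) ∈ J ∨ p - (1, 0) ∈ J
  · exact reach_horizontal' hJ hc hcl hp.1 hh hbox
  · have hv : p + (0, 1) ∈ J ∨ p - (0, 1) ∈ J := by tauto
    refine reach_horizontal' hJ.swapped (Z := fun q => Z (q.2, q.1)) (p := (p.2, p.1))
      (fun q hq => hc _ (mem_ocr_swapped.1 hq)) ?_ ?_ ?_ ?_
    · intro q hq hqb hqZ q' hq' hqb' hadj
      refine hcl _ (mem_obd_swapped.1 hq) (inBox_swapped.1 hqb) hqZ _ (mem_obd_swapped.1 hq')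
        (inBox_swapped.1 hqb') ?_
      have := adj_cases hadj
      exact adj_mk (by omega)
    · simpa using hp.1
    · obtain ⟨x, y⟩ := p
      simpa using hv
    · rw [inBox_swapped]; exact hbox

/-- The unit vectors pointing from the external sides (lowest, leftmost, highest, rightmost)
into a set. -/
def dir : Fin 4 → ℤ × ℤ := ![(0, 1), (1, 0), (0, -1), (-1, 0)]

/-- The first sites of `I` met from the side `i` in the columns or rows. -/
def most (I : Finset (ℤ × ℤ)) : Fin 4 → Finset (ℤ × ℤ) :=
  ![I.filter fun p => ∀ q ∈ I, q.1 = p.1 → p.2 ≤ q.2, I.filter fun p => ∀ q ∈ I, q.2 = p.2 → p.1 ≤ q.1,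
    I.filter fun p => ∀ q ∈ I, q.1 = p.1 → q.2 ≤ p.2, I.filter fun p => ∀ q ∈ I, q.2 = p.2 → q.1 ≤ p.1]

/-- The external slices as finsets. -/
def sl (I : Finset (ℤ × ℤ)) : Fin 4 → Finset (ℤ × ℤ) :=
  ![I.filter fun p => ∀ q ∈ I, p.2 ≤ q.2, I.filter fun p => ∀ q ∈ I, p.1 ≤ q.1,
    I.filter fun p => ∀ q ∈ I, q.2 ≤ p.2, I.filter fun p => ∀ q ∈ I, q.1 ≤ p.1]

lemma mem_most0 {I : Finset (ℤ × ℤ)} {p : ℤ × ℤ} :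
    p ∈ most I 0 ↔ p ∈ I ∧ ∀ q ∈ I, q.1 = p.1 → p.2 ≤ q.2 := Finset.mem_filter
lemma mem_most1 {I : Finset (ℤ × ℤ)} {p : ℤ × ℤ} :
    p ∈ most I 1 ↔ p ∈ I ∧ ∀ q ∈ I, q.2 = p.2 → p.1 ≤ q.1 := Finset.mem_filter
lemma mem_most2 {I : Finset (ℤ × ℤ)} {p : ℤ × ℤ} :
    p ∈ most I 2 ↔ p ∈ I ∧ ∀ q ∈ I, q.1 = p.1 → q.2 ≤ p.2 := Finset.mem_filter
lemma mem_most3 {I : Finset (ℤ × ℤ)} {p : ℤ × ℤ} :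
    p ∈ most I 3 ↔ p ∈ I ∧ ∀ q ∈ I, q.2 = p.2 → q.1 ≤ p.1 := Finset.mem_filter
lemma mem_sl0 {I : Finset (ℤ × ℤ)} {p : ℤ × ℤ} :
    p ∈ sl I 0 ↔ p ∈ I ∧ ∀ q ∈ I, p.2 ≤ q.2 := Finset.mem_filter
lemma mem_sl1 {I : Finset (ℤ × ℤ)} {p : ℤ × ℤ} :
    p ∈ sl I 1 ↔ p ∈ I ∧ ∀ q ∈ I, p.1 ≤ q.1 := Finset.mem_filter
lemma mem_sl2 {I : Finset (ℤ × ℤ)} {p : ℤ × ℤ} :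
    p ∈ sl I 2 ↔ p ∈ I ∧ ∀ q ∈ I, q.2 ≤ p.2 := Finset.mem_filter
lemma mem_sl3 {I : Finset (ℤ × ℤ)} {p : ℤ × ℤ} :
    p ∈ sl I 3 ↔ p ∈ I ∧ ∀ q ∈ I, q.1 ≤ p.1 := Finset.mem_filter

lemma coe_sl (I : Finset (ℤ × ℤ)) (i : Fin 4) : (↑(sl I i) : Set (ℤ × ℤ)) = extSlice ↑I i := by
  ext p
  fin_cases i <;> simp [sl, extSlice]

lemma sl_subset_most (I : Finset (ℤ × ℤ)) (i : Fin 4) : sl I i ⊆ most I i := by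
  intro p hp
  fin_cases i
  · exact mem_most0.2 ⟨(mem_sl0.1 hp).1, fun q hq _ => (mem_sl0.1 hp).2 q hq⟩
  · exact mem_most1.2 ⟨(mem_sl1.1 hp).1, fun q hq _ => (mem_sl1.1 hp).2 q hq⟩
  · exact mem_most2.2 ⟨(mem_sl2.1 hp).1, fun q hq _ => (mem_sl2.1 hp).2 q hq⟩
  · exact mem_most3.2 ⟨(mem_sl3.1 hp).1, fun q hq _ => (mem_sl3.1 hp).2 q hq⟩

lemma most_subset (I : Finset (ℤ × ℤ)) (i : Fin 4) : most I i ⊆ I := by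
  fin_cases i <;> exact Finset.filter_subset _ _

lemma sl_nonempty {I : Finset (ℤ × ℤ)} (h : I.Nonempty) (i : Fin 4) : (sl I i).Nonempty := by
  fin_cases i
  · obtain ⟨p, hp, hm⟩ := I.exists_min_image (fun p => p.2) h
    exact ⟨p, mem_sl0.2 ⟨hp, hm⟩⟩
  · obtain ⟨p, hp, hm⟩ := I.exists_min_image (fun p => p.1) h
    exact ⟨p, mem_sl1.2 ⟨hp, hm⟩⟩
  · obtain ⟨p, hp, hm⟩ := I.exists_max_image (fun p => p.2) h
    exact ⟨p, mem_sl2.2 ⟨hp, hm⟩⟩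
  · obtain ⟨p, hp, hm⟩ := I.exists_max_image (fun p => p.1) h
    exact ⟨p, mem_sl3.2 ⟨hp, hm⟩⟩

/-- Twice the number of rows and columns met by `I`. -/
def sides (I : Finset (ℤ × ℤ)) : ℕ := ∑ i, (most I i).card

lemma sides_eq (I : Finset (ℤ × ℤ)) :
    sides I = (most I 0).card + (most I 1).card + (most I 2).card + (most I 3).card := by
  unfold sides; rw [Fin.sum_univ_four]

lemma IsStaircase.mem_most {J : Finset (ℤ × ℤ)} (hJ : IsStaircase (↑J : Set (ℤ × ℤ))) {p : ℤ × ℤ}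
    (i : Fin 4) (hp : p ∉ J) (hpi : p + dir i ∈ J) : p + dir i ∈ most J i := by
  obtain ⟨x, y⟩ := p
  have hH := hJ.row
  have hV := hJ.col
  fin_cases i
  · refine mem_most0.2 ⟨hpi, ?_⟩
    rintro ⟨a, b⟩ hq e
    simp [dir] at hpi e ⊢
    subst e
    by_contra hlt
    exact hp (hV a b y (y + 1) (by omega) (by omega) hq hpi)
  · refine mem_most1.2 ⟨hpi, ?_⟩
    rintro ⟨a, b⟩ hq e
    simp [dir] at hpi e ⊢
    subst e
    by_contra hlt
    exact hp (hH a x (x + 1) b (by omega) (by omega) hq hpi)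
  · refine mem_most2.2 ⟨hpi, ?_⟩
    rintro ⟨a, b⟩ hq e
    simp [dir] at hpi e ⊢
    subst e
    by_contra hlt
    exact hp (hV a (y + -1) y b (by omega) (by omega) hpi hq)
  · refine mem_most3.2 ⟨hpi, ?_⟩
    rintro ⟨a, b⟩ hq e
    simp [dir] at hpi e ⊢
    subst e
    by_contra hlt
    exact hp (hH (x + -1) x a b (by omega) (by omega) hpi hq)

lemma en_spin_empty_le_sides {k : ℝ} {J : Finset (ℤ × ℤ)}
    (hJ : IsStaircase (↑J : Set (ℤ × ℤ))) : en k (spin J ∅) ≤ 2 * sides J := by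
  obtain ⟨B, hB⟩ := (finSupp_spin J ∅).exists_box
  rw [en_eq_sum hB, sides_eq]
  have h0 := sum_indicator_le B (most J 0) (0, 1)
  have h1 := sum_indicator_le B (most J 1) (1, 0)
  have h2 := sum_indicator_le B (most J 2) 0
  have h3 := sum_indicator_le B (most J 3) 0
  have hs : ∑ p ∈ B, bondSum k (spin J ∅) p ≤ ∑ p ∈ B,
      (2 * (if p + (0, 1) ∈ most J 0 then (1 : ℝ) else 0) +
        2 * (if p + (1, 0) ∈ most J 1 then (1 : ℝ) else 0)
        + 2 * (if p + 0 ∈ most J 2 then (1 : ℝ) else 0)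
        + 2 * (if p + 0 ∈ most J 3 then (1 : ℝ) else 0)) := by
    apply Finset.sum_le_sum
    intro p _
    rw [add_zero]
    have k0 : p ∉ J → p + (0, 1) ∈ J → p + (0, 1) ∈ most J 0 := hJ.mem_most 0
    have k1 : p ∉ J → p + (1, 0) ∈ J → p + (1, 0) ∈ most J 1 := hJ.mem_most 1
    have k2 : p + (0, 1) ∉ J → p ∈ J → p ∈ most J 2 := by
      have := hJ.mem_most (p := p + (0, 1)) 2
      have e : p + (0, 1) + dir 2 = p := by ext <;> simp [dir]
      rwa [e] at this
    have k3 : p + (1, 0) ∉ J → p ∈ J → p ∈ most J 3 := by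
      have := hJ.mem_most (p := p + (1, 0)) 3
      have e : p + (1, 0) + dir 3 = p := by ext <;> simp [dir]
      rwa [e] at this
    have e : ∀ P : Prop, [Decidable P] → (0 : ℝ) ≤ if P then (1 : ℝ) else 0 := by
      intro P _; split_ifs <;> norm_num
    have bd : ∀ p' (P Q : Prop) [Decidable P] [Decidable Q], (p ∉ J → p' ∈ J → P) →
        (p' ∉ J → p ∈ J → Q) → bnd k (spin J ∅ p) (spin J ∅ p') ≤
        2 * (if P then (1 : ℝ) else 0) + 2 * (if Q then (1 : ℝ) else 0) := by
      intro p' P Q _ _ hP hQ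
      have e1 := e P
      have e2 := e Q
      by_cases h1 : p ∈ J <;> by_cases h2 : p' ∈ J
      · simp only [spin, h1, h2, if_true, bnd_one_one]; linarith
      · simp only [spin, h1, h2, if_true, if_false, Finset.notMem_empty, bnd_one_neg, hQ h2 h1]
        linarith
      · simp only [spin, h1, h2, if_true, if_false, Finset.notMem_empty, bnd_neg_one, hP h1 h2]
        linarith
      · simp only [spin, h1, h2, if_false, Finset.notMem_empty, bnd_neg_neg]; linarith
    have b1 := bd (p + (1, 0)) _ _ k1 k3
    have b2 := bd (p + (0, 1)) _ _ k0 k2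
    unfold bondSum
    linarith
  simp only [Finset.sum_add_distrib, ← Finset.mul_sum] at hs
  push_cast
  linarith

lemma nb_one_pos {J Z : Finset (ℤ × ℤ)} {p : ℤ × ℤ} (hp : p ∈ obd J) :
    1 ≤ nb (spin J Z) p 1 := by
  obtain ⟨-, q, hq, h⟩ := mem_obd_iff_adj.1 hp
  exact nb_pos h (spin_eq_one.2 hq)

lemma two_le_nb_one {J Z : Finset (ℤ × ℤ)} {p : ℤ × ℤ} (hp : p ∈ ocr J) :
    2 ≤ nb (spin J Z) p 1 := by
  obtain ⟨-, h1, h2⟩ := mem_ocr.1 hp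
  unfold nb
  simp only [spin_eq_one]
  rcases h1 with h1 | h1 <;> rcases h2 with h2 | h2 <;> simp only [h1, h2, if_true] <;> omega

lemma en_le_of_subset_ocr {k : ℝ} (hk' : k < 1) {J : Finset (ℤ × ℤ)}
    (hJ : IsStaircase (↑J : Set (ℤ × ℤ))) {Z : Finset (ℤ × ℤ)} (hZ : Z ⊆ ocr J) :
    en k (spin J Z) ≤ 2 * sides J - 4 * k * Z.card := by
  induction Z using Finset.induction_on with
  | empty => simpa using en_spin_empty_le_sides hJ
  | insert p Z hp ih =>
    have hpc : p ∈ ocr J := hZ (Finset.mem_insert_self _ _)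
    have ih := ih fun q hq => hZ (Finset.mem_insert_of_mem hq)
    rw [en_insert_surfactant (mem_ocr.1 hpc).1 hp, Finset.card_insert_of_notMem hp]
    have h1 : (2 : ℝ) ≤ nb (spin J Z) p 1 := by exact_mod_cast two_le_nb_one hpc
    have h2 : (0 : ℝ) ≤ (1 - k) * nb (spin J Z) p 0 := by
      apply mul_nonneg (by linarith); positivity
    push_cast
    linarith

/-- The part of the exterior boundary facing the external slice `i`. -/
def extRow (J : Finset (ℤ × ℤ)) (i : Fin 4) : Finset (ℤ × ℤ) :=
  (obd J).filter fun p => p + dir i ∈ sl J i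

lemma mem_extRow {J : Finset (ℤ × ℤ)} {i : Fin 4} {p : ℤ × ℤ} :
    p ∈ extRow J i ↔ p ∈ obd J ∧ p + dir i ∈ sl J i := Finset.mem_filter

lemma card_extRow_le (J : Finset (ℤ × ℤ)) (i : Fin 4) : (extRow J i).card ≤ (sl J i).card := by
  apply Finset.card_le_card_of_injOn (· + dir i)
  · intro p hp; exact (mem_extRow.1 hp).2
  · exact (add_left_injective _).injOn

lemma not_inBox_of_extRow {J : Finset (ℤ × ℤ)} {i : Fin 4} {p : ℤ × ℤ} (hp : p ∈ extRow J i) :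
    ¬ InBox J p := by
  rintro ⟨⟨b1, hb1, h1⟩, ⟨b2, hb2, h2⟩, ⟨b3, hb3, h3⟩, ⟨b4, hb4, h4⟩⟩
  have h := (mem_extRow.1 hp).2
  fin_cases i
  · have := (mem_sl0.1 h).2 _ hb3; simp [dir] at this; omega
  · have := (mem_sl1.1 h).2 _ hb1; simp [dir] at this; omega
  · have := (mem_sl2.1 h).2 _ hb4; simp [dir] at this; omega
  · have := (mem_sl3.1 h).2 _ hb2; simp [dir] at this; omega

lemma inBox_of_ocr {J : Finset (ℤ × ℤ)} {p : ℤ × ℤ} (hp : p ∈ ocr J) : InBox J p := by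
  obtain ⟨-, h1, h2⟩ := mem_ocr.1 hp
  obtain ⟨a, ha, ha'⟩ : ∃ a ∈ J, a.2 = p.2 := by
    rcases h1 with h | h <;> exact ⟨_, h, by simp⟩
  obtain ⟨b, hb, hb'⟩ : ∃ b ∈ J, b.1 = p.1 := by
    rcases h2 with h | h <;> exact ⟨_, h, by simp⟩
  exact ⟨⟨b, hb, by omega⟩, ⟨b, hb, by omega⟩, ⟨a, ha, by omega⟩, ⟨a, ha, by omega⟩⟩

lemma extRow_disjoint {J : Finset (ℤ × ℤ)} {i j : Fin 4} {p : ℤ × ℤ} (hi : p ∈ extRow J i)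
    (hj : p ∈ extRow J j) : i = j := by
  have h1 := (mem_extRow.1 hi).2
  have h2 := most_subset _ _ (sl_subset_most _ _ (mem_extRow.1 hj).2)
  by_contra hij
  fin_cases i
  · have := (mem_sl0.1 h1).2 _ h2
    fin_cases j <;> simp [dir] at this hij
  · have := (mem_sl1.1 h1).2 _ h2
    fin_cases j <;> simp [dir] at this hij
  · have := (mem_sl2.1 h1).2 _ h2
    fin_cases j <;> simp [dir] at this hij
  · have := (mem_sl3.1 h1).2 _ h2
    fin_cases j <;> simp [dir] at this hij

lemma exists_extRow {J : Finset (ℤ × ℤ)} {p : ℤ × ℤ} (hp : p ∈ obd J) (hbox : ¬ InBox J p) :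
    ∃ i, p ∈ extRow J i := by
  obtain ⟨-, q, hq, hadj⟩ := mem_obd_iff_adj.1 hp
  unfold InBox at hbox
  have hq' := adj_cases hadj
  have : (∀ b ∈ J, p.1 < b.1) ∨ (∀ b ∈ J, b.1 < p.1) ∨ (∀ b ∈ J, p.2 < b.2) ∨
      (∀ b ∈ J, b.2 < p.2) := by
    by_contra! hn; exact hbox ⟨hn.1, hn.2.1, hn.2.2.1, hn.2.2.2⟩
  rcases this with h | h | h | h
  · have e : q = p + dir 1 := by have := h q hq; ext <;> simp [dir] <;> omega
    exact ⟨1, mem_extRow.2 ⟨hp, mem_sl1.2 ⟨e ▸ hq, fun b hb => by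
      have := h b hb; simp [dir]; omega⟩⟩⟩
  · have e : q = p + dir 3 := by have := h q hq; ext <;> simp [dir] <;> omega
    exact ⟨3, mem_extRow.2 ⟨hp, mem_sl3.2 ⟨e ▸ hq, fun b hb => by
      have := h b hb; simp [dir]; omega⟩⟩⟩
  · have e : q = p + dir 0 := by have := h q hq; ext <;> simp [dir] <;> omega
    exact ⟨0, mem_extRow.2 ⟨hp, mem_sl0.2 ⟨e ▸ hq, fun b hb => by
      have := h b hb; simp [dir]; omega⟩⟩⟩
  · have e : q = p + dir 2 := by have := h q hq; ext <;> simp [dir] <;> omega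
    exact ⟨2, mem_extRow.2 ⟨hp, mem_sl2.2 ⟨e ▸ hq, fun b hb => by
      have := h b hb; simp [dir]; omega⟩⟩⟩

lemma exists_switch {P : ℤ → Prop} {a b : ℤ} (ha : P a) (hb : ¬ P b) :
    ∃ c c', (c' = c + 1 ∨ c' = c - 1) ∧ min a b ≤ c ∧ c ≤ max a b ∧ min a b ≤ c' ∧ c' ≤ max a b ∧
      P c ∧ ¬ P c' := by
  have main : ∀ n : ℕ, ∀ a b : ℤ, (b - a).natAbs = n → P a → ¬ P b →
      ∃ c c', (c' = c + 1 ∨ c' = c - 1) ∧ min a b ≤ c ∧ c ≤ max a b ∧ min a b ≤ c' ∧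
        c' ≤ max a b ∧ P c ∧ ¬ P c' := by
    intro n
    induction n with
    | zero => intro a b h ha hb; have : a = b := by omega
              subst this; exact absurd ha hb
    | succ n ih =>
      intro a b h ha hb
      obtain ⟨d, hd, hd'⟩ : ∃ d, (d = a + 1 ∨ d = a - 1) ∧ (b - d).natAbs = n := by
        rcases lt_trichotomy a b with hlt | heq | hlt
        · exact ⟨a + 1, by omega, by omega⟩
        · omega
        · exact ⟨a - 1, by omega, by omega⟩
      by_cases hPd : P d
      · obtain ⟨c, c', h1, h2, h3, h4, h5, h6⟩ := ih d b hd' hPd hb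
        exact ⟨c, c', h1, by omega, by omega, by omega, by omega, h6⟩
      · exact ⟨a, d, hd, by omega, by omega, by omega, by omega, ha, hPd⟩
  exact main _ a b rfl ha hb

lemma extRow_switch {J : Finset (ℤ × ℤ)} (hJ : IsStaircase (↑J : Set (ℤ × ℤ))) {i : Fin 4}
    {Z : ℤ × ℤ → Prop} {p z : ℤ × ℤ} (hp : p ∈ extRow J i) (hz : z ∈ extRow J i) (hpZ : ¬ Z p)
    (hzZ : Z z) : ∃ p' ∈ extRow J i, ∃ z' ∈ extRow J i, ¬ Z p' ∧ Z z' ∧ grid.Adj p' z' := by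
  have hH := hJ.row
  have hV := hJ.col
  have hobd : ∀ q, q ∉ J → q + dir i ∈ sl J i → q ∈ extRow J i := by
    intro q hq hqs
    have hqJ := most_subset _ _ (sl_subset_most _ _ hqs)
    refine mem_extRow.2 ⟨mem_obd.2 ⟨hq, ?_⟩, hqs⟩
    fin_cases i <;> simp [dir] at hqJ
    · exact Or.inr (Or.inr (Or.inl hqJ))
    · exact Or.inl hqJ
    · have : q - (0, 1) = q + (0, -1) := by ext <;> simp; omega
      rw [this]; exact Or.inr (Or.inr (Or.inr hqJ))
    · have : q - (1, 0) = q + (-1, 0) := by ext <;> simp; omega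
      rw [this]; exact Or.inr (Or.inl hqJ)
  obtain ⟨x, y⟩ := p
  obtain ⟨x', y'⟩ := z
  have h1 := (mem_extRow.1 hp).2
  have h2 := (mem_extRow.1 hz).2
  fin_cases i
  · obtain ⟨j1, m1⟩ := mem_sl0.1 h1
    obtain ⟨j2, m2⟩ := mem_sl0.1 h2
    have a1 := m1 _ j2
    have a2 := m2 _ j1
    simp [dir] at j1 j2 m1 m2 a1 a2
    obtain rfl : y = y' := by omega
    have seg : ∀ c, min x' x ≤ c → c ≤ max x' x → (c, y) ∈ extRow J 0 := by
      intro c hc1 hc2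
      refine hobd _ (fun hc => by have := m1 _ _ hc; omega) (mem_sl0.2 ⟨?_, ?_⟩)
      · simp only [Fin.zero_eta, dir, Matrix.cons_val_zero, Prod.mk_add_mk, add_zero]
        rcases le_total x x' with h | h
        · exact hH x c x' _ (by omega) (by omega) j1 j2
        · exact hH x' c x _ (by omega) (by omega) j2 j1
      · rintro ⟨a, b⟩ hab; have := m1 _ _ hab; simpa [dir] using this
    obtain ⟨c, c', e, c1, c2, c3, c4, c5, c6⟩ := exists_switch (P := fun t => Z (t, y)) hzZ hpZ
    exact ⟨_, seg c' c3 c4, _, seg c c1 c2, c6, c5, adj_mk (by omega)⟩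
  · obtain ⟨j1, m1⟩ := mem_sl1.1 h1
    obtain ⟨j2, m2⟩ := mem_sl1.1 h2
    have a1 := m1 _ j2
    have a2 := m2 _ j1
    simp [dir] at j1 j2 m1 m2 a1 a2
    obtain rfl : x = x' := by omega
    have seg : ∀ c, min y' y ≤ c → c ≤ max y' y → (x, c) ∈ extRow J 1 := by
      intro c hc1 hc2
      refine hobd _ (fun hc => by have := m1 _ _ hc; omega) (mem_sl1.2 ⟨?_, ?_⟩)
      · simp [dir]
        rcases le_total y y' with h | h
        · exact hV _ y c y' (by omega) (by omega) j1 j2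
        · exact hV _ y' c y (by omega) (by omega) j2 j1
      · rintro ⟨a, b⟩ hab; have := m1 _ _ hab; simpa [dir] using this
    obtain ⟨c, c', e, c1, c2, c3, c4, c5, c6⟩ := exists_switch (P := fun t => Z (x, t)) hzZ hpZ
    exact ⟨_, seg c' c3 c4, _, seg c c1 c2, c6, c5, adj_mk (by omega)⟩
  · obtain ⟨j1, m1⟩ := mem_sl2.1 h1
    obtain ⟨j2, m2⟩ := mem_sl2.1 h2
    have a1 := m1 _ j2
    have a2 := m2 _ j1
    simp [dir] at j1 j2 m1 m2 a1 a2
    obtain rfl : y = y' := by omega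
    have seg : ∀ c, min x' x ≤ c → c ≤ max x' x → (c, y) ∈ extRow J 2 := by
      intro c hc1 hc2
      refine hobd _ (fun hc => by have := m1 _ _ hc; omega) (mem_sl2.2 ⟨?_, ?_⟩)
      · simp [dir]
        rcases le_total x x' with h | h
        · exact hH x c x' _ (by omega) (by omega) j1 j2
        · exact hH x' c x _ (by omega) (by omega) j2 j1
      · rintro ⟨a, b⟩ hab; have := m1 _ _ hab; simpa [dir] using this
    obtain ⟨c, c', e, c1, c2, c3, c4, c5, c6⟩ := exists_switch (P := fun t => Z (t, y)) hzZ hpZ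
    exact ⟨_, seg c' c3 c4, _, seg c c1 c2, c6, c5, adj_mk (by omega)⟩
  · obtain ⟨j1, m1⟩ := mem_sl3.1 h1
    obtain ⟨j2, m2⟩ := mem_sl3.1 h2
    have a1 := m1 _ j2
    have a2 := m2 _ j1
    simp [dir] at j1 j2 m1 m2 a1 a2
    obtain rfl : x = x' := by omega
    have seg : ∀ c, min y' y ≤ c → c ≤ max y' y → (x, c) ∈ extRow J 3 := by
      intro c hc1 hc2
      refine hobd _ (fun hc => by have := m1 _ _ hc; omega) (mem_sl3.2 ⟨?_, ?_⟩)
      · simp [dir]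
        rcases le_total y y' with h | h
        · exact hV _ y c y' (by omega) (by omega) j1 j2
        · exact hV _ y' c y (by omega) (by omega) j2 j1
      · rintro ⟨a, b⟩ hab; have := m1 _ _ hab; simpa [dir] using this
    obtain ⟨c, c', e, c1, c2, c3, c4, c5, c6⟩ := exists_switch (P := fun t => Z (x, t)) hzZ hpZ
    exact ⟨_, seg c' c3 c4, _, seg c c1 c2, c6, c5, adj_mk (by omega)⟩

/-- The exterior boundary without the rows facing the external slices outside `A`. -/
def openBdry (J : Finset (ℤ × ℤ)) (A : Finset (Fin 4)) : Finset (ℤ × ℤ) :=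
  obd J \ Aᶜ.biUnion (extRow J)

lemma card_openBdry_le (J : Finset (ℤ × ℤ)) (A : Finset (Fin 4)) :
    (obd J).card ≤ (openBdry J A).card + ∑ i ∈ Aᶜ, (sl J i).card := by
  have h1 := Finset.le_card_sdiff (Aᶜ.biUnion (extRow J)) (obd J)
  have h2 : (Aᶜ.biUnion (extRow J)).card ≤ ∑ i ∈ Aᶜ, (sl J i).card :=
    Finset.card_biUnion_le.trans (Finset.sum_le_sum fun i _ => card_extRow_le J i)
  unfold openBdry
  omega

lemma mem_openBdry {J : Finset (ℤ × ℤ)} {A : Finset (Fin 4)} {p : ℤ × ℤ} :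
    p ∈ openBdry J A ↔ p ∈ obd J ∧ ∀ i, i ∉ A → p ∉ extRow J i := by
  simp [openBdry]

lemma ocr_subset_obd (J : Finset (ℤ × ℤ)) : ocr J ⊆ obd J := Finset.filter_subset _ _

lemma exists_surfactant_aux {k : ℝ} (hk' : k < 1) {J : Finset (ℤ × ℤ)}
    (hJ : IsStaircase (↑J : Set (ℤ × ℤ))) (A : Finset (Fin 4)) {m : ℕ} (hm : (ocr J).card ≤ m)
    (hm' : m ≤ (openBdry J A).card) : ∃ Z : Finset (ℤ × ℤ), ocr J ⊆ Z ∧ Z ⊆ openBdry J A ∧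
      Z.card = m ∧ en k (spin J Z) ≤ 2 * sides J - 4 * k * (ocr J).card -
        (3 * k - 1) * (m - (ocr J).card) +
        (1 - k) * (A.filter fun i => ∃ z ∈ Z, z ∈ extRow J i).card := by
  induction m, hm using Nat.le_induction with
  | base =>
    refine ⟨ocr J, Finset.Subset.refl _, fun p hp => ?_, rfl, ?_⟩
    · exact mem_openBdry.2 ⟨ocr_subset_obd J hp, fun i _ hi =>
        not_inBox_of_extRow hi (inBox_of_ocr hp)⟩
    · have h1 := en_le_of_subset_ocr hk' hJ (Finset.Subset.refl (ocr J))
      have h2 : (0 : ℝ) ≤ (1 - k) * (A.filter fun i => ∃ z ∈ ocr J, z ∈ extRow J i).card := by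
        apply mul_nonneg (by linarith); positivity
      linarith
  | succ m hm ih =>
    obtain ⟨Z, hcZ, hZO, hZc, hen⟩ := ih (by omega)
    have hmono : ∀ p, (A.filter fun i => ∃ z ∈ Z, z ∈ extRow J i) ⊆
        (A.filter fun i => ∃ z ∈ insert p Z, z ∈ extRow J i) := by
      intro p i hi
      rw [Finset.mem_filter] at hi ⊢
      obtain ⟨h1, z, hz, h2⟩ := hi
      exact ⟨h1, z, Finset.mem_insert_of_mem hz, h2⟩
    have fin : ∀ p ∈ openBdry J A, p ∉ Z → (((A.filter fun i => ∃ z ∈ Z, z ∈ extRow J i).card + 1 ≤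
        (A.filter fun i => ∃ z ∈ insert p Z, z ∈ extRow J i).card) ∨ ∃ z ∈ Z, grid.Adj p z) →
        ∃ Z : Finset (ℤ × ℤ), ocr J ⊆ Z ∧ Z ⊆ openBdry J A ∧ Z.card = m + 1 ∧
          en k (spin J Z) ≤ 2 * sides J - 4 * k * (ocr J).card -
          (3 * k - 1) * ((m + 1 : ℕ) - (ocr J).card) +
          (1 - k) * (A.filter fun i => ∃ z ∈ Z, z ∈ extRow J i).card := by
      intro p hp hpZ hor
      have hpJ := (mem_obd.1 (mem_openBdry.1 hp).1).1
      refine ⟨insert p Z, hcZ.trans (Finset.subset_insert _ _),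
        Finset.insert_subset hp hZO, by rw [Finset.card_insert_of_notMem hpZ, hZc], ?_⟩
      rw [en_insert_surfactant hpJ hpZ]
      have h1 : (1 : ℝ) ≤ nb (spin J Z) p 1 := by
        exact_mod_cast nb_one_pos (mem_openBdry.1 hp).1
      have h3 : (((A.filter fun i => ∃ z ∈ Z, z ∈ extRow J i).card : ℕ) : ℝ) ≤
          (A.filter fun i => ∃ z ∈ insert p Z, z ∈ extRow J i).card := by
        exact_mod_cast Finset.card_le_card (hmono p)
      have h4 : (0 : ℝ) ≤ nb (spin J Z) p 0 := by positivity
      push_cast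
      rcases hor with hor | ⟨z, hz, hadj⟩
      · have hor' : (((A.filter fun i => ∃ z ∈ Z, z ∈ extRow J i).card : ℕ) : ℝ) + 1 ≤
          (A.filter fun i => ∃ z ∈ insert p Z, z ∈ extRow J i).card := by exact_mod_cast hor
        have h5 := mul_le_mul_of_nonneg_left hor' (by linarith : 0 ≤ 1 - k)
        have h6 : 0 ≤ (1 - k) * (nb (spin J Z) p 0 : ℝ) := mul_nonneg (by linarith) h4
        linarith
      · have hzJ := (mem_obd.1 (mem_openBdry.1 (hZO hz)).1).1
        have h2 : (1 : ℝ) ≤ nb (spin J Z) p 0 := by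
          exact_mod_cast nb_pos (u := spin J Z) hadj (by simp [spin, hzJ, hz])
        have h5 := mul_le_mul_of_nonneg_left h3 (by linarith : 0 ≤ 1 - k)
        have h6 := mul_le_mul_of_nonneg_left h2 (by linarith : 0 ≤ 1 - k)
        linarith
    by_cases hex : ∃ p ∈ openBdry J A, p ∉ Z ∧ ∃ z ∈ Z, grid.Adj p z
    · obtain ⟨p, hp, hpZ, hz⟩ := hex
      exact fin p hp hpZ (Or.inr hz)
    · push Not at hex
      have hbox : ∀ p ∈ obd J, InBox J p → p ∈ Z := by
        intro p hp hb
        refine mem_of_obd hJ (Z := fun p => p ∈ Z) (fun q hq => hcZ hq) ?_ hp hb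
        intro q hq hqb hqZ q' hq' _ hadj hq'Z
        exact hex q (mem_openBdry.2 ⟨hq, fun i _ hi => not_inBox_of_extRow hi hqb⟩) hqZ q' hq'Z hadj
      obtain ⟨p, hp, hpZ⟩ : ∃ p ∈ openBdry J A, p ∉ Z := by
        by_contra! hn
        have := Finset.card_le_card (show openBdry J A ⊆ Z from hn)
        omega
      have hpO := mem_openBdry.1 hp
      obtain ⟨i, hi⟩ := exists_extRow hpO.1 fun hb => hpZ (hbox p hpO.1 hb)
      have hiA : i ∈ A := by
        by_contra hiA; exact hpO.2 i hiA hi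
      refine fin p hp hpZ (Or.inl ?_)
      rw [Nat.succ_le_iff]
      refine Finset.card_lt_card ⟨hmono p, fun hsub => ?_⟩
      have : i ∈ A.filter fun i => ∃ z ∈ Z, z ∈ extRow J i :=
        hsub (Finset.mem_filter.2 ⟨hiA, p, Finset.mem_insert_self _ _, hi⟩)
      obtain ⟨-, z, hz, hzi⟩ := Finset.mem_filter.1 this
      obtain ⟨p', hp', z', hz', h1, h2, h3⟩ :=
        extRow_switch hJ (Z := fun p => p ∈ Z) hi hzi hpZ hz
      refine hex p' (mem_openBdry.2 ⟨(mem_extRow.1 hp').1, fun j hj hpj => ?_⟩) h1 z' h2 h3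
      exact hj (extRow_disjoint hp' hpj ▸ hiA)

/-- The site is to the right of a nonempty row of `I`. -/
def IsRight (I : Finset (ℤ × ℤ)) (p : ℤ × ℤ) : Prop :=
  (∃ q ∈ I, q.2 = p.2) ∧ ∀ q ∈ I, q.2 = p.2 → q.1 < p.1

instance (I : Finset (ℤ × ℤ)) : DecidablePred (IsRight I) := fun _ => by
  unfold IsRight; infer_instance

/-- Left ends of the horizontal gaps of `I`, shifted to the last site of the gap. -/
def gap (I : Finset (ℤ × ℤ)) : Finset (ℤ × ℤ) :=
  (I.image (· - (1, 0))).filter fun p => p ∉ I ∧ p + (1, 0) ∉ most I 1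

lemma mem_gap {I : Finset (ℤ × ℤ)} {p : ℤ × ℤ} :
    p ∈ gap I ↔ p + (1, 0) ∈ I ∧ p ∉ I ∧ p + (1, 0) ∉ most I 1 := by
  unfold gap
  rw [Finset.mem_filter]
  refine and_congr_left fun _ => ?_
  simp only [Finset.mem_image]
  exact ⟨by rintro ⟨a, ha, rfl⟩; simpa using ha, fun h => ⟨_, h, by simp⟩⟩

/-- Rows containing surfactant but no site of `I`. -/
def unhit (I Z : Finset (ℤ × ℤ)) : Finset ℤ := Z.image Prod.snd \ I.image Prod.snd

/-- The surfactant sites covering a site of `most I i`. -/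
def cov (I Z : Finset (ℤ × ℤ)) (i : Fin 4) : Finset (ℤ × ℤ) := Z.filter fun z => z + dir i ∈ most I i

lemma mem_cov {I Z : Finset (ℤ × ℤ)} {i : Fin 4} {z : ℤ × ℤ} :
    z ∈ cov I Z i ↔ z ∈ Z ∧ z + dir i ∈ most I i := Finset.mem_filter

lemma sum_indicator_eq {B T : Finset (ℤ × ℤ)} {e : ℤ × ℤ} (h : ∀ p, p + e ∈ T → p ∈ B) :
    ∑ p ∈ B, (if p + e ∈ T then (1 : ℝ) else 0) = T.card := by
  rw [Finset.sum_boole]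
  congr 1
  apply Finset.card_bij (fun p _ => p + e)
  · intro p hp; exact (Finset.mem_filter.1 hp).2
  · intro p _ q _ h; exact add_right_cancel h
  · intro q hq
    have : q - e + e ∈ T := by simpa using hq
    exact ⟨q - e, Finset.mem_filter.2 ⟨h _ this, this⟩, by simp⟩

lemma bnd_cases_ge {k : ℝ} (hk : 0 < k) (hk' : k < 1) {a b c d r r' l m g w : Prop}
    [Decidable a] [Decidable b] [Decidable c] [Decidable d] [Decidable r] [Decidable r']
    [Decidable l] [Decidable m] [Decidable g] [Decidable w] (hac : a → ¬ c) (hbd : b → ¬ d)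
    (hlb : l → b) (hma : m → a) (hla : l → ¬ a) (hmb : m → ¬ b) (hmr : m → r') (hrb : r → ¬ b)
    (hrr : r → r') (hg : g → b ∧ ¬ a ∧ ¬ l) (hwr : w → ¬ r) (hwb : w → ¬ b) :
    (1 - k) * (if d ∧ ¬ r' then (1 : ℝ) else 0) + (1 - k) * (if c ∧ r then (1 : ℝ) else 0) +
      2 * (if l then (1 : ℝ) else 0) + 2 * (if m then (1 : ℝ) else 0) -
      (1 + k) * (if c ∧ l then (1 : ℝ) else 0) - (1 + k) * (if d ∧ m then (1 : ℝ) else 0) +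
      (1 - k) * (if g then (1 : ℝ) else 0) + (1 - k) * (if c ∧ w ∧ ¬ d then (1 : ℝ) else 0) ≤
      bnd k (if a then 1 else if c then 0 else -1) (if b then 1 else if d then 0 else -1) := by
  by_cases ha : a
  · have hl : ¬ l := fun h => hla h ha
    have hg : ¬ g := fun h => (hg h).2.1 ha
    have hc := hac ha
    by_cases hb : b
    · have hm : ¬ m := fun h => hmb h hb
      have hd := hbd hb
      simp [ha, hb, hl, hm, hg, hc, hd]
    · by_cases hd : d <;> by_cases hm : m
      · have hr' := hmr hm
        simp [ha, hb, hl, hm, hg, hc, hd, hr']; linarith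
      · by_cases hr' : r' <;> simp [ha, hb, hl, hm, hg, hc, hd, hr']
        linarith
      · simp [ha, hb, hl, hm, hg, hc, hd]
      · simp [ha, hb, hl, hm, hg, hc, hd]
  · have hm : ¬ m := fun h => ha (hma h)
    by_cases hb : b
    · have hd := hbd hb
      have hr : ¬ r := fun h => hrb h hb
      have hw : ¬ w := fun h => hwb h hb
      by_cases hl : l
      · have hg : ¬ g := fun h => (hg h).2.2 hl
        by_cases hc : c <;> simp [ha, hb, hl, hm, hg, hc, hd, hr, hw]
        linarith
      · by_cases hc : c <;> by_cases hg : g <;> simp [ha, hb, hl, hm, hg, hc, hd, hr, hw] <;>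
          linarith
    · have hl : ¬ l := fun h => hb (hlb h)
      have hg : ¬ g := fun h => hb (hg h).1
      by_cases hc : c
      · by_cases hr : r
        · have hr' := hrr hr
          have hw : ¬ w := fun h => hwr h hr
          by_cases hd : d <;> simp [ha, hb, hl, hm, hg, hc, hd, hr, hr', hw]
        · by_cases hd : d <;> by_cases hr' : r' <;> by_cases hw : w <;>
            simp [ha, hb, hl, hm, hg, hc, hd, hr, hr', hw] <;> linarith
      · by_cases hd : d <;> by_cases hr' : r' <;> simp [ha, hb, hl, hm, hg, hc, hd, hr']
        linarith

lemma bnd_horizontal_ge {k : ℝ} (hk : 0 < k) (hk' : k < 1) {I Z : Finset (ℤ × ℤ)}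
    (hIZ : Disjoint I Z) (p : ℤ × ℤ) :
    (1 - k) * (if p + (1, 0) ∈ Z.filter (¬ IsRight I ·) then (1 : ℝ) else 0) +
      (1 - k) * (if p + 0 ∈ Z.filter (IsRight I ·) then (1 : ℝ) else 0) +
      2 * (if p + (1, 0) ∈ most I 1 then (1 : ℝ) else 0) +
      2 * (if p + 0 ∈ most I 3 then (1 : ℝ) else 0) -
      (1 + k) * (if p + 0 ∈ cov I Z 1 then (1 : ℝ) else 0) -
      (1 + k) * (if p + (1, 0) ∈ cov I Z 3 then (1 : ℝ) else 0) +
      (1 - k) * (if p + 0 ∈ gap I then (1 : ℝ) else 0) +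
      (1 - k) * (if p + 0 ∈ Z.filter (fun z => (∀ q ∈ I, q.2 ≠ z.2) ∧ z + (1, 0) ∉ Z)
        then (1 : ℝ) else 0) ≤ bnd k (spin I Z p) (spin I Z (p + (1, 0))) := by
  have e1 : p + (1, 0) + dir 3 = p := by ext <;> simp [dir]
  have e2 : p + dir 1 = p + (1, 0) := rfl
  have hd := Finset.disjoint_left.1 hIZ
  simp only [add_zero, Finset.mem_filter, mem_cov, e1, e2]
  have hac : p ∈ I → p ∉ Z := fun h1 h2 => hd h1 h2
  have hbd : p + (1, 0) ∈ I → p + (1, 0) ∉ Z := fun h1 h2 => hd h1 h2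
  have hlb : p + (1, 0) ∈ most I 1 → p + (1, 0) ∈ I := fun h => (mem_most1.1 h).1
  have hma : p ∈ most I 3 → p ∈ I := fun h => (mem_most3.1 h).1
  have hla : p + (1, 0) ∈ most I 1 → p ∉ I := by
    intro h h'; have := (mem_most1.1 h).2 p h' (by simp); simp at this
  have hmb : p ∈ most I 3 → p + (1, 0) ∉ I := by
    intro h h'; have := (mem_most3.1 h).2 _ h' (by simp); simp at this
  have hmr : p ∈ most I 3 → IsRight I (p + (1, 0)) := by
    intro h
    refine ⟨⟨p, hma h, by simp⟩, fun q hq e => ?_⟩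
    have := (mem_most3.1 h).2 q hq (by simpa using e)
    simp; omega
  have hrb : IsRight I p → p + (1, 0) ∉ I := by
    intro h h'; have := h.2 _ h' (by simp); simp at this
  have hrr : IsRight I p → IsRight I (p + (1, 0)) := by
    rintro ⟨⟨q, hq, e⟩, h⟩
    exact ⟨⟨q, hq, by simpa using e⟩, fun q hq e => by
      have := h q hq (by simpa using e); simp; omega⟩
  have hg : p ∈ gap I → p + (1, 0) ∈ I ∧ p ∉ I ∧ p + (1, 0) ∉ most I 1 := mem_gap.1
  have hwr : (∀ q ∈ I, q.2 ≠ p.2) → ¬ IsRight I p := by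
    rintro h ⟨⟨q, hq, e⟩, -⟩; exact h q hq e
  have hwb : (∀ q ∈ I, q.2 ≠ p.2) → p + (1, 0) ∉ I := fun h h' => h _ h' (by simp)
  exact bnd_cases_ge hk hk' hac hbd hlb hma hla hmb hmr hrb hrr hg hwr hwb

lemma card_unhit_le (I Z : Finset (ℤ × ℤ)) : (unhit I Z).card ≤
    (Z.filter (fun z => (∀ q ∈ I, q.2 ≠ z.2) ∧ z + (1, 0) ∉ Z)).card := by
  apply Finset.card_le_card_of_surjOn Prod.snd
  intro y hy
  simp only [unhit, Finset.coe_sdiff, Finset.coe_image, Set.mem_sdiff, Set.mem_image,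
    Finset.mem_coe, not_exists, not_and] at hy
  obtain ⟨⟨z, hz, rfl⟩, h2⟩ := hy
  obtain ⟨w, hw, hmax⟩ := (Z.filter fun w => w.2 = z.2).exists_max_image (fun p => p.1)
    ⟨z, by simp [hz]⟩
  rw [Finset.mem_filter] at hw
  refine ⟨w, ?_, hw.2⟩
  rw [Finset.mem_coe, Finset.mem_filter]
  refine ⟨hw.1, fun q hq e => h2 q hq (e.trans hw.2), fun h => ?_⟩
  have := hmax (w + (1, 0)) (Finset.mem_filter.2 ⟨h, by simpa using hw.2⟩)
  simp at this

lemma enH_ge {k : ℝ} (hk : 0 < k) (hk' : k < 1) {I Z : Finset (ℤ × ℤ)} (hIZ : Disjoint I Z)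
    {B : Finset (ℤ × ℤ)}
    (hB : ∀ p ∉ B, spin I Z p = -1 ∧ spin I Z (p + (1, 0)) = -1) :
    2 * ((most I 1).card + (most I 3).card : ℝ) - (1 + k) * ((cov I Z 1).card + (cov I Z 3).card)
      + (1 - k) * (Z.card + (gap I).card + (unhit I Z).card) ≤
      ∑ p ∈ B, bnd k (spin I Z p) (spin I Z (p + (1, 0))) := by
  have h1 : ∀ p, p ∈ I → p + 0 ∈ B := by
    intro p hp; by_contra h
    rw [add_zero] at h
    exact (spin_eq_neg.1 (hB p h).1).1 hp
  have h2 : ∀ p, p ∈ Z → p + 0 ∈ B := by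
    intro p hp; by_contra h
    rw [add_zero] at h
    exact (spin_eq_neg.1 (hB p h).1).2 hp
  simp only [add_zero] at h1 h2
  have h3 : ∀ p, p + (1, 0) ∈ I → p ∈ B := by
    intro p hp; by_contra h
    exact (spin_eq_neg.1 (hB p h).2).1 hp
  have h4 : ∀ p, p + (1, 0) ∈ Z → p ∈ B := by
    intro p hp; by_contra h
    exact (spin_eq_neg.1 (hB p h).2).2 hp
  have hsum := Finset.sum_le_sum fun p (_ : p ∈ B) => bnd_horizontal_ge hk hk' hIZ p
  simp only [Finset.sum_add_distrib, Finset.sum_sub_distrib, ← Finset.mul_sum] at hsum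
  have s1 := sum_indicator_eq (B := B) (T := Z.filter (¬ IsRight I ·)) (e := (1, 0))
    (fun p hp => h4 p (Finset.mem_filter.1 hp).1)
  have s2 := sum_indicator_eq (B := B) (T := Z.filter (IsRight I ·)) (e := 0)
    (fun p hp => h2 p (by simpa using (Finset.mem_filter.1 hp).1))
  have s3 := sum_indicator_eq (B := B) (T := most I 1) (e := (1, 0))
    (fun p hp => h3 p (most_subset _ _ hp))
  have s4 := sum_indicator_eq (B := B) (T := most I 3) (e := 0)
    (fun p hp => h1 p (by simpa using most_subset _ _ hp))
  have s5 := sum_indicator_le B (cov I Z 1) 0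
  have s6 := sum_indicator_le B (cov I Z 3) (1, 0)
  have s7 := sum_indicator_eq (B := B) (T := gap I) (e := 0)
    (fun p hp => h3 p (mem_gap.1 (by simpa using hp)).1)
  have s8 := sum_indicator_eq (B := B) (T := Z.filter (fun z => (∀ q ∈ I, q.2 ≠ z.2) ∧
    z + (1, 0) ∉ Z)) (e := 0) (fun p hp => h2 p (by simpa using (Finset.mem_filter.1 hp).1))
  rw [s1, s2, s3, s4, s7, s8] at hsum
  have c1 : ((Z.filter (¬ IsRight I ·)).card : ℝ) + (Z.filter (IsRight I ·)).card = Z.card := by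
    rw [add_comm]; exact_mod_cast Finset.card_filter_add_card_filter_not (IsRight I)
  have c2 : ((unhit I Z).card : ℝ) ≤ (Z.filter (fun z => (∀ q ∈ I, q.2 ≠ z.2) ∧
    z + (1, 0) ∉ Z)).card := by exact_mod_cast card_unhit_le I Z
  have m5 := mul_le_mul_of_nonneg_left s5 (by linarith : 0 ≤ 1 + k)
  have m6 := mul_le_mul_of_nonneg_left s6 (by linarith : 0 ≤ 1 + k)
  have m8 := mul_le_mul_of_nonneg_left c2 (by linarith : 0 ≤ 1 - k)
  rw [← c1]
  linarith

lemma most_swapped (I : Finset (ℤ × ℤ)) : most (swapped I) 1 = swapped (most I 0) ∧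
    most (swapped I) 3 = swapped (most I 2) := by
  have h : ∀ P : ℤ × ℤ → Prop, (∀ q ∈ swapped I, P q) ↔ ∀ q ∈ I, P (q.2, q.1) :=
    fun P => ⟨fun h q hq => h _ (by simpa using hq), fun h q hq => h _ (mem_swapped.1 hq)⟩
  constructor
  · ext p
    rw [mem_most1, mem_swapped, mem_swapped, mem_most0, h]
  · ext p
    rw [mem_most3, mem_swapped, mem_swapped, mem_most2, h]

lemma cov_swapped (I Z : Finset (ℤ × ℤ)) : cov (swapped I) (swapped Z) 1 = swapped (cov I Z 0) ∧
    cov (swapped I) (swapped Z) 3 = swapped (cov I Z 2) := by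
  constructor
  · ext p
    rw [mem_cov, (most_swapped I).1, mem_swapped, mem_swapped, mem_swapped, mem_cov]
    rfl
  · ext p
    rw [mem_cov, (most_swapped I).2, mem_swapped, mem_swapped, mem_swapped, mem_cov]
    rfl

/-- Number of gaps in the rows and columns. -/
def gaps (I : Finset (ℤ × ℤ)) : ℕ := (gap I).card + (gap (swapped I)).card

/-- Number of rows and columns with surfactant and without sites of `I`. -/
def unhits (I Z : Finset (ℤ × ℤ)) : ℕ := (unhit I Z).card + (unhit (swapped I) (swapped Z)).card

lemma spin_swapped (I Z : Finset (ℤ × ℤ)) (p : ℤ × ℤ) :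
    spin (swapped I) (swapped Z) p = spin I Z (p.2, p.1) := by
  unfold spin; simp only [mem_swapped]

lemma en_ge {k : ℝ} (hk : 0 < k) (hk' : k < 1) {I Z : Finset (ℤ × ℤ)} (hIZ : Disjoint I Z) :
    2 * (sides I : ℝ) - (1 + k) * (∑ i, (cov I Z i).card : ℕ) + 2 * (1 - k) * Z.card +
      (1 - k) * (gaps I + unhits I Z) ≤ en k (spin I Z) := by
  obtain ⟨B, hB⟩ := (finSupp_spin I Z).exists_box
  have h1 := enH_ge hk hk' hIZ (B := B) fun p hp => ⟨(hB p hp).1, (hB p hp).2.1⟩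
  have h2 := enH_ge hk hk' (disjoint_swapped hIZ) (B := swapped B) fun p hp => by
    rw [mem_swapped] at hp
    rw [spin_swapped, spin_swapped]
    refine ⟨(hB _ hp).1, ?_⟩
    have := (hB _ hp).2.2
    simpa using this
  have h3 : ∑ p ∈ swapped B, bnd k (spin (swapped I) (swapped Z) p)
      (spin (swapped I) (swapped Z) (p + (1, 0))) =
      ∑ p ∈ B, bnd k (spin I Z p) (spin I Z (p + (0, 1))) := by
    unfold swapped
    rw [Finset.sum_map]
    apply Finset.sum_congr rfl
    intro p _
    have := spin_swapped I Z
    unfold swapped at this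
    rw [this, this]
    rfl
  rw [h3, (most_swapped I).1, (most_swapped I).2, (cov_swapped I Z).1, (cov_swapped I Z).2] at h2
  simp only [card_swapped] at h2
  rw [en_eq_sum hB]
  simp only [bondSum, Finset.sum_add_distrib]
  rw [sides_eq, Fin.sum_univ_four, gaps, unhits]
  push_cast
  linarith

/-- Surfactant sites covering a row end and a column end. -/
def dbl (I Z : Finset (ℤ × ℤ)) : Finset (ℤ × ℤ) :=
  Z.filter fun z => (z ∈ cov I Z 1 ∨ z ∈ cov I Z 3) ∧ (z ∈ cov I Z 0 ∨ z ∈ cov I Z 2)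

/-- Surfactant sites covering no row end and no column end. -/
def nul (I Z : Finset (ℤ × ℤ)) : Finset (ℤ × ℤ) := 
  Z.filter fun z => z ∉ cov I Z 0 ∧ z ∉ cov I Z 1 ∧ z ∉ cov I Z 2 ∧ z ∉ cov I Z 3

lemma cov_one_three {I Z : Finset (ℤ × ℤ)} {z : ℤ × ℤ} (h : z ∈ cov I Z 1) : z ∉ cov I Z 3 := by
  intro h'
  have h1 := mem_most1.1 (mem_cov.1 h).2
  have h2 := h1.2 _ (most_subset _ _ (mem_cov.1 h').2) (by simp [dir])
  simp [dir] at h2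

lemma cov_zero_two {I Z : Finset (ℤ × ℤ)} {z : ℤ × ℤ} (h : z ∈ cov I Z 0) : z ∉ cov I Z 2 := by
  intro h'
  have h1 := mem_most0.1 (mem_cov.1 h).2
  have h2 := h1.2 _ (most_subset _ _ (mem_cov.1 h').2) (by simp [dir])
  simp [dir] at h2

lemma sum_cov (I Z : Finset (ℤ × ℤ)) :
    ∑ i, (cov I Z i).card + (nul I Z).card = Z.card + (dbl I Z).card := by
  have h : ∀ i, (cov I Z i).card = ∑ z ∈ Z, if z ∈ cov I Z i then 1 else 0 := by
    intro i
    rw [Finset.sum_ite_mem, Finset.sum_const, smul_eq_mul, mul_one,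
      Finset.inter_eq_right.2 (show cov I Z i ⊆ Z from Finset.filter_subset _ _)]
  rw [Fin.sum_univ_four, h, h, h, h, nul, dbl, Finset.card_filter, Finset.card_filter,
    Finset.card_eq_sum_ones Z]
  simp only [← Finset.sum_add_distrib]
  apply Finset.sum_congr rfl
  intro z _
  have a := @cov_one_three I Z z
  have b := @cov_zero_two I Z z
  by_cases h0 : z ∈ cov I Z 0 <;> by_cases h1 : z ∈ cov I Z 1 <;> by_cases h2 : z ∈ cov I Z 2 <;>
    by_cases h3 : z ∈ cov I Z 3 <;> simp_all

/-- The sides of `I` whose external slices are touched by surfactant from outside. -/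
def touched (I Z : Finset (ℤ × ℤ)) : Finset (Fin 4) :=
  Finset.univ.filter fun i => ∃ z ∈ Z, z + dir i ∈ sl I i

lemma card_cov_add_le (I Z : Finset (ℤ × ℤ)) {i : Fin 4} (hi : i ∉ touched I Z) :
    (cov I Z i).card + (sl I i).card ≤ (most I i).card := by
  have h1 : (cov I Z i).card ≤ ((most I i) \ sl I i).card := by
    apply Finset.card_le_card_of_injOn (· + dir i)
    · intro z hz
      have hz := mem_cov.1 hz
      rw [Finset.mem_coe, Finset.mem_sdiff]
      refine ⟨hz.2, fun h => hi ?_⟩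
      exact Finset.mem_filter.2 ⟨Finset.mem_univ _, z, hz.1, h⟩
    · exact (add_left_injective _).injOn
  have h2 := Finset.card_sdiff_add_card_eq_card (sl_subset_most I i)
  omega

lemma card_cov_le (I Z : Finset (ℤ × ℤ)) (i : Fin 4) : (cov I Z i).card ≤ (most I i).card := by
  apply Finset.card_le_card_of_injOn (· + dir i)
  · intro z hz; exact (mem_cov.1 hz).2
  · exact (add_left_injective _).injOn

lemma sum_cov_add_le (I Z : Finset (ℤ × ℤ)) :
    ∑ i, (cov I Z i).card + ∑ i ∈ (touched I Z)ᶜ, (sl I i).card ≤ sides I := by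
  unfold sides
  rw [← Finset.sum_add_sum_compl (touched I Z) (fun i => (cov I Z i).card),
    ← Finset.sum_add_sum_compl (touched I Z) (fun i => (most I i).card), add_assoc,
    ← Finset.sum_add_distrib]
  refine add_le_add (Finset.sum_le_sum fun i _ => card_cov_le I Z i)
    (Finset.sum_le_sum fun i hi => card_cov_add_le I Z (Finset.mem_compl.1 hi))

lemma card_unhit_ge {I Z : Finset (ℤ × ℤ)} : (if 0 ∈ touched I Z then 1 else 0) +
    (if 2 ∈ touched I Z then 1 else 0) ≤ (unhit I Z).card := by
  have h0 : 0 ∈ touched I Z → ∃ y ∈ unhit I Z, ∀ q ∈ I, y < q.2 := by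
    intro h
    obtain ⟨z, hz, hzs⟩ := (Finset.mem_filter.1 h).2
    have := (mem_sl0.1 hzs).2
    have hlt : ∀ q ∈ I, z.2 < q.2 := fun q hq => by have := this q hq; simp [dir] at this; omega
    refine ⟨z.2, ?_, hlt⟩
    simp only [unhit, Finset.mem_sdiff, Finset.mem_image, not_exists, not_and]
    exact ⟨⟨z, hz, rfl⟩, fun q hq => (hlt q hq).ne'⟩
  have h2 : 2 ∈ touched I Z → ∃ y ∈ unhit I Z, (∀ q ∈ I, q.2 < y) ∧ I.Nonempty := by
    intro h
    obtain ⟨z, hz, hzs⟩ := (Finset.mem_filter.1 h).2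
    have := (mem_sl2.1 hzs).2
    have hlt : ∀ q ∈ I, q.2 < z.2 := fun q hq => by have := this q hq; simp [dir] at this; omega
    refine ⟨z.2, ?_, hlt, ⟨_, (mem_sl2.1 hzs).1⟩⟩
    simp only [unhit, Finset.mem_sdiff, Finset.mem_image, not_exists, not_and]
    exact ⟨⟨z, hz, rfl⟩, fun q hq => (hlt q hq).ne⟩
  by_cases c0 : 0 ∈ touched I Z <;> by_cases c2 : 2 ∈ touched I Z
  · obtain ⟨y, hy, hy'⟩ := h0 c0
    obtain ⟨w, hw, hw', ⟨q, hq⟩⟩ := h2 c2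
    rw [if_pos c0, if_pos c2]
    have := hy' q hq
    have := hw' q hq
    exact Finset.one_lt_card.2 ⟨y, hy, w, hw, by omega⟩
  · obtain ⟨y, hy, -⟩ := h0 c0
    rw [if_pos c0, if_neg c2]
    exact Finset.card_pos.2 ⟨y, hy⟩
  · obtain ⟨y, hy, -⟩ := h2 c2
    rw [if_neg c0, if_pos c2]
    exact Finset.card_pos.2 ⟨y, hy⟩
  · rw [if_neg c0, if_neg c2]; exact Nat.zero_le _

lemma sl_swapped (I : Finset (ℤ × ℤ)) : sl (swapped I) 0 = swapped (sl I 1) ∧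
    sl (swapped I) 2 = swapped (sl I 3) := by
  have h : ∀ P : ℤ × ℤ → Prop, (∀ q ∈ swapped I, P q) ↔ ∀ q ∈ I, P (q.2, q.1) :=
    fun P => ⟨fun h q hq => h _ (by simpa using hq), fun h q hq => h _ (mem_swapped.1 hq)⟩
  constructor
  · ext p
    rw [mem_sl0, mem_swapped, mem_swapped, mem_sl1, h]
  · ext p
    rw [mem_sl2, mem_swapped, mem_swapped, mem_sl3, h]

lemma touched_swapped (I Z : Finset (ℤ × ℤ)) :
    (0 ∈ touched (swapped I) (swapped Z) ↔ 1 ∈ touched I Z) ∧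
    (2 ∈ touched (swapped I) (swapped Z) ↔ 3 ∈ touched I Z) := by
  unfold touched
  simp only [Finset.mem_filter, Finset.mem_univ, true_and, (sl_swapped I).1, (sl_swapped I).2,
    mem_swapped]
  exact ⟨⟨fun ⟨z, hz, h⟩ => ⟨_, hz, h⟩, fun ⟨z, hz, h⟩ => ⟨(z.2, z.1), hz, h⟩⟩,
    ⟨fun ⟨z, hz, h⟩ => ⟨_, hz, h⟩, fun ⟨z, hz, h⟩ => ⟨(z.2, z.1), hz, h⟩⟩⟩

lemma card_touched_le (I Z : Finset (ℤ × ℤ)) : (touched I Z).card ≤ unhits I Z := by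
  have h1 := card_unhit_ge (I := I) (Z := Z)
  have h2 := card_unhit_ge (I := swapped I) (Z := swapped Z)
  simp only [(touched_swapped I Z).1, (touched_swapped I Z).2] at h2
  have h3 : (touched I Z).card = ∑ i : Fin 4, if i ∈ touched I Z then 1 else 0 := by
    rw [Finset.sum_ite_mem, Finset.univ_inter, Finset.card_eq_sum_ones]
  rw [h3, Fin.sum_univ_four]
  unfold unhits
  omega

lemma card_cov_obd (J : Finset (ℤ × ℤ)) (i : Fin 4) :
    (cov J (obd J) i).card = (most J i).card := by
  apply Finset.card_bij (fun p _ => p + dir i)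
  · intro p hp; exact (mem_cov.1 hp).2
  · intro p _ q _ h; exact add_right_cancel h
  · intro q hq
    refine ⟨q - dir i, mem_cov.2 ⟨mem_obd.2 ?_, by simpa using hq⟩, by simp⟩
    have hqJ := most_subset _ _ hq
    have e : q - dir i + dir i = q := by simp
    fin_cases i
    · refine ⟨fun h => ?_, Or.inr (Or.inr (Or.inl (by simpa [dir] using hqJ)))⟩
      have := (mem_most0.1 hq).2 _ h (by simp [dir]); simp [dir] at this
    · refine ⟨fun h => ?_, Or.inl (by simpa [dir] using hqJ)⟩
      have := (mem_most1.1 hq).2 _ h (by simp [dir]); simp [dir] at this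
    · refine ⟨fun h => ?_, Or.inr (Or.inr (Or.inr ?_))⟩
      · have := (mem_most2.1 hq).2 _ h (by simp [dir]); simp [dir] at this
      · have : q - dir 2 - (0, 1) = q := by ext <;> simp [dir]
        simpa [this] using hqJ
    · refine ⟨fun h => ?_, Or.inr (Or.inl ?_)⟩
      · have := (mem_most3.1 hq).2 _ h (by simp [dir]); simp [dir] at this
      · have : q - dir 3 - (1, 0) = q := by ext <;> simp [dir]
        simpa [this] using hqJ

lemma sub_eq_add_dir (p : ℤ × ℤ) : p - (0, 1) = p + dir 2 ∧ p - (1, 0) = p + dir 3 := by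
  constructor <;> ext <;> simp [dir] <;> omega

lemma dbl_obd_subset (J : Finset (ℤ × ℤ)) : dbl J (obd J) ⊆ ocr J := by
  intro p hp
  obtain ⟨hp, h1, h2⟩ := Finset.mem_filter.1 hp
  have h : ∀ i, p ∈ cov J (obd J) i → p + dir i ∈ J :=
    fun i h => most_subset _ _ (mem_cov.1 h).2
  rw [mem_ocr, (sub_eq_add_dir p).1, (sub_eq_add_dir p).2]
  exact ⟨(mem_obd.1 hp).1, h1.imp (h 1) (h 3), h2.imp (h 0) (h 2)⟩

lemma sides_le (J : Finset (ℤ × ℤ)) : sides J ≤ (obd J).card + (ocr J).card := by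
  have h := sum_cov J (obd J)
  simp only [card_cov_obd] at h
  have := Finset.card_le_card (dbl_obd_subset J)
  unfold sides
  omega

lemma IsStaircase.sides_eq {J : Finset (ℤ × ℤ)} (hJ : IsStaircase (↑J : Set (ℤ × ℤ))) :
    sides J = (obd J).card + (ocr J).card := by
  have h := sum_cov J (obd J)
  simp only [card_cov_obd] at h
  have hc : ∀ p ∈ obd J, ∀ i, p + dir i ∈ J → p ∈ cov J (obd J) i :=
    fun p hp i hi => mem_cov.2 ⟨hp, hJ.mem_most i (mem_obd.1 hp).1 hi⟩
  have h1 : dbl J (obd J) = ocr J := by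
    refine Finset.Subset.antisymm (dbl_obd_subset J) fun p hp => ?_
    have hp' := ocr_subset_obd J hp
    rw [mem_ocr, (sub_eq_add_dir p).1, (sub_eq_add_dir p).2] at hp
    exact Finset.mem_filter.2 ⟨hp', hp.2.1.imp (hc p hp' 1) (hc p hp' 3),
      hp.2.2.imp (hc p hp' 0) (hc p hp' 2)⟩
  have h2 : nul J (obd J) = ∅ := by
    rw [Finset.eq_empty_iff_forall_notMem]
    intro p hp
    obtain ⟨hp, h0, h1, h2, h3⟩ := Finset.mem_filter.1 hp
    have hp' := mem_obd.1 hp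
    rw [(sub_eq_add_dir p).1, (sub_eq_add_dir p).2] at hp'
    rcases hp'.2 with h' | h' | h' | h'
    exacts [h1 (hc p hp 1 h'), h3 (hc p hp 3 h'), h0 (hc p hp 0 h'), h2 (hc p hp 2 h')]
  rw [h1, h2, Finset.card_empty] at h
  unfold sides
  omega

lemma exists_surfactant {k : ℝ} (hk' : k < 1) {J : Finset (ℤ × ℤ)}
    (hJ : IsStaircase (↑J : Set (ℤ × ℤ))) (A : Finset (Fin 4)) {n : ℕ} (hn : (ocr J).card ≤ n)
    (hn' : n + ∑ i ∈ Aᶜ, (sl J i).card ≤ (obd J).card) : ∃ Z : Finset (ℤ × ℤ), Disjoint J Z ∧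
      Z.card = n ∧ en k (spin J Z) ≤ 2 * sides J - 4 * k * (ocr J).card -
        (3 * k - 1) * (n - (ocr J).card) + (1 - k) * A.card := by
  have h1 := card_openBdry_le J A
  obtain ⟨Z, -, hZ, hc, he⟩ := exists_surfactant_aux hk' hJ A hn (by omega)
  refine ⟨Z, ?_, hc, he.trans ?_⟩
  · rw [Finset.disjoint_left]
    intro p hp hpZ
    exact (mem_obd.1 (mem_openBdry.1 (hZ hpZ)).1).1 hp
  · have : ((A.filter fun i => ∃ z ∈ Z, z ∈ extRow J i).card : ℝ) ≤ A.card := by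
      exact_mod_cast Finset.card_filter_le _ _
    have := mul_le_mul_of_nonneg_left this (by linarith : 0 ≤ 1 - k)
    linarith

/-- Comparison of a configuration with an arbitrary phase-one set and the best configuration
having a prescribed staircase set as phase-one set. -/
lemma exists_better {k : ℝ} (hk : 1 / 3 < k) (hk' : k < 1) {I Z J : Finset (ℤ × ℤ)} {n : ℕ}
    (hIZ : Disjoint I Z) (hn : Z.card = n) (hJ : IsStaircase (↑J : Set (ℤ × ℤ)))
    (B : Finset (Fin 4)) (hB : 2 * B.card + sides J ≤ sides I)
    (hdbl : (dbl I Z).card + sides J ≤ (ocr J).card + sides I)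
    (hsl : ∀ i, i ∉ B → (sl J i).card ≤ (sl I i).card) (hsat : n ≤ (obd J).card) :
    ∃ Z', Disjoint J Z' ∧ Z'.card = n ∧ en k (spin J Z') ≤ en k (spin I Z) ∧
      (en k (spin J Z') = en k (spin I Z) → sides J = sides I ∧ gaps I = 0) := by
  have hlb := en_ge (by linarith) hk' hIZ (k := k)
  have hK := sum_cov I Z
  have hcap := sum_cov_add_le I Z
  have hX := card_touched_le I Z
  have hJne : J.Nonempty := by
    obtain ⟨p, hp⟩ := hJ.connected.nonempty; exact ⟨p, hp⟩
  rw [hn] at hlb hK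
  have hdn : (dbl I Z).card ≤ n := hn ▸ Finset.card_filter_le _ _
  set K := ∑ i, (cov I Z i).card
  set n2 := (dbl I Z).card
  set n0 := (nul I Z).card
  set c := (ocr J).card
  set sI := sides I
  set sJ := sides J
  set X := unhits I Z
  set g := gaps I
  have hK' : (K : ℝ) = n + n2 - n0 := by
    have : (K : ℝ) + n0 = n + n2 := by exact_mod_cast hK
    linarith
  rw [hK'] at hlb
  have hX0 : (0 : ℝ) ≤ X := Nat.cast_nonneg _
  have hD1 : (sJ : ℝ) ≤ sI := by exact_mod_cast (by omega : sJ ≤ sI)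
  have fin : ∀ Z' : Finset (ℤ × ℤ), Disjoint J Z' → Z'.card = n →
      (1 - k) * ((sI - sJ) / 2 + g) ≤ en k (spin I Z) - en k (spin J Z') →
      ∃ Z', Disjoint J Z' ∧ Z'.card = n ∧ en k (spin J Z') ≤ en k (spin I Z) ∧
      (en k (spin J Z') = en k (spin I Z) → sJ = sI ∧ g = 0) := by
    intro Z' h1 h2 h3
    refine ⟨Z', h1, h2, ?_, fun he => ?_⟩
    · have : 0 ≤ (1 - k) * ((sI - sJ) / 2 + g : ℝ) := mul_nonneg (by linarith) (by linarith)
      linarith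
    · rw [he, sub_self] at h3
      have : (sI - sJ) / 2 + g ≤ (0 : ℝ) := by
        by_contra hlt
        have := mul_pos (by linarith : 0 < 1 - k) (not_le.1 hlt)
        linarith
      have e1 : (sJ : ℝ) = sI := by linarith
      have e2 : (g : ℝ) = 0 := by linarith
      exact ⟨by exact_mod_cast e1, by exact_mod_cast e2⟩
  rcases le_or_gt n c with hnc | hnc
  · obtain ⟨Z', hZ', hZc⟩ := Finset.exists_subset_card_eq hnc
    have hub := en_le_of_subset_ocr hk' hJ hZ'
    rw [hZc] at hub
    refine fin Z' ?_ hZc ?_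
    · rw [Finset.disjoint_left]
      intro p hp hpZ
      exact (mem_ocr.1 (hZ' hpZ)).1 hp
    · have h1 : (n2 : ℝ) ≤ n := by exact_mod_cast hdn
      have h2 : (0 : ℝ) ≤ (1 + k) * (n + n0 - n2) := mul_nonneg (by linarith) (by linarith)
      have h3 : (0 : ℝ) ≤ (1 - k) * X := mul_nonneg (by linarith) hX0
      have h4 : 0 ≤ (3 + k) * (sI - sJ : ℝ) := mul_nonneg (by linarith) (by linarith)
      linarith
  · set A₁ := touched I Z ∪ B
    have hA₁ : A₁.card ≤ X + B.card := (Finset.card_union_le _ _).trans (by omega)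
    have hsum1 : ∑ i ∈ A₁ᶜ, (sl J i).card ≤ ∑ i ∈ (touched I Z)ᶜ, (sl I i).card := by
      calc ∑ i ∈ A₁ᶜ, (sl J i).card ≤ ∑ i ∈ A₁ᶜ, (sl I i).card :=
            Finset.sum_le_sum fun i hi => hsl i fun hiB =>
              (Finset.mem_compl.1 hi) (Finset.mem_union_right _ hiB)
        _ ≤ _ := Finset.sum_le_sum_of_subset (by
            rw [Finset.compl_subset_compl]; exact Finset.subset_union_left)
    have hsl1 := sides_le J
    have base : n + n2 + ∑ i ∈ A₁ᶜ, (sl J i).card + sJ ≤ (obd J).card + sI + n0 + c := by omega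
    have concl : ∀ A : Finset (Fin 4), n + ∑ i ∈ Aᶜ, (sl J i).card ≤ (obd J).card →
        (1 - k) * ((sI - sJ) / 2 + g : ℝ) ≤ 2 * (sI - sJ) + (1 + k) * (c + n0 - n2) +
          (1 - k) * (g + X - A.card) →
        ∃ Z', Disjoint J Z' ∧ Z'.card = n ∧ en k (spin J Z') ≤ en k (spin I Z) ∧
        (en k (spin J Z') = en k (spin I Z) → sJ = sI ∧ g = 0) := by
      intro A h1 h2
      obtain ⟨Z', hZ', hZc, hub⟩ := exists_surfactant hk' hJ A hnc.le h1
      refine fin Z' hZ' hZc (h2.trans ?_)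
      linarith
    have hBr : 2 * (B.card : ℝ) ≤ sI - sJ := by
      have : 2 * (B.card : ℝ) + sJ ≤ sI := by exact_mod_cast hB
      linarith
    have hAr : (A₁.card : ℝ) ≤ X + B.card := by exact_mod_cast hA₁
    rcases lt_trichotomy (sI + n0 + c) (sJ + n2 + 1) with he | he | he
    · refine concl A₁ (by omega) ?_
      have e : (sI + n0 + c : ℝ) = sJ + n2 := by exact_mod_cast (by omega : sI + n0 + c = sJ + n2)
      have h1 := mul_le_mul_of_nonneg_left hAr (by linarith : 0 ≤ 1 - k)
      have h2 := mul_le_mul_of_nonneg_left hBr (by linarith : 0 ≤ 1 - k)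
      have e1 : (c + n0 - n2 : ℝ) = sJ - sI := by linarith
      rw [e1]
      linarith
    · obtain ⟨A, hA, hAs⟩ : ∃ A : Finset (Fin 4), A.card ≤ A₁.card + 1 ∧
          n + ∑ i ∈ Aᶜ, (sl J i).card ≤ (obd J).card := by
        by_cases hu : A₁ = Finset.univ
        · exact ⟨A₁, by omega, by rw [hu]; simpa using hsat⟩
        · obtain ⟨i, hi⟩ : ∃ i, i ∉ A₁ := by
            by_contra! h; exact hu (Finset.eq_univ_iff_forall.2 h)
          refine ⟨insert i A₁, Finset.card_insert_le _ _, ?_⟩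
          have h1 : A₁ᶜ = insert i (insert i A₁)ᶜ := by
            ext j; simp only [Finset.mem_compl, Finset.mem_insert, not_or]
            by_cases hj : j = i
            · subst hj; simp [hi]
            · simp [hj]
          rw [h1, Finset.sum_insert (by simp)] at base
          have := Finset.card_pos.2 (sl_nonempty hJne i)
          omega
      refine concl A hAs ?_
      have hAr' : (A.card : ℝ) ≤ A₁.card + 1 := by exact_mod_cast hA
      have e : (sI + n0 + c : ℝ) = sJ + n2 + 1 := by exact_mod_cast he
      have h1 := mul_le_mul_of_nonneg_left (hAr'.trans (add_le_add_left hAr 1))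
        (by linarith : 0 ≤ 1 - k)
      have h2 := mul_le_mul_of_nonneg_left hBr (by linarith : 0 ≤ 1 - k)
      have e1 : (c + n0 - n2 : ℝ) = sJ - sI + 1 := by linarith
      rw [e1]
      linarith
    · refine concl Finset.univ (by simpa using hsat) ?_
      have e : (sJ + n2 + 2 : ℝ) ≤ sI + n0 + c := by
        exact_mod_cast (by omega : sJ + n2 + 2 ≤ sI + n0 + c)
      have h1 := mul_le_mul_of_nonneg_left (by linarith : (sJ - sI + 2 : ℝ) ≤ c + n0 - n2)
        (by linarith : 0 ≤ 1 + k)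
      have h3 : (0 : ℝ) ≤ (1 - k) * X := mul_nonneg (by linarith) hX0
      have h4 : 0 ≤ (1 - k) * (sI - sJ : ℝ) := mul_nonneg (by linarith) (by linarith)
      simp only [Finset.card_univ, Fintype.card_fin]
      push_cast
      linarith

/-- Data of an octagon with prescribed external rows and columns. -/
structure Frame where
  (x0 x1 y0 y1 s1 s2 d1 d2 p1 q1 p2 q2 p3 q3 p4 q4 : ℤ)

namespace Frame

/-- Membership in the lattice set described by a frame. -/
def Mem (F : Frame) (x y : ℤ) : Prop :=
  (F.x0 ≤ x ∧ x ≤ F.x1 ∧ F.y0 ≤ y ∧ y ≤ F.y1) ∧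
  (F.s1 ≤ x + y ∧ x + y ≤ F.s2 ∧ F.d1 ≤ x - y ∧ x - y ≤ F.d2) ∧
  (y = F.y0 → F.p1 ≤ x ∧ x ≤ F.q1) ∧ (x = F.x0 → F.p2 ≤ y ∧ y ≤ F.q2) ∧
  (y = F.y1 → F.p3 ≤ x ∧ x ≤ F.q3) ∧ (x = F.x1 → F.p4 ≤ y ∧ y ≤ F.q4)

instance (F : Frame) (x y : ℤ) : Decidable (F.Mem x y) := by unfold Mem; infer_instance

/-- The lattice set described by a frame. -/
noncomputable def fin (F : Frame) : Finset (ℤ × ℤ) :=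
  (Finset.Icc F.x0 F.x1 ×ˢ Finset.Icc F.y0 F.y1).filter fun p => F.Mem p.1 p.2

lemma mem_fin {F : Frame} {p : ℤ × ℤ} : p ∈ F.fin ↔ F.Mem p.1 p.2 := by
  unfold fin
  rw [Finset.mem_filter, Finset.mem_product, Finset.mem_Icc, Finset.mem_Icc]
  refine ⟨fun h => h.2, fun h => ⟨?_, h⟩⟩
  have := h.1
  tauto

/-- Compatibility of the data of a frame. -/
structure Valid (F : Frame) : Prop where
  sw : F.x0 + F.y0 ≤ F.s1 ∧ F.s1 ≤ F.p1 + F.y0 ∧ F.s1 ≤ F.x0 + F.p2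
  se : F.d2 ≤ F.x1 - F.y0 ∧ F.q1 - F.y0 ≤ F.d2 ∧ F.x1 - F.p4 ≤ F.d2
  ne : F.s2 ≤ F.x1 + F.y1 ∧ F.q3 + F.y1 ≤ F.s2 ∧ F.x1 + F.q4 ≤ F.s2
  nw : F.x0 - F.y1 ≤ F.d1 ∧ F.d1 ≤ F.p3 - F.y1 ∧ F.d1 ≤ F.x0 - F.q2
  sw' : F.p1 = F.x0 ↔ F.p2 = F.y0
  se' : F.q1 = F.x1 ↔ F.p4 = F.y0
  ne' : F.q3 = F.x1 ↔ F.q4 = F.y1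
  nw' : F.p3 = F.x0 ↔ F.q2 = F.y1
  le : F.p1 ≤ F.q1 ∧ F.p2 ≤ F.q2 ∧ F.p3 ≤ F.q3 ∧ F.p4 ≤ F.q4
  fat : F.x0 + 4 ≤ F.x1 ∧ F.y0 + 4 ≤ F.y1 ∧ F.s1 + 4 ≤ F.s2 ∧ F.d1 + 4 ≤ F.d2
  diag : F.s1 + 4 ≤ F.x1 + F.y0 ∧ F.s1 + 4 ≤ F.x0 + F.y1 ∧ F.x1 + F.y0 + 4 ≤ F.s2 ∧
    F.x0 + F.y1 + 4 ≤ F.s2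
  diag' : F.d1 + 4 ≤ F.x0 - F.y0 ∧ F.d1 + 4 ≤ F.x1 - F.y1 ∧ F.x0 - F.y0 + 4 ≤ F.d2 ∧
    F.x1 - F.y1 + 4 ≤ F.d2
  conn : (F.x0 < F.q1 ∨ F.y0 < F.q2) ∧ (F.p1 < F.x1 ∨ F.y0 < F.q4) ∧
    (F.p3 < F.x1 ∨ F.p4 < F.y1) ∧ (F.x0 < F.q3 ∨ F.p2 < F.y1)
  center : ∃ x y : ℤ, (F.x0 + 1 < x ∧ x < F.x1 - 1 ∧ F.y0 + 1 < y ∧ y < F.y1 - 1) ∧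
    (F.s1 < x + y ∧ x + y < F.s2 ∧ F.d1 < x - y ∧ x - y < F.d2)

/-- Reflection at the diagonal. -/
def swap (F : Frame) : Frame :=
  ⟨F.y0, F.y1, F.x0, F.x1, F.s1, F.s2, -F.d2, -F.d1, F.p2, F.q2, F.p1, F.q1, F.p4, F.q4,
    F.p3, F.q3⟩

/-- Reflection at the vertical axis. -/
def flip (F : Frame) : Frame :=
  ⟨-F.x1, -F.x0, F.y0, F.y1, -F.d2, -F.d1, -F.s2, -F.s1, -F.q1, -F.p1, F.p4, F.q4, -F.q3, -F.p3,
    F.p2, F.q2⟩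

lemma mem_swap {F : Frame} {x y : ℤ} : F.swap.Mem x y ↔ F.Mem y x := by
  unfold Mem Frame.swap
  constructor <;> rintro ⟨h1, h2, h3, h4, h5, h6⟩ <;>
    exact ⟨by simp only at *; omega, by simp only at *; omega, h4, h3, h6, h5⟩

lemma mem_flip {F : Frame} {x y : ℤ} : F.flip.Mem x y ↔ F.Mem (-x) y := by
  unfold Mem Frame.flip
  simp only
  constructor <;> rintro ⟨h1, h2, h3, h4, h5, h6⟩ <;>
    exact ⟨by omega, by omega, by omega, by omega, by omega, by omega⟩

lemma Valid.swap {F : Frame} (h : F.Valid) : F.swap.Valid := by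
  obtain ⟨h1, h2, h3, h4, h5, h6, h7, h8, h9, h10, h11, h12, h15, x, y, h13, h14⟩ := h
  unfold Frame.swap
  refine ⟨?_, ?_, ?_, ?_, h5.symm, h8.symm, h7.symm, h6.symm, ?_, ?_, ?_, ?_, ?_, y, x, ?_, ?_⟩ <;>
    simp only <;> omega

lemma Valid.flip {F : Frame} (h : F.Valid) : F.flip.Valid := by
  obtain ⟨h1, h2, h3, h4, h5, h6, h7, h8, h9, h10, h11, h12, h15, x, y, h13, h14⟩ := h
  unfold Frame.flip
  refine ⟨?_, ?_, ?_, ?_, ?_, ?_, ?_, ?_, ?_, ?_, ?_, ?_, ?_, -x, y, ?_, ?_⟩ <;>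
    simp only <;> omega

lemma Valid.mem_bottom {F : Frame} (h : F.Valid) {x : ℤ} (h1 : F.p1 ≤ x) (h2 : x ≤ F.q1) :
    F.Mem x F.y0 := by
  have a1 := h.sw; have a2 := h.se; have a3 := h.ne; have a4 := h.nw; have a5 := h.sw'
  have a6 := h.se'; have a7 := h.le; have a8 := h.fat
  refine ⟨by omega, by omega, fun _ => ⟨h1, h2⟩, fun e => ?_, fun e => by omega, fun e => ?_⟩
  · have : F.p2 = F.y0 := a5.1 (by omega)
    omega
  · have : F.p4 = F.y0 := a6.1 (by omega)
    omega

lemma Valid.mem_left {F : Frame} (h : F.Valid) {y : ℤ} (h1 : F.p2 ≤ y) (h2 : y ≤ F.q2) :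
    F.Mem F.x0 y := mem_swap.1 (h.swap.mem_bottom (x := y) h1 h2)

lemma Valid.mem_right {F : Frame} (h : F.Valid) {y : ℤ} (h1 : F.p4 ≤ y) (h2 : y ≤ F.q4) :
    F.Mem F.x1 y := by
  have := mem_flip.1 (h.flip.mem_left (y := y) h1 h2)
  simpa [Frame.flip] using this

lemma Valid.mem_top {F : Frame} (h : F.Valid) {x : ℤ} (h1 : F.p3 ≤ x) (h2 : x ≤ F.q3) :
    F.Mem x F.y1 := mem_swap.1 (h.swap.mem_right (y := x) h1 h2)

lemma mem_row {F : Frame} {a b c y : ℤ} (h1 : a ≤ b) (h2 : b ≤ c) (ha : F.Mem a y)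
    (hc : F.Mem c y) : F.Mem b y := by
  obtain ⟨a1, a2, a3, a4, a5, a6⟩ := ha
  obtain ⟨c1, c2, c3, c4, c5, c6⟩ := hc
  refine ⟨by omega, by omega, fun e => ?_, fun e => ?_, fun e => ?_, fun e => ?_⟩
  · have := a3 e; have := c3 e; omega
  · exact a4 (by omega)
  · have := a5 e; have := c5 e; omega
  · exact c6 (by omega)

lemma mem_col {F : Frame} {a b c x : ℤ} (h1 : a ≤ b) (h2 : b ≤ c) (ha : F.Mem x a)
    (hc : F.Mem x c) : F.Mem x b :=
  mem_swap.1 (mem_row h1 h2 (mem_swap.2 ha) (mem_swap.2 hc))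

lemma Valid.overlap {F : Frame} (h : F.Valid) {y : ℤ} (h1 : F.y0 ≤ y) (h2 : y < F.y1) :
    ∃ x, F.Mem x y ∧ F.Mem x (y + 1) := by
  have a1 := h.sw; have a2 := h.se; have a3 := h.ne; have a4 := h.nw
  have a7 := h.le; have a8 := h.fat; have a9 := h.diag; have a10 := h.diag'
  have key : ∀ x, F.x0 < x → x < F.x1 → F.s1 ≤ x + y → F.d1 ≤ x - (y + 1) → x + (y + 1) ≤ F.s2 →
      x - y ≤ F.d2 → (y = F.y0 → F.p1 ≤ x ∧ x ≤ F.q1) → (y + 1 = F.y1 → F.p3 ≤ x ∧ x ≤ F.q3) →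
      ∃ x, F.Mem x y ∧ F.Mem x (y + 1) := fun x l1 l2 l3 l4 l5 l6 l7 l8 =>
    ⟨x, ⟨by omega, by omega, l7, by omega, by omega, by omega⟩,
      ⟨by omega, by omega, by omega, by omega, l8, by omega⟩⟩
  have a11 := h.conn; have a12 := h.sw'; have a13 := h.se'; have a14 := h.ne'
  have a15 := h.nw'
  by_cases e0 : y = F.y0
  · subst e0
    by_cases k1 : F.q1 = F.x0
    · exact ⟨F.x0, h.mem_left (by omega) (by omega), h.mem_left (by omega) (by omega)⟩
    by_cases k2 : F.p1 = F.x1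
    · exact ⟨F.x1, h.mem_right (by omega) (by omega), h.mem_right (by omega) (by omega)⟩
    exact key (max (F.x0 + 1) F.p1) (by omega) (by omega) (by omega) (by omega) (by omega)
      (by omega) (by omega) (by omega)
  by_cases e1 : y + 1 = F.y1
  · by_cases k1 : F.q3 = F.x0
    · exact ⟨F.x0, h.mem_left (by omega) (by omega), h.mem_left (by omega) (by omega)⟩
    by_cases k2 : F.p3 = F.x1
    · exact ⟨F.x1, h.mem_right (by omega) (by omega), h.mem_right (by omega) (by omega)⟩
    exact key (max (F.x0 + 1) F.p3) (by omega) (by omega) (by omega) (by omega) (by omega)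
      (by omega) (by omega) (by omega)
  refine key (max (max (F.x0 + 1) (F.s1 - y)) (F.d1 + y + 1)) (by omega) (by omega) (by omega)
    (by omega) (by omega) (by omega) (by omega) (by omega)

lemma Valid.isStaircase {F : Frame} (h : F.Valid) : IsStaircase (↑F.fin : Set (ℤ × ℤ)) := by
  have hmem : ∀ x y, (x, y) ∈ (↑F.fin : Set (ℤ × ℤ)) ↔ F.Mem x y := fun x y => by
    rw [Finset.mem_coe, mem_fin]
  refine ⟨F.fin.finite_toSet, ?_, ?_, ?_⟩
  · have hrow : ∀ a c y, a ≤ c → ∀ (ha : (a, y) ∈ (↑F.fin : Set (ℤ × ℤ)))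
        (hc : (c, y) ∈ (↑F.fin : Set (ℤ × ℤ))),
        (grid.induce (↑F.fin : Set (ℤ × ℤ))).Reachable ⟨(a, y), ha⟩ ⟨(c, y), hc⟩ := by
      intro a c y hac ha hc
      induction c, hac using Int.leInduction with
      | base => exact .refl _
      | succ c hac ih =>
        have hc' : (c, y) ∈ (↑F.fin : Set (ℤ × ℤ)) :=
          (hmem _ _).2 (mem_row hac (by omega) ((hmem _ _).1 ha) ((hmem _ _).1 hc))
        exact (ih hc').trans (SimpleGraph.Adj.reachable (adj_mk (by omega)))
    have hrow' : ∀ a c y, ∀ (ha : (a, y) ∈ (↑F.fin : Set (ℤ × ℤ)))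
        (hc : (c, y) ∈ (↑F.fin : Set (ℤ × ℤ))),
        (grid.induce (↑F.fin : Set (ℤ × ℤ))).Reachable ⟨(a, y), ha⟩ ⟨(c, y), hc⟩ := by
      intro a c y ha hc
      rcases le_total a c with hac | hac
      · exact hrow a c y hac ha hc
      · exact (hrow c a y hac hc ha).symm
    have hcol : ∀ y y', y ≤ y' → ∀ a c, ∀ (ha : (a, y) ∈ (↑F.fin : Set (ℤ × ℤ)))
        (hc : (c, y') ∈ (↑F.fin : Set (ℤ × ℤ))),
        (grid.induce (↑F.fin : Set (ℤ × ℤ))).Reachable ⟨(a, y), ha⟩ ⟨(c, y'), hc⟩ := by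
      intro y y' hy
      induction y', hy using Int.leInduction with
      | base => intro a c ha hc; exact hrow' a c y ha hc
      | succ z hz ih =>
        intro a c ha hc
        have h1 := ((hmem _ _).1 ha).1
        have h2 := ((hmem _ _).1 hc).1
        obtain ⟨x, hx, hx'⟩ := h.overlap (y := z) (by omega) (by omega)
        refine (ih a x ha ((hmem _ _).2 hx)).trans
          (SimpleGraph.Reachable.trans (v := ⟨(x, z + 1), (hmem _ _).2 hx'⟩) ?_
            (hrow' x c _ _ hc))
        exact SimpleGraph.Adj.reachable (adj_mk (by omega))
    have : Nonempty (↑F.fin : Set (ℤ × ℤ)) :=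
      ⟨⟨(F.p1, F.y0), (hmem _ _).2 (h.mem_bottom le_rfl h.le.1)⟩⟩
    refine ⟨?_⟩
    rintro ⟨⟨a, y⟩, ha⟩ ⟨⟨c, y'⟩, hc⟩
    rcases le_total y y' with hy | hy
    · exact hcol y y' hy a c ha hc
    · exact (hcol y' y hy c a hc ha).symm
  · intro a b c y h1 h2 ha hc
    rw [hmem] at *
    exact mem_row h1 h2 ha hc
  · intro x a b c h1 h2 ha hc
    rw [hmem] at *
    exact mem_col h1 h2 ha hc

lemma Valid.mem_sl0 {F : Frame} (h : F.Valid) {p : ℤ × ℤ} :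
    p ∈ sl F.fin 0 ↔ p.2 = F.y0 ∧ F.p1 ≤ p.1 ∧ p.1 ≤ F.q1 := by
  rw [Surfactant.mem_sl0, mem_fin]
  constructor
  · rintro ⟨h1, h2⟩
    have := h2 (F.p1, F.y0) (mem_fin.2 (h.mem_bottom le_rfl h.le.1))
    have h3 := h1.1
    simp only at this
    have e : p.2 = F.y0 := by omega
    exact ⟨e, h1.2.2.1 e⟩
  · rintro ⟨h1, h2, h3⟩
    refine ⟨h1 ▸ h.mem_bottom h2 h3, fun q hq => ?_⟩
    have := (mem_fin.1 hq).1
    omega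

lemma Valid.mem_sl1 {F : Frame} (h : F.Valid) {p : ℤ × ℤ} :
    p ∈ sl F.fin 1 ↔ p.1 = F.x0 ∧ F.p2 ≤ p.2 ∧ p.2 ≤ F.q2 := by
  rw [Surfactant.mem_sl1, mem_fin]
  constructor
  · rintro ⟨h1, h2⟩
    have := h2 (F.x0, F.p2) (mem_fin.2 (h.mem_left le_rfl h.le.2.1))
    have h3 := h1.1
    simp only at this
    have e : p.1 = F.x0 := by omega
    exact ⟨e, h1.2.2.2.1 e⟩
  · rintro ⟨h1, h2, h3⟩
    refine ⟨h1 ▸ h.mem_left h2 h3, fun q hq => ?_⟩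
    have := (mem_fin.1 hq).1
    omega

lemma Valid.mem_sl2 {F : Frame} (h : F.Valid) {p : ℤ × ℤ} :
    p ∈ sl F.fin 2 ↔ p.2 = F.y1 ∧ F.p3 ≤ p.1 ∧ p.1 ≤ F.q3 := by
  rw [Surfactant.mem_sl2, mem_fin]
  constructor
  · rintro ⟨h1, h2⟩
    have := h2 (F.p3, F.y1) (mem_fin.2 (h.mem_top le_rfl h.le.2.2.1))
    have h3 := h1.1
    simp only at this
    have e : p.2 = F.y1 := by omega
    exact ⟨e, h1.2.2.2.2.1 e⟩
  · rintro ⟨h1, h2, h3⟩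
    refine ⟨h1 ▸ h.mem_top h2 h3, fun q hq => ?_⟩
    have := (mem_fin.1 hq).1
    omega

lemma Valid.mem_sl3 {F : Frame} (h : F.Valid) {p : ℤ × ℤ} :
    p ∈ sl F.fin 3 ↔ p.1 = F.x1 ∧ F.p4 ≤ p.2 ∧ p.2 ≤ F.q4 := by
  rw [Surfactant.mem_sl3, mem_fin]
  constructor
  · rintro ⟨h1, h2⟩
    have := h2 (F.x1, F.p4) (mem_fin.2 (h.mem_right le_rfl h.le.2.2.2))
    have h3 := h1.1
    simp only at this
    have e : p.1 = F.x1 := by omega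
    exact ⟨e, h1.2.2.2.2.2 e⟩
  · rintro ⟨h1, h2, h3⟩
    refine ⟨h1 ▸ h.mem_right h2 h3, fun q hq => ?_⟩
    have := (mem_fin.1 hq).1
    omega

/-- All nearest neighbours belong to the set. -/
def Inner (F : Frame) (x y : ℤ) : Prop :=
  F.Mem (x + 1) y ∧ F.Mem (x - 1) y ∧ F.Mem x (y + 1) ∧ F.Mem x (y - 1)

lemma inner_of_lt {F : Frame} {x y : ℤ} (h1 : F.x0 + 2 ≤ x) (h2 : x ≤ F.x1 - 2)
    (h3 : F.y0 + 2 ≤ y) (h4 : y ≤ F.y1 - 2) (h5 : F.s1 < x + y) (h6 : x + y < F.s2)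
    (h7 : F.d1 < x - y) (h8 : x - y < F.d2) : F.Inner x y := by
  refine ⟨?_, ?_, ?_, ?_⟩ <;>
    exact ⟨by omega, by omega, by omega, by omega, by omega, by omega⟩

lemma Valid.inner_second {F : Frame} (h : F.Valid) {y : ℤ} (h1 : F.Mem F.x0 y)
    (h3 : F.y0 + 2 ≤ y) (h4 : y ≤ F.y1 - 2) : F.Inner (F.x0 + 1) y := by
  have a1 := h.sw; have a3 := h.ne; have a4 := h.nw
  have a7 := h.le; have a8 := h.fat; have a10 := h.diag'
  obtain ⟨b1, b2, b3, b4, b5, b6⟩ := h1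
  have b4 := b4 rfl
  refine ⟨⟨by omega, by omega, by omega, by omega, by omega, by omega⟩, ?_,
    ⟨by omega, by omega, by omega, by omega, by omega, by omega⟩,
    ⟨by omega, by omega, by omega, by omega, by omega, by omega⟩⟩
  rw [add_sub_cancel_right]
  exact ⟨b1, b2, b3, fun _ => b4, b5, b6⟩

lemma Valid.flat_row {F : Frame} (h : F.Valid) {x y : ℤ} (h1 : F.Mem x y) (h2 : F.Mem (x + 1) y)
    (h3 : ¬ F.Inner x y) (h4 : ¬ F.Inner (x + 1) y) : y ≤ F.y0 + 1 ∨ F.y1 - 1 ≤ y := by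
  by_contra! hy
  have a1 := h.sw; have a2 := h.se; have a3 := h.ne; have a4 := h.nw
  have a7 := h.le; have a8 := h.fat; have a9 := h.diag; have a10 := h.diag'
  have b1 := h1.1; have b2 := h1.2.1; have c1 := h2.1; have c2 := h2.2.1
  have l : x ≠ F.x0 := by
    rintro rfl
    exact h4 (h.inner_second h1 (by omega) (by omega))
  have r : x + 1 ≠ F.x1 := by
    intro e
    have hm : F.flip.Mem F.flip.x0 y := by rw [mem_flip]; simpa [Frame.flip, ← e] using h2
    have := h.flip.inner_second hm (by simp only [Frame.flip]; omega) (by simp only [Frame.flip]; omega)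
    obtain ⟨k1, k2, k3, k4⟩ := this
    rw [mem_flip] at k1 k2 k3 k4
    have e1 : -(F.flip.x0 + 1 + 1) = x - 1 := by simp only [Frame.flip]; omega
    have e2 : -(F.flip.x0 + 1 - 1) = x + 1 := by simp only [Frame.flip]; omega
    have e3 : -(F.flip.x0 + 1) = x := by simp only [Frame.flip]; omega
    rw [e1] at k1; rw [e2] at k2; rw [e3] at k3 k4
    exact h3 ⟨k2, k1, k3, k4⟩
  by_cases k : F.x0 + 2 ≤ x ∧ F.s1 < x + y ∧ F.d1 < x - y
  · exact h3 (inner_of_lt (by omega) (by omega) (by omega) (by omega) (by omega) (by omega)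
      (by omega) (by omega))
  · exact h4 (inner_of_lt (by omega) (by omega) (by omega) (by omega) (by omega) (by omega)
      (by omega) (by omega))

lemma not_inner {F : Frame} {p : ℤ × ℤ} (h : p ∈ innerBdry (↑F.fin : Set (ℤ × ℤ))) :
    F.Mem p.1 p.2 ∧ ¬ F.Inner p.1 p.2 := by
  obtain ⟨h1, q, hq, hadj⟩ := h
  refine ⟨mem_fin.1 h1, fun hi => hq ?_⟩
  rw [Finset.mem_coe, mem_fin]
  obtain ⟨i1, i2, i3, i4⟩ := hi
  rcases adj_cases hadj with ⟨e1, e2⟩ | ⟨e1, e2⟩ | ⟨e1, e2⟩ | ⟨e1, e2⟩ <;> rw [e1, e2] <;>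
    assumption

lemma isDiscreteOctagon_inner {F : Frame} (h : F.Valid) : IsDiscreteOctagon
    {p : ℤ × ℤ | (F.x0 + 1 ≤ p.1 ∧ p.1 ≤ F.x1 - 1 ∧ F.y0 + 1 ≤ p.2 ∧ p.2 ≤ F.y1 - 1) ∧
      (F.s1 ≤ p.1 + p.2 ∧ p.1 + p.2 ≤ F.s2 ∧ F.d1 ≤ p.1 - p.2 ∧ p.1 - p.2 ≤ F.d2)} := by
  refine ⟨{x | x.1 ∈ Icc ((F.x0 + 1 : ℤ) : ℝ) (F.x1 - 1 : ℤ) ∧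
    x.2 ∈ Icc ((F.y0 + 1 : ℤ) : ℝ) (F.y1 - 1 : ℤ) ∧ x.1 + x.2 ∈ Icc (F.s1 : ℝ) F.s2 ∧
    x.1 - x.2 ∈ Icc (F.d1 : ℝ) F.d2}, ⟨?_, _, _, _, _, _, _, _, _, rfl⟩, ?_⟩
  · obtain ⟨x, y, ⟨h1, h2, h3, h4⟩, h5, h6, h7, h8⟩ := h.center
    refine ⟨((x : ℝ), (y : ℝ)), mem_interior.2 ⟨{x | x.1 ∈ Ioo ((F.x0 + 1 : ℤ) : ℝ) (F.x1 - 1 : ℤ) ∧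
      x.2 ∈ Ioo ((F.y0 + 1 : ℤ) : ℝ) (F.y1 - 1 : ℤ) ∧ x.1 + x.2 ∈ Ioo (F.s1 : ℝ) F.s2 ∧
      x.1 - x.2 ∈ Ioo (F.d1 : ℝ) F.d2}, ?_, ?_, ?_⟩⟩
    · rintro ⟨a, b⟩ ⟨k1, k2, k3, k4⟩
      exact ⟨Ioo_subset_Icc_self k1, Ioo_subset_Icc_self k2, Ioo_subset_Icc_self k3,
        Ioo_subset_Icc_self k4⟩
    · refine (isOpen_Ioo.preimage continuous_fst).inter ((isOpen_Ioo.preimage continuous_snd).inter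
        ((isOpen_Ioo.preimage (continuous_fst.add continuous_snd)).inter
        (isOpen_Ioo.preimage (continuous_fst.sub continuous_snd))))
    · have cast : ∀ {a b : ℤ}, a < b → (a : ℝ) < b := fun h => by exact_mod_cast h
      simp only [Set.mem_ofPred_eq, Set.mem_Ioo, ← Int.cast_add x y, ← Int.cast_sub x y]
      exact ⟨⟨cast h1, cast h2⟩, ⟨cast h3, cast h4⟩, ⟨cast h5, cast h6⟩, ⟨cast h7, cast h8⟩⟩
  · ext p
    simp only [Set.mem_ofPred_eq, Set.mem_Icc, ← Int.cast_add p.1 p.2, ← Int.cast_sub p.1 p.2,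
      Int.cast_le]
    tauto

lemma Valid.isQuasiOctagon {F : Frame} (h : F.Valid) :
    IsQuasiOctagon (↑F.fin : Set (ℤ × ℤ)) := by
  have hsl : ∀ i, (extSlice (↑F.fin : Set (ℤ × ℤ)) i) = ↑(sl F.fin i) :=
    fun i => (coe_sl _ i).symm
  refine ⟨h.isStaircase, ⟨_, isDiscreteOctagon_inner h, ?_⟩, ?_⟩
  · ext p
    simp only [hsl, Set.mem_union, Set.mem_iUnion, Finset.mem_coe, Set.mem_ofPred_eq]
    constructor
    · intro hp
      have hp' := mem_fin.1 hp
      have b1 := hp'.1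
      by_cases e0 : p.2 = F.y0
      · exact Or.inr ⟨0, h.mem_sl0.2 ⟨e0, hp'.2.2.1 e0⟩⟩
      by_cases e1 : p.1 = F.x0
      · exact Or.inr ⟨1, h.mem_sl1.2 ⟨e1, hp'.2.2.2.1 e1⟩⟩
      by_cases e2 : p.2 = F.y1
      · exact Or.inr ⟨2, h.mem_sl2.2 ⟨e2, hp'.2.2.2.2.1 e2⟩⟩
      by_cases e3 : p.1 = F.x1
      · exact Or.inr ⟨3, h.mem_sl3.2 ⟨e3, hp'.2.2.2.2.2 e3⟩⟩
      exact Or.inl ⟨by omega, hp'.2.1⟩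
    · rintro (⟨h1, h2⟩ | ⟨i, hi⟩)
      · exact mem_fin.2 ⟨by omega, h2, by omega, by omega, by omega, by omega⟩
      · exact most_subset _ _ (sl_subset_most _ _ hi)
  · have s0 : ∀ p : ℤ × ℤ, F.Mem p.1 p.2 → p.2 = F.y0 + 1 → p ∈ secondSlice (↑F.fin) 0 := by
      intro p hp e
      refine ⟨mem_fin.2 hp, (F.p1, F.y0), ?_, e⟩
      rw [hsl]; exact h.mem_sl0.2 ⟨rfl, le_rfl, h.le.1⟩
    have s1 : ∀ p : ℤ × ℤ, F.Mem p.1 p.2 → p.1 = F.x0 + 1 → p ∈ secondSlice (↑F.fin) 1 := by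
      intro p hp e
      refine ⟨mem_fin.2 hp, (F.x0, F.p2), ?_, e⟩
      rw [hsl]; exact h.mem_sl1.2 ⟨rfl, le_rfl, h.le.2.1⟩
    have s2 : ∀ p : ℤ × ℤ, F.Mem p.1 p.2 → p.2 = F.y1 - 1 → p ∈ secondSlice (↑F.fin) 2 := by
      intro p hp e
      refine ⟨mem_fin.2 hp, (F.p3, F.y1), ?_, e⟩
      rw [hsl]; exact h.mem_sl2.2 ⟨rfl, le_rfl, h.le.2.2.1⟩
    have s3 : ∀ p : ℤ × ℤ, F.Mem p.1 p.2 → p.1 = F.x1 - 1 → p ∈ secondSlice (↑F.fin) 3 := by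
      intro p hp e
      refine ⟨mem_fin.2 hp, (F.x1, F.p4), ?_, e⟩
      rw [hsl]; exact h.mem_sl3.2 ⟨rfl, le_rfl, h.le.2.2.2⟩
    rintro ⟨x, y⟩ hp q hq hpq
    obtain ⟨m1, n1⟩ := not_inner hp
    obtain ⟨m2, n2⟩ := not_inner hq
    simp only [hsl, Set.insert_subset_iff, Set.singleton_subset_iff, Finset.mem_coe]
    rcases hpq with rfl | rfl
    · simp only [Prod.mk_add_mk, add_zero] at m2 n2 ⊢
      have := h.flat_row m1 m2 n1 n2
      have b1 := m1.1
      simp only at b1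
      have c : y = F.y0 ∨ y = F.y0 + 1 ∨ y = F.y1 ∨ y = F.y1 - 1 := by omega
      rcases c with e | e | e | e
      · exact ⟨0, Or.inl ⟨h.mem_sl0.2 ⟨e, m1.2.2.1 e⟩, h.mem_sl0.2 ⟨e, m2.2.2.1 e⟩⟩⟩
      · exact ⟨0, Or.inr ⟨s0 _ m1 e, s0 _ m2 e⟩⟩
      · exact ⟨2, Or.inl ⟨h.mem_sl2.2 ⟨e, m1.2.2.2.2.1 e⟩, h.mem_sl2.2 ⟨e, m2.2.2.2.2.1 e⟩⟩⟩
      · exact ⟨2, Or.inr ⟨s2 _ m1 e, s2 _ m2 e⟩⟩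
    · simp only [Prod.mk_add_mk, add_zero] at m2 n2 ⊢
      have hsw : ∀ a b, F.swap.Inner a b → F.Inner b a := by
        rintro a b ⟨i1, i2, i3, i4⟩
        rw [mem_swap] at i1 i2 i3 i4
        exact ⟨i3, i4, i1, i2⟩
      have := h.swap.flat_row (mem_swap.2 m1) (mem_swap.2 m2) (fun hi => n1 (hsw _ _ hi))
        (fun hi => n2 (hsw _ _ hi))
      simp only [Frame.swap] at this
      have b1 := m1.1
      simp only at b1
      have c : x = F.x0 ∨ x = F.x0 + 1 ∨ x = F.x1 ∨ x = F.x1 - 1 := by omega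
      rcases c with e | e | e | e
      · exact ⟨1, Or.inl ⟨h.mem_sl1.2 ⟨e, m1.2.2.2.1 e⟩, h.mem_sl1.2 ⟨e, m2.2.2.2.1 e⟩⟩⟩
      · exact ⟨1, Or.inr ⟨s1 _ m1 e, s1 _ m2 e⟩⟩
      · exact ⟨3, Or.inl ⟨h.mem_sl3.2 ⟨e, m1.2.2.2.2.2 e⟩, h.mem_sl3.2 ⟨e, m2.2.2.2.2.2 e⟩⟩⟩
      · exact ⟨3, Or.inr ⟨s3 _ m1 e, s3 _ m2 e⟩⟩

end Frame

lemma sum_range_card_le (f : ℕ → ℕ) (s : Finset ℕ) (h : ∀ m ∈ s, ∀ a ≤ m, f a ≤ f m) :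
    ∑ j ∈ Finset.range s.card, f j ≤ ∑ j ∈ s, f j := by
  induction s using Finset.induction_on_max with
  | empty => simp
  | insert m s hm ih =>
    have hms : m ∉ s := fun h => lt_irrefl _ (hm m h)
    rw [Finset.card_insert_of_notMem hms, Finset.sum_range_succ, Finset.sum_insert hms, add_comm]
    refine add_le_add (h m (Finset.mem_insert_self _ _) _ ?_)
      (ih fun a ha => h a (Finset.mem_insert_of_mem ha))
    have : s ⊆ Finset.range m := fun a ha => Finset.mem_range.2 (hm a ha)
    simpa using Finset.card_le_card this

/-- The width of the `i`-th row of the region in which a corner is compressed. -/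
def wid (W E M i : ℕ) : ℕ := if i < E then W else max E (M + 2 * E - i)

open Classical in
/-- The missing sites of the row `i`. -/
noncomputable def miss (w : ℕ → ℕ) (A : ℕ → ℕ → Prop) (i : ℕ) : Finset ℕ :=
  (Finset.range (w i)).filter fun j => ¬ A j i

lemma mem_miss {w : ℕ → ℕ} {A : ℕ → ℕ → Prop} {i j : ℕ} : j ∈ miss w A i ↔ j < w i ∧ ¬ A j i := by
  classical
  unfold miss
  rw [Finset.mem_filter, Finset.mem_range]

lemma card_miss_le (w : ℕ → ℕ) (A : ℕ → ℕ → Prop) (i : ℕ) : (miss w A i).card ≤ w i := by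
  have : miss w A i ⊆ Finset.range (w i) := fun j hj => Finset.mem_range.2 (mem_miss.1 hj).1
  simpa using Finset.card_le_card this

/-- The number of rows with more than `j` missing sites. -/
noncomputable def prof (w : ℕ → ℕ) (A : ℕ → ℕ → Prop) (R j : ℕ) : ℕ :=
  ((Finset.range R).filter fun i => j < (miss w A i).card).card

/-- The conjugate profile. -/
def conj (W : ℕ) (h : ℕ → ℕ) (i : ℕ) : ℕ := ((Finset.range W).filter fun j => i < h j).card

lemma prof_anti (w : ℕ → ℕ) (A : ℕ → ℕ → Prop) (R : ℕ) : Antitone (prof w A R) := by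
  intro a b hab
  refine Finset.card_le_card fun i hi => ?_
  rw [Finset.mem_filter] at hi ⊢
  exact ⟨hi.1, by omega⟩

lemma prof_le (w : ℕ → ℕ) (A : ℕ → ℕ → Prop) (R j : ℕ) : prof w A R j ≤ R := by
  simpa [prof] using Finset.card_filter_le (Finset.range R) (fun i => j < (miss w A i).card)

lemma lt_conj {W : ℕ} {h : ℕ → ℕ} (hh : Antitone h) {i j : ℕ} :
    j < conj W h i ↔ j < W ∧ i < h j := by
  have hs : ∀ a b, a ≤ b → b ∈ (Finset.range W).filter (fun j => i < h j) →
      a ∈ (Finset.range W).filter (fun j => i < h j) := by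
    intro a b hab hb
    rw [Finset.mem_filter, Finset.mem_range] at hb ⊢
    have := hh hab
    omega
  have hm : (j < W ∧ i < h j) ↔ j ∈ (Finset.range W).filter (fun j => i < h j) := by
    rw [Finset.mem_filter, Finset.mem_range]
  rw [hm]
  unfold conj
  constructor
  · intro hj
    by_contra hn
    have : (Finset.range W).filter (fun j => i < h j) ⊆ Finset.range j := fun a ha => by
      rw [Finset.mem_range]
      by_contra hja
      exact hn (hs j a (by omega) ha)
    have := Finset.card_le_card this
    rw [Finset.card_range] at this
    omega
  · intro hj
    have : Finset.range (j + 1) ⊆ (Finset.range W).filter (fun j => i < h j) := fun a ha => by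
      rw [Finset.mem_range] at ha
      exact hs a j (by omega) hj
    have := Finset.card_le_card this
    rw [Finset.card_range] at this
    omega

lemma conj_le (W : ℕ) (h : ℕ → ℕ) (i : ℕ) : conj W h i ≤ W := by
  simpa [conj] using Finset.card_filter_le (Finset.range W) (fun j => i < h j)

lemma le_conj {W : ℕ} {h : ℕ → ℕ} (hh : Antitone h) {i n : ℕ} (hn : n ≤ W)
    (hi : ∀ j < n, i < h j) : n ≤ conj W h i := by
  by_contra! hc
  have := (lt_conj hh (W := W) (i := i) (j := conj W h i)).2 ⟨by omega, hi _ hc⟩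
  omega

lemma card_le_prof {w : ℕ → ℕ} {A : ℕ → ℕ → Prop} {R j : ℕ} (T : Finset ℕ)
    (h : ∀ i ∈ T, i < R ∧ j < (miss w A i).card) : T.card ≤ prof w A R j :=
  Finset.card_le_card fun i hi => Finset.mem_filter.2 ⟨Finset.mem_range.2 (h i hi).1, (h i hi).2⟩

lemma prof_eq {w : ℕ → ℕ} {A : ℕ → ℕ → Prop} {R j : ℕ} (h : ∀ i < R, j < (miss w A i).card) :
    prof w A R j = R := by
  have := card_le_prof (w := w) (A := A) (R := R) (j := j) (Finset.range R)
    fun i hi => ⟨Finset.mem_range.1 hi, h i (Finset.mem_range.1 hi)⟩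
  rw [Finset.card_range] at this
  exact le_antisymm (prof_le _ _ _ _) this

/-- The compressed set of missing sites has the smallest weight. -/
lemma sum_prof_le {w : ℕ → ℕ} {A : ℕ → ℕ → Prop} {R W : ℕ} (hw : ∀ i, w i ≤ W) (f : ℕ → ℕ → ℕ)
    (hf : ∀ j j' i, i < R → j' < w i → j ≤ j' → f j i ≤ f j' i)
    (hf' : ∀ j i i', i' < R → j < w i' → i ≤ i' → f j i ≤ f j i') :
    ∑ j ∈ Finset.range W, ∑ i ∈ Finset.range (prof w A R j), f j i ≤
      ∑ i ∈ Finset.range R, ∑ j ∈ miss w A i, f j i := by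
  have hL := card_miss_le w A
  calc ∑ j ∈ Finset.range W, ∑ i ∈ Finset.range (prof w A R j), f j i
      ≤ ∑ j ∈ Finset.range W, ∑ i ∈ (Finset.range R).filter (fun i => j < (miss w A i).card),
          f j i := by
        refine Finset.sum_le_sum fun j _ => sum_range_card_le (f j) _ fun m hm a ha => ?_
        rw [Finset.mem_filter, Finset.mem_range] at hm
        exact hf' j a m hm.1 (hm.2.trans_le (hL m)) ha
    _ = ∑ i ∈ Finset.range R, ∑ j ∈ Finset.range (miss w A i).card, f j i := by
        apply Finset.sum_comm'
        intro j i
        simp only [Finset.mem_range, Finset.mem_filter]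
        have := hL i
        have := hw i
        constructor <;> intro h <;> omega
    _ ≤ _ := by
        refine Finset.sum_le_sum fun i hi => sum_range_card_le (fun j => f j i) _ fun m hm a ha => ?_
        exact hf a m i (Finset.mem_range.1 hi) (mem_miss.1 hm).1 ha

section
variable {W E M R : ℕ} {A : ℕ → ℕ → Prop}

lemma wid_le (h1 : E ≤ W) (h2 : M + E ≤ W) (i : ℕ) : wid W E M i ≤ W := by
  unfold wid; split_ifs <;> omega

lemma le_wid (h1 : E ≤ W) (i : ℕ) : E ≤ wid W E M i := by
  unfold wid; split_ifs <;> omega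

lemma le_prof_add (hA : ∀ i j, i + j < M → ¬ A j i) (h1 : M ≤ W) (hR : M ≤ R) (j : ℕ) :
    M ≤ prof (wid W E M) A R j + j := by
  have := card_le_prof (w := wid W E M) (A := A) (R := R) (j := j) (Finset.range (M - j))
    fun i hi => by
      rw [Finset.mem_range] at hi
      have : Finset.range (M - i) ⊆ miss (wid W E M) A i := fun a ha => by
        rw [Finset.mem_range] at ha
        refine mem_miss.2 ⟨?_, hA i a (by omega)⟩
        unfold wid; split_ifs <;> omega
      have := Finset.card_le_card this
      rw [Finset.card_range] at this
      omega
  rw [Finset.card_range] at this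
  omega

lemma prof_corner_le (A : ℕ → ℕ → Prop) (R : ℕ) : prof (wid W E M) A R E ≤ M + E := by
  have : (Finset.range R).filter (fun i => E < (miss (wid W E M) A i).card) ⊆
      Finset.range (M + E) := fun i hi => by
    rw [Finset.mem_filter] at hi
    rw [Finset.mem_range]
    have := card_miss_le (wid W E M) A i
    unfold wid at this hi
    split_ifs at * <;> omega
  simpa [prof] using Finset.card_le_card this

lemma prof_last_le (A : ℕ → ℕ → Prop) (R : ℕ) (h1 : E < W) (h2 : M + E < W) :
    prof (wid W E M) A R (W - 1) ≤ E := by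
  have : (Finset.range R).filter (fun i => W - 1 < (miss (wid W E M) A i).card) ⊆
      Finset.range E := fun i hi => by
    rw [Finset.mem_filter] at hi
    rw [Finset.mem_range]
    have := card_miss_le (wid W E M) A i
    unfold wid at this hi
    split_ifs at * <;> omega
  simpa [prof] using Finset.card_le_card this

lemma conj_last_le (A : ℕ → ℕ → Prop) (h1 : M + E < R) (h2 : E < R) :
    conj W (prof (wid W E M) A R) (R - 1) ≤ E := by
  by_contra! hc
  have h3 := ((lt_conj (prof_anti _ _ _)).1 hc).2
  have h4 : (Finset.range R).filter (fun i => E < (miss (wid W E M) A i).card) ⊆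
      Finset.range (R - 1) := fun i hi => by
    rw [Finset.mem_filter, Finset.mem_range] at hi
    rw [Finset.mem_range]
    have := card_miss_le (wid W E M) A i
    unfold wid at this hi
    split_ifs at * <;> omega
  have := Finset.card_le_card h4
  rw [Finset.card_range] at this
  unfold prof at h3
  omega

/-- Full rows, full columns and sites with empty rows, all in different rows and columns, force
the profile to be large. -/
lemma card_add_le_prof_of_le (hE : E ≤ W) {T₁ T₂ : Finset ℕ} {S : Finset (ℕ × ℕ)}
    (h1 : ∀ i ∈ T₁, i < R ∧ W ≤ (miss (wid W E M) A i).card)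
    (h2 : ∀ j ∈ T₂, j < E ∧ ∀ i < R, ¬ A j i)
    (hS : ∀ z ∈ S, z.2 < R ∧ z.1 < wid W E M z.2 ∧ ∀ j ≤ z.1, ¬ A j z.2)
    (hS1 : ∀ z ∈ S, ∀ z' ∈ S, z.1 = z'.1 → z = z') (hS2 : ∀ z ∈ S, ∀ z' ∈ S, z.2 = z'.2 → z = z')
    (hS3 : ∀ z ∈ S, z.1 ∉ T₂ ∧ z.2 ∉ T₁) {b : ℕ} (hb : b < W) (hb' : T₂.card ≤ b) :
    T₁.card + T₂.card + S.card ≤ prof (wid W E M) A R b + b := by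
  set rk : ℕ × ℕ → Finset (ℕ × ℕ) := fun z => S.filter fun z' => z'.1 ≤ z.1
  set Sb := S.filter fun z => b < (rk z).card + T₂.card with hSb
  have hc : (S.filter fun z => ¬ b < (rk z).card + T₂.card).card + T₂.card ≤ b := by
    rcases (S.filter fun z => ¬ b < (rk z).card + T₂.card).eq_empty_or_nonempty with h0 | h0
    · rw [h0]; simpa using hb'
    · obtain ⟨z, hz, hm⟩ := Finset.exists_max_image _ (fun z => z.1) h0
      have : (S.filter fun z => ¬ b < (rk z).card + T₂.card) ⊆ rk z := fun a ha =>
        Finset.mem_filter.2 ⟨(Finset.mem_filter.1 ha).1, hm a ha⟩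
      have := Finset.card_le_card this
      have := (Finset.mem_filter.1 hz).2
      omega
  have hsplit := Finset.card_filter_add_card_filter_not (s := S)
    (fun z => b < (rk z).card + T₂.card)
  have himg : (Sb.image Prod.snd).card = Sb.card := Finset.card_image_of_injOn fun z hz z' hz' h =>
    hS2 z (Finset.mem_filter.1 hz).1 z' (Finset.mem_filter.1 hz').1 h
  have hdisj : Disjoint T₁ (Sb.image Prod.snd) := by
    rw [Finset.disjoint_right]
    intro i hi
    obtain ⟨z, hz, rfl⟩ := Finset.mem_image.1 hi
    exact (hS3 z (Finset.mem_filter.1 hz).1).2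
  have hle := card_le_prof (w := wid W E M) (A := A) (R := R) (j := b) (T₁ ∪ Sb.image Prod.snd)
    fun i hi => by
      rcases Finset.mem_union.1 hi with hi | hi
      · exact ⟨(h1 i hi).1, hb.trans_le (h1 i hi).2⟩
      · obtain ⟨z, hz, rfl⟩ := Finset.mem_image.1 hi
        have hz := Finset.mem_filter.1 hz
        obtain ⟨k1, k2, k3⟩ := hS z hz.1
        refine ⟨k1, ?_⟩
        have hsub : T₂ ∪ (rk z).image Prod.fst ⊆ miss (wid W E M) A z.2 := fun j hj => by
          rcases Finset.mem_union.1 hj with hj | hj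
          · exact mem_miss.2 ⟨(h2 j hj).1.trans_le (le_wid hE _), (h2 j hj).2 _ k1⟩
          · obtain ⟨z', hz', rfl⟩ := Finset.mem_image.1 hj
            have := (Finset.mem_filter.1 hz').2
            exact mem_miss.2 ⟨by omega, k3 _ this⟩
        have hd : Disjoint T₂ ((rk z).image Prod.fst) := by
          rw [Finset.disjoint_right]
          intro j hj
          obtain ⟨z', hz', rfl⟩ := Finset.mem_image.1 hj
          exact (hS3 z' (Finset.mem_filter.1 hz').1).1
        have := Finset.card_le_card hsub
        rw [Finset.card_union_of_disjoint hd, Finset.card_image_of_injOn (s := rk z)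
          fun a ha b hb h => hS1 a (Finset.mem_filter.1 ha).1 b (Finset.mem_filter.1 hb).1 h] at this
        have := hz.2
        omega
  rw [Finset.card_union_of_disjoint hdisj, himg] at hle
  rw [← hSb] at hsplit
  omega

lemma card_add_le_prof (hE : E < W) (hR : M + 2 * E ≤ R) {T₁ T₂ : Finset ℕ} {S : Finset (ℕ × ℕ)}
    (h1 : ∀ i ∈ T₁, i < R ∧ W ≤ (miss (wid W E M) A i).card)
    (h2 : ∀ j ∈ T₂, j < E ∧ ∀ i < R, ¬ A j i)
    (hS : ∀ z ∈ S, z.2 < R ∧ z.1 < wid W E M z.2 ∧ ∀ j ≤ z.1, ¬ A j z.2)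
    (hS1 : ∀ z ∈ S, ∀ z' ∈ S, z.1 = z'.1 → z = z') (hS2 : ∀ z ∈ S, ∀ z' ∈ S, z.2 = z'.2 → z = z')
    (hS3 : ∀ z ∈ S, z.1 ∉ T₂ ∧ z.2 ∉ T₁) :
    T₁.card + T₂.card + S.card ≤ M + 2 * E ∧ T₁.card ≤ prof (wid W E M) A R (W - 1) ∧
    T₂.card ≤ conj W (prof (wid W E M) A R) (R - 1) ∧
    ∀ b < W, T₁.card + T₂.card + S.card ≤ prof (wid W E M) A R b + b := by
  have hT2 : T₂.card ≤ E := by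
    have : T₂ ⊆ Finset.range E := fun j hj => Finset.mem_range.2 (h2 j hj).1
    simpa using Finset.card_le_card this
  have hfull : ∀ b < T₂.card, prof (wid W E M) A R b = R := fun b hb => prof_eq fun i hi => by
    have : T₂ ⊆ miss (wid W E M) A i := fun j hj =>
      mem_miss.2 ⟨(h2 j hj).1.trans_le (le_wid hE.le _), (h2 j hj).2 i hi⟩
    exact hb.trans_le (Finset.card_le_card this)
  have htot : T₁.card + T₂.card + S.card ≤ M + 2 * E := by
    have := card_add_le_prof_of_le hE.le h1 h2 hS hS1 hS2 hS3 hE hT2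
    have := prof_corner_le (W := W) (E := E) (M := M) A R
    omega
  refine ⟨htot, card_le_prof T₁ fun i hi => ⟨(h1 i hi).1, ?_⟩,
    le_conj (prof_anti _ _ _) (by omega) fun j hj => ?_, fun b hb => ?_⟩
  · have := (h1 i hi).2
    omega
  · rw [hfull j hj]; omega
  · rcases lt_or_ge b T₂.card with h | h
    · rw [hfull b h]; omega
    · exact card_add_le_prof_of_le hE.le h1 h2 hS hS1 hS2 hS3 hb h

end

lemma isStaircase_of_overlap {I : Set (ℤ × ℤ)} (hfin : I.Finite) (hne : I.Nonempty)
    (hrow : ∀ a b c y : ℤ, a ≤ b → b ≤ c → (a, y) ∈ I → (c, y) ∈ I → (b, y) ∈ I)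
    (hcol : ∀ x a b c : ℤ, a ≤ b → b ≤ c → (x, a) ∈ I → (x, c) ∈ I → (x, b) ∈ I)
    (hov : ∀ p ∈ I, ∀ q ∈ I, p.1 < q.1 → ∃ y, (p.1, y) ∈ I ∧ (p.1 + 1, y) ∈ I) :
    IsStaircase I := by
  refine ⟨hfin, ?_, hrow, hcol⟩
  have hc : ∀ x a c, a ≤ c → ∀ (ha : (x, a) ∈ I) (hc : (x, c) ∈ I),
      (grid.induce I).Reachable ⟨(x, a), ha⟩ ⟨(x, c), hc⟩ := by
    intro x a c hac ha hc
    induction c, hac using Int.leInduction with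
    | base => exact .refl _
    | succ c hac ih =>
      have hc' : (x, c) ∈ I := hcol x a c (c + 1) hac (by omega) ha hc
      exact (ih hc').trans (SimpleGraph.Adj.reachable (adj_mk (by omega)))
  have hc' : ∀ x a c, ∀ (ha : (x, a) ∈ I) (hc : (x, c) ∈ I),
      (grid.induce I).Reachable ⟨(x, a), ha⟩ ⟨(x, c), hc⟩ := by
    intro x a c ha h
    rcases le_total a c with hac | hac
    · exact hc x a c hac ha h
    · exact (hc x c a hac h ha).symm
  have key' : ∀ n : ℕ, ∀ x x' : ℤ, x' = x + n → ∀ a c, ∀ (ha : (x, a) ∈ I) (hc : (x', c) ∈ I),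
      (grid.induce I).Reachable ⟨(x, a), ha⟩ ⟨(x', c), hc⟩ := by
    intro n
    induction n with
    | zero =>
      rintro x x' e a c ha h
      obtain rfl : x' = x := by omega
      exact hc' x' a c ha h
    | succ n ih =>
      rintro x x' e a c ha h
      obtain ⟨y, h1, h2⟩ := hov _ ha _ h (by simp only; omega)
      have hadj : (grid.induce I).Adj ⟨(x, y), h1⟩ ⟨(x + 1, y), h2⟩ := adj_mk (by omega)
      exact ((hc' x a y ha h1).trans hadj.reachable).trans (ih (x + 1) x' (by push_cast at e; omega)
        y c h2 h)
  have key : ∀ x x', x ≤ x' → ∀ a c, ∀ (ha : (x, a) ∈ I) (hc : (x', c) ∈ I),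
      (grid.induce I).Reachable ⟨(x, a), ha⟩ ⟨(x', c), hc⟩ := fun x x' hx a c ha h =>
    key' (x' - x).toNat x x' (by omega) a c ha h
  have : Nonempty I := hne.to_subtype
  refine ⟨?_⟩
  rintro ⟨⟨x, a⟩, ha⟩ ⟨⟨x', c⟩, hc⟩
  rcases le_total x x' with hx | hx
  · exact key x x' hx a c ha hc
  · exact (key x' x hx c a hc ha).symm

namespace Frame

/-- Sites well inside the set described by a frame. -/
def Core (F : Frame) (E : ℕ) (x y : ℤ) : Prop :=
  (F.x0 + E ≤ x ∧ x ≤ F.x1 - E ∧ F.y0 + E ≤ y ∧ y ≤ F.y1 - E) ∧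
  (F.s1 + 2 * E ≤ x + y ∧ x + y ≤ F.s2 - 2 * E ∧ F.d1 + 2 * E ≤ x - y ∧ x - y ≤ F.d2 - 2 * E)

/-- `X₁, Y₂, X₃, Y₄` lie in the external slices, far from their ends. -/
structure Mid (F : Frame) (E : ℕ) (X₁ Y₂ X₃ Y₄ : ℤ) : Prop where
  valid : F.Valid
  pos : 4 ≤ E
  bot : F.p1 + 8 * E + 1 ≤ X₁ ∧ X₁ + 8 * E ≤ F.q1
  left : F.p2 + 8 * E + 1 ≤ Y₂ ∧ Y₂ + 8 * E ≤ F.q2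
  top : F.p3 + 8 * E + 1 ≤ X₃ ∧ X₃ + 8 * E ≤ F.q3
  right : F.p4 + 8 * E + 1 ≤ Y₄ ∧ Y₄ + 8 * E ≤ F.q4

/-- Reflection at the horizontal axis. -/
def vflip (F : Frame) : Frame := F.swap.flip.swap

lemma mem_vflip {F : Frame} {x y : ℤ} : F.vflip.Mem x y ↔ F.Mem x (-y) := by
  unfold vflip; rw [mem_swap, mem_flip, mem_swap]

section
variable {F : Frame} {E : ℕ} {X₁ Y₂ X₃ Y₄ : ℤ}

lemma Mid.swap (h : F.Mid E X₁ Y₂ X₃ Y₄) : F.swap.Mid E Y₂ X₁ Y₄ X₃ :=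
  ⟨h.valid.swap, h.pos, h.left, h.bot, h.right, h.top⟩

lemma Mid.flip (h : F.Mid E X₁ Y₂ X₃ Y₄) : F.flip.Mid E (1 - X₁) Y₄ (1 - X₃) Y₂ := by
  refine ⟨h.valid.flip, h.pos, ?_, h.right, ?_, h.left⟩
  · have := h.bot; simp only [Frame.flip]; omega
  · have := h.top; simp only [Frame.flip]; omega

lemma Mid.vflip (h : F.Mid E X₁ Y₂ X₃ Y₄) : F.vflip.Mid E X₃ (1 - Y₂) X₁ (1 - Y₄) :=
  h.swap.flip.swap

/-- Elementary consequences. -/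
lemma Mid.basic (h : F.Mid E X₁ Y₂ X₃ Y₄) :
    (F.x0 + F.y0 ≤ F.s1 ∧ F.s1 + 8 * E < X₁ + F.y0 ∧ F.s1 + 8 * E < F.x0 + Y₂) ∧
    (F.d2 ≤ F.x1 - F.y0 ∧ X₁ - F.y0 + 8 * E ≤ F.d2 ∧ F.x1 - Y₄ + 8 * E < F.d2) ∧
    (F.s2 ≤ F.x1 + F.y1 ∧ X₃ + F.y1 + 8 * E ≤ F.s2 ∧ F.x1 + Y₄ + 8 * E ≤ F.s2) ∧
    (F.x0 - F.y1 ≤ F.d1 ∧ F.d1 + 8 * E < X₃ - F.y1 ∧ F.d1 + 8 * E ≤ F.x0 - Y₂) := by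
  have a1 := h.valid.sw; have a2 := h.valid.se; have a3 := h.valid.ne; have a4 := h.valid.nw
  have b1 := h.bot; have b2 := h.left; have b3 := h.top; have b4 := h.right
  omega

lemma Core.flip {x y : ℤ} (h : F.flip.Core E x y) : F.Core E (-x) y := by
  unfold Core Frame.flip at *; simp only at h ⊢; omega

lemma Core.swap {x y : ℤ} (h : F.swap.Core E x y) : F.Core E y x := by
  unfold Core Frame.swap at *; simp only at h ⊢; omega

lemma Core.vflip {x y : ℤ} (h : F.vflip.Core E x y) : F.Core E x (-y) := h.swap.flip.swap

lemma Core.mem {x y : ℤ} (hE : 1 ≤ E) (h : F.Core E x y) : F.Mem x y := by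
  unfold Core at h
  exact ⟨by omega, by omega, by omega, by omega, by omega, by omega⟩

end

/-- Present sites near the lower left corner, in local coordinates. -/
def loc (F : Frame) (P : ℤ → ℤ → Prop) (j i : ℕ) : Prop :=
  P (F.x0 + j) (F.y0 + i) ∧ F.Mem (F.x0 + j) (F.y0 + i)

/-- Row widths near the lower left corner. -/
def wd (F : Frame) (E : ℕ) (X : ℤ) (i : ℕ) : ℕ :=
  wid (X - F.x0).toNat E (F.s1 - F.x0 - F.y0).toNat i

/-- The profile of the set to be removed at the lower left corner. -/
noncomputable def cut (F : Frame) (E : ℕ) (X Y : ℤ) (P : ℤ → ℤ → Prop) (j : ℕ) : ℕ :=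
  prof (F.wd E X) (F.loc P) (Y - F.y0).toNat j

end Frame

/-- Lower left notches of a lattice set. -/
def Notch (P : ℤ → ℤ → Prop) (x y : ℤ) : Prop :=
  P (x + 1) y ∧ P x (y + 1) ∧ (∀ x' ≤ x, ¬ P x' y) ∧ ∀ y' ≤ y, ¬ P x y'

/-- Reflection of a lattice set at the horizontal axis. -/
def vf (P : ℤ → ℤ → Prop) : ℤ → ℤ → Prop := fun x y => P x (-y)

/-- Reflection of a lattice set at the vertical axis. -/
def hf (P : ℤ → ℤ → Prop) : ℤ → ℤ → Prop := fun x y => P (-x) y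

lemma vf_vf (P : ℤ → ℤ → Prop) : vf (vf P) = P := by
  funext x y; simp [vf]

section
variable {P : ℤ → ℤ → Prop} {x x' y y' : ℤ}

lemma Notch.eq_of_row (h : Notch P x y) (h' : Notch P x' y) : x = x' := by
  by_contra hn
  rcases lt_or_gt_of_ne hn with hl | hl
  · exact h'.2.2.1 _ (by omega) h.1
  · exact h.2.2.1 _ (by omega) h'.1

lemma Notch.eq_of_col (h : Notch P x y) (h' : Notch P x y') : y = y' := by
  by_contra hn
  rcases lt_or_gt_of_ne hn with hl | hl
  · exact h'.2.2.2 _ (by omega) h.2.1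
  · exact h.2.2.2 _ (by omega) h'.2.1

lemma Notch.row_ne (h : Notch P x y) (h' : Notch (vf P) x' (-y')) : y ≠ y' := by
  rintro rfl
  have h1 := h'.1
  have h3 := h'.2.2.1
  simp only [vf, neg_neg] at h1 h3
  have e : x = x' := by
    by_contra hn
    rcases lt_or_gt_of_ne hn with hl | hl
    · exact h3 _ (by omega) h.1
    · exact h.2.2.1 _ (by omega) h1
  subst e
  have := h'.2.2.2 (-(y + 1)) (by omega)
  simp only [vf, neg_neg] at this
  exact this h.2.1

end

namespace Frame
section
variable {F : Frame} {E : ℕ} {X₁ Y₂ X₃ Y₄ : ℤ} {P : ℤ → ℤ → Prop}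

lemma Mid.core_wd (h : F.Mid E X₁ Y₂ X₃ Y₄) {i : ℕ} (hi : E ≤ i) (hi' : F.y0 + i < Y₂) :
    F.Core E (F.x0 + F.wd E X₁ i) (F.y0 + i) := by
  have b := h.basic
  have e := h.pos
  have v := h.valid.fat
  have r := h.right; have bo := h.bot
  have vs := h.valid.se; have vn := h.valid.ne
  unfold Core wd wid
  rw [if_neg (by omega)]
  push_cast
  omega

lemma Mid.wd_le (h : F.Mid E X₁ Y₂ X₃ Y₄) (i : ℕ) : F.x0 + F.wd E X₁ i ≤ X₁ := by
  have b := h.basic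
  have := wid_le (W := (X₁ - F.x0).toNat) (E := E) (M := (F.s1 - F.x0 - F.y0).toNat)
    (by omega) (by omega) i
  unfold wd
  omega

/-- Notches lie in rows or columns near the corner. -/
lemma Mid.notch_cases (h : F.Mid E X₁ Y₂ X₃ Y₄) (hP : ∀ x y, F.Core E x y → P x y) {x y : ℤ}
    (hn : Notch P x y) (hy : y ≤ F.y1) :
    y < Y₂ ∨ x < F.x0 + E ∨ (Y₂ ≤ y ∧ X₃ ≤ x) := by
  by_contra! hc
  obtain ⟨h1, h2, h3⟩ := hc
  have h3 := h3 h1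
  have b := h.basic
  have e := h.pos
  have v := h.valid.fat
  have r := h.right; have l := h.left; have bo := h.bot; have t := h.top
  have vs := h.valid.se; have vn := h.valid.ne; have vw := h.valid.nw
  have hc1 : ∀ y' ≤ y, ¬ F.Core E x y' := fun y' hy hc => hn.2.2.2 y' hy (hP _ _ hc)
  have hr1 : ∀ x' ≤ x, ¬ F.Core E x' y := fun x' hx hc => hn.2.2.1 x' hx (hP _ _ hc)
  by_cases k : max (F.y0 + E) (x - F.d2 + 2 * E) ≤ y
  · by_cases k2 : F.s1 + 2 * E - x ≤ max (F.y0 + E) (x - F.d2 + 2 * E)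
    · refine hc1 _ k ?_
      unfold Core; omega
    · refine hc1 (F.s1 + 2 * E - x) (by omega) ?_
      unfold Core; omega
  · refine hr1 (max (F.x0 + E) (max (F.s1 + 2 * E - y) (F.d1 + 2 * E + y))) (by omega) ?_
    unfold Core; omega

end
section
variable {F : Frame} {E : ℕ} {X₁ Y₂ X₃ Y₄ : ℤ} {P : ℤ → ℤ → Prop}

/-- A row without sites on the left of the middle is full. -/
lemma Mid.row_full (h : F.Mid E X₁ Y₂ X₃ Y₄) (hP : ∀ x y, F.Core E x y → P x y) {i : ℕ}
    (hi : F.y0 + i < Y₂) (hr : ∀ x < F.x0 + F.wd E X₁ i + 1, ¬ P x (F.y0 + i)) :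
    i < E ∧ (X₁ - F.x0).toNat ≤ (Surfactant.miss (F.wd E X₁) (F.loc P) i).card := by
  have hiE : i < E := by
    by_contra! hc
    exact hr _ (by omega) (hP _ _ (h.core_wd hc hi))
  refine ⟨hiE, ?_⟩
  have hw : F.wd E X₁ i = (X₁ - F.x0).toNat := by unfold wd wid; rw [if_pos hiE]
  have : Finset.range (X₁ - F.x0).toNat ⊆ Surfactant.miss (F.wd E X₁) (F.loc P) i := fun j hj => by
    rw [Finset.mem_range, ← hw] at hj
    exact mem_miss.2 ⟨hj, fun hl => hr _ (by omega) hl.1⟩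
  simpa using Finset.card_le_card this

lemma Mid.corner (h : F.Mid E X₁ Y₂ X₃ Y₄) (hP : ∀ x y, F.Core E x y → P x y)
    {T₁ T₂ : Finset ℕ} {N C : Finset (ℤ × ℤ)}
    (h1 : ∀ i ∈ T₁, i < E ∧ ∀ x, ¬ P x (F.y0 + i)) (h2 : ∀ j ∈ T₂, j < E ∧ ∀ y, ¬ P (F.x0 + j) y)
    (hN : ∀ z ∈ N, Notch P z.1 z.2 ∧ F.x0 ≤ z.1 ∧ F.y0 ≤ z.2 ∧ (z.2 < Y₂ ∨ z.1 < F.x0 + E))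
    (hC : ∀ z ∈ C, Notch (vf P) z.1 (-z.2) ∧ F.y0 ≤ z.2 ∧ z.2 < Y₂ ∧ X₁ ≤ z.1) :
    T₁.card + T₂.card + N.card + C.card ≤ (F.s1 - F.x0 - F.y0).toNat + 2 * E ∧
    T₁.card ≤ F.cut E X₁ Y₂ P ((X₁ - F.x0).toNat - 1) ∧
    T₂.card ≤ conj (X₁ - F.x0).toNat (F.cut E X₁ Y₂ P) ((Y₂ - F.y0).toNat - 1) ∧
    ∀ b < (X₁ - F.x0).toNat, T₁.card + T₂.card + N.card + C.card ≤ F.cut E X₁ Y₂ P b + b := by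
  classical
  have hb := h.basic
  have hE := h.pos
  have hwle := h.wd_le
  set a : ℤ → ℕ := fun x => (x - F.x0).toNat with ha
  set r : ℤ → ℕ := fun y => (y - F.y0).toNat with hr
  have hxa : ∀ x, F.x0 ≤ x → F.x0 + (a x : ℤ) = x := fun x hx => by simp only [ha]; omega
  have hyr : ∀ y, F.y0 ≤ y → F.y0 + (r y : ℤ) = y := fun y hy => by simp only [hr]; omega
  have hainj : ∀ x x', F.x0 ≤ x → F.x0 ≤ x' → a x = a x' → x = x' := fun x x' h1 h2 h3 => by
    have := hxa x h1; have := hxa x' h2; omega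
  have hrinj : ∀ x x', F.y0 ≤ x → F.y0 ≤ x' → r x = r x' → x = x' := fun x x' h1 h2 h3 => by
    have := hyr x h1; have := hyr x' h2; omega
  set NB := N.filter fun z => ¬ z.2 < Y₂
  set NA := N.filter fun z => z.2 < Y₂
  set Nf := NA.filter fun z => ¬ z.1 < F.x0 + F.wd E X₁ (r z.2)
  set Ns := NA.filter fun z => z.1 < F.x0 + F.wd E X₁ (r z.2)
  have c1 : NA.card + NB.card = N.card := Finset.card_filter_add_card_filter_not _
  have c2 : Ns.card + Nf.card = NA.card := Finset.card_filter_add_card_filter_not _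
  have mA : ∀ z ∈ NA, z ∈ N ∧ z.2 < Y₂ := fun z hz => Finset.mem_filter.1 hz
  have mB : ∀ z ∈ NB, z ∈ N ∧ ¬ z.2 < Y₂ := fun z hz => Finset.mem_filter.1 hz
  have mf : ∀ z ∈ Nf, z ∈ N ∧ z.2 < Y₂ ∧ ¬ z.1 < F.x0 + F.wd E X₁ (r z.2) := fun z hz =>
    ⟨(mA z (Finset.mem_filter.1 hz).1).1, (mA z (Finset.mem_filter.1 hz).1).2,
      (Finset.mem_filter.1 hz).2⟩
  have ms : ∀ z ∈ Ns, z ∈ N ∧ z.2 < Y₂ ∧ z.1 < F.x0 + F.wd E X₁ (r z.2) := fun z hz =>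
    ⟨(mA z (Finset.mem_filter.1 hz).1).1, (mA z (Finset.mem_filter.1 hz).1).2,
      (Finset.mem_filter.1 hz).2⟩
  have hNrow : ∀ z ∈ N, ∀ z' ∈ N, r z.2 = r z'.2 → z = z' := fun z hz z' hz' e => by
    have e2 := hrinj _ _ (hN z hz).2.2.1 (hN z' hz').2.2.1 e
    have n1 := (hN z hz).1
    have n2 := (hN z' hz').1
    rw [← e2] at n2
    exact Prod.ext (n1.eq_of_row n2) e2
  have hNcol : ∀ z ∈ N, ∀ z' ∈ N, a z.1 = a z'.1 → z = z' := fun z hz z' hz' e => by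
    have e2 := hainj _ _ (hN z hz).2.1 (hN z' hz').2.1 e
    have n1 := (hN z hz).1
    have n2 := (hN z' hz').1
    rw [← e2] at n2
    exact Prod.ext e2 (n1.eq_of_col n2)
  have hCrow : ∀ z ∈ C, ∀ z' ∈ C, r z.2 = r z'.2 → z = z' := fun z hz z' hz' e => by
    have e2 := hrinj _ _ (hC z hz).2.1 (hC z' hz').2.1 e
    have n1 := (hC z hz).1
    have n2 := (hC z' hz').1
    rw [← e2] at n2
    exact Prod.ext (n1.eq_of_row n2) e2
  have hT1 : ∀ z ∈ N, r z.2 ∉ T₁ := fun z hz hT => by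
    refine (h1 _ hT).2 (z.1 + 1) ?_
    rw [hyr _ (hN z hz).2.2.1]
    exact (hN z hz).1.1
  have hT1' : ∀ z ∈ C, r z.2 ∉ T₁ := fun z hz hT => by
    refine (h1 _ hT).2 (z.1 + 1) ?_
    rw [hyr _ (hC z hz).2.1]
    simpa [vf] using (hC z hz).1.1
  have hT2 : ∀ z ∈ N, a z.1 ∉ T₂ := fun z hz hT => by
    refine (h2 _ hT).2 (z.2 + 1) ?_
    rw [hxa _ (hN z hz).2.1]
    exact (hN z hz).1.2.1
  have hNC : ∀ z ∈ N, ∀ z' ∈ C, r z.2 ≠ r z'.2 := fun z hz z' hz' e =>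
    (hN z hz).1.row_ne (hC z' hz').1 (hrinj _ _ (hN z hz).2.2.1 (hC z' hz').2.1 e)
  set U := Nf.image (fun z => r z.2) ∪ C.image (fun z => r z.2) with hU
  have cU : U.card = Nf.card + C.card := by
    rw [hU, Finset.card_union_of_disjoint, Finset.card_image_of_injOn, Finset.card_image_of_injOn]
    · exact fun z hz z' hz' e => hCrow z hz z' hz' e
    · exact fun z hz z' hz' e => hNrow z (mf z hz).1 z' (mf z' hz').1 e
    · rw [Finset.disjoint_left]
      intro i hi hi'
      obtain ⟨z, hz, rfl⟩ := Finset.mem_image.1 hi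
      obtain ⟨z', hz', e⟩ := Finset.mem_image.1 hi'
      exact hNC z (mf z hz).1 z' hz' e.symm
  have cT1 : (T₁ ∪ U).card = T₁.card + U.card := by
    apply Finset.card_union_of_disjoint
    rw [Finset.disjoint_right]
    intro i hi
    rcases Finset.mem_union.1 hi with hi | hi <;> obtain ⟨z, hz, rfl⟩ := Finset.mem_image.1 hi
    · exact hT1 z (mf z hz).1
    · exact hT1' z hz
  have cT2 : (T₂ ∪ NB.image fun z => a z.1).card = T₂.card + NB.card := by
    rw [Finset.card_union_of_disjoint, Finset.card_image_of_injOn]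
    · exact fun z hz z' hz' e => hNcol z (mB z hz).1 z' (mB z' hz').1 e
    · rw [Finset.disjoint_right]
      intro i hi
      obtain ⟨z, hz, rfl⟩ := Finset.mem_image.1 hi
      exact hT2 z (mB z hz).1
  have cS : (Ns.image fun z => (a z.1, r z.2)).card = Ns.card := by
    apply Finset.card_image_of_injOn
    exact fun z hz z' hz' e => hNcol z (ms z hz).1 z' (ms z' hz').1 (Prod.ext_iff.1 e).1
  have key := card_add_le_prof (W := (X₁ - F.x0).toNat) (E := E)
    (M := (F.s1 - F.x0 - F.y0).toNat) (R := (Y₂ - F.y0).toNat) (A := F.loc P) (by omega) (by omega)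
    (T₁ := T₁ ∪ U) (T₂ := T₂ ∪ NB.image fun z => a z.1)
    (S := Ns.image fun z => (a z.1, r z.2)) ?_ ?_ ?_ ?_ ?_ ?_
  · rw [cT1, cT2, cS, cU] at key
    obtain ⟨k1, k2, k3, k4⟩ := key
    refine ⟨by omega, le_trans (by omega) k2, le_trans (by omega) k3, fun b hb => ?_⟩
    have := k4 b hb
    change _ ≤ F.cut E X₁ Y₂ P b + b at this
    omega
  · intro i hi
    have : F.y0 + i < Y₂ ∧ ∀ x < F.x0 + F.wd E X₁ i + 1, ¬ P x (F.y0 + i) := by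
      rcases Finset.mem_union.1 hi with hi | hi
      · exact ⟨by have := (h1 i hi).1; omega, fun x _ => (h1 i hi).2 x⟩
      · rcases Finset.mem_union.1 hi with hi | hi <;> obtain ⟨z, hz, rfl⟩ := Finset.mem_image.1 hi
        · obtain ⟨k1, k2, k3⟩ := mf z hz
          rw [hyr _ (hN z k1).2.2.1]
          exact ⟨k2, fun x hx => (hN z k1).1.2.2.1 x (by omega)⟩
        · rw [hyr _ (hC z hz).2.1]
          refine ⟨(hC z hz).2.2.1, fun x hx => ?_⟩
          have := (hC z hz).1.2.2.1 x (by have := hwle (r z.2); have := (hC z hz).2.2.2; omega)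
          simpa [vf] using this
    have h3 := h.row_full hP this.1 this.2
    exact ⟨by omega, h3.2⟩
  · intro j hj
    rcases Finset.mem_union.1 hj with hj | hj
    · exact ⟨(h2 j hj).1, fun i _ hl => (h2 j hj).2 _ hl.1⟩
    · obtain ⟨z, hz, rfl⟩ := Finset.mem_image.1 hj
      obtain ⟨k1, k2⟩ := mB z hz
      obtain ⟨n1, n2, n3, n4⟩ := hN z k1
      refine ⟨by have := hxa _ n2; omega, fun i hi hl => n1.2.2.2 (F.y0 + i) (by omega) ?_⟩
      have := hl.1
      rwa [hxa _ n2] at this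
  · intro z' hz'
    obtain ⟨z, hz, rfl⟩ := Finset.mem_image.1 hz'
    obtain ⟨k1, k2, k3⟩ := ms z hz
    obtain ⟨n1, n2, n3, n4⟩ := hN z k1
    have e1 := hxa _ n2
    have e2 := hyr _ n3
    refine ⟨by omega, ?_, fun j hj hl => n1.2.2.1 (F.x0 + j) (by simp only at hj; omega) ?_⟩
    · change a z.1 < F.wd E X₁ (r z.2); omega
    · have := hl.1
      simp only at this
      rwa [e2] at this
  · intro z₁ hz₁ z₂ hz₂ e
    obtain ⟨z, hz, rfl⟩ := Finset.mem_image.1 hz₁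
    obtain ⟨z', hz', rfl⟩ := Finset.mem_image.1 hz₂
    rw [hNcol z (ms z hz).1 z' (ms z' hz').1 e]
  · intro z₁ hz₁ z₂ hz₂ e
    obtain ⟨z, hz, rfl⟩ := Finset.mem_image.1 hz₁
    obtain ⟨z', hz', rfl⟩ := Finset.mem_image.1 hz₂
    rw [hNrow z (ms z hz).1 z' (ms z' hz').1 e]
  · intro z₁ hz₁
    obtain ⟨z, hz, rfl⟩ := Finset.mem_image.1 hz₁
    obtain ⟨k1, k2, k3⟩ := ms z hz
    simp only [Finset.mem_union, not_or, hU, Finset.mem_image, not_exists, not_and]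
    refine ⟨⟨hT2 z k1, fun z' hz' e => ?_⟩, hT1 z k1, fun z' hz' e => ?_, fun z' hz' e => ?_⟩
    · have := hNcol z' (mB z' hz').1 z k1 e
      rw [this] at hz'
      exact (mB z hz').2 k2
    · have := hNrow z' (mf z' hz').1 z k1 e
      rw [this] at hz'
      exact (mf z hz').2.2 k3
    · exact hNC z k1 z' hz' e.symm

end

open Classical in
/-- Rows near the bottom without sites. -/
noncomputable def emptyRows (F : Frame) (E : ℕ) (P : ℤ → ℤ → Prop) : Finset ℕ :=
  (Finset.range E).filter fun i => ∀ x, ¬ P x (F.y0 + i)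

open Classical in
/-- Columns near the left side without sites. -/
noncomputable def emptyCols (F : Frame) (E : ℕ) (P : ℤ → ℤ → Prop) : Finset ℕ :=
  (Finset.range E).filter fun j => ∀ y, ¬ P (F.x0 + j) y

lemma mem_emptyRows {F : Frame} {E : ℕ} {P : ℤ → ℤ → Prop} {i : ℕ} :
    i ∈ F.emptyRows E P ↔ i < E ∧ ∀ x, ¬ P x (F.y0 + i) := by
  classical
  unfold emptyRows
  rw [Finset.mem_filter, Finset.mem_range]

lemma mem_emptyCols {F : Frame} {E : ℕ} {P : ℤ → ℤ → Prop} {j : ℕ} :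
    j ∈ F.emptyCols E P ↔ j < E ∧ ∀ y, ¬ P (F.x0 + j) y := by
  classical
  unfold emptyCols
  rw [Finset.mem_filter, Finset.mem_range]

lemma emptyRows_flip (F : Frame) (E : ℕ) (P : ℤ → ℤ → Prop) :
    F.flip.emptyRows E (hf P) = F.emptyRows E P := by
  ext i
  rw [mem_emptyRows, mem_emptyRows]
  exact and_congr_right fun _ => ⟨fun h x => by simpa [hf, Frame.flip] using h (-x), fun h x => h (-x)⟩

lemma emptyCols_vflip (F : Frame) (E : ℕ) (P : ℤ → ℤ → Prop) :
    F.vflip.emptyCols E (vf P) = F.emptyCols E P := by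
  ext i
  rw [mem_emptyCols, mem_emptyCols]
  exact and_congr_right fun _ => ⟨fun h x => by
    simpa [vf, Frame.flip, Frame.swap, Frame.vflip] using h (-x), fun h x => h (-x)⟩

/-- Empty rows and columns and notches near the lower left corner fit into its profile. -/
def Fits (F : Frame) (E : ℕ) (X Y : ℤ) (P : ℤ → ℤ → Prop) (t₁ t₂ m : ℕ) : Prop :=
  t₁ + t₂ + m ≤ (F.s1 - F.x0 - F.y0).toNat + 2 * E ∧
  t₁ ≤ F.cut E X Y P ((X - F.x0).toNat - 1) ∧
  t₂ ≤ conj (X - F.x0).toNat (F.cut E X Y P) ((Y - F.y0).toNat - 1) ∧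
  ∀ b < (X - F.x0).toNat, t₁ + t₂ + m ≤ F.cut E X Y P b + b

section
variable {F : Frame} {E : ℕ} {X₁ Y₂ X₃ Y₄ : ℤ} {P : ℤ → ℤ → Prop}

lemma Mid.fits_left (h : F.Mid E X₁ Y₂ X₃ Y₄) (hP : ∀ x y, F.Core E x y → P x y)
    {N N' : Finset (ℤ × ℤ)}
    (hN : ∀ z ∈ N, Notch P z.1 z.2 ∧ F.x0 ≤ z.1 ∧ F.y0 ≤ z.2 ∧ z.2 ≤ F.y1)
    (hN' : ∀ z ∈ N', Notch (vf P) z.1 (-z.2) ∧ F.x0 ≤ z.1 ∧ F.y0 ≤ z.2 ∧ z.2 ≤ F.y1) :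
    ∃ m m' : ℕ, N.card + N'.card = m + m' ∧
      F.Fits E X₁ Y₂ P (F.emptyRows E P).card (F.emptyCols E P).card m ∧
      F.vflip.Fits E X₃ (1 - Y₂) (vf P) (F.vflip.emptyRows E (vf P)).card
        (F.emptyCols E P).card m' := by
  have hinj : Function.Injective fun z : ℤ × ℤ => (z.1, -z.2) := fun a b e => by
    simp only [Prod.mk.injEq, neg_inj] at e; exact Prod.ext e.1 e.2
  have hPv : ∀ x y, F.vflip.Core E x y → vf P x y := fun x y hc => hP _ _ hc.vflip
  have ey0 : F.vflip.y0 = -F.y1 := rfl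
  have ey1 : F.vflip.y1 = -F.y0 := rfl
  have ex0 : F.vflip.x0 = F.x0 := rfl
  set NA := N.filter fun z => z.2 < Y₂ ∨ z.1 < F.x0 + E
  set NC := N.filter fun z => ¬ (z.2 < Y₂ ∨ z.1 < F.x0 + E)
  set NA' := N'.filter fun z => Y₂ ≤ z.2 ∨ z.1 < F.x0 + E with hNA'
  set NC' := N'.filter fun z => ¬ (Y₂ ≤ z.2 ∨ z.1 < F.x0 + E) with hNC'
  have c : NA.card + NC.card = N.card := Finset.card_filter_add_card_filter_not _
  have c' : NA'.card + NC'.card = N'.card := Finset.card_filter_add_card_filter_not _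
  refine ⟨NA.card + NC'.card, NA'.card + NC.card, by omega, ?_, ?_⟩
  · have := h.corner hP (T₁ := F.emptyRows E P) (T₂ := F.emptyCols E P) (N := NA) (C := NC')
      (fun i hi => mem_emptyRows.1 hi) (fun j hj => mem_emptyCols.1 hj)
      (fun z hz => by
        obtain ⟨h1, h2⟩ := Finset.mem_filter.1 hz
        exact ⟨(hN z h1).1, (hN z h1).2.1, (hN z h1).2.2.1, h2⟩)
      (fun z hz => by
        obtain ⟨h1, h2⟩ := Finset.mem_filter.1 hz
        have h3 := hN' z h1
        have := h.vflip.notch_cases hPv h3.1 (by rw [ey1]; omega)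
        rw [ex0] at this
        exact ⟨h3.1, h3.2.2.1, by omega, by omega⟩)
    unfold Fits
    rw [← add_assoc]
    exact this
  · have := h.vflip.corner hPv (T₁ := F.vflip.emptyRows E (vf P)) (T₂ := F.emptyCols E P)
      (N := NA'.image fun z => (z.1, -z.2)) (C := NC.image fun z => (z.1, -z.2))
      (fun i hi => mem_emptyRows.1 hi)
      (fun j hj => by rw [← emptyCols_vflip] at hj; exact mem_emptyCols.1 hj)
      (fun z' hz' => by
        obtain ⟨z, hz, rfl⟩ := Finset.mem_image.1 hz'
        obtain ⟨h1, h2⟩ := Finset.mem_filter.1 hz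
        have h3 := hN' z h1
        exact ⟨h3.1, h3.2.1, by rw [ey0]; simp only; omega, by rw [ex0]; simp only; omega⟩)
      (fun z' hz' => by
        obtain ⟨z, hz, rfl⟩ := Finset.mem_image.1 hz'
        obtain ⟨h1, h2⟩ := Finset.mem_filter.1 hz
        have h3 := hN z h1
        have := h.notch_cases hP h3.1 (by omega)
        refine ⟨by rw [vf_vf, neg_neg]; exact h3.1, ?_, ?_, ?_⟩
        · rw [ey0]; simp only; omega
        · simp only; omega
        · simp only; omega)
    rw [Finset.card_image_of_injective _ hinj, Finset.card_image_of_injective _ hinj] at this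
    unfold Fits
    rw [← add_assoc]
    exact this

/-- The properties of the profile of a corner. -/
structure Corner (F : Frame) (E W R τ₁ τ₂ tot : ℕ) (h : ℕ → ℕ) : Prop where
  anti : Antitone h
  le_R : ∀ j, h j ≤ R
  last : τ₁ ≤ h (W - 1) ∧ τ₁ ≤ E
  last' : τ₂ ≤ conj W h (R - 1) ∧ τ₂ ≤ E
  tot_le : (tot : ℤ) ≤ F.s1 - F.x0 - F.y0 + 2 * E
  le_h : ∀ j < W, tot ≤ h j + j
  sum_h : F.s1 - F.x0 - F.y0 ≤ h τ₂ + τ₂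
  sum_conj : F.s1 - F.x0 - F.y0 ≤ conj W h τ₁ + τ₁
  tot_conj : tot ≤ conj W h τ₁ + τ₁
  h_ge : τ₁ ≤ h τ₂
  conj_ge : τ₂ ≤ conj W h τ₁
  iff : conj W h τ₁ = τ₂ ↔ h τ₂ = τ₁
  bot : τ₁ = 0 → F.p1 - F.x0 ≤ conj W h τ₁
  left : τ₂ = 0 → F.p2 - F.y0 ≤ h τ₂
  lt_W : τ₁ = h (W - 1) → conj W h τ₁ < W
  lt_R : τ₂ = conj W h (R - 1) → h τ₂ < R

lemma loc_of_lt {i j : ℕ} (h : i + j < (F.s1 - F.x0 - F.y0).toNat) : ¬ F.loc P j i := fun hl => by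
  have := hl.2.2.1
  omega

lemma Mid.cornerData (h : F.Mid E X₁ Y₂ X₃ Y₄) {t₁ t₂ m τ₁ τ₂ : ℕ}
    (hfit : F.Fits E X₁ Y₂ P t₁ t₂ m)
    (h1 : τ₁ ≤ F.cut E X₁ Y₂ P ((X₁ - F.x0).toNat - 1))
    (h2 : τ₂ ≤ conj (X₁ - F.x0).toNat (F.cut E X₁ Y₂ P) ((Y₂ - F.y0).toNat - 1)) :
    F.Corner E (X₁ - F.x0).toNat (Y₂ - F.y0).toNat τ₁ τ₂ (t₁ + t₂ + m) (F.cut E X₁ Y₂ P) := by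
  have hb := h.basic
  have hE := h.pos
  have hbo := h.bot
  have hle := h.left
  have hsw := h.valid.sw
  set W := (X₁ - F.x0).toNat
  set R := (Y₂ - F.y0).toNat
  set M := (F.s1 - F.x0 - F.y0).toNat
  set c := F.cut E X₁ Y₂ P
  have anti : Antitone c := prof_anti _ _ _
  have le_R : ∀ j, c j ≤ R := prof_le _ _ _
  have l1 : c (W - 1) ≤ E := prof_last_le (F.loc P) R (by omega) (by omega)
  have l2 : conj W c (R - 1) ≤ E := conj_last_le (F.loc P) (by omega) (by omega)
  have hMh : ∀ j, M ≤ c j + j := le_prof_add (fun i j hij => loc_of_lt hij) (by omega) (by omega)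
  obtain ⟨f1, f2, f3, f4⟩ := hfit
  have hsumc : ∀ n ≤ W, (∀ j < W, n ≤ c j + j) → n ≤ conj W c τ₁ + τ₁ := by
    intro n hn hj
    have := le_conj anti (W := W) (i := τ₁) (n := n - τ₁) (by omega) fun j hj' => by
      have := hj j (by omega); omega
    omega
  have hge : τ₁ ≤ c τ₂ := h1.trans (anti (by omega))
  have hcge : τ₂ ≤ conj W c τ₁ := le_conj anti (by omega) fun j hj => by
    have := ((lt_conj anti).1 (hj.trans_le h2)).2
    omega
  refine ⟨anti, le_R, ⟨h1, h1.trans l1⟩, ⟨h2, h2.trans l2⟩, by omega, f4, ?_, ?_, ?_, hge, hcge,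
    ?_, fun h0 => ?_, fun h0 => ?_, fun h0 => ?_, fun h0 => ?_⟩
  · have := hMh τ₂; omega
  · have := hsumc M (by omega) fun j _ => hMh j
    omega
  · exact hsumc _ (by omega) f4
  · have := lt_conj anti (W := W) (i := τ₁) (j := τ₂)
    constructor <;> intro e
    · by_contra hne
      have := this.2 ⟨by omega, by omega⟩
      omega
    · by_contra hne
      have := this.1 (by omega)
      omega
  · have := le_conj anti (W := W) (i := τ₁) (n := (F.p1 - F.x0).toNat) (by omega) fun j hj => by
      have := card_le_prof (w := F.wd E X₁) (A := F.loc P) (R := R) (j := j) {0} fun i hi => by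
        rw [Finset.mem_singleton] at hi
        subst hi
        refine ⟨by omega, ?_⟩
        have hw : F.wd E X₁ 0 = W := by unfold wd wid; rw [if_pos (by omega)]
        have : Finset.range (j + 1) ⊆ Surfactant.miss (F.wd E X₁) (F.loc P) 0 := fun a ha => by
          rw [Finset.mem_range] at ha
          refine mem_miss.2 ⟨by omega, fun hl => ?_⟩
          have := hl.2.2.2.1 (by simp)
          omega
        have := Finset.card_le_card this
        rw [Finset.card_range] at this
        omega
      rw [Finset.card_singleton] at this
      rw [h0]; exact this
    omega
  · have := card_le_prof (w := F.wd E X₁) (A := F.loc P) (R := R) (j := 0)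
      (Finset.range (F.p2 - F.y0).toNat) fun i hi => by
        rw [Finset.mem_range] at hi
        refine ⟨by omega, Finset.card_pos.2 ⟨0, mem_miss.2 ⟨?_, fun hl => ?_⟩⟩⟩
        · have := le_wid (W := W) (E := E) (M := M) (by omega) i
          change 0 < wid W E M i
          omega
        · have := hl.2.2.2.2.1 (by simp)
          omega
    rw [Finset.card_range] at this
    change _ ≤ c 0 at this
    rw [h0]
    omega
  · by_contra hn
    have := (lt_conj anti (W := W) (i := τ₁) (j := W - 1)).1 (by omega)
    omega
  · by_contra hn
    have := (lt_conj anti (W := W) (i := R - 1) (j := τ₂)).2 ⟨by omega, by omega⟩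
    omega

end
end Frame

lemma dep_congr {J J' : Finset (ℤ × ℤ)} (e : ℤ × ℤ ≃ ℤ × ℤ)
    (hd : ∀ p q, dist1 (e p) (e q) = dist1 p q) (hm : ∀ p, e p ∈ J' ↔ p ∈ J) (p : ℤ × ℤ) :
    dep J' (e p) = dep J p := by
  unfold dep
  congr 1
  ext n
  constructor
  · rintro ⟨q, h1, h2⟩
    refine ⟨e.symm q, ?_, ?_⟩
    · rw [← hm, ← hm, Equiv.apply_symm_apply]; exact h1
    · rw [← hd, Equiv.apply_symm_apply]; exact h2
  · rintro ⟨q, h1, h2⟩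
    exact ⟨e q, by rw [hm, hm]; exact h1, by rw [hd]; exact h2⟩

lemma dist1_cast (x y c d : ℤ) : (dist1 (x, y) (c, d) : ℤ) = |x - c| + |y - d| := by
  unfold dist1; push_cast; rfl

/-- Reflection at the vertical axis. -/
def negFst : ℤ × ℤ ≃ ℤ × ℤ := (Equiv.neg ℤ).prodCongr (Equiv.refl ℤ)

@[simp] lemma negFst_apply (x y : ℤ) : negFst (x, y) = (-x, y) := rfl

/-- Reflection at the horizontal axis. -/
def negSnd : ℤ × ℤ ≃ ℤ × ℤ := (Equiv.refl ℤ).prodCongr (Equiv.neg ℤ)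

@[simp] lemma negSnd_apply (x y : ℤ) : negSnd (x, y) = (x, -y) := rfl

namespace Frame

/-- The depth, as a weight on the set. -/
noncomputable def wt (F : Frame) (p : ℤ × ℤ) : ℕ := if F.Mem p.1 p.2 then dep F.fin p else 0

lemma wt_swap (F : Frame) (x y : ℤ) : F.swap.wt (x, y) = F.wt (y, x) := by
  unfold wt
  have := dep_congr (J := F.fin) (J' := F.swap.fin) (Equiv.prodComm ℤ ℤ)
    (fun p q => by simp only [Equiv.prodComm_apply, dist1, Prod.fst_swap, Prod.snd_swap]; omega)
    (fun p => by
      rw [mem_fin, mem_fin, mem_swap]; rfl) (y, x)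
  simp only [Equiv.prodComm_apply, Prod.swap_prod_mk] at this
  simp only [mem_swap, this]

lemma wt_flip (F : Frame) (x y : ℤ) : F.flip.wt (x, y) = F.wt (-x, y) := by
  unfold wt
  have := dep_congr (J := F.fin) (J' := F.flip.fin) negFst
    (fun p q => by
      obtain ⟨a, b⟩ := p; obtain ⟨c, d⟩ := q
      simp only [negFst_apply, dist1]; omega)
    (fun p => by
      obtain ⟨a, b⟩ := p
      rw [negFst_apply, mem_fin, mem_fin, mem_flip, neg_neg]) (-x, y)
  rw [negFst_apply, neg_neg] at this
  simp only [mem_flip, this]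

lemma wt_vflip (F : Frame) (x y : ℤ) : F.vflip.wt (x, y) = F.wt (x, -y) := by
  unfold vflip; rw [wt_swap, wt_flip, wt_swap]

/-- A neighbourhood of the lower left part of the boundary. -/
def Reg (F : Frame) (E : ℕ) (X Y x y : ℤ) : Prop :=
  x < X ∧ y < Y ∧ (x < F.x0 + E ∨ y < F.y0 + E ∨ x + y < F.s1 + 2 * E)

section
variable {F : Frame} {E : ℕ} {X₁ Y₂ X₃ Y₄ : ℤ} {P : ℤ → ℤ → Prop}

lemma Reg.mono {x x' y y' : ℤ} (h : F.Reg E X₁ Y₂ x' y') (hx : x ≤ x') (hy : y ≤ y') :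
    F.Reg E X₁ Y₂ x y := by
  unfold Reg at *; omega

lemma Reg.of_wd {i j : ℕ} (hi : F.y0 + i < Y₂) (hj : j < F.wd E X₁ i)
    (hw : F.x0 + F.wd E X₁ i ≤ X₁) (hs : F.x0 + F.y0 ≤ F.s1) :
    F.Reg E X₁ Y₂ (F.x0 + j) (F.y0 + i) := by
  unfold Reg
  unfold wd wid at *
  split_ifs at * <;> omega

lemma Mid.mem_succ (h : F.Mid E X₁ Y₂ X₃ Y₄) {x y a b : ℤ} (hr : F.Reg E X₁ Y₂ x y)
    (hd : |x - a| + |y - b| ≤ 2 * E) (hm : F.Mem (a - 1) b) : F.Mem a b := by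
  have hb := h.basic
  have hE := h.pos
  have bo := h.bot; have t := h.top
  have vs := h.valid.se; have vn := h.valid.ne; have vw := h.valid.nw; have v := h.valid.fat
  have vl := h.valid.sw
  have hx : a ≤ x + 2 * E ∧ b ≤ y + 2 * E ∧ a + b ≤ x + y + 2 * E := by
    have := abs_nonneg (x - a); have := abs_nonneg (y - b)
    have := neg_abs_le (x - a); have := neg_abs_le (y - b); omega
  obtain ⟨h1, h2, h3, h4, h5, h6⟩ := hm
  unfold Reg at hr
  exact ⟨by omega, by omega, by omega, by omega, by omega, by omega⟩

lemma Mid.wt_succ (h : F.Mid E X₁ Y₂ X₃ Y₄) {x y : ℤ} (hr : F.Reg E X₁ Y₂ (x + 1) y) :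
    F.wt (x, y) ≤ F.wt (x + 1, y) := by
  unfold wt
  simp only
  by_cases hm : F.Mem x y
  · have hm' : F.Mem (x + 1) y := h.mem_succ hr (by simp) (by simpa using hm)
    rw [if_pos hm, if_pos hm']
    have hJ : F.fin.Nonempty := ⟨(x, y), mem_fin.2 hm⟩
    obtain ⟨⟨a, b⟩, hab, hd⟩ := dep_spec hJ (x + 1, y)
    have hab' : ¬ F.Mem a b := fun hc =>
      absurd (mem_fin.2 hm') (hab.1 (mem_fin.2 hc))
    by_cases hbig : 2 * E ≤ dep F.fin (x + 1, y)
    · refine le_trans ?_ hbig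
      have hmx := hm.1
      have hms := hm.2.1
      have key : ∀ c d : ℤ, ¬ F.Mem c d → |x - c| + |y - d| ≤ 2 * E →
          dep F.fin (x, y) ≤ 2 * E := fun c d hc hcd => by
        have h1 := dep_le (J := F.fin) (p := (x, y)) (q := (c, d))
          (iff_of_false (fun hc' => hc (mem_fin.1 hc')) (fun hn => hn (mem_fin.2 hm)))
        have := dist1_cast x y c d
        omega
      obtain ⟨r1, r2, r3⟩ := hr
      rcases r3 with r3 | r3 | r3
      · refine key (F.x0 - 1) y (fun hc => by have := hc.1; omega) ?_
        rw [sub_self, abs_zero, abs_of_nonneg (by omega)]; omega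
      · refine key x (F.y0 - 1) (fun hc => by have := hc.1; omega) ?_
        rw [sub_self, abs_zero, abs_of_nonneg (by omega)]; omega
      · refine key (F.s1 - 1 - y) y (fun hc => by have := hc.2.1; omega) ?_
        rw [sub_self, abs_zero, abs_of_nonneg (by omega)]; omega
    · have hd2 : |x + 1 - a| + |y - b| ≤ 2 * E := by
        have := dist1_cast (x + 1) y a b
        omega
      have hn : ¬ F.Mem (a - 1) b := fun hc => hab' (h.mem_succ hr hd2 hc)
      have h1 := dep_le (J := F.fin) (p := (x, y)) (q := (a - 1, b))
        (iff_of_false (fun hc' => hn (mem_fin.1 hc')) (fun hn => hn (mem_fin.2 hm)))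
      have e : x - (a - 1) = x + 1 - a := by ring
      have h2 := dist1_cast x y (a - 1) b
      have h3 := dist1_cast (x + 1) y a b
      rw [e] at h2
      omega
  · rw [if_neg hm]; exact Nat.zero_le _

lemma Mid.wt_mono (h : F.Mid E X₁ Y₂ X₃ Y₄) {x y : ℤ} {n : ℕ} (hr : F.Reg E X₁ Y₂ (x + n) y) :
    F.wt (x, y) ≤ F.wt (x + n, y) := by
  induction n with
  | zero => simp
  | succ n ih =>
    refine (ih (hr.mono (by push_cast; omega) le_rfl)).trans ?_
    have e : x + ((n + 1 : ℕ) : ℤ) = x + n + 1 := by push_cast; ring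
    rw [e] at hr ⊢
    exact h.wt_succ hr

lemma Mid.wt_mono' (h : F.Mid E X₁ Y₂ X₃ Y₄) {x y : ℤ} {n : ℕ} (hr : F.Reg E X₁ Y₂ x (y + n)) :
    F.wt (x, y) ≤ F.wt (x, y + n) := by
  have hr' : F.swap.Reg E Y₂ X₁ (y + n) x := by
    unfold Reg Frame.swap at *
    simp only
    omega
  have := h.swap.wt_mono hr'
  rwa [wt_swap, wt_swap] at this

/-- Sites in the part of the lower left corner to be removed. -/
def InCut (F : Frame) (E : ℕ) (X Y : ℤ) (P : ℤ → ℤ → Prop) (x y : ℤ) : Prop :=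
  F.x0 ≤ x ∧ F.y0 ≤ y ∧ x < X ∧ y < F.y0 + F.cut E X Y P (x - F.x0).toNat

/-- The removed part of a corner weighs at most as much as the missing sites. -/
lemma Mid.sum_le (h : F.Mid E X₁ Y₂ X₃ Y₄) {S Q : Finset (ℤ × ℤ)}
    (hS : ∀ p ∈ S, F.InCut E X₁ Y₂ P p.1 p.2)
    (hQ : ∀ x y, F.Mem x y → ¬ P x y → F.Reg E X₁ Y₂ x y → (x, y) ∈ Q) :
    ∑ p ∈ S, F.wt p ≤ ∑ p ∈ Q, F.wt p := by
  have hb := h.basic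
  have hE := h.pos
  set W := (X₁ - F.x0).toNat
  set R := (Y₂ - F.y0).toNat
  have hwd := h.wd_le
  have hreg : ∀ i j, i < R → j < F.wd E X₁ i → F.Reg E X₁ Y₂ (F.x0 + j) (F.y0 + i) :=
    fun i j hi hj => Reg.of_wd (by omega) hj (hwd i) (by omega)
  have key := sum_prof_le (w := F.wd E X₁) (A := F.loc P) (R := R) (W := W)
    (fun i => by have := hwd i; omega) (fun j i => F.wt (F.x0 + j, F.y0 + i))
    (fun j j' i hi hj' hjj => by
      obtain ⟨n, rfl⟩ := Nat.le.dest hjj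
      have := h.wt_mono (x := F.x0 + j) (y := F.y0 + i) (n := n)
        (by rw [add_assoc, ← Nat.cast_add]; exact hreg i _ hi hj')
      simpa [add_assoc] using this)
    (fun j i i' hi' hj hii => by
      obtain ⟨n, rfl⟩ := Nat.le.dest hii
      have := h.wt_mono' (x := F.x0 + j) (y := F.y0 + i) (n := n)
        (by rw [add_assoc, ← Nat.cast_add]; exact hreg _ j hi' hj)
      simpa [add_assoc] using this)
  rw [Finset.sum_sigma', Finset.sum_sigma'] at key
  set G : (Σ _ : ℕ, ℕ) → ℤ × ℤ := fun q => (F.x0 + q.1, F.y0 + q.2) with hG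
  set G' : (Σ _ : ℕ, ℕ) → ℤ × ℤ := fun q => (F.x0 + q.2, F.y0 + q.1) with hG'
  have hGi : Function.Injective G := by
    rintro ⟨a, b⟩ ⟨c, d⟩ e
    simp only [hG, Prod.mk.injEq, add_right_inj, Nat.cast_inj] at e
    obtain ⟨rfl, rfl⟩ := e; rfl
  have hGi' : Function.Injective G' := by
    rintro ⟨a, b⟩ ⟨c, d⟩ e
    simp only [hG', Prod.mk.injEq, add_right_inj, Nat.cast_inj] at e
    obtain ⟨rfl, rfl⟩ := e; rfl
  refine le_trans ?_ (key.trans ?_)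
  · rw [← Finset.sum_image (s := Finset.sigma _ _) (g := G) (f := F.wt)
      (fun a _ b _ e => hGi e)]
    refine Finset.sum_le_sum_of_subset fun p hp => ?_
    obtain ⟨h1, h2, h3, h4⟩ := hS p hp
    refine Finset.mem_image.2 ⟨⟨(p.1 - F.x0).toNat, (p.2 - F.y0).toNat⟩, ?_, ?_⟩
    · simp only [Finset.mem_sigma, Finset.mem_range]
      change p.2 < F.y0 + (prof (F.wd E X₁) (F.loc P) R (p.1 - F.x0).toNat : ℤ) at h4
      omega
    · simp only [hG]
      ext <;> simp only <;> omega
  · rw [← Finset.sum_image (s := Finset.sigma _ _) (g := G') (f := F.wt)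
      (fun a _ b _ e => hGi' e)]
    refine Finset.sum_le_sum_of_ne_zero fun p hp hne => ?_
    obtain ⟨⟨i, j⟩, hq, rfl⟩ := Finset.mem_image.1 hp
    simp only [Finset.mem_sigma, Finset.mem_range, mem_miss] at hq
    have hm : F.Mem (F.x0 + j) (F.y0 + i) := by
      by_contra hn
      exact hne (if_neg hn)
    exact hQ (F.x0 + j) (F.y0 + i) hm (fun hP => hq.2.2 ⟨hP, hm⟩)
      (hreg i j hq.1 hq.2.1)

/-- The row slice estimate. -/
lemma Mid.le_card_row (h : F.Mid E X₁ Y₂ X₃ Y₄) {i : ℕ} (hi : i < E) {x : ℤ} (hx : P x (F.y0 + i))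
    {S : Finset ℤ} (hS : ∀ x, F.x0 ≤ x → x < X₁ → P x (F.y0 + i) → x ∈ S) :
    (X₁ - F.x0).toNat ≤ S.card +
      conj (X₁ - F.x0).toNat (F.cut E X₁ Y₂ P) (F.emptyRows E P).card := by
  have hb := h.basic
  have hE := h.pos
  set W := (X₁ - F.x0).toNat
  have hw : ∀ i < E, F.wd E X₁ i = W := fun i hi => by unfold wd wid; rw [if_pos hi]
  have h1 : (Surfactant.miss (F.wd E X₁) (F.loc P) i).card ≤
      conj W (F.cut E X₁ Y₂ P) (F.emptyRows E P).card := by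
    refine le_conj (prof_anti _ _ _) ((card_miss_le _ _ _).trans (hw i hi).le) fun j hj => ?_
    have hni : i ∉ F.emptyRows E P := fun hc => (mem_emptyRows.1 hc).2 x hx
    have := card_le_prof (w := F.wd E X₁) (A := F.loc P) (R := (Y₂ - F.y0).toNat) (j := j)
      (insert i (F.emptyRows E P)) fun a ha => by
        rcases Finset.mem_insert.1 ha with rfl | ha
        · exact ⟨by omega, hj⟩
        · have ha := mem_emptyRows.1 ha
          refine ⟨by omega, hj.trans_le ((card_miss_le _ _ _).trans ((hw i hi).le.trans ?_))⟩
          have : Finset.range W ⊆ Surfactant.miss (F.wd E X₁) (F.loc P) a := fun b hb => by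
            rw [Finset.mem_range] at hb
            exact mem_miss.2 ⟨by rw [hw a ha.1]; exact hb, fun hl => ha.2 _ hl.1⟩
          simpa using Finset.card_le_card this
    rw [Finset.card_insert_of_notMem hni] at this
    exact this
  have h2 : (Finset.range W \ Surfactant.miss (F.wd E X₁) (F.loc P) i).card ≤ S.card := by
    refine Finset.card_le_card_of_injOn (fun j : ℕ => F.x0 + j) (fun j hj => ?_)
      (fun a _ b _ e => by simpa using e)
    rw [Finset.mem_coe, Finset.mem_sdiff, Finset.mem_range, mem_miss, not_and, not_not, hw i hi] at hj
    exact hS (F.x0 + j) (by omega) (by omega) (hj.2 hj.1).1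
  have h3 := Finset.le_card_sdiff (Surfactant.miss (F.wd E X₁) (F.loc P) i) (Finset.range W)
  rw [Finset.card_range] at h3
  omega

/-- The column slice estimate. -/
lemma Mid.le_card_col (h : F.Mid E X₁ Y₂ X₃ Y₄) {j : ℕ} (hj : j < E) {y : ℤ} (hy : P (F.x0 + j) y)
    {S : Finset ℤ} (hS : ∀ y, F.y0 ≤ y → y < Y₂ → P (F.x0 + j) y → y ∈ S) :
    (Y₂ - F.y0).toNat ≤ S.card + F.cut E X₁ Y₂ P (F.emptyCols E P).card := by
  have hb := h.basic
  set R := (Y₂ - F.y0).toNat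
  have hnj : j ∉ F.emptyCols E P := fun hc => (mem_emptyCols.1 hc).2 y hy
  have hwE : ∀ i, E ≤ F.wd E X₁ i := fun i => le_wid (by omega) i
  have h2 : ((Finset.range R).filter fun i =>
      ¬ (F.emptyCols E P).card < (Surfactant.miss (F.wd E X₁) (F.loc P) i).card).card ≤ S.card := by
    refine Finset.card_le_card_of_injOn (fun i : ℕ => F.y0 + i) (fun i hi => ?_)
      (fun a _ b _ e => by simpa using e)
    rw [Finset.mem_coe, Finset.mem_filter, Finset.mem_range, not_lt] at hi
    refine hS (F.y0 + i) (by omega) (by omega) ?_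
    have hsub : F.emptyCols E P ⊆ Surfactant.miss (F.wd E X₁) (F.loc P) i := fun a ha => by
      have ha := mem_emptyCols.1 ha
      exact mem_miss.2 ⟨ha.1.trans_le (hwE i), fun hl => ha.2 _ hl.1⟩
    have heq := Finset.eq_of_subset_of_card_le hsub hi.2
    rw [heq, mem_miss, not_and, not_not] at hnj
    exact (hnj (hj.trans_le (hwE i))).1
  have h3 := Finset.card_filter_add_card_filter_not (s := Finset.range R)
    (fun i => (F.emptyCols E P).card < (Surfactant.miss (F.wd E X₁) (F.loc P) i).card)
  rw [Finset.card_range] at h3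
  have h4 : F.cut E X₁ Y₂ P (F.emptyCols E P).card = ((Finset.range R).filter fun i =>
    (F.emptyCols E P).card < (Surfactant.miss (F.wd E X₁) (F.loc P) i).card).card := rfl
  omega

/-- A row containing all nonempty columns near the left side. -/
lemma Mid.exists_row (h : F.Mid E X₁ Y₂ X₃ Y₄)
    (hlt : F.cut E X₁ Y₂ P (F.emptyCols E P).card < (Y₂ - F.y0).toNat) :
    ∃ y, F.y0 ≤ y ∧ y < Y₂ ∧ ∀ j < E, j ∉ F.emptyCols E P → P (F.x0 + j) y := by
  have hb := h.basic
  have hE := h.pos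
  have hwE : ∀ i, E ≤ F.wd E X₁ i := fun i => le_wid (by omega) i
  obtain ⟨i, hi, hmi⟩ : ∃ i < (Y₂ - F.y0).toNat,
      (Surfactant.miss (F.wd E X₁) (F.loc P) i).card ≤ (F.emptyCols E P).card := by
    by_contra! hn
    exact hlt.ne (prof_eq hn)
  refine ⟨F.y0 + i, by omega, by omega, fun j hj hnj => ?_⟩
  have hsub : F.emptyCols E P ⊆ Surfactant.miss (F.wd E X₁) (F.loc P) i := fun a ha => by
    have ha := mem_emptyCols.1 ha
    exact mem_miss.2 ⟨ha.1.trans_le (hwE i), fun hl => ha.2 _ hl.1⟩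
  have heq := Finset.eq_of_subset_of_card_le hsub hmi
  rw [heq, mem_miss, not_and, not_not] at hnj
  exact (hnj (hj.trans_le (hwE i))).1

end

/-- Lower left corner sites. -/
def CornerAt (F : Frame) (x y : ℤ) : Prop := ¬ F.Mem x y ∧ F.Mem (x + 1) y ∧ F.Mem x (y + 1)

section
variable {F : Frame}

lemma Valid.cornerAt_left (h : F.Valid) (h1 : F.y0 + 1 < F.p2) : F.CornerAt F.x0 (F.p2 - 1) := by
  have a1 := h.sw; have a4 := h.nw
  have a7 := h.le; have a8 := h.fat; have a9 := h.diag; have a10 := h.diag'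
  refine ⟨fun hc => by have := hc.2.2.2.1 rfl; omega,
    ⟨by omega, by omega, by omega, by omega, by omega, by omega⟩, ?_⟩
  rw [sub_add_cancel]
  exact h.mem_left le_rfl a7.2.1

lemma CornerAt.swap {x y : ℤ} (h : F.swap.CornerAt x y) : F.CornerAt y x := by
  unfold CornerAt at *
  rw [mem_swap, mem_swap, mem_swap] at h
  exact ⟨h.1, h.2.2, h.2.1⟩

lemma Valid.cornerAt_bottom (h : F.Valid) (h1 : F.x0 + 1 < F.p1) : F.CornerAt (F.p1 - 1) F.y0 :=
  (h.swap.cornerAt_left h1).swap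

lemma Valid.exists_corners (h : F.Valid) : ∃ S : Finset (ℤ × ℤ),
    S.card = (F.s1 - F.x0 - F.y0).toNat ∧ ∀ z ∈ S, F.CornerAt z.1 z.2 := by
  have a1 := h.sw; have a2 := h.se; have a4 := h.nw
  have a7 := h.le; have a8 := h.fat; have a9 := h.diag
  rcases lt_trichotomy (F.s1 - F.x0 - F.y0) 1 with h0 | h0 | h0
  · exact ⟨∅, by simp; omega, by simp⟩
  · by_cases k : F.y0 + 1 < F.p2
    · exact ⟨{(F.x0, F.p2 - 1)}, by simp [h0], by simpa using h.cornerAt_left k⟩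
    by_cases k' : F.x0 + 1 < F.p1
    · exact ⟨{(F.p1 - 1, F.y0)}, by simp [h0], by simpa using h.cornerAt_bottom k'⟩
    refine ⟨{(F.x0, F.y0)}, by simp [h0], ?_⟩
    simp only [Finset.mem_singleton, forall_eq]
    refine ⟨fun hc => by have := hc.2.1; omega, ?_, ?_⟩
    · have : F.x0 + 1 = F.p1 := by omega
      rw [this]; exact h.mem_bottom le_rfl a7.1
    · have : F.y0 + 1 = F.p2 := by omega
      rw [this]; exact h.mem_left le_rfl a7.2.1
  · set m := (F.s1 - F.x0 - F.y0).toNat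
    set g : ℕ → ℤ × ℤ := fun t => if t = 0 then (F.x0, F.p2 - 1) else
      if t = m - 1 then (F.p1 - 1, F.y0) else (F.x0 + t, F.s1 - 1 - F.x0 - t) with hg
    have hfst : ∀ t < m, ∀ t' < m, t < t' → (g t).1 < (g t').1 := by
      intro t ht t' ht' htt
      simp only [hg]
      split_ifs <;> simp only <;> omega
    refine ⟨(Finset.range m).image g, ?_, ?_⟩
    · rw [Finset.card_image_of_injOn, Finset.card_range]
      intro t ht t' ht' e
      rw [Finset.mem_coe, Finset.mem_range] at ht ht'
      by_contra hne
      rcases lt_or_gt_of_ne hne with hl | hl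
      · have := hfst t ht t' ht' hl; rw [e] at this; exact lt_irrefl _ this
      · have := hfst t' ht' t ht hl; rw [e] at this; exact lt_irrefl _ this
    · intro z hz
      obtain ⟨t, ht, rfl⟩ := Finset.mem_image.1 hz
      rw [Finset.mem_range] at ht
      simp only [hg]
      split_ifs with e1 e2
      · exact h.cornerAt_left (by omega)
      · exact h.cornerAt_bottom (by omega)
      · refine ⟨fun hc => by have := hc.2.1; simp only at this; omega, ?_, ?_⟩ <;>
          exact ⟨by simp only; omega, by simp only; omega, by simp only; omega,
            by simp only; omega, by simp only; omega, by simp only; omega⟩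

lemma CornerAt.flip {x y : ℤ} (h : F.flip.CornerAt x y) :
    ¬ F.Mem (-x) y ∧ F.Mem (-x - 1) y ∧ F.Mem (-x) (y + 1) := by
  unfold CornerAt at h
  rw [mem_flip, mem_flip, mem_flip] at h
  have e : -x - 1 = -(x + 1) := by ring
  rw [e]; exact h

lemma CornerAt.vflip {x y : ℤ} (h : F.vflip.CornerAt x y) :
    ¬ F.Mem x (-y) ∧ F.Mem (x + 1) (-y) ∧ F.Mem x (-y - 1) := by
  unfold CornerAt at h
  rw [mem_vflip, mem_vflip, mem_vflip] at h
  have e : -y - 1 = -(y + 1) := by ring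
  rw [e]; exact h

lemma Valid.vflip (h : F.Valid) : F.vflip.Valid := h.swap.flip.swap

/-- The total number of diagonal steps. -/
def steps (F : Frame) : ℤ := (F.s1 - F.x0 - F.y0) + (F.x1 - F.y0 - F.d2) + (F.d1 - F.x0 + F.y1) +
  (F.x1 + F.y1 - F.s2)

lemma Valid.steps_le (h : F.Valid) : F.steps ≤ (ocr F.fin).card := by
  classical
  have a1 := h.sw; have a2 := h.se; have a3 := h.ne; have a4 := h.nw
  obtain ⟨S0, c0, m0⟩ := h.exists_corners
  obtain ⟨S1, c1, m1⟩ := h.flip.exists_corners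
  obtain ⟨S2, c2, m2⟩ := h.vflip.exists_corners
  obtain ⟨S3, c3, m3⟩ := h.vflip.flip.exists_corners
  have hneg1 : Function.Injective fun z : ℤ × ℤ => (-z.1, z.2) := fun a b e => by
    simp only [Prod.mk.injEq, neg_inj] at e; exact Prod.ext e.1 e.2
  have hneg2 : Function.Injective fun z : ℤ × ℤ => (z.1, -z.2) := fun a b e => by
    simp only [Prod.mk.injEq, neg_inj] at e; exact Prod.ext e.1 e.2
  have hneg3 : Function.Injective fun z : ℤ × ℤ => (-z.1, -z.2) := fun a b e => by
    simp only [Prod.mk.injEq, neg_inj] at e; exact Prod.ext e.1 e.2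
  set T1 := S1.image fun z : ℤ × ℤ => (-z.1, z.2) with hT1
  set T2 := S2.image fun z : ℤ × ℤ => (z.1, -z.2) with hT2
  set T3 := S3.image fun z : ℤ × ℤ => (-z.1, -z.2) with hT3
  have n0 : ∀ z ∈ S0, ¬ F.Mem z.1 z.2 ∧ F.Mem (z.1 + 1) z.2 ∧ F.Mem z.1 (z.2 + 1) := m0
  have n1 : ∀ z ∈ T1, ¬ F.Mem z.1 z.2 ∧ F.Mem (z.1 - 1) z.2 ∧ F.Mem z.1 (z.2 + 1) := fun z hz => by
    obtain ⟨w, hw, rfl⟩ := Finset.mem_image.1 hz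
    exact (m1 w hw).flip
  have n2 : ∀ z ∈ T2, ¬ F.Mem z.1 z.2 ∧ F.Mem (z.1 + 1) z.2 ∧ F.Mem z.1 (z.2 - 1) := fun z hz => by
    obtain ⟨w, hw, rfl⟩ := Finset.mem_image.1 hz
    exact (m2 w hw).vflip
  have n3 : ∀ z ∈ T3, ¬ F.Mem z.1 z.2 ∧ F.Mem (z.1 - 1) z.2 ∧ F.Mem z.1 (z.2 - 1) := fun z hz => by
    obtain ⟨w, hw, rfl⟩ := Finset.mem_image.1 hz
    have := (m3 w hw).flip
    rw [mem_vflip, mem_vflip, mem_vflip] at this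
    have e : -w.2 - 1 = -(w.2 + 1) := by ring
    simp only
    rw [e]; exact this
  have hx : ∀ x y, F.Mem (x + 1) y → F.Mem (x - 1) y → F.Mem x y := fun x y k1 k2 =>
    mem_row (by omega) (by omega) k2 k1
  have hy : ∀ x y, F.Mem x (y + 1) → F.Mem x (y - 1) → F.Mem x y := fun x y k1 k2 =>
    mem_col (by omega) (by omega) k2 k1
  have d01 : Disjoint S0 T1 := Finset.disjoint_left.2 fun z k1 k2 =>
    (n0 z k1).1 (hx _ _ (n0 z k1).2.1 (n1 z k2).2.1)
  have d02 : Disjoint (S0 ∪ T1) T2 := Finset.disjoint_left.2 fun z k1 k2 => by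
    rcases Finset.mem_union.1 k1 with k1 | k1
    · exact (n0 z k1).1 (hy _ _ (n0 z k1).2.2 (n2 z k2).2.2)
    · exact (n1 z k1).1 (hx _ _ (n2 z k2).2.1 (n1 z k1).2.1)
  have d03 : Disjoint (S0 ∪ T1 ∪ T2) T3 := Finset.disjoint_left.2 fun z k1 k2 => by
    rcases Finset.mem_union.1 k1 with k1 | k1
    · rcases Finset.mem_union.1 k1 with k1 | k1
      · exact (n0 z k1).1 (hx _ _ (n0 z k1).2.1 (n3 z k2).2.1)
      · exact (n1 z k1).1 (hy _ _ (n1 z k1).2.2 (n3 z k2).2.2)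
    · exact (n2 z k1).1 (hx _ _ (n2 z k1).2.1 (n3 z k2).2.1)
  have hsub : S0 ∪ T1 ∪ T2 ∪ T3 ⊆ ocr F.fin := fun z hz => by
    rw [mem_ocr]
    simp only [mem_fin, Prod.fst_add, Prod.snd_add, Prod.fst_sub, Prod.snd_sub, add_zero, sub_zero]
    rcases Finset.mem_union.1 hz with hz | hz
    · rcases Finset.mem_union.1 hz with hz | hz
      · rcases Finset.mem_union.1 hz with hz | hz
        · have := n0 z hz; tauto
        · have := n1 z hz; tauto
      · have := n2 z hz; tauto
    · have := n3 z hz; tauto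
  have hcard := Finset.card_le_card hsub
  rw [Finset.card_union_of_disjoint d03, Finset.card_union_of_disjoint d02,
    Finset.card_union_of_disjoint d01, hT1, hT2, hT3, Finset.card_image_of_injective _ hneg1,
    Finset.card_image_of_injective _ hneg2, Finset.card_image_of_injective _ hneg3, c0, c1, c2, c3]
    at hcard
  unfold steps
  simp only [Frame.vflip, Frame.flip, Frame.swap] at hcard
  omega

end

/-- A frame with removed external rows and columns and enlarged corners. -/
def inset (F : Frame) (τ₁ τ₂ τ₃ τ₄ : ℕ) (n a b : Fin 4 → ℕ) : Frame where
  x0 := F.x0 + τ₂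
  x1 := F.x1 - τ₄
  y0 := F.y0 + τ₁
  y1 := F.y1 - τ₃
  s1 := max (max F.s1 (F.x0 + F.y0 + n 0)) (F.x0 + τ₂ + F.y0 + τ₁)
  s2 := min (min F.s2 (F.x1 + F.y1 - n 3)) (F.x1 - τ₄ + F.y1 - τ₃)
  d1 := max (max F.d1 (F.x0 - F.y1 + n 2)) (F.x0 + τ₂ - F.y1 + τ₃)
  d2 := min (min F.d2 (F.x1 - F.y0 - n 1)) (F.x1 - τ₄ - F.y0 - τ₁)
  p1 := F.x0 + a 0
  q1 := F.x1 - a 1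
  p2 := F.y0 + b 0
  q2 := F.y1 - b 2
  p3 := F.x0 + a 2
  q3 := F.x1 - a 3
  p4 := F.y0 + b 1
  q4 := F.y1 - b 3

/-- The numerical relations at one corner of an inset frame; `M` is the number of diagonal
steps and `p`, `p'` the lengths of the axis-parallel steps at the corner before the change, `W`
and `R` the distances of the corner from the middle. -/
structure CornerNum (E : ℕ) (M p p' W R : ℤ) (τ₁ τ₂ n a b : ℕ) : Prop where
  le_E : τ₁ ≤ E ∧ τ₂ ≤ E
  n_le : (n : ℤ) ≤ M + 2 * E
  sum_b : M ≤ b + τ₂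
  sum_a : M ≤ a + τ₁
  n_b : n ≤ b + τ₂
  n_a : n ≤ a + τ₁
  ge_b : τ₁ ≤ b
  ge_a : τ₂ ≤ a
  iff : a = τ₂ ↔ b = τ₁
  bot : τ₁ = 0 → p ≤ a
  left : τ₂ = 0 → p' ≤ b
  a_le : (a : ℤ) ≤ W
  b_le : (b : ℤ) ≤ R

section
variable {F : Frame} {E : ℕ} {X₁ Y₂ X₃ Y₄ : ℤ} {P : ℤ → ℤ → Prop}

lemma Corner.num {W R τ₁ τ₂ n : ℕ} {c : ℕ → ℕ} (h : F.Corner E W R τ₁ τ₂ n c) (hE : E < W) :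
    CornerNum E (F.s1 - F.x0 - F.y0) (F.p1 - F.x0) (F.p2 - F.y0) W R τ₁ τ₂ n (conj W c τ₁)
      (c τ₂) := by
  obtain ⟨h1, h2, h3, h4, h5, h6, h7, h8, h9, h10, h11, h12, h13, h14, h15, h16⟩ := h
  refine ⟨⟨h3.2, h4.2⟩, h5, h7, h8, h6 _ (by omega), h9, h10, h11, h12, h13, h14, ?_, ?_⟩
  · exact_mod_cast conj_le _ _ _
  · exact_mod_cast h2 _

lemma Mid.inset_valid (h : F.Mid E X₁ Y₂ X₃ Y₄) {τ₁ τ₂ τ₃ τ₄ : ℕ} {n a b : Fin 4 → ℕ}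
    (k0 : CornerNum E (F.s1 - F.x0 - F.y0) (F.p1 - F.x0) (F.p2 - F.y0) (X₁ - F.x0) (Y₂ - F.y0)
      τ₁ τ₂ (n 0) (a 0) (b 0))
    (k1 : CornerNum E (F.x1 - F.y0 - F.d2) (F.x1 - F.q1) (F.p4 - F.y0) (F.x1 - X₁ + 1) (Y₄ - F.y0)
      τ₁ τ₄ (n 1) (a 1) (b 1))
    (k2 : CornerNum E (F.d1 - F.x0 + F.y1) (F.p3 - F.x0) (F.y1 - F.q2) (X₃ - F.x0) (F.y1 - Y₂ + 1)
      τ₃ τ₂ (n 2) (a 2) (b 2))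
    (k3 : CornerNum E (F.x1 + F.y1 - F.s2) (F.x1 - F.q3) (F.y1 - F.q4) (F.x1 - X₃ + 1)
      (F.y1 - Y₄ + 1) τ₃ τ₄ (n 3) (a 3) (b 3))
    (e1 : a 0 < X₁ - F.x0 ∨ a 1 < F.x1 - X₁ + 1) (e2 : b 0 < Y₂ - F.y0 ∨ b 2 < F.y1 - Y₂ + 1)
    (e3 : a 2 < X₃ - F.x0 ∨ a 3 < F.x1 - X₃ + 1) (e4 : b 1 < Y₄ - F.y0 ∨ b 3 < F.y1 - Y₄ + 1) :
    (F.inset τ₁ τ₂ τ₃ τ₄ n a b).Valid ∧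
      ∀ x y, (F.inset τ₁ τ₂ τ₃ τ₄ n a b).Mem x y → F.Mem x y := by
  have hb := h.basic
  have hE := h.pos
  have hv := h.valid
  have v1 := hv.sw; have v2 := hv.se; have v3 := hv.ne; have v4 := hv.nw
  have b1 := h.bot; have b2 := h.left; have b3 := h.top; have b4 := h.right
  obtain ⟨k01, k02, k03, k04, k05, k06, k07, k08, k09, k0a, k0b, k0c, k0d⟩ := k0
  obtain ⟨k11, k12, k13, k14, k15, k16, k17, k18, k19, k1a, k1b, k1c, k1d⟩ := k1
  obtain ⟨k21, k22, k23, k24, k25, k26, k27, k28, k29, k2a, k2b, k2c, k2d⟩ := k2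
  obtain ⟨k31, k32, k33, k34, k35, k36, k37, k38, k39, k3a, k3b, k3c, k3d⟩ := k3
  constructor
  · have w0 : F.x0 + 16 * E ≤ X₁ + 8 * E ∧ X₁ + 8 * E ≤ F.x1 ∧ F.y0 + 8 * E ≤ Y₂ ∧ Y₂ + 8 * E ≤ F.y1 ∧
        F.y0 + 8 * E ≤ Y₄ ∧ Y₄ + 8 * E ≤ F.y1 ∧ F.x0 + 8 * E ≤ X₃ ∧ X₃ + 8 * E ≤ F.x1 := by
      clear * - hb b1 b2 b3 b4 v1 v2 v3 v4 hE
      omega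
    have s1 : max (max F.s1 (F.x0 + F.y0 + n 0)) (F.x0 + τ₂ + F.y0 + τ₁) ≤ F.s1 + 2 * E := by
      clear * - k02 k01 v1; omega
    have s2 : F.s2 - 2 * E ≤ min (min F.s2 (F.x1 + F.y1 - n 3)) (F.x1 - τ₄ + F.y1 - τ₃) := by
      clear * - k32 k31 v3; omega
    have s3 : max (max F.d1 (F.x0 - F.y1 + n 2)) (F.x0 + τ₂ - F.y1 + τ₃) ≤ F.d1 + 2 * E := by
      clear * - k22 k21 v4; omega
    have s4 : F.d2 - 2 * E ≤ min (min F.d2 (F.x1 - F.y0 - n 1)) (F.x1 - τ₄ - F.y0 - τ₁) := by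
      clear * - k12 k11 v2; omega
    refine ⟨?_, ?_, ?_, ?_, ?_, ?_, ?_, ?_, ?_, ?_, ?_, ?_, ?_, X₁, F.y0 + 4 * E, ?_, ?_⟩
    all_goals simp only [inset]
    · clear * - k03 k04 k05 k06 k07 k08; omega
    · clear * - k13 k14 k15 k16 k17 k18; omega
    · clear * - k33 k34 k35 k36 k37 k38; omega
    · clear * - k23 k24 k25 k26 k27 k28; omega
    · clear * - k09; omega
    · clear * - k19; omega
    · clear * - k39; omega
    · clear * - k29; omega
    · clear * - e1 e2 e3 e4 k0c k0d k1c k1d k2c k2d k3c k3d; omega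
    all_goals
      generalize max (max F.s1 (F.x0 + F.y0 + n 0)) (F.x0 + τ₂ + F.y0 + τ₁) = S1 at *
      generalize min (min F.s2 (F.x1 + F.y1 - n 3)) (F.x1 - τ₄ + F.y1 - τ₃) = S2 at *
      generalize max (max F.d1 (F.x0 - F.y1 + n 2)) (F.x0 + τ₂ - F.y1 + τ₃) = S3 at *
      generalize min (min F.d2 (F.x1 - F.y0 - n 1)) (F.x1 - τ₄ - F.y0 - τ₁) = S4 at *
    · clear * - hE hb w0 s1 s2 s3 s4 k01 k11 k21 k31; omega
    · clear * - hE hb w0 s1 s2 s3 s4 k01 k11 k21 k31; omega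
    · clear * - hE hb w0 s1 s2 s3 s4 k01 k11 k21 k31; omega
    · clear * - hE hb w0 k01 k11 k21 k31 k0c k0d k1c k1d k2c k2d k3c k3d; omega
    · clear * - hE hb w0 k01 k11 k21 k31; omega
    · clear * - hE hb w0 s1 s2 s3 s4; omega
  · rintro x y ⟨m1, m2, m3, m4, m5, m6⟩
    simp only [inset] at m1 m2 m3 m4 m5 m6
    clear * - m1 m2 m3 m4 m5 m6 k0a k0b k1a k1b k2a k2b k3a k3b
    have d1 : F.s1 ≤ x + y := ((le_max_left _ _).trans (le_max_left _ _)).trans m2.1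
    have d2 : x + y ≤ F.s2 := m2.2.1.trans ((min_le_left _ _).trans (min_le_left _ _))
    have d3 : F.d1 ≤ x - y := ((le_max_left _ _).trans (le_max_left _ _)).trans m2.2.2.1
    have d4 : x - y ≤ F.d2 := m2.2.2.2.trans ((min_le_left _ _).trans (min_le_left _ _))
    clear m2
    refine ⟨by clear * - m1; omega, ⟨d1, d2, d3, d4⟩, fun e => ?_, fun e => ?_, fun e => ?_, fun e => ?_⟩
    · clear * - m1 m3 k0a k1a e
      have := m3 (by omega)
      omega
    · clear * - m1 m4 k0b k2b e
      have := m4 (by omega)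
      omega
    · clear * - m1 m5 k2a k3a e
      have := m5 (by omega)
      omega
    · clear * - m1 m6 k1b k3b e
      have := m6 (by omega)
      omega

end
section
variable {F : Frame} {E : ℕ} {X₁ Y₂ X₃ Y₄ : ℤ} {P : ℤ → ℤ → Prop}

/-- Constraints of the inset frame at one corner, away from the removed part. -/
lemma Corner.constraint {W R τ₁ τ₂ n : ℕ} {X Y : ℤ}
    (h : F.Corner E W R τ₁ τ₂ n (F.cut E X Y P)) (hW : W = (X - F.x0).toNat)
    (hR : R = (Y - F.y0).toNat) (hEW : E < W) (hER : E < R) (hnW : n ≤ W)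
    {x y : ℤ} (hc : ¬ F.InCut E X Y P x y)
    (hx : F.x0 ≤ x) (hy : F.y0 ≤ y) : (y < Y → F.x0 + τ₂ ≤ x) ∧ (x < X → F.y0 + τ₁ ≤ y) ∧
    (F.x0 + τ₂ ≤ x → F.y0 + τ₁ ≤ y → F.x0 + F.y0 + n ≤ x + y) ∧
    (y = F.y0 + τ₁ → F.x0 + (conj W (F.cut E X Y P) τ₁ : ℕ) ≤ x) ∧
    (x = F.x0 + τ₂ → F.y0 + (F.cut E X Y P τ₂ : ℕ) ≤ y) := by
  have hE2 := h.last'.2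
  obtain ⟨j, rfl⟩ : ∃ j : ℕ, x = F.x0 + j := ⟨(x - F.x0).toNat, by omega⟩
  obtain ⟨i, rfl⟩ : ∃ i : ℕ, y = F.y0 + i := ⟨(y - F.y0).toNat, by omega⟩
  have hc' : j < W → F.cut E X Y P j ≤ i := fun hj => by
    by_contra hn
    refine hc ⟨hx, hy, by omega, ?_⟩
    have : (F.x0 + (j : ℤ) - F.x0).toNat = j := by omega
    rw [this]; omega
  have hanti := h.anti
  have hl := fun i j => lt_conj hanti (W := W) (i := i) (j := j)
  refine ⟨fun hY => ?_, fun hX => ?_, fun h1 h2 => ?_, fun e => ?_, fun e => ?_⟩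
  · by_contra hn
    have := (hl (R - 1) j).1 (lt_of_lt_of_le (by omega) h.last'.1)
    have := hc' this.1
    omega
  · have := hc' (by omega)
    have := h.last.1
    have := hanti (show j ≤ W - 1 by omega)
    omega
  · by_contra hn
    have := hc' (by omega)
    have := h.le_h j (by omega)
    omega
  · by_contra hn
    have h1 := (hl τ₁ j).1 (by omega)
    have := hc' h1.1
    omega
  · have e : j = τ₂ := by omega
    have := hc' (by omega)
    rw [e] at this
    omega

end
end Frame

lemma le_ite_add {A B C D : Prop} [Decidable A] [Decidable B] [Decidable C] [Decidable D] (w : ℕ)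
    (h : A ∨ B ∨ C ∨ D) : w ≤ (if A then w else 0) + (if B then w else 0) +
      ((if C then w else 0) + (if D then w else 0)) := by
  rcases h with h | h | h | h <;> rw [if_pos h] <;> omega

lemma ite_add_le {A B C D : Prop} [Decidable A] [Decidable B] [Decidable C] [Decidable D] (w : ℕ)
    (h1 : A → ¬ B) (h2 : A → ¬ C) (h3 : A → ¬ D) (h4 : B → ¬ C) (h5 : B → ¬ D) (h6 : C → ¬ D) :
    (if A then w else 0) + (if B then w else 0) +
      ((if C then w else 0) + (if D then w else 0)) ≤ w := by
  by_cases hA : A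
  · rw [if_pos hA, if_neg (h1 hA), if_neg (h2 hA), if_neg (h3 hA)]; omega
  by_cases hB : B
  · rw [if_neg hA, if_pos hB, if_neg (h4 hB), if_neg (h5 hB)]; omega
  by_cases hC : C
  · rw [if_neg hA, if_neg hB, if_pos hC, if_neg (h6 hC)]; omega
  rw [if_neg hA, if_neg hB, if_neg hC]
  split_ifs <;> omega

namespace Frame
section
variable {F : Frame} {E : ℕ} {X₁ Y₂ X₃ Y₄ : ℤ} {P : ℤ → ℤ → Prop}

lemma disjoint_regs (h : F.Mid E X₁ Y₂ X₃ Y₄) {x y : ℤ} (h0 : F.Reg E X₁ Y₂ x y)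
    (h3 : F.vflip.flip.Reg E (1 - X₃) (1 - Y₄) (-x) (-y)) : False := by
  have hb := h.basic
  have hE := h.pos
  have hv := h.valid
  have v4 := hv.nw
  have b2 := h.left
  unfold Reg at *
  simp only [Frame.vflip, Frame.flip, Frame.swap] at h3
  omega

lemma disjoint_regs' (h : F.Mid E X₁ Y₂ X₃ Y₄) {x y : ℤ} (h1 : F.flip.Reg E (1 - X₁) Y₄ (-x) y)
    (h2 : F.vflip.Reg E X₃ (1 - Y₂) x (-y)) : False := by
  have hb := h.basic
  have hE := h.pos
  have hv := h.valid
  have v1 := hv.sw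
  have b1 := h.bot
  unfold Reg at *
  simp only [Frame.vflip, Frame.flip, Frame.swap] at h1 h2
  omega

lemma Mid.weight_le (h : F.Mid E X₁ Y₂ X₃ Y₄) {S Q : Finset (ℤ × ℤ)}
    (hS : ∀ p ∈ S, F.InCut E X₁ Y₂ P p.1 p.2 ∨ F.flip.InCut E (1 - X₁) Y₄ (hf P) (-p.1) p.2 ∨
      F.vflip.InCut E X₃ (1 - Y₂) (vf P) p.1 (-p.2) ∨
      F.vflip.flip.InCut E (1 - X₃) (1 - Y₄) (hf (vf P)) (-p.1) (-p.2))
    (hQ : ∀ x y, F.Mem x y → ¬ P x y → (x, y) ∈ Q) : ∑ p ∈ S, F.wt p ≤ ∑ p ∈ Q, F.wt p := by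
  classical
  set e3 : ℤ × ℤ ≃ ℤ × ℤ := negSnd.trans negFst with he3
  have w1 : ∀ p, F.flip.wt (negFst p) = F.wt p := fun p => by
    obtain ⟨x, y⟩ := p; rw [negFst_apply, wt_flip, neg_neg]
  have w2 : ∀ p, F.vflip.wt (negSnd p) = F.wt p := fun p => by
    obtain ⟨x, y⟩ := p; rw [negSnd_apply, wt_vflip, neg_neg]
  have w3 : ∀ p, F.vflip.flip.wt (e3 p) = F.wt p := fun p => by
    obtain ⟨x, y⟩ := p
    rw [he3, Equiv.trans_apply, negSnd_apply, negFst_apply, wt_flip, wt_vflip, neg_neg, neg_neg]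
  have k0 : ∑ p ∈ S.filter (fun p => F.InCut E X₁ Y₂ P p.1 p.2), F.wt p ≤
      ∑ p ∈ Q.filter (fun p => F.Reg E X₁ Y₂ p.1 p.2), F.wt p :=
    h.sum_le (P := P) (fun p hp => (Finset.mem_filter.1 hp).2)
      (fun x y hm hP hr => Finset.mem_filter.2 ⟨hQ x y hm hP, hr⟩)
  have k1 : ∑ p ∈ S.filter (fun p => F.flip.InCut E (1 - X₁) Y₄ (hf P) (-p.1) p.2), F.wt p ≤
      ∑ p ∈ Q.filter (fun p => F.flip.Reg E (1 - X₁) Y₄ (-p.1) p.2), F.wt p := by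
    have := h.flip.sum_le (P := hf P)
      (S := (S.filter (fun p => F.flip.InCut E (1 - X₁) Y₄ (hf P) (-p.1) p.2)).map negFst.toEmbedding)
      (Q := (Q.filter (fun p => F.flip.Reg E (1 - X₁) Y₄ (-p.1) p.2)).map negFst.toEmbedding)
      (fun p hp => by
        obtain ⟨q, hq, rfl⟩ := Finset.mem_map.1 hp
        exact (Finset.mem_filter.1 hq).2)
      (fun x y hm hP hr => by
        rw [mem_flip] at hm
        refine Finset.mem_map.2 ⟨(-x, y), Finset.mem_filter.2 ⟨hQ _ _ hm hP, ?_⟩, by simp⟩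
        simpa using hr)
    rw [Finset.sum_map, Finset.sum_map] at this
    simpa only [Equiv.coe_toEmbedding, w1] using this
  have k2 : ∑ p ∈ S.filter (fun p => F.vflip.InCut E X₃ (1 - Y₂) (vf P) p.1 (-p.2)), F.wt p ≤
      ∑ p ∈ Q.filter (fun p => F.vflip.Reg E X₃ (1 - Y₂) p.1 (-p.2)), F.wt p := by
    have := h.vflip.sum_le (P := vf P)
      (S := (S.filter (fun p => F.vflip.InCut E X₃ (1 - Y₂) (vf P) p.1 (-p.2))).map
        negSnd.toEmbedding)
      (Q := (Q.filter (fun p => F.vflip.Reg E X₃ (1 - Y₂) p.1 (-p.2))).map negSnd.toEmbedding)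
      (fun p hp => by
        obtain ⟨q, hq, rfl⟩ := Finset.mem_map.1 hp
        exact (Finset.mem_filter.1 hq).2)
      (fun x y hm hP hr => by
        rw [mem_vflip] at hm
        refine Finset.mem_map.2 ⟨(x, -y), Finset.mem_filter.2 ⟨hQ _ _ hm hP, ?_⟩, by simp⟩
        simpa using hr)
    rw [Finset.sum_map, Finset.sum_map] at this
    simpa only [Equiv.coe_toEmbedding, w2] using this
  have k3 : ∑ p ∈ S.filter (fun p =>
      F.vflip.flip.InCut E (1 - X₃) (1 - Y₄) (hf (vf P)) (-p.1) (-p.2)), F.wt p ≤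
      ∑ p ∈ Q.filter (fun p => F.vflip.flip.Reg E (1 - X₃) (1 - Y₄) (-p.1) (-p.2)), F.wt p := by
    have := h.vflip.flip.sum_le (P := hf (vf P))
      (S := (S.filter (fun p => F.vflip.flip.InCut E (1 - X₃) (1 - Y₄) (hf (vf P)) (-p.1)
        (-p.2))).map e3.toEmbedding)
      (Q := (Q.filter (fun p => F.vflip.flip.Reg E (1 - X₃) (1 - Y₄) (-p.1) (-p.2))).map
        e3.toEmbedding)
      (fun p hp => by
        obtain ⟨q, hq, rfl⟩ := Finset.mem_map.1 hp
        exact (Finset.mem_filter.1 hq).2)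
      (fun x y hm hP hr => by
        rw [mem_flip, mem_vflip] at hm
        refine Finset.mem_map.2 ⟨(-x, -y), Finset.mem_filter.2 ⟨hQ _ _ hm hP, ?_⟩, by simp [he3]⟩
        simpa using hr)
    rw [Finset.sum_map, Finset.sum_map] at this
    simpa only [Equiv.coe_toEmbedding, w3] using this
  have l1 := add_le_add (add_le_add k0 k1) (add_le_add k2 k3)
  simp only [Finset.sum_filter, ← Finset.sum_add_distrib] at l1
  refine le_trans (Finset.sum_le_sum fun p hp => ?_) (l1.trans (Finset.sum_le_sum fun p _ => ?_))
  · exact le_ite_add _ (hS p hp)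
  · have d03 := disjoint_regs h (x := p.1) (y := p.2)
    have d12 := disjoint_regs' h (x := p.1) (y := p.2)
    have d01 : F.Reg E X₁ Y₂ p.1 p.2 → ¬ F.flip.Reg E (1 - X₁) Y₄ (-p.1) p.2 := fun a b => by
      have := a.1; have := b.1; omega
    have d02 : F.Reg E X₁ Y₂ p.1 p.2 → ¬ F.vflip.Reg E X₃ (1 - Y₂) p.1 (-p.2) := fun a b => by
      have := a.2.1; have := b.2.1; omega
    have d13 : F.flip.Reg E (1 - X₁) Y₄ (-p.1) p.2 →
        ¬ F.vflip.flip.Reg E (1 - X₃) (1 - Y₄) (-p.1) (-p.2) := fun a b => by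
      have := a.2.1; have := b.2.1; omega
    have d23 : F.vflip.Reg E X₃ (1 - Y₂) p.1 (-p.2) →
        ¬ F.vflip.flip.Reg E (1 - X₃) (1 - Y₄) (-p.1) (-p.2) := fun a b => by
      have := a.1; have := b.1; omega
    exact ite_add_le _ d01 d02 (fun a b => d03 a b) (fun a b => d12 a b) d13 d23

end
section
variable {F : Frame} {E : ℕ} {X₁ Y₂ X₃ Y₄ : ℤ} {P : ℤ → ℤ → Prop}

lemma vflip_flip (F : Frame) : F.vflip.flip = F.flip.vflip := by
  simp [vflip, Frame.flip, Frame.swap]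

/-- The number of empty rows or columns next to the side `i`. -/
noncomputable def empties (F : Frame) (E : ℕ) (P : ℤ → ℤ → Prop) : Fin 4 → ℕ :=
  ![(F.emptyRows E P).card, (F.emptyCols E P).card, (F.vflip.emptyRows E (vf P)).card,
    (F.flip.emptyCols E (hf P)).card]

/-- The result of the compression of the missing sites into the corners: `G` is a frame inside `F`
whose complement weighs at most as much as the missing sites. -/
structure Compressed (F : Frame) (E : ℕ) (P : ℤ → ℤ → Prop) (m : ℕ) (G : Frame)
    (τ : Fin 4 → ℕ) : Prop where
  valid : G.Valid
  mem : ∀ x y, G.Mem x y → F.Mem x y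
  box : G.y0 = F.y0 + τ 0 ∧ G.x0 = F.x0 + τ 1 ∧ G.y1 = F.y1 - τ 2 ∧ G.x1 = F.x1 - τ 3
  le : ∀ i, F.empties E P i ≤ τ i ∧ τ i ≤ E
  core : ∀ x y, F.Core (E + 1) x y → G.Mem x y
  weight : ∀ Q : Finset (ℤ × ℤ), (∀ x y, F.Mem x y → ¬ P x y → (x, y) ∈ Q) →
    ∑ p ∈ F.fin \ G.fin, F.wt p ≤ ∑ p ∈ Q, F.wt p
  steps : (m : ℤ) + 2 * (∑ i, F.empties E P i : ℕ) ≤ G.steps + 2 * (∑ i, τ i : ℕ)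
  slice0 : τ 0 = F.empties E P 0 → ∀ i < E, (∃ x, P x (F.y0 + i)) → ∀ S : Finset ℤ,
    (∀ x, F.x0 ≤ x → x ≤ F.x1 → P x (F.y0 + i) → x ∈ S) → G.q1 - G.p1 + 1 ≤ S.card
  slice1 : τ 1 = F.empties E P 1 → ∀ i < E, (∃ y, P (F.x0 + i) y) → ∀ S : Finset ℤ,
    (∀ y, F.y0 ≤ y → y ≤ F.y1 → P (F.x0 + i) y → y ∈ S) → G.q2 - G.p2 + 1 ≤ S.card
  slice2 : τ 2 = F.empties E P 2 → ∀ i < E, (∃ x, P x (F.y1 - i)) → ∀ S : Finset ℤ,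
    (∀ x, F.x0 ≤ x → x ≤ F.x1 → P x (F.y1 - i) → x ∈ S) → G.q3 - G.p3 + 1 ≤ S.card
  slice3 : τ 3 = F.empties E P 3 → ∀ i < E, (∃ y, P (F.x1 - i) y) → ∀ S : Finset ℤ,
    (∀ y, F.y0 ≤ y → y ≤ F.y1 → P (F.x1 - i) y → y ∈ S) → G.q4 - G.p4 + 1 ≤ S.card
  row1 : τ 1 = F.empties E P 1 → ∃ y, ∀ j < E, (∃ y, P (F.x0 + j) y) → P (F.x0 + j) y
  row3 : τ 3 = F.empties E P 3 → ∃ y, ∀ j < E, (∃ y, P (F.x1 - j) y) → P (F.x1 - j) y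

lemma Mid.exists_fits (h : F.Mid E X₁ Y₂ X₃ Y₄) (hP : ∀ x y, F.Core E x y → P x y)
    {N : Fin 4 → Finset (ℤ × ℤ)}
    (hN : ∀ i, ∀ z ∈ N i, F.x0 ≤ z.1 ∧ z.1 ≤ F.x1 ∧ F.y0 ≤ z.2 ∧ z.2 ≤ F.y1)
    (hN0 : ∀ z ∈ N 0, Notch P z.1 z.2) (hN1 : ∀ z ∈ N 1, Notch (hf P) (-z.1) z.2)
    (hN2 : ∀ z ∈ N 2, Notch (vf P) z.1 (-z.2))
    (hN3 : ∀ z ∈ N 3, Notch (hf (vf P)) (-z.1) (-z.2)) :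
    ∃ m : Fin 4 → ℕ, ∑ i, (N i).card = ∑ i, m i ∧
      F.Fits E X₁ Y₂ P (F.empties E P 0) (F.empties E P 1) (m 0) ∧
      F.flip.Fits E (1 - X₁) Y₄ (hf P) (F.empties E P 0) (F.empties E P 3) (m 1) ∧
      F.vflip.Fits E X₃ (1 - Y₂) (vf P) (F.empties E P 2) (F.empties E P 1) (m 2) ∧
      F.vflip.flip.Fits E (1 - X₃) (1 - Y₄) (hf (vf P)) (F.empties E P 2) (F.empties E P 3)
        (m 3) := by
  have hinj : Function.Injective fun z : ℤ × ℤ => (-z.1, z.2) := fun a b e => by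
    simp only [Prod.mk.injEq, neg_inj] at e; exact Prod.ext e.1 e.2
  obtain ⟨m0, m2, e1, f0, f2⟩ := h.fits_left hP (N := N 0) (N' := N 2)
    (fun z hz => ⟨hN0 z hz, (hN _ z hz).1, (hN _ z hz).2.2.1, (hN _ z hz).2.2.2⟩)
    (fun z hz => ⟨hN2 z hz, (hN _ z hz).1, (hN _ z hz).2.2.1, (hN _ z hz).2.2.2⟩)
  obtain ⟨m1, m3, e2, f1, f3⟩ := h.flip.fits_left (P := hf P) (fun x y hc => hP _ _ hc.flip)
    (N := (N 1).image fun z => (-z.1, z.2)) (N' := (N 3).image fun z => (-z.1, z.2))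
    (fun z' hz' => by
      obtain ⟨z, hz, rfl⟩ := Finset.mem_image.1 hz'
      have := hN _ z hz
      refine ⟨hN1 z hz, ?_, this.2.2.1, this.2.2.2⟩
      change -F.x1 ≤ -z.1
      omega)
    (fun z' hz' => by
      obtain ⟨z, hz, rfl⟩ := Finset.mem_image.1 hz'
      have := hN _ z hz
      refine ⟨hN3 z hz, ?_, this.2.2.1, this.2.2.2⟩
      change -F.x1 ≤ -z.1
      omega)
  rw [Finset.card_image_of_injective _ hinj, Finset.card_image_of_injective _ hinj] at e2
  rw [emptyRows_flip] at f1
  rw [← vflip_flip] at f3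
  have e3 : (F.vflip.flip.emptyRows E (vf (hf P))) = F.vflip.emptyRows E (vf P) :=
    emptyRows_flip F.vflip E (vf P)
  rw [e3] at f3
  refine ⟨![m0, m1, m2, m3], ?_, f0, f1, f2, f3⟩
  rw [Fin.sum_univ_four, Fin.sum_univ_four]
  change _ = m0 + m1 + m2 + m3
  omega

lemma Mid.slice_row (h : F.Mid E X₁ Y₂ X₃ Y₄) {i : ℕ} (hi : i < E) {x : ℤ} (hx : P x (F.y0 + i))
    {S : Finset ℤ} (hS : ∀ x, F.x0 ≤ x → x ≤ F.x1 → P x (F.y0 + i) → x ∈ S) :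
    F.x1 - F.x0 + 1 ≤ S.card +
      conj (X₁ - F.x0).toNat (F.cut E X₁ Y₂ P) (F.emptyRows E P).card +
      conj (1 - X₁ - F.flip.x0).toNat (F.flip.cut E (1 - X₁) Y₄ (hf P)) (F.emptyRows E P).card := by
  have k1 := h.le_card_row hi hx (S := S.filter (· < X₁)) fun x a b c =>
    Finset.mem_filter.2 ⟨hS x a (by have := h.bot; have := h.valid.se; omega) c, b⟩
  have k2 := h.flip.le_card_row (P := hf P) (x := -x) hi (by simpa [hf, Frame.flip] using hx)
    (S := (S.filter fun x => ¬ x < X₁).image Neg.neg) fun x a b c => by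
      refine Finset.mem_image.2 ⟨-x, Finset.mem_filter.2 ⟨hS _ ?_ ?_ c, by omega⟩, neg_neg x⟩
      · have := h.bot; have := h.valid.sw; omega
      · simp only [Frame.flip] at a; omega
  rw [Finset.card_image_of_injective _ neg_injective, emptyRows_flip] at k2
  have k3 := Finset.card_filter_add_card_filter_not (s := S) (· < X₁)
  have : F.flip.x0 = -F.x1 := rfl
  rw [this] at k2 ⊢
  omega

lemma Mid.slice_col (h : F.Mid E X₁ Y₂ X₃ Y₄) {i : ℕ} (hi : i < E) {y : ℤ} (hy : P (F.x0 + i) y)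
    {S : Finset ℤ} (hS : ∀ y, F.y0 ≤ y → y ≤ F.y1 → P (F.x0 + i) y → y ∈ S) :
    F.y1 - F.y0 + 1 ≤ S.card + F.cut E X₁ Y₂ P (F.emptyCols E P).card +
      F.vflip.cut E X₃ (1 - Y₂) (vf P) (F.emptyCols E P).card := by
  have k1 := h.le_card_col hi hy (S := S.filter (· < Y₂)) fun x a b c =>
    Finset.mem_filter.2 ⟨hS x a (by have := h.left; have := h.valid.nw; omega) c, b⟩
  have k2 := h.vflip.le_card_col (P := vf P) (y := -y) hi
    (by simpa [vf, Frame.flip, Frame.vflip, Frame.swap] using hy)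
    (S := (S.filter fun x => ¬ x < Y₂).image Neg.neg) fun x a b c => by
      refine Finset.mem_image.2 ⟨-x, Finset.mem_filter.2 ⟨hS _ ?_ ?_ c, by omega⟩, neg_neg x⟩
      · have := h.left; have := h.valid.sw; omega
      · simp only [Frame.flip, Frame.vflip, Frame.swap] at a; omega
  rw [Finset.card_image_of_injective _ neg_injective, emptyCols_vflip] at k2
  have k3 := Finset.card_filter_add_card_filter_not (s := S) (· < Y₂)
  have : F.vflip.y0 = -F.y1 := rfl
  rw [this] at k2
  omega

lemma conj_lt_or {τ W W' : ℕ} {c c' : ℕ → ℕ} (h : Antitone c) (h' : Antitone c') (hW : 0 < W)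
    (hW' : 0 < W') (e : τ = c (W - 1) ∨ τ = c' (W' - 1)) : conj W c τ < W ∨ conj W' c' τ < W' := by
  refine e.imp (fun e => ?_) (fun e => ?_) <;> by_contra hn
  · have := ((lt_conj h (W := W) (i := τ) (j := W - 1)).1 (by omega)).2
    omega
  · have := ((lt_conj h' (W := W') (i := τ) (j := W' - 1)).1 (by omega)).2
    omega

lemma lt_or_of_conj {τ W W' R R' : ℕ} {c c' : ℕ → ℕ} (h : Antitone c) (h' : Antitone c')
    (hW : τ < W) (hW' : τ < W') (hR : 0 < R) (hR' : 0 < R')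
    (e : τ = conj W c (R - 1) ∨ τ = conj W' c' (R' - 1)) : c τ < R ∨ c' τ < R' := by
  refine e.imp (fun e => ?_) (fun e => ?_) <;> by_contra hn
  · have := (lt_conj h (W := W) (i := R - 1) (j := τ)).2 ⟨hW, by omega⟩
    omega
  · have := (lt_conj h' (W := W') (i := R' - 1) (j := τ)).2 ⟨hW', by omega⟩
    omega

lemma Mid.exists_compressed (h : F.Mid E X₁ Y₂ X₃ Y₄) (hP : ∀ x y, F.Core E x y → P x y)
    {N : Fin 4 → Finset (ℤ × ℤ)}
    (hN : ∀ i, ∀ z ∈ N i, F.x0 ≤ z.1 ∧ z.1 ≤ F.x1 ∧ F.y0 ≤ z.2 ∧ z.2 ≤ F.y1)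
    (hN0 : ∀ z ∈ N 0, Notch P z.1 z.2) (hN1 : ∀ z ∈ N 1, Notch (hf P) (-z.1) z.2)
    (hN2 : ∀ z ∈ N 2, Notch (vf P) z.1 (-z.2))
    (hN3 : ∀ z ∈ N 3, Notch (hf (vf P)) (-z.1) (-z.2)) :
    ∃ G τ, F.Compressed E P (∑ i, (N i).card) G τ := by
  obtain ⟨m, hm, f0, f1, f2, f3⟩ := h.exists_fits hP hN hN0 hN1 hN2 hN3
  have hb := h.basic
  have hE := h.pos
  have hv := h.valid
  have b1 := h.bot; have b2 := h.left; have b3 := h.top; have b4 := h.right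
  have v1 := hv.sw; have v2 := hv.se; have v3 := hv.ne; have v4 := hv.nw
  have w0 : F.x0 + 8 * E < X₁ ∧ X₁ + 8 * E ≤ F.x1 ∧ F.y0 + 8 * E < Y₂ ∧ Y₂ + 8 * E ≤ F.y1 ∧
      F.y0 + 8 * E < Y₄ ∧ Y₄ + 8 * E ≤ F.y1 ∧ F.x0 + 8 * E < X₃ ∧ X₃ + 8 * E ≤ F.x1 := by
    clear * - hb b1 b2 b3 b4 v1 v2 v3 v4 hE
    omega
  set W0 := (X₁ - F.x0).toNat with hW0
  set R0 := (Y₂ - F.y0).toNat with hR0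
  set W1 := (1 - X₁ - F.flip.x0).toNat with hW1
  set R1 := (Y₄ - F.flip.y0).toNat with hR1
  set W2 := (X₃ - F.vflip.x0).toNat with hW2
  set R2 := (1 - Y₂ - F.vflip.y0).toNat with hR2
  set W3 := (1 - X₃ - F.vflip.flip.x0).toNat with hW3
  set R3 := (1 - Y₄ - F.vflip.flip.y0).toNat with hR3
  have eW1 : (W1 : ℤ) = F.x1 - X₁ + 1 := by simp only [hW1, Frame.flip]; omega
  have eR1 : (R1 : ℤ) = Y₄ - F.y0 := by simp only [hR1, Frame.flip]; omega
  have eW2 : (W2 : ℤ) = X₃ - F.x0 := by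
    simp only [hW2, Frame.vflip, Frame.flip, Frame.swap]; omega
  have eR2 : (R2 : ℤ) = F.y1 - Y₂ + 1 := by
    simp only [hR2, Frame.vflip, Frame.flip, Frame.swap]; omega
  have eW3 : (W3 : ℤ) = F.x1 - X₃ + 1 := by
    simp only [hW3, Frame.vflip, Frame.flip, Frame.swap]; omega
  have eR3 : (R3 : ℤ) = F.y1 - Y₄ + 1 := by
    simp only [hR3, Frame.vflip, Frame.flip, Frame.swap]; omega
  set c0 := F.cut E X₁ Y₂ P with hc0
  set c1 := F.flip.cut E (1 - X₁) Y₄ (hf P) with hc1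
  set c2 := F.vflip.cut E X₃ (1 - Y₂) (vf P) with hc2
  set c3 := F.vflip.flip.cut E (1 - X₃) (1 - Y₄) (hf (vf P)) with hc3
  set t := F.empties E P
  obtain ⟨τ₁, u10, u11, u12⟩ : ∃ τ, τ ≤ c0 (W0 - 1) ∧ τ ≤ c1 (W1 - 1) ∧
      (τ = c0 (W0 - 1) ∨ τ = c1 (W1 - 1)) := ⟨min _ _, min_le_left _ _, min_le_right _ _, min_choice _ _⟩
  obtain ⟨τ₂, u20, u21, u22⟩ : ∃ τ, τ ≤ conj W0 c0 (R0 - 1) ∧ τ ≤ conj W2 c2 (R2 - 1) ∧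
      (τ = conj W0 c0 (R0 - 1) ∨ τ = conj W2 c2 (R2 - 1)) :=
    ⟨min _ _, min_le_left _ _, min_le_right _ _, min_choice _ _⟩
  obtain ⟨τ₃, u30, u31, u32⟩ : ∃ τ, τ ≤ c2 (W2 - 1) ∧ τ ≤ c3 (W3 - 1) ∧
      (τ = c2 (W2 - 1) ∨ τ = c3 (W3 - 1)) := ⟨min _ _, min_le_left _ _, min_le_right _ _, min_choice _ _⟩
  obtain ⟨τ₄, u40, u41, u42⟩ : ∃ τ, τ ≤ conj W1 c1 (R1 - 1) ∧ τ ≤ conj W3 c3 (R3 - 1) ∧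
      (τ = conj W1 c1 (R1 - 1) ∨ τ = conj W3 c3 (R3 - 1)) :=
    ⟨min _ _, min_le_left _ _, min_le_right _ _, min_choice _ _⟩
  have t10 : t 0 ≤ τ₁ := by
    rcases u12 with e | e <;> rw [e]; exacts [f0.2.1, f1.2.1]
  have t20 : t 1 ≤ τ₂ := by
    rcases u22 with e | e <;> rw [e]; exacts [f0.2.2.1, f2.2.2.1]
  have t30 : t 2 ≤ τ₃ := by
    rcases u32 with e | e <;> rw [e]; exacts [f2.2.1, f3.2.1]
  have t40 : t 3 ≤ τ₄ := by
    rcases u42 with e | e <;> rw [e]; exacts [f1.2.2.1, f3.2.2.1]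
  have K0 := h.cornerData f0 u10 u20
  have K1 := h.flip.cornerData f1 u11 u40
  have K2 := h.vflip.cornerData f2 u30 u21
  have K3 := h.vflip.flip.cornerData f3 u31 u41
  rw [← hW0, ← hR0, ← hc0] at K0
  rw [← hW1, ← hR1, ← hc1] at K1
  rw [← hW2, ← hR2, ← hc2] at K2
  rw [← hW3, ← hR3, ← hc3] at K3
  have hlarge : (E < W0 ∧ E < R0) ∧ (E < W1 ∧ E < R1) ∧ (E < W2 ∧ E < R2) ∧ (E < W3 ∧ E < R3) := by
    clear * - w0 eW1 eW2 eW3 eR1 eR2 eR3 hW0 hR0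
    omega
  obtain ⟨⟨lW0, lR0⟩, ⟨lW1, lR1⟩, ⟨lW2, lR2⟩, lW3, lR3⟩ := hlarge
  have eW0 : (W0 : ℤ) = X₁ - F.x0 := by clear * - w0 hW0; omega
  have eR0 : (R0 : ℤ) = Y₂ - F.y0 := by clear * - w0 hR0; omega
  have k0 := K0.num lW0
  have k1 := K1.num lW1
  have k2 := K2.num lW2
  have k3 := K3.num lW3
  have z2 : ∀ a b : ℤ, -a - -b = b - a := fun a b => by ring
  have z3 : ∀ a b c : ℤ, a - b - -c = a - b + c := fun a b c => by ring
  rw [eW0, eR0] at k0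
  rw [eW1, eR1] at k1
  rw [eW2, eR2] at k2
  rw [eW3, eR3] at k3
  simp only [Frame.flip, z2] at k1
  rw [show F.x1 - F.d2 - F.y0 = F.x1 - F.y0 - F.d2 by ring] at k1
  simp only [Frame.flip, Frame.vflip, Frame.swap, neg_neg, z3, z2] at k2
  simp only [Frame.flip, Frame.vflip, Frame.swap, neg_neg, z2] at k3
  rw [show F.x1 - F.s2 - -F.y1 = F.x1 + F.y1 - F.s2 by ring] at k3
  have e1 := conj_lt_or K0.anti K1.anti (by omega) (by omega) u12
  have e3 := conj_lt_or K2.anti K3.anti (by omega) (by omega) u32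
  have e2 := lt_or_of_conj K0.anti K2.anti (k0.le_E.2.trans_lt lW0) (k0.le_E.2.trans_lt lW2)
    (by omega) (by omega) u22
  have e4 := lt_or_of_conj K1.anti K3.anti (k1.le_E.2.trans_lt lW1) (k1.le_E.2.trans_lt lW3)
    (by omega) (by omega) u42
  set G := F.inset τ₁ τ₂ τ₃ τ₄ ![t 0 + t 1 + m 0, t 0 + t 3 + m 1, t 2 + t 1 + m 2, t 2 + t 3 + m 3]
    ![conj W0 c0 τ₁, conj W1 c1 τ₁, conj W2 c2 τ₃, conj W3 c3 τ₃] ![c0 τ₂, c1 τ₄, c2 τ₂, c3 τ₄]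
    with hG
  obtain ⟨g1, g2⟩ := h.inset_valid (n := ![t 0 + t 1 + m 0, t 0 + t 3 + m 1, t 2 + t 1 + m 2, t 2 + t 3 + m 3])
    (a := ![conj W0 c0 τ₁, conj W1 c1 τ₁, conj W2 c2 τ₃, conj W3 c3 τ₃])
    (b := ![c0 τ₂, c1 τ₄, c2 τ₂, c3 τ₄]) k0 k1 k2 k3 (by rw [← eW0, ← eW1]; exact_mod_cast e1)
    (by rw [← eR0, ← eR2]; exact_mod_cast e2) (by rw [← eW2, ← eW3]; exact_mod_cast e3)
    (by rw [← eR1, ← eR3]; exact_mod_cast e4)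
  refine ⟨G, ![τ₁, τ₂, τ₃, τ₄], g1, g2, ⟨rfl, rfl, rfl, rfl⟩, ?_, ?_, ?_, ?_, ?_, ?_, ?_, ?_, ?_, ?_⟩
  · intro i
    fin_cases i
    exacts [⟨t10, k0.le_E.1⟩, ⟨t20, k0.le_E.2⟩, ⟨t30, k2.le_E.1⟩, ⟨t40, k1.le_E.2⟩]
  · intro x y hc
    have l0 := k0.n_le; have l1 := k1.n_le; have l2 := k2.n_le; have l3 := k3.n_le
    have E0 := k0.le_E; have E1 := k3.le_E
    unfold Frame.Core at hc
    rw [hG]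
    clear * - l0 l1 l2 l3 E0 E1 hc v1 v2 v3 v4
    unfold Frame.Mem
    simp only [ inset, Matrix.cons_val_zero, Matrix.cons_val_one, Matrix.cons_val]
    omega
  · intro Q hQ
    refine h.weight_le (fun p hp => ?_) hQ
    rw [Finset.mem_sdiff, mem_fin, mem_fin] at hp
    obtain ⟨x, y⟩ := p
    obtain ⟨hm1, hm2⟩ := hp
    by_contra! hn
    refine hm2 ?_
    have nW : t 0 + t 1 + m 0 ≤ W0 ∧ t 0 + t 3 + m 1 ≤ W1 ∧ t 2 + t 1 + m 2 ≤ W2 ∧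
        t 2 + t 3 + m 3 ≤ W3 := by
      have l0 := k0.n_le; have l1 := k1.n_le; have l2 := k2.n_le; have l3 := k3.n_le
      clear * - l0 l1 l2 l3 hb eW0 eW1 eW2 eW3
      omega
    have C0 := K0.constraint hW0 hR0 lW0 lR0 nW.1 hn.1 hm1.1.1 hm1.1.2.2.1
    have C1 := K1.constraint hW1 hR1 lW1 lR1 nW.2.1 hn.2.1 (neg_le_neg hm1.1.2.1) hm1.1.2.2.1
    have C2 := K2.constraint hW2 hR2 lW2 lR2 nW.2.2.1 hn.2.2.1 hm1.1.1 (neg_le_neg hm1.1.2.2.2)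
    have C3 := K3.constraint hW3 hR3 lW3 lR3 nW.2.2.2 hn.2.2.2 (neg_le_neg hm1.1.2.1)
      (neg_le_neg hm1.1.2.2.2)
    rw [← hc0] at C0
    rw [← hc1] at C1
    rw [← hc2] at C2
    rw [← hc3] at C3
    simp only [Frame.flip, Frame.vflip, Frame.swap, neg_neg] at C1 C2 C3
    have hm' := hm1
    clear hn hm2 hQ
    clear_value W0 W1 W2 W3 R0 R1 R2 R3 c0 c1 c2 c3 t
    have E0 := k0.le_E; have E1 := k3.le_E
    unfold Frame.Mem
    simp only [hG, inset, Matrix.cons_val_zero, Matrix.cons_val_one, Matrix.cons_val]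
    obtain ⟨mm1, mm2, -⟩ := hm'
    clear * - mm1 mm2 C0 C1 C2 C3 E0 E1
    obtain ⟨A1, A2, A3, A4, A5⟩ := C0
    obtain ⟨B1, B2, B3, B4, B5⟩ := C1
    obtain ⟨D1, D2, D3, D4, D5⟩ := C3
    obtain ⟨C1, C2, C3, C4, C5⟩ := C2
    have a1 : F.x0 + τ₂ ≤ x := by clear * - A1 C1; omega
    have a2 : F.y0 + τ₁ ≤ y := by clear * - A2 B2; omega
    have a3 : x ≤ F.x1 - τ₄ := by clear * - B1 D1; omega
    have a4 : y ≤ F.y1 - τ₃ := by clear * - C2 D2; omega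
    have A3 := A3 a1 a2
    have B3 := B3 (by clear * - a3; omega) a2
    have C3 := C3 a1 (by clear * - a4; omega)
    have D3 := D3 (by clear * - a3; omega) (by clear * - a4; omega)
    refine ⟨⟨a1, a3, a2, a4⟩, ⟨?_, ?_, ?_, ?_⟩, fun e => ⟨?_, ?_⟩, fun e => ⟨?_, ?_⟩, fun e => ⟨?_, ?_⟩,
      fun e => ⟨?_, ?_⟩⟩
    · clear * - mm2 A3 a1 a2; push_cast at *; omega
    · clear * - mm2 D3 a3 a4; push_cast at *; omega
    · clear * - mm2 C3 a1 a4; push_cast at *; omega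
    · clear * - mm2 B3 a3 a2; push_cast at *; omega
    · exact A4 e
    · have := B4 e; clear * - this; omega
    · exact A5 e
    · have := C5 e; clear * - this; omega
    · exact C4 (by clear * - e; omega)
    · have := D4 (by clear * - e; omega); clear * - this; omega
    · exact B5 (by clear * - e; omega)
    · have := D5 (by clear * - e; omega); clear * - this; omega
  · rw [hm, Fin.sum_univ_four, Fin.sum_univ_four, Fin.sum_univ_four]
    simp only [hG, inset, Frame.steps]
    simp only [Matrix.cons_val_zero, Matrix.cons_val_one, Matrix.cons_val]
    clear * -
    push_cast
    have y1 := (le_max_right F.s1 (F.x0 + F.y0 + ((t 0 + t 1 + m 0 : ℕ) : ℤ))).trans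
      (le_max_left _ (F.x0 + τ₂ + F.y0 + τ₁))
    have y2 := (min_le_left (min F.s2 (F.x1 + F.y1 - ((t 2 + t 3 + m 3 : ℕ) : ℤ)))
      (F.x1 - τ₄ + F.y1 - τ₃)).trans (min_le_right _ _)
    have y3 := (le_max_right F.d1 (F.x0 - F.y1 + ((t 2 + t 1 + m 2 : ℕ) : ℤ))).trans
      (le_max_left _ (F.x0 + τ₂ - F.y1 + τ₃))
    have y4 := (min_le_left (min F.d2 (F.x1 - F.y0 - ((t 0 + t 3 + m 1 : ℕ) : ℤ)))
      (F.x1 - τ₄ - F.y0 - τ₁)).trans (min_le_right _ _)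
    push_cast at y1 y2 y3 y4
    linarith
  · rintro (e : τ₁ = t 0) i hi ⟨x, hx⟩ S hS
    have := h.slice_row hi hx hS
    change F.x1 - ((conj W1 c1 τ₁ : ℕ) : ℤ) - (F.x0 + (conj W0 c0 τ₁ : ℕ)) + 1 ≤ _
    rw [e]
    change _ ≤ (S.card : ℤ) + (conj W0 c0 (t 0) : ℕ) + (conj W1 c1 (t 0) : ℕ) at this
    linarith
  · rintro (e : τ₂ = t 1) i hi ⟨x, hx⟩ S hS
    have := h.slice_col hi hx hS
    change F.y1 - ((c2 τ₂ : ℕ) : ℤ) - (F.y0 + (c0 τ₂ : ℕ)) + 1 ≤ _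
    rw [e]
    change _ ≤ (S.card : ℤ) + (c0 (t 1) : ℕ) + (c2 (t 1) : ℕ) at this
    linarith
  · rintro (e : τ₃ = t 2) i hi ⟨x, hx⟩ S hS
    have := h.vflip.slice_row (P := vf P) (S := S) (x := x) hi (by
      simp only [Frame.vflip, Frame.flip, Frame.swap, vf]
      rwa [show -(-F.y1 + (i : ℤ)) = F.y1 - i by ring])
      (fun x a b c => hS x a b (by
        simp only [Frame.vflip, Frame.flip, Frame.swap, vf] at c
        rwa [show -(-F.y1 + (i : ℤ)) = F.y1 - i by ring] at c))
    change F.x1 - ((conj W3 c3 τ₃ : ℕ) : ℤ) - (F.x0 + (conj W2 c2 τ₃ : ℕ)) + 1 ≤ _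
    rw [e]
    change F.x1 - F.x0 + 1 ≤ (S.card : ℤ) + (conj W2 c2 (t 2) : ℕ) + (conj W3 c3 (t 2) : ℕ) at this
    linarith
  · rintro (e : τ₄ = t 3) i hi ⟨y, hy⟩ S hS
    have := h.flip.slice_col (P := hf P) (S := S) (y := y) hi (by
      simp only [Frame.flip, hf]
      rwa [show -(-F.x1 + (i : ℤ)) = F.x1 - i by ring])
      (fun x a b c => hS x a b (by
        simp only [Frame.flip, hf] at c
        rwa [show -(-F.x1 + (i : ℤ)) = F.x1 - i by ring] at c))
    rw [← vflip_flip] at this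
    change F.y1 - ((c3 τ₄ : ℕ) : ℤ) - (F.y0 + (c1 τ₄ : ℕ)) + 1 ≤ _
    rw [e]
    change F.y1 - F.y0 + 1 ≤ (S.card : ℤ) + (c1 (t 3) : ℕ) + (c3 (t 3) : ℕ) at this
    linarith
  · rintro (e : τ₂ = t 1)
    rw [e] at e2
    have ne : ∀ j < E, (∃ y, P (F.x0 + j) y) → j ∉ F.emptyCols E P :=
      fun j hj ⟨y, hy⟩ hc => (mem_emptyCols.1 hc).2 y hy
    rcases e2 with e2 | e2
    · obtain ⟨y, -, -, hy⟩ := h.exists_row (P := P) e2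
      exact ⟨y, fun j hj hn => hy j hj (ne j hj hn)⟩
    · obtain ⟨y, -, -, hy⟩ := h.vflip.exists_row (P := vf P) (by rw [emptyCols_vflip]; exact e2)
      refine ⟨-y, fun j hj hn => hy j hj ?_⟩
      rw [emptyCols_vflip]
      exact ne j hj hn
  · rintro (e : τ₄ = t 3)
    rw [e] at e4
    have ne : ∀ j < E, (∃ y, P (F.x1 - j) y) → j ∉ F.flip.emptyCols E (hf P) :=
      fun j hj ⟨y, hy⟩ hc => (mem_emptyCols.1 hc).2 y (by
        simp only [Frame.flip, hf]
        rwa [show -(-F.x1 + (j : ℤ)) = F.x1 - j by ring])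
    have key : ∀ j : ℕ, ∀ y, hf P (F.flip.x0 + j) y → P (F.x1 - j) y := fun j y hy => by
      simp only [Frame.flip, hf] at hy
      rwa [show -(-F.x1 + (j : ℤ)) = F.x1 - j by ring] at hy
    rcases e4 with e4 | e4
    · obtain ⟨y, -, -, hy⟩ := h.flip.exists_row (P := hf P) e4
      exact ⟨y, fun j hj hn => key j y (hy j hj (ne j hj hn))⟩
    · rw [hc3, hR3, vflip_flip] at e4
      obtain ⟨y, -, -, hy⟩ := h.flip.vflip.exists_row (P := vf (hf P)) (by
        rw [emptyCols_vflip]; exact e4)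
      refine ⟨-y, fun j hj hn => key j _ (hy j hj ?_)⟩
      rw [emptyCols_vflip]
      exact ne j hj hn

end
end Frame

/-- The sites of the complement of `I` at a corner of `I`, sorted by the position of the corner
(lower left, lower right, upper left, upper right). -/
def NotchAt (I : Finset (ℤ × ℤ)) (i : Fin 4) (z : ℤ × ℤ) : Prop :=
  match i with
  | 0 => Notch (fun x y => (x, y) ∈ I) z.1 z.2
  | 1 => Notch (hf fun x y => (x, y) ∈ I) (-z.1) z.2
  | 2 => Notch (vf fun x y => (x, y) ∈ I) z.1 (-z.2)
  | 3 => Notch (hf (vf fun x y => (x, y) ∈ I)) (-z.1) (-z.2)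

lemma notchAt_zero {I : Finset (ℤ × ℤ)} {x y : ℤ} : NotchAt I 0 (x, y) ↔
    (x + 1, y) ∈ I ∧ (x, y + 1) ∈ I ∧ (∀ x' ≤ x, (x', y) ∉ I) ∧ ∀ y' ≤ y, (x, y') ∉ I := Iff.rfl

lemma notchAt_one {I : Finset (ℤ × ℤ)} {x y : ℤ} : NotchAt I 1 (x, y) ↔
    (x - 1, y) ∈ I ∧ (x, y + 1) ∈ I ∧ (∀ x', x ≤ x' → (x', y) ∉ I) ∧ ∀ y' ≤ y, (x, y') ∉ I := by
  unfold NotchAt Notch hf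
  simp only [neg_neg, neg_add_rev]
  rw [show -1 + x = x - 1 by ring]
  refine and_congr_right fun _ => and_congr_right fun _ => and_congr_left fun _ => ?_
  exact ⟨fun h x' hx => by have := h (-x') (by omega); rwa [neg_neg] at this,
    fun h x' hx => h (-x') (by omega)⟩

lemma notchAt_two {I : Finset (ℤ × ℤ)} {x y : ℤ} : NotchAt I 2 (x, y) ↔
    (x + 1, y) ∈ I ∧ (x, y - 1) ∈ I ∧ (∀ x' ≤ x, (x', y) ∉ I) ∧ ∀ y', y ≤ y' → (x, y') ∉ I := by
  unfold NotchAt Notch vf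
  simp only [neg_neg, neg_add_rev]
  rw [show -1 + y = y - 1 by ring]
  refine and_congr_right fun _ => and_congr_right fun _ => and_congr_right fun _ => ?_
  exact ⟨fun h x' hx => by have := h (-x') (by omega); rwa [neg_neg] at this,
    fun h x' hx => h (-x') (by omega)⟩

lemma notchAt_three {I : Finset (ℤ × ℤ)} {x y : ℤ} : NotchAt I 3 (x, y) ↔
    (x - 1, y) ∈ I ∧ (x, y - 1) ∈ I ∧ (∀ x', x ≤ x' → (x', y) ∉ I) ∧
      ∀ y', y ≤ y' → (x, y') ∉ I := by
  unfold NotchAt Notch vf hf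
  simp only [neg_neg, neg_add_rev]
  rw [show -1 + y = y - 1 by ring, show -1 + x = x - 1 by ring]
  refine and_congr_right fun _ => and_congr_right fun _ => and_congr ?_ ?_
  · exact ⟨fun h x' hx => by have := h (-x') (by omega); rwa [neg_neg] at this,
      fun h x' hx => h (-x') (by omega)⟩
  · exact ⟨fun h x' hx => by have := h (-x') (by omega); rwa [neg_neg] at this,
      fun h x' hx => h (-x') (by omega)⟩

lemma NotchAt.notMem {I : Finset (ℤ × ℤ)} {i : Fin 4} {z : ℤ × ℤ} (h : NotchAt I i z) : z ∉ I := by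
  obtain ⟨x, y⟩ := z
  fin_cases i
  · exact (notchAt_zero.1 h).2.2.1 x le_rfl
  · exact (notchAt_one.1 h).2.2.1 x le_rfl
  · exact (notchAt_two.1 h).2.2.1 x le_rfl
  · exact (notchAt_three.1 h).2.2.1 x le_rfl

/-- A notch has a neighbour in the set in its row and in its column. -/
lemma NotchAt.exists_nbr {I : Finset (ℤ × ℤ)} {i : Fin 4} {x y : ℤ} (h : NotchAt I i (x, y)) :
    ((x + 1, y) ∈ I ∨ (x - 1, y) ∈ I) ∧ ((x, y + 1) ∈ I ∨ (x, y - 1) ∈ I) := by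
  fin_cases i
  · exact ⟨.inl (notchAt_zero.1 h).1, .inl (notchAt_zero.1 h).2.1⟩
  · exact ⟨.inr (notchAt_one.1 h).1, .inl (notchAt_one.1 h).2.1⟩
  · exact ⟨.inl (notchAt_two.1 h).1, .inr (notchAt_two.1 h).2.1⟩
  · exact ⟨.inr (notchAt_three.1 h).1, .inr (notchAt_three.1 h).2.1⟩

lemma exists_notchAt_of_dbl {I Z : Finset (ℤ × ℤ)} {z : ℤ × ℤ} (hz : z ∈ dbl I Z) :
    ∃ i, NotchAt I i z := by
  obtain ⟨x, y⟩ := z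
  have hz := (Finset.mem_filter.1 hz).2
  simp only [mem_cov, mem_most0, mem_most1, mem_most2, mem_most3] at hz
  simp only [dir, Matrix.cons_val_zero, Matrix.cons_val_one, Matrix.cons_val, Prod.mk_add_mk,
    add_zero, ← sub_eq_add_neg] at hz
  obtain ⟨h1, h2⟩ := hz
  rcases h1 with ⟨-, h1, h1'⟩ | ⟨-, h1, h1'⟩ <;> rcases h2 with ⟨-, h2, h2'⟩ | ⟨-, h2, h2'⟩
  · exact ⟨0, notchAt_zero.2 ⟨h1, h2, fun x' hx hm => by have := h1' _ hm rfl; simp only at this; omega,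
      fun x' hx hm => by have := h2' _ hm rfl; simp only at this; omega⟩⟩
  · exact ⟨2, notchAt_two.2 ⟨h1, h2, fun x' hx hm => by have := h1' _ hm rfl; simp only at this; omega,
      fun x' hx hm => by have := h2' _ hm rfl; simp only at this; omega⟩⟩
  · exact ⟨1, notchAt_one.2 ⟨h1, h2, fun x' hx hm => by have := h1' _ hm rfl; simp only at this; omega,
      fun x' hx hm => by have := h2' _ hm rfl; simp only at this; omega⟩⟩
  · exact ⟨3, notchAt_three.2 ⟨h1, h2, fun x' hx hm => by have := h1' _ hm rfl; simp only at this; omega,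
      fun x' hx hm => by have := h2' _ hm rfl; simp only at this; omega⟩⟩

lemma exists_notchAt_of_ocr {I : Finset (ℤ × ℤ)} (hI : IsStaircase (↑I : Set (ℤ × ℤ))) {z : ℤ × ℤ}
    (hz : z ∈ ocr I) : ∃ i, NotchAt I i z := by
  have hH := hI.row
  have hV := hI.col
  obtain ⟨x, y⟩ := z
  obtain ⟨h0, h1, h2⟩ := mem_ocr.1 hz
  simp only [Prod.mk_add_mk, Prod.mk_sub_mk, add_zero, sub_zero] at h1 h2
  rcases h1 with h1 | h1 <;> rcases h2 with h2 | h2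
  · exact ⟨0, notchAt_zero.2 ⟨h1, h2, fun x' hx hm => h0 (hH x' x (x + 1) y hx (by omega) hm h1),
      fun y' hy hm => h0 (hV x y' y (y + 1) hy (by omega) hm h2)⟩⟩
  · exact ⟨2, notchAt_two.2 ⟨h1, h2, fun x' hx hm => h0 (hH x' x (x + 1) y hx (by omega) hm h1),
      fun y' hy hm => h0 (hV x (y - 1) y y' (by omega) hy h2 hm)⟩⟩
  · exact ⟨1, notchAt_one.2 ⟨h1, h2, fun x' hx hm => h0 (hH (x - 1) x x' y (by omega) hx h1 hm),
      fun y' hy hm => h0 (hV x y' y (y + 1) hy (by omega) hm h2)⟩⟩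
  · exact ⟨3, notchAt_three.2 ⟨h1, h2, fun x' hx hm => h0 (hH (x - 1) x x' y (by omega) hx h1 hm),
      fun y' hy hm => h0 (hV x (y - 1) y y' (by omega) hy h2 hm)⟩⟩

open Classical in
/-- The sites of `Z` at the corners of `I` of a given type. -/
noncomputable def notches (I Z : Finset (ℤ × ℤ)) (i : Fin 4) : Finset (ℤ × ℤ) :=
  Z.filter fun z => NotchAt I i z

lemma mem_notches {I Z : Finset (ℤ × ℤ)} {i : Fin 4} {z : ℤ × ℤ} :
    z ∈ notches I Z i ↔ z ∈ Z ∧ NotchAt I i z := by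
  classical
  unfold notches; rw [Finset.mem_filter]

lemma card_le_sum_notches {I Z : Finset (ℤ × ℤ)} (h : ∀ z ∈ Z, ∃ i, NotchAt I i z) :
    Z.card ≤ ∑ i, (notches I Z i).card := by
  classical
  refine (Finset.card_le_card (t := Finset.univ.biUnion (notches I Z)) fun z hz => ?_).trans
    Finset.card_biUnion_le
  obtain ⟨i, hi⟩ := h z hz
  exact Finset.mem_biUnion.2 ⟨i, Finset.mem_univ _, mem_notches.2 ⟨hz, hi⟩⟩

lemma card_most (I : Finset (ℤ × ℤ)) :
    (most I 0).card = (I.image Prod.fst).card ∧ (most I 1).card = (I.image Prod.snd).card ∧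
    (most I 2).card = (I.image Prod.fst).card ∧ (most I 3).card = (I.image Prod.snd).card := by
  have key : ∀ (T : Finset (ℤ × ℤ)) (f : ℤ × ℤ → ℤ), T ⊆ I → (∀ p ∈ T, ∀ q ∈ T, f p = f q → p = q) →
      (∀ p ∈ I, ∃ q ∈ T, f q = f p) → T.card = (I.image f).card := by
    intro T f h1 h2 h3
    rw [← Finset.card_image_of_injOn (f := f) (s := T) fun p hp q hq e => h2 p hp q hq e]
    congr 1
    ext a
    simp only [Finset.mem_image]
    exact ⟨fun ⟨p, hp, e⟩ => ⟨p, h1 hp, e⟩, fun ⟨p, hp, e⟩ => by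
      obtain ⟨q, hq, e'⟩ := h3 p hp
      exact ⟨q, hq, e'.trans e⟩⟩
  refine ⟨key _ _ (most_subset I 0) (fun p hp q hq e => ?_) (fun p hp => ?_),
    key _ _ (most_subset I 1) (fun p hp q hq e => ?_) (fun p hp => ?_),
    key _ _ (most_subset I 2) (fun p hp q hq e => ?_) (fun p hp => ?_),
    key _ _ (most_subset I 3) (fun p hp q hq e => ?_) (fun p hp => ?_)⟩
  · rw [mem_most0] at hp hq
    exact Prod.ext e (le_antisymm (hp.2 q hq.1 e.symm) (hq.2 p hp.1 e))
  · obtain ⟨q, hq, hm⟩ := (I.filter fun q => q.1 = p.1).exists_min_image (fun q => q.2)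
      ⟨p, Finset.mem_filter.2 ⟨hp, rfl⟩⟩
    rw [Finset.mem_filter] at hq
    exact ⟨q, mem_most0.2 ⟨hq.1, fun r hr e => hm r (Finset.mem_filter.2 ⟨hr, e.trans hq.2⟩)⟩, hq.2⟩
  · rw [mem_most1] at hp hq
    exact Prod.ext (le_antisymm (hp.2 q hq.1 e.symm) (hq.2 p hp.1 e)) e
  · obtain ⟨q, hq, hm⟩ := (I.filter fun q => q.2 = p.2).exists_min_image (fun q => q.1)
      ⟨p, Finset.mem_filter.2 ⟨hp, rfl⟩⟩
    rw [Finset.mem_filter] at hq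
    exact ⟨q, mem_most1.2 ⟨hq.1, fun r hr e => hm r (Finset.mem_filter.2 ⟨hr, e.trans hq.2⟩)⟩, hq.2⟩
  · rw [mem_most2] at hp hq
    exact Prod.ext e (le_antisymm (hq.2 p hp.1 e) (hp.2 q hq.1 e.symm))
  · obtain ⟨q, hq, hm⟩ := (I.filter fun q => q.1 = p.1).exists_max_image (fun q => q.2)
      ⟨p, Finset.mem_filter.2 ⟨hp, rfl⟩⟩
    rw [Finset.mem_filter] at hq
    exact ⟨q, mem_most2.2 ⟨hq.1, fun r hr e => hm r (Finset.mem_filter.2 ⟨hr, e.trans hq.2⟩)⟩, hq.2⟩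
  · rw [mem_most3] at hp hq
    exact Prod.ext (le_antisymm (hq.2 p hp.1 e) (hp.2 q hq.1 e.symm)) e
  · obtain ⟨q, hq, hm⟩ := (I.filter fun q => q.2 = p.2).exists_max_image (fun q => q.1)
      ⟨p, Finset.mem_filter.2 ⟨hp, rfl⟩⟩
    rw [Finset.mem_filter] at hq
    exact ⟨q, mem_most3.2 ⟨hq.1, fun r hr e => hm r (Finset.mem_filter.2 ⟨hr, e.trans hq.2⟩)⟩, hq.2⟩

lemma sides_eq_image (I : Finset (ℤ × ℤ)) :
    sides I = 2 * (I.image Prod.fst).card + 2 * (I.image Prod.snd).card := by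
  obtain ⟨h0, h1, h2, h3⟩ := card_most I
  rw [sides_eq, h0, h1, h2, h3]
  ring

namespace Frame
section
variable {F : Frame} {E : ℕ} {X₁ Y₂ X₃ Y₄ : ℤ}

lemma Mid.mono {E' : ℕ} (h : F.Mid E X₁ Y₂ X₃ Y₄) (h4 : 4 ≤ E') (hE : E' ≤ E) :
    F.Mid E' X₁ Y₂ X₃ Y₄ := by
  obtain ⟨h1, h2, h3, h5, h6, h7⟩ := h
  exact ⟨h1, h4, by omega, by omega, by omega, by omega⟩

lemma Core.mono {E' : ℕ} {x y : ℤ} (h : F.Core E x y) (hE : E' ≤ E) : F.Core E' x y := by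
  unfold Core at *; omega

/-- Two consecutive rows have core sites in a common column. -/
lemma Mid.exists_core_row (h : F.Mid E X₁ Y₂ X₃ Y₄) {y : ℤ} (h1 : F.y0 + E ≤ y)
    (h2 : y + 1 ≤ F.y1 - E) : ∃ x, F.Core E x y ∧ F.Core E x (y + 1) := by
  have hb := h.basic
  have v1 := h.valid.sw; have v2 := h.valid.se; have v3 := h.valid.ne; have v4 := h.valid.nw
  have b1 := h.bot; have b2 := h.left; have b3 := h.top; have b4 := h.right
  have hE := h.pos
  refine ⟨max (max (F.x0 + E) (F.s1 + 2 * E - y)) (F.d1 + 2 * E + y + 1), ?_, ?_⟩ <;>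
    unfold Core <;> clear * - hb v1 v2 v3 v4 b1 b2 b3 b4 hE h1 h2 <;>
    refine ⟨⟨?_, ?_, ?_, ?_⟩, ?_, ?_, ?_, ?_⟩ <;> omega

lemma Mid.exists_core_col (h : F.Mid E X₁ Y₂ X₃ Y₄) {x : ℤ} (h1 : F.x0 + E ≤ x)
    (h2 : x + 1 ≤ F.x1 - E) : ∃ y, F.Core E x y ∧ F.Core E (x + 1) y := by
  obtain ⟨y, a, b⟩ := h.swap.exists_core_row (y := x) h1 h2
  exact ⟨y, a.swap, b.swap⟩

lemma Mid.core_row (h : F.Mid E X₁ Y₂ X₃ Y₄) {y : ℤ} (h1 : F.y0 + E ≤ y) (h2 : y ≤ F.y1 - E) :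
    ∃ x, F.Core E x y := by
  have v1 := h.valid.sw; have v4 := h.valid.nw; have b2 := h.left; have hE := h.pos
  rcases h2.lt_or_eq with h3 | h3
  · obtain ⟨x, hx, -⟩ := h.exists_core_row h1 (by omega)
    exact ⟨x, hx⟩
  · obtain ⟨x, -, hx⟩ := h.exists_core_row (y := y - 1) (by omega) (by omega)
    exact ⟨x, by rwa [sub_add_cancel] at hx⟩

lemma Mid.core_col (h : F.Mid E X₁ Y₂ X₃ Y₄) {x : ℤ} (h1 : F.x0 + E ≤ x) (h2 : x ≤ F.x1 - E) :
    ∃ y, F.Core E x y := by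
  obtain ⟨y, hy⟩ := h.swap.core_row (y := x) h1 h2
  exact ⟨y, hy.swap⟩

/-- There are not many more corner sites than diagonal steps. -/
lemma Mid.card_notches_le (h : F.Mid E X₁ Y₂ X₃ Y₄) {I Z : Finset (ℤ × ℤ)}
    (hI : ∀ x y, F.Core E x y → (x, y) ∈ I)
    (hZ : ∀ z ∈ Z, F.x0 ≤ z.1 ∧ z.1 ≤ F.x1 ∧ F.y0 ≤ z.2 ∧ z.2 ≤ F.y1) :
    (∑ i, (notches I Z i).card : ℤ) ≤ F.steps + 8 * E := by
  obtain ⟨m, hm, f0, f1, f2, f3⟩ := h.exists_fits (P := fun x y => (x, y) ∈ I) hI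
    (N := notches I Z) (fun i z hz => hZ z (mem_notches.1 hz).1) (fun z hz => (mem_notches.1 hz).2)
    (fun z hz => (mem_notches.1 hz).2) (fun z hz => (mem_notches.1 hz).2)
    (fun z hz => (mem_notches.1 hz).2)
  have v1 := h.valid.sw; have v2 := h.valid.se; have v3 := h.valid.ne; have v4 := h.valid.nw
  have g0 := f0.1; have g1 := f1.1; have g2 := f2.1; have g3 := f3.1
  simp only [Frame.flip, Frame.vflip, Frame.swap] at g1 g2 g3
  rw [Fin.sum_univ_four, Fin.sum_univ_four] at hm
  rw [Fin.sum_univ_four]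
  unfold steps
  clear * - hm g0 g1 g2 g3 v1 v2 v3 v4
  omega

lemma sides_fin_le (h : F.x0 ≤ F.x1) (h' : F.y0 ≤ F.y1) {I : Finset (ℤ × ℤ)}
    (hI : ∀ p ∈ I, F.Mem p.1 p.2) :
    (sides I : ℤ) ≤ 2 * (F.x1 - F.x0 + 1) + 2 * (F.y1 - F.y0 + 1) := by
  rw [sides_eq_image]
  have h1 : (I.image Prod.fst).card ≤ (Finset.Icc F.x0 F.x1).card :=
    Finset.card_le_card fun a ha => by
      obtain ⟨p, hp, rfl⟩ := Finset.mem_image.1 ha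
      have := (hI p hp).1
      exact Finset.mem_Icc.2 ⟨this.1, this.2.1⟩
  have h2 : (I.image Prod.snd).card ≤ (Finset.Icc F.y0 F.y1).card :=
    Finset.card_le_card fun a ha => by
      obtain ⟨p, hp, rfl⟩ := Finset.mem_image.1 ha
      have := (hI p hp).1
      exact Finset.mem_Icc.2 ⟨this.2.2.1, this.2.2.2⟩
  rw [Int.card_Icc] at h1 h2
  push_cast
  omega

lemma Mid.obd_le (h : F.Mid E X₁ Y₂ X₃ Y₄) {I : Finset (ℤ × ℤ)}
    (hst : IsStaircase (↑I : Set (ℤ × ℤ))) (hI : ∀ x y, F.Core E x y → (x, y) ∈ I)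
    (hIF : ∀ p ∈ I, F.Mem p.1 p.2) : (obd F.fin).card ≤ (obd I).card + 16 * E := by
  have v1 := h.valid.sw; have v2 := h.valid.se; have v3 := h.valid.ne; have v4 := h.valid.nw
  have b1 := h.bot; have b2 := h.left; have b3 := h.top; have b4 := h.right
  have e1 := h.valid.isStaircase.sides_eq
  have e2 := hst.sides_eq
  have e3 := h.valid.steps_le
  have e4 := sides_fin_le (F := F) (by omega) (by omega) (I := F.fin) fun p hp => mem_fin.1 hp
  have hbox : ∀ z ∈ ocr I, F.x0 ≤ z.1 ∧ z.1 ≤ F.x1 ∧ F.y0 ≤ z.2 ∧ z.2 ≤ F.y1 := by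
    rintro ⟨x, y⟩ hz
    obtain ⟨-, z1, z2⟩ := mem_ocr.1 hz
    simp only [Prod.mk_add_mk, Prod.mk_sub_mk, add_zero, sub_zero] at z1 z2
    have y1 : F.y0 ≤ y ∧ y ≤ F.y1 := by
      rcases z1 with z | z <;> exact (hIF _ z).1.2.2
    have y2 : F.x0 ≤ x ∧ x ≤ F.x1 := by
      rcases z2 with z | z <;> exact ⟨(hIF _ z).1.1, (hIF _ z).1.2.1⟩
    exact ⟨y2.1, y2.2, y1⟩
  have e5 := h.card_notches_le hI hbox
  have e6 := card_le_sum_notches (I := I) (Z := ocr I) fun z hz => exists_notchAt_of_ocr hst hz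
  have e7 := sides_eq_image I
  have h1 : (Finset.Icc (F.x0 + E) (F.x1 - E)).card ≤ (I.image Prod.fst).card :=
    Finset.card_le_card fun a ha => by
      obtain ⟨y, hy⟩ := h.core_col (Finset.mem_Icc.1 ha).1 (Finset.mem_Icc.1 ha).2
      exact Finset.mem_image.2 ⟨_, hI _ _ hy, rfl⟩
  have h2 : (Finset.Icc (F.y0 + E) (F.y1 - E)).card ≤ (I.image Prod.snd).card :=
    Finset.card_le_card fun a ha => by
      obtain ⟨y, hy⟩ := h.core_row (Finset.mem_Icc.1 ha).1 (Finset.mem_Icc.1 ha).2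
      exact Finset.mem_image.2 ⟨_, hI _ _ hy, rfl⟩
  rw [Int.card_Icc] at h1 h2
  zify at e1 e2 e6 e7
  clear * - e1 e2 e3 e4 e5 e6 e7 h1 h2 b1 b2 b3 b4 v1 v2 v3 v4
  omega

end
end Frame

lemma diss_eq_add (J I : Finset (ℤ × ℤ)) :
    diss J I = ∑ p ∈ J \ I, dep J p + ∑ p ∈ I \ J, dep J p := by
  unfold diss
  rw [symmDiff_def, Finset.sup_eq_union, Finset.sum_union (Finset.disjoint_left.2 fun p h1 h2 =>
    (Finset.mem_sdiff.1 h2).2 (Finset.mem_sdiff.1 h1).1), add_comm]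

lemma diss_of_subset {J I : Finset (ℤ × ℤ)} (h : I ⊆ J) : diss J I = ∑ p ∈ J \ I, dep J p := by
  rw [diss_eq_add, Finset.sdiff_eq_empty_iff_subset.2 h, Finset.sum_empty, add_zero]

/-- A competitor with at most the same energy and dissipation has the same energy and
dissipation as a minimizer. -/
lemma IsMin.eq_of_le {k ε : ℝ} (hk : 0 < k) (hε : 0 < ε) {J I Z I' Z' : Finset (ℤ × ℤ)} {n : ℕ}
    (h : IsMin k (4 * k) ε J n I Z) (hd : Disjoint I' Z') (hc : Z'.card = Z.card)
    (he : en k (spin I' Z') ≤ en k (spin I Z)) (hs : diss J I' ≤ diss J I) :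
    en k (spin I' Z') = en k (spin I Z) ∧ diss J I' = diss J I := by
  have h1 := h.2 I' Z' hd
  unfold fn at h1
  rw [hc] at h1
  have h2 : (diss J I' : ℝ) ≤ diss J I := by exact_mod_cast hs
  have h3 : 0 < 4 * k * ε := by positivity
  have h4 := mul_le_mul_of_nonneg_left h2 h3.le
  have h5 : en k (spin I' Z') = en k (spin I Z) := by linarith
  refine ⟨h5, le_antisymm hs ?_⟩
  have : (diss J I : ℝ) ≤ diss J I' := le_of_mul_le_mul_left (by linarith) h3
  exact_mod_cast this

lemma row_of_gap {I : Finset (ℤ × ℤ)} (h : gap I = ∅) {a b c y : ℤ} (hab : a ≤ b) (hbc : b ≤ c)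
    (ha : (a, y) ∈ I) (hc : (c, y) ∈ I) : (b, y) ∈ I := by
  revert hab
  induction b, hbc using Int.leInductionDown with
  | base => exact fun _ => hc
  | pred b hb ih =>
    intro hab
    by_contra hn
    have : (b - 1, y) ∈ gap I := by
      rw [mem_gap]
      simp only [Prod.mk_add_mk, sub_add_cancel, add_zero]
      refine ⟨ih (by omega), hn, fun hm => ?_⟩
      have := (mem_most1.1 hm).2 _ ha rfl
      simp only at this
      omega
    rw [h] at this
    simp at this

lemma convex_of_gaps {I : Finset (ℤ × ℤ)} (h : gaps I = 0) :
    (∀ a b c y : ℤ, a ≤ b → b ≤ c → (a, y) ∈ I → (c, y) ∈ I → (b, y) ∈ I) ∧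
    (∀ x a b c : ℤ, a ≤ b → b ≤ c → (x, a) ∈ I → (x, c) ∈ I → (x, b) ∈ I) := by
  unfold gaps at h
  have h1 : gap I = ∅ := Finset.card_eq_zero.1 (by omega)
  have h2 : gap (swapped I) = ∅ := Finset.card_eq_zero.1 (by omega)
  refine ⟨fun a b c y hab hbc ha hc => row_of_gap h1 hab hbc ha hc,
    fun x a b c hab hbc ha hc => ?_⟩
  have := row_of_gap h2 hab hbc (y := x) (mem_swapped.2 ha) (mem_swapped.2 hc)
  exact mem_swapped.1 this

lemma card_line_le {T : Finset ℤ} {a b : ℤ} {E : ℕ} {s s' : Finset ℕ} (hab : a ≤ b + 1)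
    (hmid : ∀ y, a + E ≤ y → y ≤ b - E → y ∈ T) (hs : ∀ i < E, a + (i : ℕ) ∉ T → i ∈ s)
    (hs' : ∀ i < E, b - (i : ℕ) ∉ T → i ∈ s') :
    b - a + 1 + (T.filter (· < a)).card + (T.filter (b < ·)).card ≤ T.card + s.card + s'.card := by
  have h1 : Finset.Icc a b ⊆ (T.filter fun y => a ≤ y ∧ y ≤ b) ∪
      (s.image fun i : ℕ => a + (i : ℤ)) ∪ s'.image fun i : ℕ => b - (i : ℤ) := by
    intro y hy
    rw [Finset.mem_Icc] at hy
    by_cases hT : y ∈ T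
    · simp [hT, hy]
    rw [Finset.mem_union, Finset.mem_union, Finset.mem_image, Finset.mem_image]
    by_cases h1 : y < a + E
    · refine .inl (.inr ⟨(y - a).toNat, hs _ (by omega) ?_, by omega⟩)
      rwa [show a + (((y - a).toNat : ℕ) : ℤ) = y by omega]
    by_cases h2 : b - E < y
    · refine .inr ⟨(b - y).toNat, hs' _ (by omega) ?_, by omega⟩
      rwa [show b - (((b - y).toNat : ℕ) : ℤ) = y by omega]
    exact absurd (hmid y (by omega) (by omega)) hT
  have h2 := (Finset.card_le_card h1).trans ((Finset.card_union_le _ _).trans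
    (add_le_add (Finset.card_union_le _ _) le_rfl))
  have h3 := Finset.card_image_le (s := s) (f := fun i : ℕ => a + (i : ℤ))
  have h4 := Finset.card_image_le (s := s') (f := fun i : ℕ => b - (i : ℤ))
  have h5 : (T.filter fun y => a ≤ y ∧ y ≤ b).card + (T.filter (· < a)).card +
      (T.filter (b < ·)).card ≤ T.card := by
    rw [← Finset.card_union_of_disjoint, ← Finset.card_union_of_disjoint]
    · refine Finset.card_le_card fun y hy => ?_
      simp only [Finset.mem_union, Finset.mem_filter] at hy
      tauto
    · rw [Finset.disjoint_left]
      intro y hy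
      simp only [Finset.mem_union, Finset.mem_filter] at hy ⊢
      omega
    · rw [Finset.disjoint_left]
      intro y hy
      simp only [Finset.mem_filter] at hy ⊢
      omega
  rw [Int.card_Icc] at h2
  omega

lemma card_le_two_mul_rows {I Z T : Finset (ℤ × ℤ)}
    (hT : ∀ z ∈ T, z ∈ cov I Z 1 ∨ z ∈ cov I Z 3) : T.card ≤ 2 * (T.image Prod.snd).card := by
  refine Finset.card_le_mul_card_image T 2 fun y _ => ?_
  have h : (T.filter fun z => z.2 = y) ⊆ ((T.filter fun z => z.2 = y).filter (· ∈ cov I Z 1)) ∪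
      ((T.filter fun z => z.2 = y).filter (· ∈ cov I Z 3)) := fun z hz => by
    rw [Finset.mem_union]
    exact (hT z (Finset.mem_filter.1 hz).1).imp (fun h => Finset.mem_filter.2 ⟨hz, h⟩)
      fun h => Finset.mem_filter.2 ⟨hz, h⟩
  refine (Finset.card_le_card h).trans ((Finset.card_union_le _ _).trans ?_)
  refine add_le_add (b := 1) (d := 1) ?_ ?_ <;> rw [Finset.card_le_one] <;> intro a ha b hb <;>
    simp only [Finset.mem_filter, mem_cov] at ha hb
  · have h1 := (mem_most1.1 ha.2.2).2 _ (mem_most1.1 hb.2.2).1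
    have h2 := (mem_most1.1 hb.2.2).2 _ (mem_most1.1 ha.2.2).1
    simp [dir] at h1 h2
    exact Prod.ext (by omega) (by omega)
  · have h1 := (mem_most3.1 ha.2.2).2 _ (mem_most3.1 hb.2.2).1
    have h2 := (mem_most3.1 hb.2.2).2 _ (mem_most3.1 ha.2.2).1
    simp [dir] at h1 h2
    exact Prod.ext (by omega) (by omega)

lemma card_le_two_mul_cols {I Z T : Finset (ℤ × ℤ)}
    (hT : ∀ z ∈ T, z ∈ cov I Z 0 ∨ z ∈ cov I Z 2) : T.card ≤ 2 * (T.image Prod.fst).card := by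
  refine Finset.card_le_mul_card_image T 2 fun y _ => ?_
  have h : (T.filter fun z => z.1 = y) ⊆ ((T.filter fun z => z.1 = y).filter (· ∈ cov I Z 0)) ∪
      ((T.filter fun z => z.1 = y).filter (· ∈ cov I Z 2)) := fun z hz => by
    rw [Finset.mem_union]
    exact (hT z (Finset.mem_filter.1 hz).1).imp (fun h => Finset.mem_filter.2 ⟨hz, h⟩)
      fun h => Finset.mem_filter.2 ⟨hz, h⟩
  refine (Finset.card_le_card h).trans ((Finset.card_union_le _ _).trans ?_)
  refine add_le_add (b := 1) (d := 1) ?_ ?_ <;> rw [Finset.card_le_one] <;> intro a ha b hb <;>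
    simp only [Finset.mem_filter, mem_cov] at ha hb
  · have h1 := (mem_most0.1 ha.2.2).2 _ (mem_most0.1 hb.2.2).1
    have h2 := (mem_most0.1 hb.2.2).2 _ (mem_most0.1 ha.2.2).1
    simp [dir] at h1 h2
    exact Prod.ext (by omega) (by omega)
  · have h1 := (mem_most2.1 ha.2.2).2 _ (mem_most2.1 hb.2.2).1
    have h2 := (mem_most2.1 hb.2.2).2 _ (mem_most2.1 ha.2.2).1
    simp [dir] at h1 h2
    exact Prod.ext (by omega) (by omega)

/-- The rows or columns met by `I` outside the box of a frame, sorted by sides. -/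
def Frame.outs (F : Frame) (I : Finset (ℤ × ℤ)) : Fin 4 → ℕ :=
  ![((I.image Prod.snd).filter (· < F.y0)).card, ((I.image Prod.fst).filter (· < F.x0)).card,
    ((I.image Prod.snd).filter (F.y1 < ·)).card, ((I.image Prod.fst).filter (F.x1 < ·)).card]

lemma card_dbl_le (F : Frame) (I Z : Finset (ℤ × ℤ)) : (dbl I Z).card ≤
    ∑ i, (notches I ((dbl I Z).filter fun z => F.x0 ≤ z.1 ∧ z.1 ≤ F.x1 ∧ F.y0 ≤ z.2 ∧ z.2 ≤ F.y1) i).card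
      + 2 * ∑ i, F.outs I i := by
  set D := dbl I Z
  have hrow : ∀ z ∈ D, z.2 ∈ I.image Prod.snd ∧ z.1 ∈ I.image Prod.fst := by
    rintro ⟨x, y⟩ hz
    obtain ⟨i, hi⟩ := exists_notchAt_of_dbl hz
    obtain ⟨h1, h2⟩ := hi.exists_nbr
    rw [Finset.mem_image, Finset.mem_image]
    constructor
    · rcases h1 with h1 | h1 <;> exact ⟨_, h1, rfl⟩
    · rcases h2 with h2 | h2 <;> exact ⟨_, h2, rfl⟩
  have hcov : ∀ z ∈ D, (z ∈ cov I Z 1 ∨ z ∈ cov I Z 3) ∧ (z ∈ cov I Z 0 ∨ z ∈ cov I Z 2) :=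
    fun z hz => (Finset.mem_filter.1 hz).2
  have hsub : D ⊆ (D.filter fun z => F.x0 ≤ z.1 ∧ z.1 ≤ F.x1 ∧ F.y0 ≤ z.2 ∧ z.2 ≤ F.y1) ∪
      ((D.filter fun z => z.2 < F.y0 ∨ F.y1 < z.2) ∪ D.filter fun z => z.1 < F.x0 ∨ F.x1 < z.1) := by
    intro z hz
    simp only [Finset.mem_union, Finset.mem_filter, hz, true_and]
    omega
  have h1 := (Finset.card_le_card hsub).trans ((Finset.card_union_le _ _).trans
    (add_le_add le_rfl (Finset.card_union_le _ _)))
  have h2 := card_le_sum_notches (I := I)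
    (Z := D.filter fun z => F.x0 ≤ z.1 ∧ z.1 ≤ F.x1 ∧ F.y0 ≤ z.2 ∧ z.2 ≤ F.y1)
    fun z hz => exists_notchAt_of_dbl (Finset.mem_filter.1 hz).1
  have h3 := card_le_two_mul_rows (I := I) (Z := Z) (T := D.filter fun z => z.2 < F.y0 ∨ F.y1 < z.2)
    fun z hz => (hcov z (Finset.mem_filter.1 hz).1).1
  have h4 := card_le_two_mul_cols (I := I) (Z := Z) (T := D.filter fun z => z.1 < F.x0 ∨ F.x1 < z.1)
    fun z hz => (hcov z (Finset.mem_filter.1 hz).1).2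
  have h5 : ((D.filter fun z => z.2 < F.y0 ∨ F.y1 < z.2).image Prod.snd).card ≤
      F.outs I 0 + F.outs I 2 := by
    refine (Finset.card_le_card (t := (I.image Prod.snd).filter (· < F.y0) ∪
      (I.image Prod.snd).filter (F.y1 < ·)) fun y hy => ?_).trans (Finset.card_union_le _ _)
    obtain ⟨z, hz, rfl⟩ := Finset.mem_image.1 hy
    rw [Finset.mem_filter] at hz
    rw [Finset.mem_union, Finset.mem_filter, Finset.mem_filter]
    have := (hrow z hz.1).1
    tauto
  have h6 : ((D.filter fun z => z.1 < F.x0 ∨ F.x1 < z.1).image Prod.fst).card ≤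
      F.outs I 1 + F.outs I 3 := by
    refine (Finset.card_le_card (t := (I.image Prod.fst).filter (· < F.x0) ∪
      (I.image Prod.fst).filter (F.x1 < ·)) fun y hy => ?_).trans (Finset.card_union_le _ _)
    obtain ⟨z, hz, rfl⟩ := Finset.mem_image.1 hy
    rw [Finset.mem_filter] at hz
    rw [Finset.mem_union, Finset.mem_filter, Finset.mem_filter]
    have := (hrow z hz.1).2
    tauto
  rw [Fin.sum_univ_four (F.outs I)]
  omega

namespace Frame
section
variable {F G : Frame} {E K : ℕ} {X₁ Y₂ X₃ Y₄ : ℤ} {I Z : Finset (ℤ × ℤ)}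

lemma Mid.le_sides (h : F.Mid E X₁ Y₂ X₃ Y₄) (hI : ∀ x y, F.Core E x y → (x, y) ∈ I) :
    2 * (F.x1 - F.x0 + 1) + 2 * (F.y1 - F.y0 + 1) + 2 * (∑ i, F.outs I i : ℕ) ≤
      sides I + 2 * (∑ i, F.empties E (fun x y => (x, y) ∈ I) i : ℕ) := by
  have v1 := h.valid.sw; have v2 := h.valid.se; have v4 := h.valid.nw
  have b1 := h.bot; have b2 := h.left
  have h1 := card_line_le (T := I.image Prod.snd) (a := F.y0) (b := F.y1) (E := E)
    (s := F.emptyRows E fun x y => (x, y) ∈ I) (s' := F.vflip.emptyRows E (vf fun x y => (x, y) ∈ I))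
    (by omega)
    (fun y hy hy' => by
      obtain ⟨x, hx⟩ := h.core_row hy hy'
      exact Finset.mem_image.2 ⟨_, hI _ _ hx, rfl⟩)
    (fun i hi hn => mem_emptyRows.2 ⟨hi, fun x hx => hn (Finset.mem_image.2 ⟨_, hx, rfl⟩)⟩)
    (fun i hi hn => mem_emptyRows.2 ⟨hi, fun x hx => hn (Finset.mem_image.2 ⟨_, hx, by
      simp only [Frame.vflip, Frame.flip, Frame.swap]; ring⟩)⟩)
  have h2 := card_line_le (T := I.image Prod.fst) (a := F.x0) (b := F.x1) (E := E)
    (s := F.emptyCols E fun x y => (x, y) ∈ I) (s' := F.flip.emptyCols E (hf fun x y => (x, y) ∈ I))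
    (by omega)
    (fun y hy hy' => by
      obtain ⟨x, hx⟩ := h.core_col hy hy'
      exact Finset.mem_image.2 ⟨_, hI _ _ hx, rfl⟩)
    (fun i hi hn => mem_emptyCols.2 ⟨hi, fun x hx => hn (Finset.mem_image.2 ⟨_, hx, rfl⟩)⟩)
    (fun i hi hn => mem_emptyCols.2 ⟨hi, fun x hx => hn (Finset.mem_image.2 ⟨_, hx, by
      simp only [Frame.flip]; ring⟩)⟩)
  rw [sides_eq_image, Fin.sum_univ_four, Fin.sum_univ_four]
  simp only [outs, empties, Matrix.cons_val_zero, Matrix.cons_val_one, Matrix.cons_val]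
  push_cast
  linarith

lemma Valid.card_sl_le (h : F.Valid) : ((sl F.fin 0).card : ℤ) ≤ F.q1 - F.p1 + 1 ∧
    ((sl F.fin 1).card : ℤ) ≤ F.q2 - F.p2 + 1 ∧ ((sl F.fin 2).card : ℤ) ≤ F.q3 - F.p3 + 1 ∧
    ((sl F.fin 3).card : ℤ) ≤ F.q4 - F.p4 + 1 := by
  have hle := h.le
  have key : ∀ (T : Finset (ℤ × ℤ)) (f g : ℤ × ℤ → ℤ) (a b c : ℤ), a ≤ b →
      (∀ p q, f p = f q → g p = g q → p = q) →
      (∀ p ∈ T, g p = c ∧ a ≤ f p ∧ f p ≤ b) → (T.card : ℤ) ≤ b - a + 1 := by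
    intro T f g a b c hab hinj hT
    have := Finset.card_le_card_of_injOn (s := T) (t := Finset.Icc a b) f
      (fun p hp => Finset.mem_coe.2 (Finset.mem_Icc.2 (hT p hp).2))
      fun p hp q hq e => hinj p q e ((hT p hp).1.trans (hT q hq).1.symm)
    rw [Int.card_Icc] at this
    omega
  exact ⟨key _ Prod.fst Prod.snd _ _ _ hle.1 (fun p q => Prod.ext) fun p hp => h.mem_sl0.1 hp,
    key _ Prod.snd Prod.fst _ _ _ hle.2.1 (fun p q a b => Prod.ext b a) fun p hp => h.mem_sl1.1 hp,
    key _ Prod.fst Prod.snd _ _ _ hle.2.2.1 (fun p q => Prod.ext) fun p hp => h.mem_sl2.1 hp,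
    key _ Prod.snd Prod.fst _ _ _ hle.2.2.2 (fun p q a b => Prod.ext b a) fun p hp => h.mem_sl3.1 hp⟩

lemma Mid.card_sl_le (h : F.Mid (K + 1) X₁ Y₂ X₃ Y₄) (hI : ∀ x y, F.Core K x y → (x, y) ∈ I)
    {m : ℕ} {τ : Fin 4 → ℕ} (hG : F.Compressed (K + 1) (fun x y => (x, y) ∈ I) m G τ) (hK : 4 ≤ K)
    (i : Fin 4) (hτ : τ i = F.empties (K + 1) (fun x y => (x, y) ∈ I) i) (ho : F.outs I i = 0) :
    (sl G.fin i).card ≤ (sl I i).card := by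
  have h' := h.mono hK (Nat.le_succ K)
  have hw := hG.valid.card_sl_le
  have v1 := h.valid.sw; have v2 := h.valid.se; have v4 := h.valid.nw
  have b1 := h.bot; have b2 := h.left
  obtain ⟨xc, hxc⟩ := h'.core_row (y := F.y0 + K) le_rfl (by omega)
  obtain ⟨xd, hxd⟩ := h'.core_row (y := F.y1 - K) (by omega) le_rfl
  obtain ⟨yc, hyc⟩ := h'.core_col (x := F.x0 + K) le_rfl (by omega)
  obtain ⟨yd, hyd⟩ := h'.core_col (x := F.x1 - K) (by omega) le_rfl
  have hne : I.Nonempty := ⟨_, hI _ _ hxc⟩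
  fin_cases i
  · obtain ⟨⟨x, y⟩, hp⟩ := sl_nonempty hne 0
    have hp' := mem_sl0.1 hp
    have h1 : F.y0 ≤ y := by
      by_contra hn
      have ho' : ((I.image Prod.snd).filter (· < F.y0)).card = 0 := ho
      exact Finset.notMem_empty y (Finset.card_eq_zero.1 ho' ▸
        Finset.mem_filter.2 ⟨Finset.mem_image.2 ⟨_, hp'.1, rfl⟩, not_le.1 hn⟩)
    have h2 := hp'.2 _ (hI _ _ hxc)
    obtain ⟨i, rfl⟩ : ∃ i : ℕ, y = F.y0 + i := ⟨(y - F.y0).toNat, by omega⟩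
    simp only at h2
    have h3 := hG.slice0 hτ i (by omega) ⟨x, hp'.1⟩ ((sl I 0).image Prod.fst) fun x' _ _ hx' =>
      Finset.mem_image.2 ⟨_, mem_sl0.2 ⟨hx', hp'.2⟩, rfl⟩
    have h4 := Finset.card_image_le (s := sl I 0) (f := Prod.fst)
    change (sl G.fin 0).card ≤ (sl I 0).card
    omega
  · obtain ⟨⟨x, y⟩, hp⟩ := sl_nonempty hne 1
    have hp' := mem_sl1.1 hp
    have h1 : F.x0 ≤ x := by
      by_contra hn
      have ho' : ((I.image Prod.fst).filter (· < F.x0)).card = 0 := ho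
      exact Finset.notMem_empty x (Finset.card_eq_zero.1 ho' ▸
        Finset.mem_filter.2 ⟨Finset.mem_image.2 ⟨_, hp'.1, rfl⟩, not_le.1 hn⟩)
    have h2 := hp'.2 _ (hI _ _ hyc)
    obtain ⟨i, rfl⟩ : ∃ i : ℕ, x = F.x0 + i := ⟨(x - F.x0).toNat, by omega⟩
    simp only at h2
    have h3 := hG.slice1 hτ i (by omega) ⟨y, hp'.1⟩ ((sl I 1).image Prod.snd) fun x' _ _ hx' =>
      Finset.mem_image.2 ⟨_, mem_sl1.2 ⟨hx', hp'.2⟩, rfl⟩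
    have h4 := Finset.card_image_le (s := sl I 1) (f := Prod.snd)
    change (sl G.fin 1).card ≤ (sl I 1).card
    omega
  · obtain ⟨⟨x, y⟩, hp⟩ := sl_nonempty hne 2
    have hp' := mem_sl2.1 hp
    have h1 : y ≤ F.y1 := by
      by_contra hn
      have ho' : ((I.image Prod.snd).filter (F.y1 < ·)).card = 0 := ho
      exact Finset.notMem_empty y (Finset.card_eq_zero.1 ho' ▸
        Finset.mem_filter.2 ⟨Finset.mem_image.2 ⟨_, hp'.1, rfl⟩, not_le.1 hn⟩)
    have h2 := hp'.2 _ (hI _ _ hxd)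
    obtain ⟨i, rfl⟩ : ∃ i : ℕ, y = F.y1 - i := ⟨(F.y1 - y).toNat, by omega⟩
    simp only at h2
    have h3 := hG.slice2 hτ i (by omega) ⟨x, hp'.1⟩ ((sl I 2).image Prod.fst) fun x' _ _ hx' =>
      Finset.mem_image.2 ⟨_, mem_sl2.2 ⟨hx', hp'.2⟩, rfl⟩
    have h4 := Finset.card_image_le (s := sl I 2) (f := Prod.fst)
    change (sl G.fin 2).card ≤ (sl I 2).card
    omega
  · obtain ⟨⟨x, y⟩, hp⟩ := sl_nonempty hne 3
    have hp' := mem_sl3.1 hp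
    have h1 : x ≤ F.x1 := by
      by_contra hn
      have ho' : ((I.image Prod.fst).filter (F.x1 < ·)).card = 0 := ho
      exact Finset.notMem_empty x (Finset.card_eq_zero.1 ho' ▸
        Finset.mem_filter.2 ⟨Finset.mem_image.2 ⟨_, hp'.1, rfl⟩, not_le.1 hn⟩)
    have h2 := hp'.2 _ (hI _ _ hyd)
    obtain ⟨i, rfl⟩ : ∃ i : ℕ, x = F.x1 - i := ⟨(F.x1 - x).toNat, by omega⟩
    simp only at h2
    have h3 := hG.slice3 hτ i (by omega) ⟨y, hp'.1⟩ ((sl I 3).image Prod.snd) fun x' _ _ hx' =>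
      Finset.mem_image.2 ⟨_, mem_sl3.2 ⟨hx', hp'.2⟩, rfl⟩
    have h4 := Finset.card_image_le (s := sl I 3) (f := Prod.snd)
    change (sl G.fin 3).card ≤ (sl I 3).card
    omega

/-- Consecutive columns of a convex set overlap if nothing is lost by the compression. -/
lemma Mid.isStaircase (h : F.Mid (K + 1) X₁ Y₂ X₃ Y₄) (hI : ∀ x y, F.Core K x y → (x, y) ∈ I)
    {m : ℕ} {τ : Fin 4 → ℕ} (hG : F.Compressed (K + 1) (fun x y => (x, y) ∈ I) m G τ) (hK : 4 ≤ K)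
    (hτ : ∀ i, τ i = F.empties (K + 1) (fun x y => (x, y) ∈ I) i) (hIF : I ⊆ F.fin)
    (hrow : ∀ a b c y : ℤ, a ≤ b → b ≤ c → (a, y) ∈ I → (c, y) ∈ I → (b, y) ∈ I)
    (hcol : ∀ x a b c : ℤ, a ≤ b → b ≤ c → (x, a) ∈ I → (x, c) ∈ I → (x, b) ∈ I) :
    IsStaircase (↑I : Set (ℤ × ℤ)) := by
  have h' := h.mono hK (Nat.le_succ K)
  have v1 := h.valid.sw; have v2 := h.valid.se
  have b1 := h.bot
  obtain ⟨yc, hyc⟩ := h'.core_col (x := F.x0 + K) le_rfl (by omega)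
  obtain ⟨yd, hyd⟩ := h'.core_col (x := F.x1 - K) (by omega) le_rfl
  refine isStaircase_of_overlap I.finite_toSet ⟨_, Finset.mem_coe.2 (hI _ _ hyc)⟩ hrow hcol ?_
  rintro ⟨x, y⟩ hp ⟨x', y'⟩ hq hlt
  simp only at hlt ⊢
  have hp' := (mem_fin.1 (hIF hp)).1
  have hq' := (mem_fin.1 (hIF hq)).1
  simp only at hp' hq'
  by_cases k1 : x < F.x0 + K
  · obtain ⟨c, hc⟩ := hG.row1 (hτ 1)
    have c1 : (x, c) ∈ I := by
      have := hc (x - F.x0).toNat (by omega)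
      rw [show F.x0 + ((x - F.x0).toNat : ℤ) = x by omega] at this
      exact this ⟨y, hp⟩
    have c2 : (F.x0 + K, c) ∈ I := hc K (by omega) ⟨yc, hI _ _ hyc⟩
    exact ⟨c, c1, hrow x (x + 1) (F.x0 + K) c (by omega) (by omega) c1 c2⟩
  by_cases k2 : F.x1 - K < x + 1
  · obtain ⟨c, hc⟩ := hG.row3 (hτ 3)
    have c1 : (x', c) ∈ I := by
      have := hc (F.x1 - x').toNat (by omega)
      rw [show F.x1 - ((F.x1 - x').toNat : ℤ) = x' by omega] at this
      exact this ⟨y', hq⟩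
    have c2 : (F.x1 - K, c) ∈ I := hc K (by omega) ⟨yd, hI _ _ hyd⟩
    exact ⟨c, hrow _ _ _ c (by omega) (by omega) c2 c1, hrow _ _ _ c (by omega) (by omega) c2 c1⟩
  · obtain ⟨c, hc, hc'⟩ := h'.exists_core_col (x := x) (by omega) (by omega)
    exact ⟨c, hI _ _ hc, hI _ _ hc'⟩

/-- The phase-one set of a minimizer with the same number of surfactant sites is a staircase set
contained in the previous one. -/
theorem Mid.isStaircase_of_isMin {k ε : ℝ} (hk : 1 / 3 < k) (hk' : k < 1) (hε : 0 < ε)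
    (h : F.Mid (K + 2) X₁ Y₂ X₃ Y₄) (hK : 4 ≤ K) (hI : ∀ x y, F.Core K x y → (x, y) ∈ I) {n : ℕ}
    (hmin : IsMin k (4 * k) ε F.fin n I Z) (hn : Z.card = n)
    (hsat : n + 16 * (K + 2) ≤ (obd F.fin).card) :
    IsStaircase (↑I : Set (ℤ × ℤ)) ∧ I ⊆ F.fin := by
  classical
  have h1 : F.Mid (K + 1) X₁ Y₂ X₃ Y₄ := h.mono (by omega) (by omega)
  set D := (dbl I Z).filter fun z => F.x0 ≤ z.1 ∧ z.1 ≤ F.x1 ∧ F.y0 ≤ z.2 ∧ z.2 ≤ F.y1 with hD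
  obtain ⟨G, τ, hG⟩ := h1.exists_compressed (P := fun x y => (x, y) ∈ I) (fun x y hc => hI x y (hc.mono (Nat.le_succ K)))
    (N := notches I D) (fun i z hz => (Finset.mem_filter.1 (mem_notches.1 hz).1).2)
    (fun z hz => (mem_notches.1 hz).2) (fun z hz => (mem_notches.1 hz).2)
    (fun z hz => (mem_notches.1 hz).2) (fun z hz => (mem_notches.1 hz).2)
  have hGF : G.fin ⊆ F.fin := fun p hp => mem_fin.2 (hG.mem _ _ (mem_fin.1 hp))
  have hst := hG.valid.isStaircase
  have hsat' : n ≤ (obd G.fin).card := by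
    have := h.obd_le hst (fun x y hc => mem_fin.2 (hG.core x y hc))
      fun p hp => mem_fin.1 (hGF hp)
    omega
  have hdbl := card_dbl_le F I Z
  rw [← hD] at hdbl
  have hsI := h1.le_sides (I := I) fun x y hc => hI x y (hc.mono (Nat.le_succ K))
  have hle := fun i => (hG.le i).1
  have hsG : (sides G.fin : ℤ) + 2 * (∑ i, τ i : ℕ) ≤
      2 * (F.x1 - F.x0 + 1) + 2 * (F.y1 - F.y0 + 1) := by
    have v := hG.valid.fat
    have := sides_fin_le (F := G) (I := G.fin) (by omega) (by omega) fun p hp => mem_fin.1 hp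
    have hb := hG.box
    rw [Fin.sum_univ_four]
    push_cast
    omega
  have hsteps := hG.steps
  have hocr := hG.valid.steps_le
  set B : Finset (Fin 4) := Finset.univ.filter fun i =>
    τ i ≠ F.empties (K + 1) (fun x y => (x, y) ∈ I) i ∨ F.outs I i ≠ 0 with hB
  have hBc : B.card + ∑ i, F.empties (K + 1) (fun x y => (x, y) ∈ I) i ≤ ∑ i, τ i + ∑ i, F.outs I i := by
    rw [hB, Finset.card_filter, ← Finset.sum_add_distrib, ← Finset.sum_add_distrib]
    refine Finset.sum_le_sum fun i _ => ?_
    have := hle i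
    split_ifs <;> omega
  have hsides : 2 * B.card + sides G.fin ≤ sides I := by
    clear * - hBc hsG hsI
    omega
  have hIZ := hmin.1
  obtain ⟨Z', z1, z2, z3, z4⟩ := exists_better hk hk' hIZ hn hst B hsides
    (by clear * - hdbl hsI hsG hsteps hocr; omega)
    (fun i hi => h1.card_sl_le hI hG hK i (by_contra fun hc => hi (by simp [hB, hc]))
      (by_contra fun hc => hi (by simp [hB, hc]))) hsat'
  have hw : ∑ p ∈ F.fin \ G.fin, dep F.fin p ≤ ∑ p ∈ F.fin \ I, dep F.fin p := by
    have := hG.weight (F.fin \ I) fun x y hm hn => Finset.mem_sdiff.2 ⟨mem_fin.2 hm, hn⟩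
    have e : ∀ S : Finset (ℤ × ℤ), ∑ p ∈ F.fin \ S, F.wt p = ∑ p ∈ F.fin \ S, dep F.fin p :=
      fun S => Finset.sum_congr rfl fun p hp => by
        unfold wt; rw [if_pos (mem_fin.1 (Finset.mem_sdiff.1 hp).1)]
    rwa [e, e] at this
  obtain ⟨e1, e2⟩ := hmin.eq_of_le (by linarith) hε z1 (z2.trans hn.symm) z3 (by
    rw [diss_of_subset hGF, diss_eq_add]; omega)
  obtain ⟨e3, e4⟩ := z4 e1
  have hFne : F.fin.Nonempty := by
    obtain ⟨p, hp⟩ := h.valid.isStaircase.connected.nonempty; exact ⟨p, hp⟩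
  have hIF : I ⊆ F.fin := by
    rw [diss_of_subset hGF, diss_eq_add] at e2
    have h0 : ∑ p ∈ I \ F.fin, dep F.fin p = 0 := by omega
    intro p hp
    by_contra hn
    have := (Finset.sum_eq_zero_iff.1 h0) p (Finset.mem_sdiff.2 ⟨hp, hn⟩)
    exact (dep_pos hFne p).ne' this
  have hB0 : B = ∅ := Finset.card_eq_zero.1 (by omega)
  obtain ⟨c1, c2⟩ := convex_of_gaps e4
  refine ⟨h1.isStaircase hI hG hK (fun i => ?_) hIF c1 c2, hIF⟩
  by_contra hc
  have : i ∈ B := by simp [hB, hc]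
  simp [hB0] at this

end
end Frame

/-- `p` does not lie in the quadrant at `w` that is opposite to the set near a notch of type `i`. -/
def Sep (i : Fin 4) (w p : ℤ × ℤ) : Prop :=
  match i with
  | 0 => w.1 < p.1 ∨ w.2 < p.2
  | 1 => p.1 < w.1 ∨ w.2 < p.2
  | 2 => w.1 < p.1 ∨ p.2 < w.2
  | 3 => p.1 < w.1 ∨ p.2 < w.2

/-- The distance from the corner `i` of a box. -/
def quad (x0 x1 y0 y1 : ℤ) (i : Fin 4) (p : ℤ × ℤ) : ℤ :=
  match i with
  | 0 => p.1 - x0 + (p.2 - y0)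
  | 1 => x1 - p.1 + (p.2 - y0)
  | 2 => p.1 - x0 + (y1 - p.2)
  | 3 => x1 - p.1 + (y1 - p.2)

lemma NotchAt.sep {I : Finset (ℤ × ℤ)} (hI : IsStaircase (↑I : Set (ℤ × ℤ))) {i : Fin 4}
    {w : ℤ × ℤ} (h : NotchAt I i w) {p : ℤ × ℤ} (hp : p ∈ I) : Sep i w p := by
  have hq := hI.quadrant (p := w) h.notMem
  obtain ⟨x, y⟩ := w
  by_contra hn
  fin_cases i
  · have h' := notchAt_zero.1 h
    simp only [Sep] at hn
    push Not at hn
    rcases hq with hq | hq | hq | hq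
    exacts [hq _ hp (by simpa using hn), hq _ h'.1 (by simp), hq _ h'.1 (by simp),
      hq _ h'.2.1 (by simp)]
  · have h' := notchAt_one.1 h
    simp only [Sep] at hn
    push Not at hn
    rcases hq with hq | hq | hq | hq
    exacts [hq _ h'.1 (by simp), hq _ hp (by simpa using hn), hq _ h'.2.1 (by simp),
      hq _ h'.1 (by simp)]
  · have h' := notchAt_two.1 h
    simp only [Sep] at hn
    push Not at hn
    rcases hq with hq | hq | hq | hq
    exacts [hq _ h'.2.1 (by simp), hq _ h'.1 (by simp), hq _ h'.1 (by simp),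
      hq _ hp (by simpa using hn)]
  · have h' := notchAt_three.1 h
    simp only [Sep] at hn
    push Not at hn
    rcases hq with hq | hq | hq | hq
    exacts [hq _ h'.1 (by simp), hq _ h'.2.1 (by simp), hq _ hp (by simpa using hn),
      hq _ h'.1 (by simp)]

lemma NotchAt.sep_ocr {I : Finset (ℤ × ℤ)} (hI : IsStaircase (↑I : Set (ℤ × ℤ))) {i : Fin 4}
    {w : ℤ × ℤ} (h : NotchAt I i w) {z : ℤ × ℤ} (hz : z ∈ ocr I) (hne : z ≠ w) : Sep i w z := by
  obtain ⟨x, y⟩ := z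
  obtain ⟨-, h1, h2⟩ := mem_ocr.1 hz
  simp only [Prod.mk_add_mk, Prod.mk_sub_mk, add_zero, sub_zero] at h1 h2
  have hne' : x ≠ w.1 ∨ y ≠ w.2 := by
    by_contra! hc; exact hne (Prod.ext hc.1 hc.2)
  fin_cases i <;> rcases h1 with h1 | h1 <;> rcases h2 with h2 | h2 <;>
    have k1 := h.sep hI h1 <;> have k2 := h.sep hI h2 <;> simp only [Sep] at k1 k2 ⊢ <;> omega

lemma card_le_of_inj {N : Finset (ℤ × ℤ)} {f g : ℤ × ℤ → ℤ} {a b u v : ℤ}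
    (hf : ∀ p ∈ N, ∀ q ∈ N, f p = f q → p = q) (hg : ∀ p ∈ N, ∀ q ∈ N, g p = g q → p = q)
    (h : ∀ w ∈ N, a ≤ f w ∧ b ≤ g w ∧ (f w < u ∨ g w < v)) (hu : a ≤ u) (hv : b ≤ v) :
    (N.card : ℤ) ≤ u - a + (v - b) := by
  have h1 : (N.filter fun w => f w < u).card ≤ (Finset.Ico a u).card :=
    Finset.card_le_card_of_injOn f (fun w hw => by
      rw [Finset.mem_coe, Finset.mem_filter] at hw
      exact Finset.mem_coe.2 (Finset.mem_Ico.2 ⟨(h w hw.1).1, hw.2⟩))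
      fun p hp q hq e => hf p (Finset.mem_filter.1 hp).1 q (Finset.mem_filter.1 hq).1 e
  have h2 : (N.filter fun w => ¬ f w < u).card ≤ (Finset.Ico b v).card :=
    Finset.card_le_card_of_injOn g (fun w hw => by
      rw [Finset.mem_coe, Finset.mem_filter] at hw
      have := h w hw.1
      exact Finset.mem_coe.2 (Finset.mem_Ico.2 ⟨this.2.1, this.2.2.resolve_left hw.2⟩))
      fun p hp q hq e => hg p (Finset.mem_filter.1 hp).1 q (Finset.mem_filter.1 hq).1 e
  have h3 := Finset.card_filter_add_card_filter_not (s := N) fun w => f w < u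
  rw [Int.card_Ico] at h1 h2
  omega

lemma card_le_quad {I N : Finset (ℤ × ℤ)} {x0 x1 y0 y1 : ℤ}
    (hbox : ∀ p ∈ I, x0 ≤ p.1 ∧ p.1 ≤ x1 ∧ y0 ≤ p.2 ∧ p.2 ≤ y1) {i : Fin 4}
    (hN : ∀ w ∈ N, NotchAt I i w) {p : ℤ × ℤ} (hp : x0 ≤ p.1 ∧ p.1 ≤ x1 ∧ y0 ≤ p.2 ∧ p.2 ≤ y1)
    (hs : ∀ w ∈ N, Sep i w p) : (N.card : ℤ) ≤ quad x0 x1 y0 y1 i p := by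
  have hwbox : ∀ w ∈ N, x0 ≤ w.1 ∧ w.1 ≤ x1 ∧ y0 ≤ w.2 ∧ w.2 ≤ y1 := by
    rintro ⟨x, y⟩ hw
    obtain ⟨h1, h2⟩ := (hN _ hw).exists_nbr
    have k1 : y0 ≤ y ∧ y ≤ y1 := by rcases h1 with h1 | h1 <;> exact (hbox _ h1).2.2
    have k2 : x0 ≤ x ∧ x ≤ x1 := by
      rcases h2 with h2 | h2 <;> exact ⟨(hbox _ h2).1, (hbox _ h2).2.1⟩
    exact ⟨k2.1, k2.2, k1.1, k1.2⟩
  have hrow : ∀ a ∈ N, ∀ b ∈ N, a.2 = b.2 → a = b := by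
    rintro ⟨x, y⟩ ha ⟨x', y'⟩ hb (rfl : y = y')
    have ha := hN _ ha
    have hb := hN _ hb
    refine Prod.ext ?_ rfl
    by_contra hne
    rcases lt_or_gt_of_ne hne with hl | hl
    all_goals
      fin_cases i
      · first
        | exact (notchAt_zero.1 hb).2.2.1 (x + 1) (by simp only at hl; omega) (notchAt_zero.1 ha).1
        | exact (notchAt_zero.1 ha).2.2.1 (x' + 1) (by simp only at hl; omega) (notchAt_zero.1 hb).1
      · first
        | exact (notchAt_one.1 hb).2.2.1 (x - 1) (by simp only at hl; omega) (notchAt_one.1 ha).1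
        | exact (notchAt_one.1 ha).2.2.1 (x' - 1) (by simp only at hl; omega) (notchAt_one.1 hb).1
      · first
        | exact (notchAt_two.1 hb).2.2.1 (x + 1) (by simp only at hl; omega) (notchAt_two.1 ha).1
        | exact (notchAt_two.1 ha).2.2.1 (x' + 1) (by simp only at hl; omega) (notchAt_two.1 hb).1
      · first
        | exact (notchAt_three.1 hb).2.2.1 (x - 1) (by simp only at hl; omega) (notchAt_three.1 ha).1
        | exact (notchAt_three.1 ha).2.2.1 (x' - 1) (by simp only at hl; omega) (notchAt_three.1 hb).1
  have hcol : ∀ a ∈ N, ∀ b ∈ N, a.1 = b.1 → a = b := by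
    rintro ⟨x, y⟩ ha ⟨x', y'⟩ hb (rfl : x = x')
    have ha := hN _ ha
    have hb := hN _ hb
    refine Prod.ext rfl ?_
    by_contra hne
    rcases lt_or_gt_of_ne hne with hl | hl
    all_goals
      fin_cases i
      · first
        | exact (notchAt_zero.1 hb).2.2.2 (y + 1) (by simp only at hl; omega) (notchAt_zero.1 ha).2.1
        | exact (notchAt_zero.1 ha).2.2.2 (y' + 1) (by simp only at hl; omega) (notchAt_zero.1 hb).2.1
      · first
        | exact (notchAt_one.1 hb).2.2.2 (y + 1) (by simp only at hl; omega) (notchAt_one.1 ha).2.1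
        | exact (notchAt_one.1 ha).2.2.2 (y' + 1) (by simp only at hl; omega) (notchAt_one.1 hb).2.1
      · first
        | exact (notchAt_two.1 hb).2.2.2 (y - 1) (by simp only at hl; omega) (notchAt_two.1 ha).2.1
        | exact (notchAt_two.1 ha).2.2.2 (y' - 1) (by simp only at hl; omega) (notchAt_two.1 hb).2.1
      · first
        | exact (notchAt_three.1 hb).2.2.2 (y - 1) (by simp only at hl; omega) (notchAt_three.1 ha).2.1
        | exact (notchAt_three.1 ha).2.2.2 (y' - 1) (by simp only at hl; omega) (notchAt_three.1 hb).2.1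
  fin_cases i
  · exact card_le_of_inj (f := Prod.fst) (g := Prod.snd) hcol hrow
      (fun w hw => ⟨(hwbox w hw).1, (hwbox w hw).2.2.1, hs w hw⟩) hp.1 hp.2.2.1
  · have := card_le_of_inj (f := fun w => -w.1) (g := Prod.snd) (a := -x1) (b := y0) (u := -p.1)
      (v := p.2) (fun a ha b hb e => hcol a ha b hb (neg_injective e)) hrow
      (fun w hw => ⟨neg_le_neg (hwbox w hw).2.1, (hwbox w hw).2.2.1, by
        have : p.1 < w.1 ∨ w.2 < p.2 := hs w hw
        omega⟩) (neg_le_neg hp.2.1) hp.2.2.1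
    change (N.card : ℤ) ≤ x1 - p.1 + (p.2 - y0)
    omega
  · have := card_le_of_inj (f := Prod.fst) (g := fun w => -w.2) (a := x0) (b := -y1) (u := p.1)
      (v := -p.2) hcol (fun a ha b hb e => hrow a ha b hb (neg_injective e))
      (fun w hw => ⟨(hwbox w hw).1, neg_le_neg (hwbox w hw).2.2.2, by
        have : w.1 < p.1 ∨ p.2 < w.2 := hs w hw
        omega⟩) hp.1 (neg_le_neg hp.2.2.2)
    change (N.card : ℤ) ≤ p.1 - x0 + (y1 - p.2)
    omega
  · have := card_le_of_inj (f := fun w => -w.1) (g := fun w => -w.2) (a := -x1) (b := -y1)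
      (u := -p.1) (v := -p.2) (fun a ha b hb e => hcol a ha b hb (neg_injective e))
      (fun a ha b hb e => hrow a ha b hb (neg_injective e))
      (fun w hw => ⟨neg_le_neg (hwbox w hw).2.1, neg_le_neg (hwbox w hw).2.2.2, by
        have : p.1 < w.1 ∨ p.2 < w.2 := hs w hw
        omega⟩) (neg_le_neg hp.2.1) (neg_le_neg hp.2.2.2)
    change (N.card : ℤ) ≤ x1 - p.1 + (y1 - p.2)
    omega

lemma exists_ends {T : Finset ℤ} (hne : T.Nonempty)
    (hc : ∀ a b c : ℤ, a ≤ b → b ≤ c → a ∈ T → c ∈ T → b ∈ T) :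
    ∃ p q : ℤ, p ≤ q ∧ ∀ x, x ∈ T ↔ p ≤ x ∧ x ≤ q :=
  ⟨T.min' hne, T.max' hne, T.min'_le_max' hne, fun _ => ⟨fun h => ⟨T.min'_le _ h, T.le_max' _ h⟩,
    fun h => hc _ _ _ h.1 h.2 (T.min'_mem hne) (T.max'_mem hne)⟩⟩

lemma IsStaircase.exists_adj {I : Set (ℤ × ℤ)} (hI : IsStaircase I) {p q : ℤ × ℤ} (hp : p ∈ I)
    (hq : q ∈ I) (hne : q ≠ p) : ∃ r ∈ I, grid.Adj p r := by
  obtain ⟨a, ha, b, hb, h1, h2, hab⟩ := exists_crossing hI.connected (P := fun r => r = p) hp hq rfl hne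
  exact ⟨b, hb, h1 ▸ hab⟩

lemma IsStaircase.exists_col {I : Set (ℤ × ℤ)} (hI : IsStaircase I) {p q : ℤ × ℤ} (hp : p ∈ I)
    (hq : q ∈ I) {x : ℤ} (h1 : p.1 ≤ x) (h2 : x ≤ q.1) : ∃ r ∈ I, r.1 = x := by
  rcases h2.eq_or_lt with h2 | h2
  · exact ⟨q, hq, h2.symm⟩
  obtain ⟨a, ha, b, hb, k1, k2, hab⟩ := exists_crossing hI.connected (P := fun r => r.1 ≤ x) hp hq h1
    (not_le.2 h2)
  refine ⟨a, ha, ?_⟩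
  have := adj_cases hab
  omega

lemma IsStaircase.exists_row {I : Set (ℤ × ℤ)} (hI : IsStaircase I) {p q : ℤ × ℤ} (hp : p ∈ I)
    (hq : q ∈ I) {y : ℤ} (h1 : p.2 ≤ y) (h2 : y ≤ q.2) : ∃ r ∈ I, r.2 = y := by
  rcases h2.eq_or_lt with h2 | h2
  · exact ⟨q, hq, h2.symm⟩
  obtain ⟨a, ha, b, hb, k1, k2, hab⟩ := exists_crossing hI.connected (P := fun r => r.2 ≤ y) hp hq h1
    (not_le.2 h2)
  refine ⟨a, ha, ?_⟩
  have := adj_cases hab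
  omega

/-- A convex set between a staircase set and its bounding box that is cut out by diagonal
constraints away from the sides of the box is described by a frame. -/
lemma exists_frame {I H : Finset (ℤ × ℤ)} (hI : IsStaircase (↑I : Set (ℤ × ℤ))) (hIH : I ⊆ H)
    (hrow : ∀ a b c y : ℤ, a ≤ b → b ≤ c → (a, y) ∈ H → (c, y) ∈ H → (b, y) ∈ H)
    (hcol : ∀ x a b c : ℤ, a ≤ b → b ≤ c → (x, a) ∈ H → (x, c) ∈ H → (x, b) ∈ H)
    {x0 x1 y0 y1 s1 s2 d1 d2 : ℤ} (hbox : ∀ p ∈ H, x0 ≤ p.1 ∧ p.1 ≤ x1 ∧ y0 ≤ p.2 ∧ p.2 ≤ y1)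
    (hb : ∃ x, (x, y0) ∈ I) (hl : ∃ y, (x0, y) ∈ I) (ht : ∃ x, (x, y1) ∈ I) (hr : ∃ y, (x1, y) ∈ I)
    (hdiag : ∀ p ∈ H, s1 ≤ p.1 + p.2 ∧ p.1 + p.2 ≤ s2 ∧ d1 ≤ p.1 - p.2 ∧ p.1 - p.2 ≤ d2)
    (hin : ∀ x y : ℤ, x0 < x → x < x1 → y0 < y → y < y1 → s1 ≤ x + y → x + y ≤ s2 → d1 ≤ x - y →
      x - y ≤ d2 → (x, y) ∈ H)
    (hs : x0 + y0 ≤ s1 ∧ s2 ≤ x1 + y1 ∧ x0 - y1 ≤ d1 ∧ d2 ≤ x1 - y0)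
    (fat : x0 + 4 ≤ x1 ∧ y0 + 4 ≤ y1 ∧ s1 + 4 ≤ s2 ∧ d1 + 4 ≤ d2)
    (diag : s1 + 4 ≤ x1 + y0 ∧ s1 + 4 ≤ x0 + y1 ∧ x1 + y0 + 4 ≤ s2 ∧ x0 + y1 + 4 ≤ s2)
    (diag' : d1 + 4 ≤ x0 - y0 ∧ d1 + 4 ≤ x1 - y1 ∧ x0 - y0 + 4 ≤ d2 ∧ x1 - y1 + 4 ≤ d2)
    (center : ∃ x y : ℤ, (x0 + 1 < x ∧ x < x1 - 1 ∧ y0 + 1 < y ∧ y < y1 - 1) ∧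
      (s1 < x + y ∧ x + y < s2 ∧ d1 < x - y ∧ x - y < d2)) :
    ∃ F : Frame, F.Valid ∧ F.fin = H ∧ (F.x0 = x0 ∧ F.x1 = x1 ∧ F.y0 = y0 ∧ F.y1 = y1) ∧
      (F.s1 = s1 ∧ F.s2 = s2 ∧ F.d1 = d1 ∧ F.d2 = d2) := by
  have rowEnds : ∀ y : ℤ, (∃ x, (x, y) ∈ I) → ∃ p q : ℤ, p ≤ q ∧ ∀ x, (x, y) ∈ H ↔ p ≤ x ∧ x ≤ q := by
    rintro y ⟨x, hx⟩
    obtain ⟨p, q, h1, h2⟩ := exists_ends (T := (H.filter fun p => p.2 = y).image Prod.fst)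
      ⟨x, Finset.mem_image.2 ⟨_, Finset.mem_filter.2 ⟨hIH hx, rfl⟩, rfl⟩⟩ (fun a b c hab hbc ha hc => by
        simp only [Finset.mem_image, Finset.mem_filter, Prod.exists, exists_and_right,
          exists_eq_right] at ha hc ⊢
        exact hrow a b c _ hab hbc ha hc)
    refine ⟨p, q, h1, fun x => ?_⟩
    rw [← h2]
    simp
  have colEnds : ∀ x : ℤ, (∃ y, (x, y) ∈ I) → ∃ p q : ℤ, p ≤ q ∧ ∀ y, (x, y) ∈ H ↔ p ≤ y ∧ y ≤ q := by
    rintro x ⟨y, hy⟩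
    obtain ⟨p, q, h1, h2⟩ := exists_ends (T := (H.filter fun p => p.1 = x).image Prod.snd)
      ⟨y, Finset.mem_image.2 ⟨_, Finset.mem_filter.2 ⟨hIH hy, rfl⟩, rfl⟩⟩ (fun a b c hab hbc ha hc => by
        simp only [Finset.mem_image, Finset.mem_filter, Prod.exists, exists_eq_right] at ha hc ⊢
        exact hcol _ a b c hab hbc ha hc)
    refine ⟨p, q, h1, fun y => ?_⟩
    rw [← h2]
    simp
  obtain ⟨p1, q1, l1, m1⟩ := rowEnds y0 hb
  obtain ⟨p2, q2, l2, m2⟩ := colEnds x0 hl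
  obtain ⟨p3, q3, l3, m3⟩ := rowEnds y1 ht
  obtain ⟨p4, q4, l4, m4⟩ := colEnds x1 hr
  have D : ∀ x y, (x, y) ∈ H → (x0 ≤ x ∧ x ≤ x1 ∧ y0 ≤ y ∧ y ≤ y1) ∧
    (s1 ≤ x + y ∧ x + y ≤ s2 ∧ d1 ≤ x - y ∧ x - y ≤ d2) := fun x y h => ⟨hbox _ h, hdiag _ h⟩
  have a1 := D _ _ ((m1 p1).2 ⟨le_rfl, l1⟩)
  have a2 := D _ _ ((m1 q1).2 ⟨l1, le_rfl⟩)
  have a3 := D _ _ ((m2 p2).2 ⟨le_rfl, l2⟩)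
  have a4 := D _ _ ((m2 q2).2 ⟨l2, le_rfl⟩)
  have a5 := D _ _ ((m3 p3).2 ⟨le_rfl, l3⟩)
  have a6 := D _ _ ((m3 q3).2 ⟨l3, le_rfl⟩)
  have a7 := D _ _ ((m4 p4).2 ⟨le_rfl, l4⟩)
  have a8 := D _ _ ((m4 q4).2 ⟨l4, le_rfl⟩)
  have c00 := (m1 x0).symm.trans (m2 y0)
  have c10 := (m1 x1).symm.trans (m4 y0)
  have c01 := (m3 x0).symm.trans (m2 y1)
  have c11 := (m3 x1).symm.trans (m4 y1)
  have iso : ∀ x y, (x, y) ∈ I → (x + 1, y) ∈ H ∨ (x - 1, y) ∈ H ∨ (x, y + 1) ∈ H ∨ (x, y - 1) ∈ H := by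
    intro x y hxy
    obtain ⟨xb, hxb⟩ := hb
    obtain ⟨xt, hxt⟩ := ht
    obtain ⟨r, hr1, hr2⟩ : ∃ r ∈ (↑I : Set (ℤ × ℤ)), grid.Adj (x, y) r := by
      by_cases e : (xb, y0) = (x, y)
      · refine hI.exists_adj (q := (xt, y1)) hxy hxt fun e' => ?_
        simp only [Prod.mk.injEq] at e e'
        omega
      · exact hI.exists_adj hxy hxb e
    obtain ⟨a, b⟩ := r
    have := adj_cases hr2
    simp only at this
    have hr1 := hIH hr1
    rcases this with ⟨rfl, rfl⟩ | ⟨rfl, rfl⟩ | ⟨rfl, rfl⟩ | ⟨rfl, rfl⟩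
    exacts [.inl hr1, .inr (.inl hr1), .inr (.inr (.inl hr1)), .inr (.inr (.inr hr1))]
  have n1 : ∀ x, (x, y0 - 1) ∉ H := fun x h => by have := (D _ _ h).1; omega
  have n2 : ∀ x, (x, y1 + 1) ∉ H := fun x h => by have := (D _ _ h).1; omega
  have n3 : ∀ y, (x0 - 1, y) ∉ H := fun x h => by have := (D _ _ h).1; omega
  have n4 : ∀ y, (x1 + 1, y) ∉ H := fun x h => by have := (D _ _ h).1; omega
  obtain ⟨xb, hxb⟩ := hb
  obtain ⟨xt, hxt⟩ := ht
  refine ⟨⟨x0, x1, y0, y1, s1, s2, d1, d2, p1, q1, p2, q2, p3, q3, p4, q4⟩,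
    ⟨?_, ?_, ?_, ?_, ?_, ?_, ?_, ?_, ⟨l1, l2, l3, l4⟩, fat, diag, diag', ?_, center⟩, ?_,
    ⟨rfl, rfl, rfl, rfl⟩, rfl, rfl, rfl, rfl⟩
  any_goals simp only
  · omega
  · omega
  · omega
  · omega
  · omega
  · omega
  · omega
  · omega
  · have hxb' := (m1 xb).1 (hIH hxb)
    have hxt' := (m3 xt).1 (hIH hxt)
    refine ⟨?_, ?_, ?_, ?_⟩ <;> by_contra! hn
    · obtain rfl : xb = x0 := by omega
      have := iso _ _ hxb
      simp only [n1, n3, or_false, false_or] at this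
      rw [m1, m2] at this
      omega
    · obtain rfl : xb = x1 := by omega
      have := iso _ _ hxb
      simp only [n1, n4, or_false, false_or] at this
      rw [m1, m4] at this
      omega
    · obtain rfl : xt = x1 := by omega
      have := iso _ _ hxt
      simp only [n2, n4, false_or] at this
      rw [m3, m4] at this
      omega
    · obtain rfl : xt = x0 := by omega
      have := iso _ _ hxt
      simp only [n2, n3, false_or] at this
      rw [m3, m2] at this
      omega
  · ext ⟨x, y⟩
    rw [Frame.mem_fin]
    constructor
    · rintro ⟨b1, b2, b3, b4, b5, b6⟩
      simp only at b1 b2 b3 b4 b5 b6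
      by_cases e1 : y = y0
      · rw [e1]; exact (m1 x).2 (b3 e1)
      by_cases e2 : x = x0
      · rw [e2]; exact (m2 y).2 (b4 e2)
      by_cases e3 : y = y1
      · rw [e3]; exact (m3 x).2 (b5 e3)
      by_cases e4 : x = x1
      · rw [e4]; exact (m4 y).2 (b6 e4)
      exact hin x y (by omega) (by omega) (by omega) (by omega) b2.1 b2.2.1 b2.2.2.1 b2.2.2.2
    · intro h
      have := D _ _ h
      refine ⟨this.1, this.2, ?_, ?_, ?_, ?_⟩ <;> rintro (e : _ = _) <;> simp only at e <;>
        rw [e] at h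
      exacts [(m1 x).1 h, (m2 y).1 h, (m3 x).1 h, (m4 y).1 h]

namespace Frame
section
variable {F : Frame} {E : ℕ} {X₁ Y₂ X₃ Y₄ : ℤ}

/-- Core sites on the extreme rows, columns and diagonals. -/
lemma Mid.core_extreme (h : F.Mid E X₁ Y₂ X₃ Y₄) :
    ((∃ x, F.Core E x (F.y0 + E)) ∧ (∃ y, F.Core E (F.x0 + E) y) ∧ (∃ x, F.Core E x (F.y1 - E)) ∧
      ∃ y, F.Core E (F.x1 - E) y) ∧
    F.Core E (F.x0 + E) (F.s1 - F.x0 + E) ∧ F.Core E (F.x1 - E) (F.x1 - F.d2 + E) ∧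
    F.Core E (F.x0 + E) (F.x0 - F.d1 - E) ∧ F.Core E (F.x1 - E) (F.s2 - F.x1 - E) := by
  have hb := h.basic
  have v1 := h.valid.sw; have v2 := h.valid.se; have v3 := h.valid.ne; have v4 := h.valid.nw
  have b1 := h.bot; have b2 := h.left; have b3 := h.top; have b4 := h.right
  have hE := h.pos
  refine ⟨⟨h.core_row le_rfl (by omega), h.core_col le_rfl (by omega), h.core_row (by omega) le_rfl,
    h.core_col (by omega) le_rfl⟩, ?_, ?_, ?_, ?_⟩ <;> unfold Core <;>
    clear * - hb v1 v2 v3 v4 b1 b2 b3 b4 hE <;> refine ⟨⟨?_, ?_, ?_, ?_⟩, ?_, ?_, ?_, ?_⟩ <;> omega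

end
section
variable {F : Frame} {E : ℕ} {X₁ Y₂ X₃ Y₄ : ℤ}

/-- A staircase set `I` near the set of a frame is contained in the set of a frame with the same
bounding box and as many diagonal steps as `I` has corner sites; the external slices of the new set
are contained in a given set `Q`. -/
lemma Mid.exists_fill (h : F.Mid E X₁ Y₂ X₃ Y₄) {I Q : Finset (ℤ × ℤ)}
    (hI : IsStaircase (↑I : Set (ℤ × ℤ))) (hcore : ∀ x y, F.Core E x y → (x, y) ∈ I)
    (hIQ : I ⊆ Q) (hQF : Q ⊆ F.fin) (hQ : IsStaircase (↑Q : Set (ℤ × ℤ)))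
    {N : Fin 4 → Finset (ℤ × ℤ)} (hN : ∀ i, ∀ w ∈ N i, NotchAt I i w) :
    ∃ G : Frame, G.Valid ∧ I ⊆ G.fin ∧ G.fin ⊆ F.fin ∧ (∑ i, (N i).card : ℕ) ≤ G.steps ∧
      sides G.fin = sides I ∧ (∀ i, sl G.fin i ⊆ Q) ∧ (∀ i, sl I i ⊆ sl G.fin i) ∧
      ∀ z ∈ Q, z ∈ ocr I → (∀ i, z ∉ N i) → z ∈ G.fin := by
  classical
  have hne : I.Nonempty := by
    obtain ⟨p, hp⟩ := hI.connected.nonempty; exact ⟨p, hp⟩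
  obtain ⟨⟨xb, y0⟩, hb, hb'⟩ := I.exists_min_image (fun p => p.2) hne
  obtain ⟨⟨x0, yl⟩, hl, hl'⟩ := I.exists_min_image (fun p => p.1) hne
  obtain ⟨⟨xt, y1⟩, ht, ht'⟩ := I.exists_max_image (fun p => p.2) hne
  obtain ⟨⟨x1, yr⟩, hr, hr'⟩ := I.exists_max_image (fun p => p.1) hne
  simp only at hb' hl' ht' hr'
  have hbox : ∀ p ∈ I, x0 ≤ p.1 ∧ p.1 ≤ x1 ∧ y0 ≤ p.2 ∧ p.2 ≤ y1 := fun p hp =>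
    ⟨hl' p hp, hr' p hp, hb' p hp, ht' p hp⟩
  have hIF : ∀ p ∈ I, F.Mem p.1 p.2 := fun p hp => mem_fin.1 (hQF (hIQ hp))
  have hquad : ∀ p ∈ I, ∀ i, ((N i).card : ℤ) ≤ quad x0 x1 y0 y1 i p := fun p hp i =>
    card_le_quad hbox (hN i) (hbox p hp) fun w hw => (hN i w hw).sep hI hp
  set H := F.fin.filter fun p => (x0 ≤ p.1 ∧ p.1 ≤ x1 ∧ y0 ≤ p.2 ∧ p.2 ≤ y1) ∧
    (∀ i, ((N i).card : ℤ) ≤ quad x0 x1 y0 y1 i p) ∧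
    (p.1 = x0 ∨ p.1 = x1 ∨ p.2 = y0 ∨ p.2 = y1 → p ∈ Q) with hH
  have hmem : ∀ {p}, p ∈ H ↔ p ∈ F.fin ∧ (x0 ≤ p.1 ∧ p.1 ≤ x1 ∧ y0 ≤ p.2 ∧ p.2 ≤ y1) ∧
    (∀ i, ((N i).card : ℤ) ≤ quad x0 x1 y0 y1 i p) ∧
    (p.1 = x0 ∨ p.1 = x1 ∨ p.2 = y0 ∨ p.2 = y1 → p ∈ Q) := fun {p} => by
    rw [hH, Finset.mem_filter]
  have hIH : I ⊆ H := fun p hp => hmem.2 ⟨hQF (hIQ hp), hbox p hp, hquad p hp, fun _ => hIQ hp⟩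
  have hQH := hQ.row
  have hQV := hQ.col
  have hrow : ∀ a b c y : ℤ, a ≤ b → b ≤ c → (a, y) ∈ H → (c, y) ∈ H → (b, y) ∈ H := by
    intro a b c y hab hbc ha hc
    rcases hab.eq_or_lt with rfl | hab'
    · exact ha
    rcases hbc.eq_or_lt with rfl | hbc'
    · exact hc
    rw [hmem] at ha hc ⊢
    obtain ⟨a1, a2, a3, a4⟩ := ha
    obtain ⟨c1, c2, c3, c4⟩ := hc
    simp only at a2 c2 a4 c4 ⊢
    refine ⟨mem_fin.2 (mem_row hab hbc (mem_fin.1 a1) (mem_fin.1 c1)), by omega, fun i => ?_,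
      fun hs => hQH a b c y hab hbc (a4 (by omega)) (c4 (by omega))⟩
    have k1 := a3 i
    have k2 := c3 i
    fin_cases i <;> simp only [quad] at k1 k2 ⊢ <;> omega
  have hcol : ∀ x a b c : ℤ, a ≤ b → b ≤ c → (x, a) ∈ H → (x, c) ∈ H → (x, b) ∈ H := by
    intro x a b c hab hbc ha hc
    rcases hab.eq_or_lt with rfl | hab'
    · exact ha
    rcases hbc.eq_or_lt with rfl | hbc'
    · exact hc
    rw [hmem] at ha hc ⊢
    obtain ⟨a1, a2, a3, a4⟩ := ha
    obtain ⟨c1, c2, c3, c4⟩ := hc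
    simp only at a2 c2 a4 c4 ⊢
    refine ⟨mem_fin.2 (mem_col hab hbc (mem_fin.1 a1) (mem_fin.1 c1)), by omega, fun i => ?_,
      fun hs => hQV x a b c hab hbc (a4 (by omega)) (c4 (by omega))⟩
    have k1 := a3 i
    have k2 := c3 i
    fin_cases i <;> simp only [quad] at k1 k2 ⊢ <;> omega
  obtain ⟨⟨⟨xc, e1⟩, ⟨yc, e2⟩, ⟨xd, e3⟩, yd, e4⟩, e5, e6, e7, e8⟩ := h.core_extreme
  have g1 := hbox _ (hcore _ _ e1)
  have g2 := hbox _ (hcore _ _ e2)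
  have g3 := hbox _ (hcore _ _ e3)
  have g4 := hbox _ (hcore _ _ e4)
  have g5 := hquad _ (hcore _ _ e5) 0
  have g6 := hquad _ (hcore _ _ e6) 1
  have g7 := hquad _ (hcore _ _ e7) 2
  have g8 := hquad _ (hcore _ _ e8) 3
  simp only [quad] at g1 g2 g3 g4 g5 g6 g7 g8
  have f1 := (hIF _ hb).1
  have f2 := (hIF _ hl).1
  have f3 := (hIF _ ht).1
  have f4 := (hIF _ hr).1
  simp only at f1 f2 f3 f4
  have hbas := h.basic
  have v1 := h.valid.sw; have v2 := h.valid.se; have v3 := h.valid.ne; have v4 := h.valid.nw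
  have b1 := h.bot; have b2 := h.left; have b3 := h.top; have b4 := h.right
  have hE := h.pos
  have near : (F.x0 ≤ x0 ∧ x0 ≤ F.x0 + E) ∧ (F.y0 ≤ y0 ∧ y0 ≤ F.y0 + E) ∧
      (x1 ≤ F.x1 ∧ F.x1 - E ≤ x1) ∧ (y1 ≤ F.y1 ∧ F.y1 - E ≤ y1) := by
    clear * - f1 f2 f3 f4 g1 g2 g3 g4
    omega
  have large : F.x0 + 8 * E < X₁ ∧ X₁ + 8 * E ≤ F.x1 ∧ F.y0 + 8 * E < Y₂ ∧ Y₂ + 8 * E ≤ F.y1 ∧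
      F.y0 + 8 * E < Y₄ ∧ Y₄ + 8 * E ≤ F.y1 ∧ F.x0 + 8 * E < X₃ ∧ X₃ + 8 * E ≤ F.x1 := by
    clear * - hbas b1 b2 b3 b4 v1 v2 v3 v4 hE
    omega
  obtain ⟨s1, s1a, s1b, s1c, s1d⟩ : ∃ s, F.s1 ≤ s ∧ x0 + y0 + (N 0).card ≤ s ∧ s ≤ F.s1 + 2 * E ∧
      (s = F.s1 ∨ s = x0 + y0 + (N 0).card) := ⟨max F.s1 (x0 + y0 + (N 0).card), le_max_left _ _,
        le_max_right _ _, by omega, max_choice _ _⟩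
  obtain ⟨d2, d2a, d2b, d2c, d2d⟩ : ∃ s, s ≤ F.d2 ∧ s ≤ x1 - y0 - (N 1).card ∧ F.d2 - 2 * E ≤ s ∧
      (s = F.d2 ∨ s = x1 - y0 - (N 1).card) := ⟨min F.d2 (x1 - y0 - (N 1).card), min_le_left _ _,
        min_le_right _ _, by omega, min_choice _ _⟩
  obtain ⟨d1, d1a, d1b, d1c, d1d⟩ : ∃ s, F.d1 ≤ s ∧ x0 - y1 + (N 2).card ≤ s ∧ s ≤ F.d1 + 2 * E ∧
      (s = F.d1 ∨ s = x0 - y1 + (N 2).card) := ⟨max F.d1 (x0 - y1 + (N 2).card), le_max_left _ _,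
        le_max_right _ _, by omega, max_choice _ _⟩
  obtain ⟨s2, s2a, s2b, s2c, s2d⟩ : ∃ s, s ≤ F.s2 ∧ s ≤ x1 + y1 - (N 3).card ∧ F.s2 - 2 * E ≤ s ∧
      (s = F.s2 ∨ s = x1 + y1 - (N 3).card) := ⟨min F.s2 (x1 + y1 - (N 3).card), min_le_left _ _,
        min_le_right _ _, by omega, min_choice _ _⟩
  obtain ⟨G, G1, G2, G3, G4⟩ := exists_frame hI hIH hrow hcol (x0 := x0) (x1 := x1) (y0 := y0) (y1 := y1)
    (s1 := s1) (s2 := s2) (d1 := d1) (d2 := d2) (fun p hp => (hmem.1 hp).2.1) ⟨xb, hb⟩ ⟨yl, hl⟩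
    ⟨xt, ht⟩ ⟨yr, hr⟩ (fun p hp => by
      have k1 := (hmem.1 hp).2.2.1
      have k2 := (mem_fin.1 (hmem.1 hp).1).2.1
      have l0 := k1 0; have l1 := k1 1; have l2 := k1 2; have l3 := k1 3
      simp only [quad] at l0 l1 l2 l3
      clear * - k2 l0 l1 l2 l3 s1d s2d d1d d2d
      omega)
    (fun x y h1 h2 h3 h4 h5 h6 h7 h8 => by
      refine hmem.2 ⟨mem_fin.2 ?_, by simp only; omega, fun i => ?_, fun hc => by simp only at hc; omega⟩
      · clear * - near h1 h2 h3 h4 h5 h6 h7 h8 s1a s2a d1a d2a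
        refine ⟨?_, ?_, ?_, ?_, ?_, ?_⟩ <;> omega
      · clear * - h5 h6 h7 h8 s1b s2b d1b d2b
        fin_cases i
        · change ((N 0).card : ℤ) ≤ x - x0 + (y - y0); omega
        · change ((N 1).card : ℤ) ≤ x1 - x + (y - y0); omega
        · change ((N 2).card : ℤ) ≤ x - x0 + (y1 - y); omega
        · change ((N 3).card : ℤ) ≤ x1 - x + (y1 - y); omega)
    (by clear * - s1b s2b d1b d2b; omega)
    (by clear * - near large hbas s1c s2c d1c d2c hE; omega)
    (by clear * - near large hbas s1c s2c d1c d2c hE; omega)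
    (by clear * - near large hbas s1c s2c d1c d2c hE; omega)
    ⟨X₁, F.y0 + 4 * E, by clear * - near large hE; omega,
      by clear * - near large hbas s1c s2c d1c d2c hE; omega⟩
  have side0 : ∀ p, p ∈ sl H 0 → p.2 = y0 := fun p hp => by
    have k := (mem_sl0.1 hp).2 _ (hIH hb)
    have := (hmem.1 (mem_sl0.1 hp).1).2.1
    simp only at k; omega
  have side1 : ∀ p, p ∈ sl H 1 → p.1 = x0 := fun p hp => by
    have k := (mem_sl1.1 hp).2 _ (hIH hl)
    have := (hmem.1 (mem_sl1.1 hp).1).2.1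
    simp only at k; omega
  have side2 : ∀ p, p ∈ sl H 2 → p.2 = y1 := fun p hp => by
    have k := (mem_sl2.1 hp).2 _ (hIH ht)
    have := (hmem.1 (mem_sl2.1 hp).1).2.1
    simp only at k; omega
  have side3 : ∀ p, p ∈ sl H 3 → p.1 = x1 := fun p hp => by
    have k := (mem_sl3.1 hp).2 _ (hIH hr)
    have := (hmem.1 (mem_sl3.1 hp).1).2.1
    simp only at k; omega
  refine ⟨G, G1, by rw [G2]; exact hIH, by rw [G2]; exact Finset.filter_subset _ _, ?_, ?_, ?_, ?_, ?_⟩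
  · rw [Fin.sum_univ_four]
    unfold steps
    rw [G3.1, G3.2.1, G3.2.2.1, G3.2.2.2, G4.1, G4.2.1, G4.2.2.1, G4.2.2.2]
    push_cast
    clear * - s1b s2b d1b d2b
    omega
  · rw [G2, sides_eq_image, sides_eq_image]
    have i1 : H.image Prod.fst = I.image Prod.fst :=
      (Finset.Subset.antisymm (Finset.image_subset_image hIH) fun a ha => by
        obtain ⟨p, hp, rfl⟩ := Finset.mem_image.1 ha
        have := (hmem.1 hp).2.1
        obtain ⟨r, hr, e⟩ := hI.exists_col hl hr (x := p.1) this.1 this.2.1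
        exact Finset.mem_image.2 ⟨r, hr, e⟩).symm
    have i2 : H.image Prod.snd = I.image Prod.snd :=
      (Finset.Subset.antisymm (Finset.image_subset_image hIH) fun a ha => by
        obtain ⟨p, hp, rfl⟩ := Finset.mem_image.1 ha
        have := (hmem.1 hp).2.1
        obtain ⟨r, hr, e⟩ := hI.exists_row hb ht (y := p.2) this.2.2.1 this.2.2.2
        exact Finset.mem_image.2 ⟨r, hr, e⟩).symm
    rw [i1, i2]
  · rw [G2]
    intro i p hp
    have hpH := hmem.1 (most_subset _ _ (sl_subset_most _ _ hp))
    fin_cases i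
    · exact hpH.2.2.2 (.inr (.inr (.inl (side0 p hp))))
    · exact hpH.2.2.2 (.inl (side1 p hp))
    · exact hpH.2.2.2 (.inr (.inr (.inr (side2 p hp))))
    · exact hpH.2.2.2 (.inr (.inl (side3 p hp)))
  · rw [G2]
    intro i p hp
    have hpI := most_subset _ _ (sl_subset_most _ _ hp)
    fin_cases i
    · exact mem_sl0.2 ⟨hIH hpI, fun q hq => by
        have := (mem_sl0.1 hp).2 _ hb
        have := (hmem.1 hq).2.1
        simp only at *; omega⟩
    · exact mem_sl1.2 ⟨hIH hpI, fun q hq => by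
        have := (mem_sl1.1 hp).2 _ hl
        have := (hmem.1 hq).2.1
        simp only at *; omega⟩
    · exact mem_sl2.2 ⟨hIH hpI, fun q hq => by
        have := (mem_sl2.1 hp).2 _ ht
        have := (hmem.1 hq).2.1
        simp only at *; omega⟩
    · exact mem_sl3.2 ⟨hIH hpI, fun q hq => by
        have := (mem_sl3.1 hp).2 _ hr
        have := (hmem.1 hq).2.1
        simp only at *; omega⟩
  · rw [G2]
    intro z hz hzo hzN
    have zbox : x0 ≤ z.1 ∧ z.1 ≤ x1 ∧ y0 ≤ z.2 ∧ z.2 ≤ y1 := by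
      obtain ⟨x, y⟩ := z
      obtain ⟨-, z1, z2⟩ := mem_ocr.1 hzo
      simp only [Prod.mk_add_mk, Prod.mk_sub_mk, add_zero, sub_zero] at z1 z2
      have k1 : y0 ≤ y ∧ y ≤ y1 := by rcases z1 with z | z <;> exact (hbox _ z).2.2
      have k2 : x0 ≤ x ∧ x ≤ x1 := by
        rcases z2 with z | z <;> exact ⟨(hbox _ z).1, (hbox _ z).2.1⟩
      exact ⟨k2.1, k2.2, k1⟩
    exact hmem.2 ⟨hQF hz, zbox, fun i => card_le_quad hbox (hN i) zbox fun w hw =>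
      (hN i w hw).sep_ocr hI hzo fun e => hzN i (e ▸ hw), fun _ => hz⟩

end
end Frame

lemma eq_of_diss_eq {J I H : Finset (ℤ × ℤ)} (hJ : J.Nonempty) (hIH : I ⊆ H) (hHJ : H ⊆ J)
    (h : diss J H = diss J I) : H = I := by
  rw [diss_of_subset hHJ, diss_of_subset (hIH.trans hHJ),
    ← Finset.sum_sdiff (Finset.sdiff_subset_sdiff le_rfl hIH)] at h
  refine Finset.Subset.antisymm (fun p hp => ?_) hIH
  by_contra hn
  have h0 : ∑ p ∈ (J \ I) \ (J \ H), dep J p = 0 := by omega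
  exact (dep_pos hJ p).ne' ((Finset.sum_eq_zero_iff.1 h0) p (by simp [hHJ hp, hn, hp]))

lemma mem_ocr_of_nb {I Z : Finset (ℤ × ℤ)} (hI : IsStaircase (↑I : Set (ℤ × ℤ))) {z : ℤ × ℤ}
    (hz : z ∉ I) (h : nb (spin I Z) z 1 = 2) : z ∈ ocr I := by
  have hH := hI.row
  have hV := hI.col
  obtain ⟨x, y⟩ := z
  have c1 : ¬ ((x + 1, y) ∈ I ∧ (x - 1, y) ∈ I) := fun h => hz (hH _ x _ y (by omega) (by omega) h.2 h.1)
  have c2 : ¬ ((x, y + 1) ∈ I ∧ (x, y - 1) ∈ I) := fun h => hz (hV x _ y _ (by omega) (by omega) h.2 h.1)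
  rw [mem_ocr]
  unfold nb at h
  simp only [spin_eq_one, Prod.mk_add_mk, Prod.mk_sub_mk, add_zero, sub_zero] at h ⊢
  refine ⟨hz, ?_, ?_⟩
  · by_contra! hc
    simp only [hc.1, hc.2, if_false] at h
    split_ifs at h <;> simp_all
  · by_contra! hc
    simp only [hc.1, hc.2, if_false] at h
    split_ifs at h <;> simp_all

namespace Frame
section
variable {F : Frame} {E : ℕ} {X₁ Y₂ X₃ Y₄ : ℤ} {I Z : Finset (ℤ × ℤ)}

/-- A staircase minimizer with the same number of surfactant sites is described by a frame. -/
theorem Mid.isQuasiOctagon_of_isMin {k ε : ℝ} (hk : 1 / 3 < k) (hk' : k < 1) (hε : 0 < ε)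
    (h : F.Mid E X₁ Y₂ X₃ Y₄) (hI : IsStaircase (↑I : Set (ℤ × ℤ)))
    (hcore : ∀ x y, F.Core E x y → (x, y) ∈ I) (hIF : I ⊆ F.fin) {n : ℕ}
    (hmin : IsMin k (4 * k) ε F.fin n I Z) (hn : Z.card = n)
    (hsat : n + 16 * E ≤ (obd F.fin).card) : IsQuasiOctagon (↑I : Set (ℤ × ℤ)) := by
  obtain ⟨G, g1, g2, g3, g4, g5, g6, g7, -⟩ := h.exists_fill hI hcore le_rfl hIF hI
    (N := notches I (dbl I Z)) fun i w hw => (mem_notches.1 hw).2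
  have hst := g1.isStaircase
  have hsat' := h.obd_le hst (fun x y hc => g2 (hcore x y hc)) fun p hp => mem_fin.1 (g3 hp)
  have hd := card_le_sum_notches (I := I) (Z := dbl I Z) fun z hz => exists_notchAt_of_dbl hz
  have hst' := g1.steps_le
  have hFne : F.fin.Nonempty := by
    obtain ⟨p, hp⟩ := h.valid.isStaircase.connected.nonempty; exact ⟨p, hp⟩
  obtain ⟨Z', z1, z2, z3, -⟩ := exists_better hk hk' hmin.1 hn hst ∅ (by simp [g5]) (by omega)
    (fun i _ => Finset.card_le_card fun p hp => by
      have hpI := g6 i hp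
      fin_cases i
      · exact mem_sl0.2 ⟨hpI, fun q hq => (mem_sl0.1 hp).2 q (g2 hq)⟩
      · exact mem_sl1.2 ⟨hpI, fun q hq => (mem_sl1.1 hp).2 q (g2 hq)⟩
      · exact mem_sl2.2 ⟨hpI, fun q hq => (mem_sl2.1 hp).2 q (g2 hq)⟩
      · exact mem_sl3.2 ⟨hpI, fun q hq => (mem_sl3.1 hp).2 q (g2 hq)⟩) (by omega)
  obtain ⟨-, e⟩ := hmin.eq_of_le (by linarith) hε z1 (z2.trans hn.symm) z3 (by
    rw [diss_of_subset g3, diss_of_subset hIF]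
    exact Finset.sum_le_sum_of_subset (Finset.sdiff_subset_sdiff le_rfl g2))
  rw [← eq_of_diss_eq hFne g2 g3 e]
  exact g1.isQuasiOctagon

/-- The surfactant at the corners of a minimizer lies at the corners of the previous phase-one set
if there is more surfactant than before. -/
theorem Mid.subset_ocr_of_isMin {k ε : ℝ} (hk : 1 / 3 < k) (hk' : k < 1) (hε : 0 < ε)
    (h : F.Mid E X₁ Y₂ X₃ Y₄) (hI : IsStaircase (↑I : Set (ℤ × ℤ)))
    (hcore : ∀ x y, F.Core E x y → (x, y) ∈ I) (hIF : I ⊆ F.fin) {n : ℕ}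
    (hmin : ∀ Z' ⊆ Z, n ≤ Z'.card → IsMin k (4 * k) ε F.fin n I Z') (hn : n < Z.card)
    (hZ : Z ⊆ ocr I) : Z ⊆ ocr F.fin := by
  intro z hz
  by_contra hzF
  have hFne : F.fin.Nonempty := by
    obtain ⟨p, hp⟩ := h.valid.isStaircase.connected.nonempty; exact ⟨p, hp⟩
  have hc := Finset.card_erase_of_mem hz
  have hmin := hmin (Z.erase z) (Finset.erase_subset _ _) (by omega)
  obtain ⟨G, g1, g2, g3, g4, g5, -, -, g8⟩ := h.exists_fill hI hcore hIF le_rfl h.valid.isStaircase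
    (N := notches I (Z.erase z)) fun i w hw => (mem_notches.1 hw).2
  have hd := card_le_sum_notches (I := I) (Z := Z.erase z) fun w hw =>
    exists_notchAt_of_ocr hI (hZ (Finset.mem_of_mem_erase hw))
  have hst' := g1.steps_le
  obtain ⟨Z', z1, z2⟩ := Finset.exists_subset_card_eq (s := ocr G.fin) (n := (Z.erase z).card) (by omega)
  have hub := en_le_of_subset_ocr hk' g1.isStaircase z1
  have hlb := en_ge (by linarith) hk' hmin.1 (k := k)
  have hK : ∑ i, (cov I (Z.erase z) i).card ≤ 2 * (Z.erase z).card := by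
    have h1 := sum_cov I (Z.erase z)
    have h2 : (dbl I (Z.erase z)).card ≤ (Z.erase z).card := Finset.card_filter_le _ _
    omega
  have hK' := mul_le_mul_of_nonneg_left (Nat.cast_le (α := ℝ).2 hK) (by linarith : 0 ≤ 1 + k)
  have hg : 0 ≤ (1 - k) * (gaps I + unhits I (Z.erase z) : ℝ) :=
    mul_nonneg (by linarith) (by positivity)
  rw [g5, z2] at hub
  push_cast at hK' hlb
  obtain ⟨-, e⟩ := hmin.eq_of_le (by linarith) hε (Finset.disjoint_left.2 fun p hp hpZ =>
      (mem_ocr.1 (z1 hpZ)).1 hp) z2 (by linarith) (by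
    rw [diss_of_subset g3, diss_of_subset hIF]
    exact Finset.sum_le_sum_of_subset (Finset.sdiff_subset_sdiff le_rfl g2))
  have hGI := eq_of_diss_eq hFne g2 g3 e
  have hzI := mem_ocr.1 (hZ hz)
  refine hzF (mem_ocr.2 ⟨fun hzJ => hzI.1 ?_, hzI.2.1.imp (fun h => hIF h) fun h => hIF h,
    hzI.2.2.imp (fun h => hIF h) fun h => hIF h⟩)
  rw [← hGI]
  exact g8 z hzJ (hZ hz) fun i hi => Finset.notMem_erase z Z (mem_notches.1 hi).1

end
end Frame

/-- The site has a neighbour outside the set. -/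
def Open (P : ℤ → ℤ → Prop) (x y : ℤ) : Prop :=
  ¬ (P (x + 1) y ∧ P (x - 1) y ∧ P x (y + 1) ∧ P x (y - 1))

/-- A convex set in a box whose inner part is cut out by diagonal constraints, with flat parts of
the boundary only near the sides of the box. -/
structure Octagonal (P : ℤ → ℤ → Prop) (x0 x1 y0 y1 c c' d d' : ℤ) : Prop where
  box : ∀ x y, P x y → x0 ≤ x ∧ x ≤ x1 ∧ y0 ≤ y ∧ y ≤ y1
  row : ∀ a b e y, a ≤ b → b ≤ e → P a y → P e y → P b y
  col : ∀ x a b e, a ≤ b → b ≤ e → P x a → P x e → P x b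
  inner : ∀ x y, x0 < x → x < x1 → y0 < y → y < y1 →
    (P x y ↔ c ≤ x + y ∧ x + y ≤ c' ∧ d ≤ x - y ∧ x - y ≤ d')
  left : ∃ y, y0 + 1 < y ∧ y < y1 - 1 ∧ P x0 y ∧ P (x0 + 1) y
  right : ∃ y, y0 + 1 < y ∧ y < y1 - 1 ∧ P x1 y ∧ P (x1 - 1) y
  bottom : ∃ x, x0 + 1 < x ∧ x < x1 - 1 ∧ P x y0 ∧ P x (y0 + 1)
  top : ∃ x, x0 + 1 < x ∧ x < x1 - 1 ∧ P x y1 ∧ P x (y1 - 1)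
  flatH : ∀ x y, y0 + 1 < y → y < y1 - 1 → P x y → P (x + 1) y → Open P x y → Open P (x + 1) y →
    False
  flatV : ∀ x y, x0 + 1 < x → x < x1 - 1 → P x y → P x (y + 1) → Open P x y → Open P x (y + 1) →
    False

section
variable {P : ℤ → ℤ → Prop} {x0 x1 y0 y1 c c' d d' : ℤ}

lemma Octagonal.swap (h : Octagonal P x0 x1 y0 y1 c c' d d') :
    Octagonal (fun x y => P y x) y0 y1 x0 x1 c c' (-d') (-d) where
  box x y hp := by have := h.box y x hp; omega
  row a b e y := h.col y a b e
  col x a b e := h.row a b e x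
  inner x y h1 h2 h3 h4 := by rw [h.inner y x h3 h4 h1 h2]; omega
  left := h.bottom
  right := h.top
  bottom := h.left
  top := h.right
  flatH x y h1 h2 h3 h4 h5 h6 := h.flatV y x h1 h2 h3 h4 (fun hc => h5 (by tauto))
    fun hc => h6 (by tauto)
  flatV x y h1 h2 h3 h4 h5 h6 := h.flatH y x h1 h2 h3 h4 (fun hc => h5 (by tauto))
    fun hc => h6 (by tauto)

lemma open_hf {x y : ℤ} (h : Open (hf P) x y) : Open P (-x) y := fun hc => h (by
  unfold hf
  rw [show -(x + 1) = -x - 1 by ring, show -(x - 1) = -x + 1 by ring]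
  tauto)

lemma Octagonal.flip (h : Octagonal P x0 x1 y0 y1 c c' d d') :
    Octagonal (hf P) (-x1) (-x0) y0 y1 (-d') (-d) (-c') (-c) where
  box x y hp := by have := h.box _ _ hp; omega
  row a b e y h1 h2 h3 h4 := h.row _ (-b) _ y (neg_le_neg h2) (neg_le_neg h1) h4 h3
  col x a b e := h.col (-x) a b e
  inner x y h1 h2 h3 h4 := by
    unfold hf; rw [h.inner (-x) y (by omega) (by omega) h3 h4]; omega
  left := by
    obtain ⟨y, h1, h2, h3, h4⟩ := h.right
    refine ⟨y, h1, h2, ?_, ?_⟩ <;> unfold hf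
    · rwa [neg_neg]
    · rwa [show -(-x1 + 1) = x1 - 1 by ring]
  right := by
    obtain ⟨y, h1, h2, h3, h4⟩ := h.left
    refine ⟨y, h1, h2, ?_, ?_⟩ <;> unfold hf
    · rwa [neg_neg]
    · rwa [show -(-x0 - 1) = x0 + 1 by ring]
  bottom := by
    obtain ⟨x, h1, h2, h3, h4⟩ := h.bottom
    refine ⟨-x, by omega, by omega, ?_, ?_⟩ <;> unfold hf <;> rwa [neg_neg]
  top := by
    obtain ⟨x, h1, h2, h3, h4⟩ := h.top
    refine ⟨-x, by omega, by omega, ?_, ?_⟩ <;> unfold hf <;> rwa [neg_neg]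
  flatH x y h1 h2 h3 h4 h5 h6 := by
    have e : -(x + 1) + 1 = -x := by ring
    refine h.flatH (-(x + 1)) y h1 h2 h4 ?_ (open_hf h6) ?_ <;> rw [e]
    exacts [h3, open_hf h5]
  flatV x y h1 h2 h3 h4 h5 h6 := h.flatV (-x) y (by omega) (by omega) h3 h4 (open_hf h5) (open_hf h6)

lemma Octagonal.vflip (h : Octagonal P x0 x1 y0 y1 c c' d d') :
    Octagonal (vf P) x0 x1 (-y1) (-y0) d d' c c' := by
  have := h.swap.flip.swap
  rwa [neg_neg, neg_neg, neg_neg, neg_neg] at this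

lemma Octagonal.le_left (h : Octagonal P x0 x1 y0 y1 c c' d d') (hc : x0 + y0 + 2 < c) {y : ℤ}
    (hy : P x0 y) : c ≤ x0 + y := by
  by_contra! hn
  obtain ⟨yl, l1, l2, l3, l4⟩ := h.left
  obtain ⟨xb, b1, b2, b3, b4⟩ := h.bottom
  have hx : x0 + 1 < x1 := by omega
  have i1 := (h.inner (x0 + 1) yl (by omega) hx (by omega) (by omega)).1 l4
  have i2 := (h.inner xb (y0 + 1) (by omega) (by omega) (by omega) (by omega)).1 b4
  have k1 : P x0 (c - 1 - x0) := h.col x0 y _ yl (by omega) (by omega) hy l3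
  have k2 : P (x0 + 1) (c - 1 - x0) :=
    (h.inner _ _ (by omega) hx (by omega) (by omega)).2 ⟨by omega, by omega, by omega, by omega⟩
  refine h.flatH x0 (c - 1 - x0) (by omega) (by omega) k1 k2 (fun hc => ?_) fun hc => ?_
  · have := h.box _ _ hc.2.1; omega
  · have := (h.inner _ _ (by omega) hx (by omega) (by omega)).1 hc.2.2.2; omega

/-- The diagonal constraint at the lower left corner can be adapted to the whole set. -/
lemma Octagonal.exists_bound (h : Octagonal P x0 x1 y0 y1 c c' d d') :
    ∃ s, x0 + y0 ≤ s ∧ (∀ x y, P x y → s ≤ x + y) ∧ ∀ x y, x0 < x → y0 < y → s ≤ x + y → c ≤ x + y := by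
  by_cases hc : c ≤ x0 + y0 + 2
  · by_cases hp : P x0 y0
    · exact ⟨x0 + y0, le_rfl, fun x y hxy => by have := h.box x y hxy; omega,
        fun x y h1 h2 h3 => by omega⟩
    · refine ⟨x0 + y0 + 1, by omega, fun x y hxy => ?_, fun x y h1 h2 h3 => by omega⟩
      have := h.box x y hxy
      by_contra hn
      obtain rfl : x = x0 := by omega
      obtain rfl : y = y0 := by omega
      exact hp hxy
  · refine ⟨c, by omega, fun x y hxy => ?_, fun x y _ _ h => h⟩
    have hb := h.box x y hxy
    obtain ⟨yl, l1, l2, l3, l4⟩ := h.left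
    obtain ⟨xb, b1, b2, b3, b4⟩ := h.bottom
    have i1 := (h.inner (x0 + 1) yl (by omega) (by omega) (by omega) (by omega)).1 l4
    have i2 := (h.inner xb (y0 + 1) (by omega) (by omega) (by omega) (by omega)).1 b4
    by_cases e1 : x = x0
    · rw [e1] at hxy ⊢; exact h.le_left (by omega) hxy
    by_cases e2 : y = y0
    · rw [e2] at hxy ⊢; have := h.swap.le_left (by omega) hxy; omega
    by_cases e3 : x = x1
    · omega
    by_cases e4 : y = y1
    · omega
    exact ((h.inner x y (by omega) (by omega) (by omega) (by omega)).1 hxy).1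

end

lemma IsStaircase.exists_inner {J : Finset (ℤ × ℤ)} (hJ : IsStaircase (↑J : Set (ℤ × ℤ)))
    {x e x' p q p' q' y0 y1 : ℤ} (he : e = 1 ∨ e = -1) (hne : x ≠ x')
    (hy : ∀ r ∈ J, y0 ≤ r.2 ∧ r.2 ≤ y1) (hb : ∃ x, (x, y0) ∈ J) (ht : ∃ x, (x, y1) ∈ J)
    (hcol : ∀ y, (x, y) ∈ J ↔ p ≤ y ∧ y ≤ q) (hcol' : ∀ y, (x', y) ∈ J ↔ p' ≤ y ∧ y ≤ q')
    (hpq : p + 4 ≤ q) (hpq' : p' + 4 ≤ q') (hx : ∀ r ∈ J, 0 ≤ e * (r.1 - x)) :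
    ∃ y, y0 + 1 < y ∧ y < y1 - 1 ∧ (x, y) ∈ J ∧ (x + e, y) ∈ J := by
  by_contra! hn
  have hH := hJ.row
  have single : ∀ y, y0 + 1 < y → y < y1 - 1 → p ≤ y → y ≤ q → ∀ a, (a, y) ∈ J → a = x := by
    intro y h1 h2 h3 h4 a ha
    have h5 := (hcol y).2 ⟨h3, h4⟩
    have h6 := hn y h1 h2 h5
    by_contra hax
    have h7 := hx _ ha
    rcases he with rfl | rfl
    · exact h6 (hH x _ a y (by omega) (by simp only at h7; omega) h5 ha)
    · exact h6 (hH a _ x y (by simp only at h7; omega) (by omega) ha h5)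
  have hp := hy _ ((hcol p).2 (by omega))
  have hq := hy _ ((hcol q).2 (by omega))
  have hp' := hy _ ((hcol' p').2 (by omega))
  have hq' := hy _ ((hcol' q').2 (by omega))
  simp only at hp hq hp' hq'
  by_cases h1 : q < y1 - 1
  · obtain ⟨xt, ht⟩ := ht
    obtain ⟨⟨a, b⟩, ha, ⟨a', b'⟩, ha', h3, h4, h5⟩ := exists_crossing hJ.connected
      (P := fun r => r.2 ≤ q) (Finset.mem_coe.2 ((hcol q).2 (by omega))) (Finset.mem_coe.2 ht) le_rfl
      (by simp only; omega)
    have h5 := adj_cases h5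
    simp only at h3 h4 h5
    obtain ⟨rfl, rfl⟩ : b = q ∧ b' = q + 1 := by omega
    obtain rfl : a' = a := by omega
    obtain rfl := single _ (by omega) h1 (by omega) le_rfl _ ha
    have := (hcol _).1 ha'
    omega
  by_cases h2 : y0 + 1 < p
  · obtain ⟨xb, hb⟩ := hb
    obtain ⟨⟨a, b⟩, ha, ⟨a', b'⟩, ha', h3, h4, h5⟩ := exists_crossing hJ.connected
      (P := fun r => r.2 < p) (Finset.mem_coe.2 hb) (Finset.mem_coe.2 ((hcol p).2 (by omega)))
      (by simp only; omega) (by simp)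
    have h5 := adj_cases h5
    simp only at h3 h4 h5
    obtain ⟨rfl, rfl⟩ : b' = p ∧ b = p - 1 := by omega
    obtain rfl : a' = a := by omega
    obtain rfl := single _ h2 (by omega) le_rfl (by omega) _ ha'
    have := (hcol _).1 ha
    omega
  exact hne (single (p' + 2) (by omega) (by omega) (by omega) (by omega) x'
    ((hcol' _).2 (by omega))).symm

lemma IsStaircase.exists_col_ends {J : Finset (ℤ × ℤ)} (hJ : IsStaircase (↑J : Set (ℤ × ℤ))) {x : ℤ}
    {T : Finset (ℤ × ℤ)} (hT : ∀ p, p ∈ T ↔ p ∈ J ∧ p.1 = x) (hne : T.Nonempty) :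
    ∃ p q : ℤ, (T.card : ℤ) ≤ q - p + 1 ∧ ∀ y, (x, y) ∈ J ↔ p ≤ y ∧ y ≤ q := by
  have hV := hJ.col
  have hm : ∀ y, y ∈ T.image Prod.snd ↔ (x, y) ∈ J := fun y => by
    simp only [Finset.mem_image, hT, Prod.exists, exists_eq_right]
  obtain ⟨p, q, h1, h2⟩ := exists_ends (hne.image Prod.snd) fun a b c hab hbc ha hc =>
    (hm b).2 (hV x a b c hab hbc ((hm a).1 ha) ((hm c).1 hc))
  refine ⟨p, q, ?_, fun y => (hm y).symm.trans (h2 y)⟩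
  have h3 : (T.image Prod.snd).card = T.card := Finset.card_image_of_injOn fun a ha b hb e =>
    Prod.ext (((hT a).1 ha).2.trans ((hT b).1 hb).2.symm) e
  have h4 : (T.image Prod.snd).card ≤ (Finset.Icc p q).card :=
    Finset.card_le_card fun y hy => Finset.mem_Icc.2 ((h2 y).1 hy)
  rw [Int.card_Icc] at h4
  omega

lemma IsStaircase.exists_row_ends {J : Finset (ℤ × ℤ)} (hJ : IsStaircase (↑J : Set (ℤ × ℤ))) {y : ℤ}
    {T : Finset (ℤ × ℤ)} (hT : ∀ p, p ∈ T ↔ p ∈ J ∧ p.2 = y) (hne : T.Nonempty) :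
    ∃ p q : ℤ, (T.card : ℤ) ≤ q - p + 1 ∧ ∀ x, (x, y) ∈ J ↔ p ≤ x ∧ x ≤ q := by
  obtain ⟨p, q, h1, h2⟩ := hJ.swapped.exists_col_ends (x := y) (T := Surfactant.swapped T)
    (fun p => by simp [hT]) (by
      obtain ⟨r, hr⟩ := hne
      exact ⟨(r.2, r.1), mem_swapped.2 hr⟩)
  rw [card_swapped] at h1
  exact ⟨p, q, h1, fun x => by rw [← h2]; simp⟩

section
variable {J : Finset (ℤ × ℤ)} {x0 x1 y0 y1 p1 q1 p2 q2 p3 q3 p4 q4 : ℤ}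

/-- The bounding box of a lattice set and the ends of its external slices. -/
structure HasEnds (J : Finset (ℤ × ℤ)) (x0 x1 y0 y1 p1 q1 p2 q2 p3 q3 p4 q4 : ℤ) : Prop where
  box : ∀ x y, (x, y) ∈ J → x0 ≤ x ∧ x ≤ x1 ∧ y0 ≤ y ∧ y ≤ y1
  bot : ∀ x, (x, y0) ∈ J ↔ p1 ≤ x ∧ x ≤ q1
  left : ∀ y, (x0, y) ∈ J ↔ p2 ≤ y ∧ y ≤ q2
  top : ∀ x, (x, y1) ∈ J ↔ p3 ≤ x ∧ x ≤ q3
  right : ∀ y, (x1, y) ∈ J ↔ p4 ≤ y ∧ y ≤ q4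

lemma IsStaircase.exists_hasEnds (hJ : IsStaircase (↑J : Set (ℤ × ℤ))) {m : ℕ} (hm : 1 ≤ m)
    (h : ∀ i, m ≤ (sl J i).card) : ∃ x0 x1 y0 y1 p1 q1 p2 q2 p3 q3 p4 q4 : ℤ,
      HasEnds J x0 x1 y0 y1 p1 q1 p2 q2 p3 q3 p4 q4 ∧
      (p1 + m ≤ q1 + 1 ∧ p2 + m ≤ q2 + 1 ∧ p3 + m ≤ q3 + 1 ∧ p4 + m ≤ q4 + 1) := by
  have hne : ∀ i, (sl J i).Nonempty := fun i => Finset.card_pos.1 (by have := h i; omega)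
  obtain ⟨r0, h0⟩ := hne 0
  obtain ⟨r1, h1⟩ := hne 1
  obtain ⟨r2, h2⟩ := hne 2
  obtain ⟨r3, h3⟩ := hne 3
  rw [mem_sl0] at h0; rw [mem_sl1] at h1; rw [mem_sl2] at h2; rw [mem_sl3] at h3
  obtain ⟨p1, q1, a1, b1⟩ := hJ.exists_row_ends (y := r0.2) (T := sl J 0) (fun p => by
    rw [mem_sl0]
    exact and_congr_right fun hp => ⟨fun hq => le_antisymm (hq _ h0.1) (h0.2 _ hp),
      fun e q hq => e ▸ h0.2 q hq⟩) (hne 0)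
  obtain ⟨p2, q2, a2, b2⟩ := hJ.exists_col_ends (x := r1.1) (T := sl J 1) (fun p => by
    rw [mem_sl1]
    exact and_congr_right fun hp => ⟨fun hq => le_antisymm (hq _ h1.1) (h1.2 _ hp),
      fun e q hq => e ▸ h1.2 q hq⟩) (hne 1)
  obtain ⟨p3, q3, a3, b3⟩ := hJ.exists_row_ends (y := r2.2) (T := sl J 2) (fun p => by
    rw [mem_sl2]
    exact and_congr_right fun hp => ⟨fun hq => le_antisymm (h2.2 _ hp) (hq _ h2.1),
      fun e q hq => e ▸ h2.2 q hq⟩) (hne 2)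
  obtain ⟨p4, q4, a4, b4⟩ := hJ.exists_col_ends (x := r3.1) (T := sl J 3) (fun p => by
    rw [mem_sl3]
    exact and_congr_right fun hp => ⟨fun hq => le_antisymm (h3.2 _ hp) (hq _ h3.1),
      fun e q hq => e ▸ h3.2 q hq⟩) (hne 3)
  have c0 := h 0; have c1 := h 1; have c2 := h 2; have c3 := h 3
  exact ⟨r1.1, r3.1, r0.2, r2.2, p1, q1, p2, q2, p3, q3, p4, q4,
    ⟨fun x y hp => ⟨h1.2 _ hp, h3.2 _ hp, h0.2 _ hp, h2.2 _ hp⟩, b1, b2, b3, b4⟩,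
    by omega, by omega, by omega, by omega⟩

lemma IsQuasiOctagon.exists_octagonal (hq : IsQuasiOctagon (↑J : Set (ℤ × ℤ)))
    (h : HasEnds J x0 x1 y0 y1 p1 q1 p2 q2 p3 q3 p4 q4)
    (hl : p1 + 4 ≤ q1 ∧ p2 + 4 ≤ q2 ∧ p3 + 4 ≤ q3 ∧ p4 + 4 ≤ q4) :
    ∃ c c' d d', Octagonal (fun x y => (x, y) ∈ J) x0 x1 y0 y1 c c' d d' := by
  have hst := hq.staircase
  have m1 := (h.bot p1).2 (by omega)
  have m2 := (h.left p2).2 (by omega)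
  have m3 := (h.top p3).2 (by omega)
  have m4 := (h.right p4).2 (by omega)
  have hx : x0 < x1 := by
    have := h.box _ _ m1; have := h.box _ _ ((h.bot q1).2 (by omega)); omega
  have hy : y0 < y1 := by
    have := h.box _ _ m2; have := h.box _ _ ((h.left q2).2 (by omega)); omega
  have e0 : ∀ x y, (x, y) ∈ extSlice (↑J : Set (ℤ × ℤ)) 0 → y = y0 := fun x y hp => by
    rw [← coe_sl, Finset.mem_coe, mem_sl0] at hp
    exact le_antisymm (hp.2 _ m1) (h.box _ _ hp.1).2.2.1
  have e1 : ∀ x y, (x, y) ∈ extSlice (↑J : Set (ℤ × ℤ)) 1 → x = x0 := fun x y hp => by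
    rw [← coe_sl, Finset.mem_coe, mem_sl1] at hp
    exact le_antisymm (hp.2 _ m2) (h.box _ _ hp.1).1
  have e2 : ∀ x y, (x, y) ∈ extSlice (↑J : Set (ℤ × ℤ)) 2 → y = y1 := fun x y hp => by
    rw [← coe_sl, Finset.mem_coe, mem_sl2] at hp
    exact le_antisymm (h.box _ _ hp.1).2.2.2 (hp.2 _ m3)
  have e3 : ∀ x y, (x, y) ∈ extSlice (↑J : Set (ℤ × ℤ)) 3 → x = x1 := fun x y hp => by
    rw [← coe_sl, Finset.mem_coe, mem_sl3] at hp
    exact le_antisymm (h.box _ _ hp.1).2.1 (hp.2 _ m4)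
  have f0 : ∀ x y, (x, y) ∈ secondSlice (↑J : Set (ℤ × ℤ)) 0 → y = y0 + 1 := by
    rintro x y ⟨-, ⟨a, b⟩, hr, he⟩; rw [← e0 a b hr]; exact he
  have f1 : ∀ x y, (x, y) ∈ secondSlice (↑J : Set (ℤ × ℤ)) 1 → x = x0 + 1 := by
    rintro x y ⟨-, ⟨a, b⟩, hr, he⟩; rw [← e1 a b hr]; exact he
  have f2 : ∀ x y, (x, y) ∈ secondSlice (↑J : Set (ℤ × ℤ)) 2 → y = y1 - 1 := by
    rintro x y ⟨-, ⟨a, b⟩, hr, he⟩; rw [← e2 a b hr]; exact he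
  have f3 : ∀ x y, (x, y) ∈ secondSlice (↑J : Set (ℤ × ℤ)) 3 → x = x1 - 1 := by
    rintro x y ⟨-, ⟨a, b⟩, hr, he⟩; rw [← e3 a b hr]; exact he
  have hin : ∀ x y, (x, y) ∈ J → Open (fun x y => (x, y) ∈ J) x y →
      (x, y) ∈ innerBdry (↑J : Set (ℤ × ℤ)) := by
    intro x y hp ho
    refine ⟨hp, ?_⟩
    unfold Open at ho
    by_contra! hc
    have key : ∀ a b, grid.Adj (x, y) (a, b) → (a, b) ∈ J := fun a b hab =>
      not_not.1 fun hn => hc (a, b) hn hab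
    exact ho ⟨key _ _ (by simp [grid]), key _ _ (by simp [grid]), key _ _ (by simp [grid]),
      key _ _ (by simp [grid])⟩
  have flat : ∀ x y x' y', (x, y) ∈ J → (x', y') ∈ J → Open (fun x y => (x, y) ∈ J) x y →
      Open (fun x y => (x, y) ∈ J) x' y' → ((x' = x + 1 ∧ y' = y) ∨ (x' = x ∧ y' = y + 1)) →
      (y = y' ∧ (y ≤ y0 + 1 ∨ y1 - 1 ≤ y)) ∨ (x = x' ∧ (x ≤ x0 + 1 ∨ x1 - 1 ≤ x)) := by
    intro x y x' y' hp hp' ho ho' hxy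
    obtain ⟨i, hi⟩ := hq.flat _ (hin x y hp ho) _ (hin x' y' hp' ho') (by simpa using hxy)
    simp only [Set.insert_subset_iff, Set.singleton_subset_iff] at hi
    fin_cases i
    · rcases hi with ⟨h1, h2⟩ | ⟨h1, h2⟩
      · have := e0 _ _ h1; have := e0 _ _ h2; omega
      · have := f0 _ _ h1; have := f0 _ _ h2; omega
    · rcases hi with ⟨h1, h2⟩ | ⟨h1, h2⟩
      · have := e1 _ _ h1; have := e1 _ _ h2; omega
      · have := f1 _ _ h1; have := f1 _ _ h2; omega
    · rcases hi with ⟨h1, h2⟩ | ⟨h1, h2⟩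
      · have := e2 _ _ h1; have := e2 _ _ h2; omega
      · have := f2 _ _ h1; have := f2 _ _ h2; omega
    · rcases hi with ⟨h1, h2⟩ | ⟨h1, h2⟩
      · have := e3 _ _ h1; have := e3 _ _ h2; omega
      · have := f3 _ _ h1; have := f3 _ _ h2; omega
  have hby : ∀ r ∈ J, y0 ≤ r.2 ∧ r.2 ≤ y1 := fun r hr => (h.box r.1 r.2 hr).2.2
  have hbx : ∀ r ∈ Surfactant.swapped J, x0 ≤ r.2 ∧ r.2 ≤ x1 := fun r hr => by
    have := h.box _ _ (mem_swapped.1 hr); omega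
  have L := hst.exists_inner (x := x0) (e := 1) (x' := x1) (Or.inl rfl) (by omega) hby
    ⟨_, m1⟩ ⟨_, m3⟩ h.left h.right (by omega) (by omega) fun r hr => by
      have := h.box r.1 r.2 hr; omega
  have R := hst.exists_inner (x := x1) (e := -1) (x' := x0) (Or.inr rfl) (by omega) hby
    ⟨_, m1⟩ ⟨_, m3⟩ h.right h.left (by omega) (by omega) fun r hr => by
      have := h.box r.1 r.2 hr; omega
  have B := hst.swapped.exists_inner (x := y0) (e := 1) (x' := y1) (Or.inl rfl) (by omega) hbx
    ⟨p2, mem_swapped.2 m2⟩ ⟨p4, mem_swapped.2 m4⟩ (fun y => mem_swapped.trans (h.bot y))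
    (fun y => mem_swapped.trans (h.top y)) (by omega) (by omega) fun r hr => by
      have := h.box _ _ (mem_swapped.1 hr); omega
  have T := hst.swapped.exists_inner (x := y1) (e := -1) (x' := y0) (Or.inr rfl) (by omega) hbx
    ⟨p2, mem_swapped.2 m2⟩ ⟨p4, mem_swapped.2 m4⟩ (fun y => mem_swapped.trans (h.top y))
    (fun y => mem_swapped.trans (h.bot y)) (by omega) (by omega) fun r hr => by
      have := h.box _ _ (mem_swapped.1 hr); omega
  simp only [mem_swapped] at B T
  obtain ⟨J', ⟨A, ⟨-, a, a', b, b', c, c', d, d', rfl⟩, rfl⟩, hdec⟩ := hq.decomposition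
  have inner : ∀ x y, x0 < x → x < x1 → y0 < y → y < y1 → ((x, y) ∈ J ↔
      ((a ≤ x ∧ (x : ℝ) ≤ a') ∧ (b ≤ y ∧ (y : ℝ) ≤ b') ∧ (c ≤ (x : ℝ) + y ∧ (x : ℝ) + y ≤ c') ∧
        (d ≤ (x : ℝ) - y ∧ (x : ℝ) - y ≤ d'))) := by
    intro x y h1 h2 h3 h4
    rw [← Finset.mem_coe, hdec]
    constructor
    · rintro (hp | hp)
      · exact hp
      · obtain ⟨i, hi⟩ := Set.mem_iUnion.1 hp
        fin_cases i
        · have := e0 _ _ hi; omega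
        · have := e1 _ _ hi; omega
        · have := e2 _ _ hi; omega
        · have := e3 _ _ hi; omega
    · exact fun hp => Or.inl hp
  obtain ⟨yl, l1, l2, l3, l4⟩ := L
  obtain ⟨yr, r1, r2, r3, r4⟩ := R
  obtain ⟨xb, b1, b2, b3, b4⟩ := B
  obtain ⟨xt, t1, t2, t3, t4⟩ := T
  have il := ((inner _ _ (by omega) (by omega) (by omega) (by omega)).1 l4).1.1
  have ir := ((inner _ _ (by omega) (by omega) (by omega) (by omega)).1 r4).1.2
  have ib := ((inner _ _ (by omega) (by omega) (by omega) (by omega)).1 b4).2.1.1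
  have it := ((inner _ _ (by omega) (by omega) (by omega) (by omega)).1 t4).2.1.2
  refine ⟨⌈c⌉, ⌊c'⌋, ⌈d⌉, ⌊d'⌋, h.box, fun a b e y => hst.horizontal a b e y,
    fun x a b e => hst.vertical x a b e, fun x y h1 h2 h3 h4 => ?_,
    ⟨yl, l1, l2, l3, l4⟩, ⟨yr, r1, r2, r3, r4⟩, ⟨xb, b1, b2, b3, b4⟩, ⟨xt, t1, t2, t3, t4⟩,
    fun x y h1 h2 h3 h4 h5 h6 => ?_, fun x y h1 h2 h3 h4 h5 h6 => ?_⟩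
  · rw [inner x y h1 h2 h3 h4, Int.ceil_le, Int.le_floor, Int.ceil_le, Int.le_floor]
    push_cast
    have g1 : ((x0 + 1 : ℤ) : ℝ) ≤ x := by exact_mod_cast h1
    have g2 : (x : ℝ) ≤ ((x1 + -1 : ℤ) : ℝ) := by exact_mod_cast (by omega : x ≤ x1 + -1)
    have g3 : ((y0 + 1 : ℤ) : ℝ) ≤ y := by exact_mod_cast h3
    have g4 : (y : ℝ) ≤ ((y1 + -1 : ℤ) : ℝ) := by exact_mod_cast (by omega : y ≤ y1 + -1)
    constructor
    · rintro ⟨-, -, ⟨u1, u2⟩, u3, u4⟩; exact ⟨u1, u2, u3, u4⟩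
    · rintro ⟨u1, u2, u3, u4⟩
      exact ⟨⟨il.trans g1, g2.trans ir⟩, ⟨ib.trans g3, g4.trans it⟩, ⟨u1, u2⟩, u3, u4⟩
  · have := flat _ _ _ _ h3 h4 h5 h6 (Or.inl ⟨rfl, rfl⟩); omega
  · have := flat _ _ _ _ h3 h4 h5 h6 (Or.inr ⟨rfl, rfl⟩); omega

/-- A quasi-octagon with long external slices is described by a frame. -/
theorem IsQuasiOctagon.exists_mid (hq : IsQuasiOctagon (↑J : Set (ℤ × ℤ))) {E : ℕ} (hE : 4 ≤ E)
    (hm : ∀ i, 16 * E + 2 ≤ (sl J i).card) :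
    ∃ (F : Frame) (X₁ Y₂ X₃ Y₄ : ℤ), F.Mid E X₁ Y₂ X₃ Y₄ ∧ F.fin = J := by
  obtain ⟨x0, x1, y0, y1, p1, q1, p2, q2, p3, q3, p4, q4, h, l1, l2, l3, l4⟩ :=
    hq.staircase.exists_hasEnds (by omega) hm
  push_cast at l1 l2 l3 l4
  obtain ⟨c, c', d, d', ho⟩ := hq.exists_octagonal h (by omega)
  obtain ⟨s1, u1, v1, w1⟩ := ho.exists_bound
  obtain ⟨s2, u2, v2, w2⟩ := ho.vflip.flip.exists_bound
  obtain ⟨d1, u3, v3, w3⟩ := ho.vflip.exists_bound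
  obtain ⟨d2, u4, v4, w4⟩ := ho.flip.exists_bound
  have hdiag : ∀ x y, (x, y) ∈ J → s1 ≤ x + y ∧ x + y ≤ -s2 ∧ d1 ≤ x - y ∧ x - y ≤ -d2 := by
    intro x y hp
    have k1 := v1 x y hp
    have k2 := v2 (-x) (-y) (by simpa [hf, vf] using hp)
    have k3 := v3 x (-y) (by simpa [vf] using hp)
    have k4 := v4 (-x) y (by simpa [hf] using hp)
    omega
  have a1 := hdiag _ _ ((h.bot p1).2 (by omega)); have a2 := hdiag _ _ ((h.bot q1).2 (by omega))
  have a3 := hdiag _ _ ((h.left p2).2 (by omega)); have a4 := hdiag _ _ ((h.left q2).2 (by omega))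
  have a5 := hdiag _ _ ((h.top p3).2 (by omega)); have a6 := hdiag _ _ ((h.top q3).2 (by omega))
  have a7 := hdiag _ _ ((h.right p4).2 (by omega)); have a8 := hdiag _ _ ((h.right q4).2 (by omega))
  have b1 := h.box _ _ ((h.bot p1).2 (by omega)); have b2 := h.box _ _ ((h.bot q1).2 (by omega))
  have b3 := h.box _ _ ((h.left p2).2 (by omega)); have b4 := h.box _ _ ((h.left q2).2 (by omega))
  have b8 := h.box _ _ ((h.right q4).2 (by omega))
  obtain ⟨F, hF, rfl, -⟩ := exists_frame hq.staircase (Finset.Subset.refl J) ho.row ho.col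
    (fun p hp => h.box p.1 p.2 hp) ⟨p1, (h.bot p1).2 (by omega)⟩ ⟨p2, (h.left p2).2 (by omega)⟩
    ⟨p3, (h.top p3).2 (by omega)⟩ ⟨p4, (h.right p4).2 (by omega)⟩ (fun p hp => hdiag p.1 p.2 hp)
    (fun x y k1 k2 k3 k4 k5 k6 k7 k8 => (ho.inner x y k1 k2 k3 k4).2 (by
      have g1 := w1 x y (by omega) (by omega) (by omega)
      have g2 := w2 (-x) (-y) (by omega) (by omega) (by omega)
      have g3 := w3 x (-y) (by omega) (by omega) (by omega)
      have g4 := w4 (-x) y (by omega) (by omega) (by omega)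
      omega)) (by omega) (by omega) (by omega) (by omega)
    ⟨p1 + 8, y0 + 4, by omega, by omega⟩
  have hc := hF.card_sl_le
  have k0 := hm 0; have k1 := hm 1; have k2 := hm 2; have k3 := hm 3
  exact ⟨F, F.p1 + 8 * E + 1, F.p2 + 8 * E + 1, F.p3 + 8 * E + 1, F.p4 + 8 * E + 1,
    ⟨hF, hE, by omega, by omega, by omega, by omega⟩, rfl⟩

end

lemma le_dep {J : Finset (ℤ × ℤ)} (hJ : J.Nonempty) {D : ℕ} {p : ℤ × ℤ} (hp : p ∈ J)
    (h : ∀ q, dist1 p q < D → q ∈ J) : D ≤ dep J p := by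
  by_contra! hn
  obtain ⟨q, hq, hd⟩ := dep_spec hJ p
  exact hq.1 (h q (by omega)) hp

lemma Frame.Core.le_dep {F : Frame} {K : ℕ} {x y : ℤ} (h : F.Core K x y) (hK : 1 ≤ K) :
    K ≤ dep F.fin (x, y) := by
  obtain ⟨h1, h2⟩ := h
  have key : ∀ q, dist1 (x, y) q < K → q ∈ F.fin := by
    intro q hq
    unfold dist1 at hq
    simp only at hq
    exact Frame.mem_fin.2 ⟨by omega, by omega, by omega, by omega, by omega, by omega⟩
  have hp := key (x, y) (by simp [dist1]; omega)
  exact Surfactant.le_dep ⟨_, hp⟩ hp key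

lemma IsStaircase.exists_deep {J : Finset (ℤ × ℤ)} (hJ : IsStaircase (↑J : Set (ℤ × ℤ))) {D : ℕ}
    (hD : 1 ≤ D) (h : ∀ i, 2 * D + 1 ≤ (sl J i).card) : ∃ p ∈ J, D ≤ dep J p := by
  obtain ⟨x0, x1, y0, y1, p1, q1, p2, q2, p3, q3, p4, q4, he, l1, l2, l3, l4⟩ :=
    hJ.exists_hasEnds (by omega) h
  push_cast at l1 l2 l3 l4
  have m1 := (he.bot p1).2 (by omega); have m2 := (he.bot q1).2 (by omega)
  have m3 := (he.left p2).2 (by omega); have m4 := (he.left q2).2 (by omega)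
  have m5 := (he.top p3).2 (by omega); have m6 := (he.top q3).2 (by omega)
  have m7 := (he.right p4).2 (by omega); have m8 := (he.right q4).2 (by omega)
  have b1 := he.box _ _ m1; have b2 := he.box _ _ m2; have b3 := he.box _ _ m3
  have b4 := he.box _ _ m4
  have b7 := he.box _ _ m7; have b8 := he.box _ _ m8
  suffices hs : ∃ a b : ℤ, ∀ x y : ℤ, a ≤ x → x ≤ a + 2 * D → b ≤ y → y ≤ b + 2 * D → (x, y) ∈ J by
    obtain ⟨a, b, hs⟩ := hs
    have hp := hs (a + D) (b + D) (by omega) (by omega) (by omega) (by omega)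
    refine ⟨_, hp, le_dep ⟨_, hp⟩ hp fun q hq => ?_⟩
    unfold dist1 at hq
    simp only at hq
    exact hs q.1 q.2 (by omega) (by omega) (by omega) (by omega)
  have key : ∀ a b : ℤ, (∃ q ∈ J, q.1 ≤ a ∧ q.2 ≤ b) → (∃ q ∈ J, a + 2 * D ≤ q.1 ∧ q.2 ≤ b) →
      (∃ q ∈ J, a + 2 * D ≤ q.1 ∧ b + 2 * D ≤ q.2) → (∃ q ∈ J, q.1 ≤ a ∧ b + 2 * D ≤ q.2) →
      ∃ a b : ℤ, ∀ x y : ℤ, a ≤ x → x ≤ a + 2 * D → b ≤ y → y ≤ b + 2 * D → (x, y) ∈ J := by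
    rintro a b ⟨r1, h1, g1⟩ ⟨r2, h2, g2⟩ ⟨r3, h3, g3⟩ ⟨r4, h4, g4⟩
    refine ⟨a, b, fun x y k1 k2 k3 k4 => ?_⟩
    by_contra hn
    rcases hJ.quadrant hn with hc | hc | hc | hc
    · exact hc _ h1 (by simp only; omega)
    · exact hc _ h2 (by simp only; omega)
    · exact hc _ h3 (by simp only; omega)
    · exact hc _ h4 (by simp only; omega)
  by_cases hc : p1 + 2 * D ≤ q3
  · exact key p1 p2 ⟨_, m1, by simp only; omega⟩ ⟨_, m2, by simp only; omega⟩
      ⟨_, m6, by simp only; omega⟩ ⟨_, m4, by simp only; omega⟩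
  · exact key (q1 - 2 * D) p4 ⟨_, m1, by simp only; omega⟩ ⟨_, m2, by simp only; omega⟩
      ⟨_, m8, by simp only; omega⟩ ⟨_, m5, by simp only; omega⟩

lemma IsStaircase.ocr_subset_outerCorners {J : Finset (ℤ × ℤ)}
    (hJ : IsStaircase (↑J : Set (ℤ × ℤ))) : (↑(ocr J) : Set (ℤ × ℤ)) ⊆ outerCorners ↑J := by
  rintro ⟨x, y⟩ hp
  have hH := hJ.row
  have hV := hJ.col
  rw [Finset.mem_coe] at hp
  have hb : (x, y) ∈ outerBdry (↑J : Set (ℤ × ℤ)) := by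
    rw [← coe_obd]; exact Finset.mem_coe.2 (Finset.mem_filter.1 hp).1
  obtain ⟨hn, h1, h2⟩ := mem_ocr.1 hp
  simp only [Prod.mk_add_mk, Prod.mk_sub_mk, add_zero, sub_zero] at h1 h2
  have c1 : ¬ ((x + 1, y) ∈ J ∧ (x - 1, y) ∈ J) := fun h =>
    hn (hH _ x _ y (by omega) (by omega) h.2 h.1)
  have c2 : ¬ ((x, y + 1) ∈ J ∧ (x, y - 1) ∈ J) := fun h =>
    hn (hV x _ y _ (by omega) (by omega) h.2 h.1)
  refine ⟨hb, ?_⟩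
  have key : ∀ a b, a ∈ J → b ∈ J → grid.Adj (x, y) a → grid.Adj (x, y) b → a ≠ b →
      (∀ r ∈ J, grid.Adj (x, y) r → r = a ∨ r = b) →
      (grid.neighborSet (x, y) ∩ (↑J : Set (ℤ × ℤ))).ncard = 2 := by
    intro a b ha hb h1 h2 hab h
    rw [← Set.ncard_pair hab]
    congr 1
    ext r
    simp only [Set.mem_inter_iff, SimpleGraph.mem_neighborSet, Finset.mem_coe, Set.mem_insert_iff,
      Set.mem_singleton_iff]
    exact ⟨fun ⟨g1, g2⟩ => h r g2 g1, by rintro (rfl | rfl) <;> exact ⟨by assumption, by assumption⟩⟩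
  have nbr : ∀ r ∈ J, grid.Adj (x, y) r →
      r = (x + 1, y) ∨ r = (x - 1, y) ∨ r = (x, y + 1) ∨ r = (x, y - 1) := by
    rintro ⟨a, b⟩ - hr
    simpa using adj_cases hr
  rcases h1 with h1 | h1 <;> rcases h2 with h2 | h2 <;>
    refine key _ _ h1 h2 (adj_mk (by simp)) (adj_mk (by simp)) (by simp) fun r hr ha => ?_ <;>
    rcases nbr r hr ha with rfl | rfl | rfl | rfl <;> tauto

lemma card_le_of_ball {J : Finset (ℤ × ℤ)} {R ε x y : ℝ} (hR : 0 < R) (hε : 0 < ε) (hε1 : ε ≤ 1)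
    (h : ∀ p ∈ J, (ε * p.1 - x) ^ 2 + (ε * p.2 - y) ^ 2 ≤ R ^ 2) :
    (J.card : ℝ) ≤ ((2 * R + 1) / ε) ^ 2 := by
  have hI : ∀ z : ℝ, ((Finset.Icc ⌈(z - R) / ε⌉ ⌊(z + R) / ε⌋).card : ℝ) ≤ (2 * R + 1) / ε := by
    intro z
    have h0 : (0 : ℝ) ≤ (2 * R + 1) / ε := by positivity
    have h1 := Int.le_ceil ((z - R) / ε)
    have h2 := Int.floor_le ((z + R) / ε)
    have h3 : (z + R) / ε + 1 - (z - R) / ε ≤ (2 * R + 1) / ε := by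
      rw [le_div_iff₀ hε]; field_simp; linarith
    have h4 : (((⌊(z + R) / ε⌋ + 1 - ⌈(z - R) / ε⌉ : ℤ)) : ℝ) ≤ (2 * R + 1) / ε := by
      push_cast; linarith
    rw [Int.card_Icc]
    rcases le_total 0 (⌊(z + R) / ε⌋ + 1 - ⌈(z - R) / ε⌉) with h5 | h5
    · calc (((⌊(z + R) / ε⌋ + 1 - ⌈(z - R) / ε⌉).toNat : ℕ) : ℝ)
          = (((⌊(z + R) / ε⌋ + 1 - ⌈(z - R) / ε⌉).toNat : ℤ) : ℝ) := by push_cast; rfl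
        _ ≤ _ := by rw [Int.toNat_of_nonneg h5]; exact h4
    · rw [Int.toNat_of_nonpos h5]; exact_mod_cast h0
  have hsub : J ⊆ Finset.Icc ⌈(x - R) / ε⌉ ⌊(x + R) / ε⌋ ×ˢ Finset.Icc ⌈(y - R) / ε⌉ ⌊(y + R) / ε⌋ := by
    intro p hp
    have h1 := h p hp
    obtain ⟨a1, a2⟩ := abs_le_of_sq_le_sq' (show (ε * p.1 - x) ^ 2 ≤ R ^ 2 by nlinarith [sq_nonneg (ε * p.2 - y)]) hR.le
    obtain ⟨a3, a4⟩ := abs_le_of_sq_le_sq' (show (ε * p.2 - y) ^ 2 ≤ R ^ 2 by nlinarith [sq_nonneg (ε * p.1 - x)]) hR.le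
    rw [Finset.mem_product, Finset.mem_Icc, Finset.mem_Icc, Int.ceil_le, Int.le_floor, Int.ceil_le,
      Int.le_floor, div_le_iff₀ hε, le_div_iff₀ hε, div_le_iff₀ hε, le_div_iff₀ hε]
    exact ⟨⟨by linarith, by linarith⟩, by linarith, by linarith⟩
  have h1 := Finset.card_le_card hsub
  rw [Finset.card_product] at h1
  rw [pow_two]
  refine le_trans (?_ : (J.card : ℝ) ≤ _) (mul_le_mul (hI x) (hI y) (by positivity) (by positivity))
  exact_mod_cast h1

/-- The width of the layer in which phases can change: of order `ε ^ (-7 / 10)`. -/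
lemma exists_scale {κ δ c C : ℝ} (hκ : 0 < κ) (hδ : 0 < δ) (hc : 0 < c) (hC : 0 < C) :
    ∃ ε₀ : ℝ, 0 < ε₀ ∧ ∀ ε : ℝ, 0 < ε → ε ≤ ε₀ → ε ≤ 1 ∧ ∃ s : ℕ, 1 ≤ s ∧
      κ * ε * (2 * s : ℕ) < δ ∧ C / ε ^ 3 * Real.exp (-(κ * ε * s ^ 2 / 8)) < 1 ∧
      ((16 * (2 * s + 4) : ℕ) : ℝ) ≤ 8 * ε ^ (-(3 / 4) : ℝ) ∧
      ((16 * (2 * s + 4) + 2 : ℕ) : ℝ) ≤ c / ε := by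
  have h1 : ∀ᶠ x : ℝ in Filter.atTop, x ^ 60 * Real.exp (-x) < (κ / 8) ^ 60 / C :=
    (Real.tendsto_pow_mul_exp_neg_atTop_nhds_zero 60).eventually_lt_const (by positivity)
  obtain ⟨T₁, hT₁⟩ := Filter.eventually_atTop.1 h1
  set T := max (max 24 (T₁ / (κ / 8))) (max (4 * κ / δ + 1) (200 / c))
  have hT1 : 24 ≤ T := (le_max_left _ _).trans (le_max_left _ _)
  have hT2 : T₁ / (κ / 8) ≤ T := (le_max_right _ _).trans (le_max_left _ _)
  have hT3 : 4 * κ / δ + 1 ≤ T := (le_max_left _ _).trans (le_max_right _ _)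
  have hT4 : 200 / c ≤ T := (le_max_right _ _).trans (le_max_right _ _)
  clear_value T
  refine ⟨(T ^ 20)⁻¹, by positivity, fun ε hε hεT => ?_⟩
  set t := ε ^ (-(1 / 20) : ℝ) with ht
  have ht0 : 0 < t := Real.rpow_pos_of_pos hε _
  have e20 : t ^ 20 = ε⁻¹ := by
    rw [ht, ← Real.rpow_natCast, ← Real.rpow_mul hε.le, ← Real.rpow_neg_one]; norm_num
  have e15 : ε ^ (-(3 / 4) : ℝ) = t ^ 15 := by
    rw [ht, ← Real.rpow_natCast, ← Real.rpow_mul hε.le]; norm_num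
  have hεt : ε = (t ^ 20)⁻¹ := by rw [e20, inv_inv]
  have htT : T ≤ t := by
    refine le_of_pow_le_pow_left₀ (n := 20) (by norm_num) ht0.le ?_
    rw [e20, le_inv_comm₀ (by positivity) hε]; exact hεT
  have ht1 : 1 ≤ t := by linarith
  have hs : (⌈t ^ 14⌉₊ : ℝ) ≤ 2 * t ^ 14 := by
    have := Nat.ceil_lt_add_one (show 0 ≤ t ^ 14 by positivity)
    have := one_le_pow₀ ht1 (n := 14)
    linarith
  have hs' : t ^ 14 ≤ (⌈t ^ 14⌉₊ : ℝ) := Nat.le_ceil _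
  have h14 : 1 ≤ t ^ 14 := one_le_pow₀ ht1
  have h6 : t ≤ t ^ 6 := le_self_pow₀ ht1 (by norm_num)
  set s := ⌈t ^ 14⌉₊
  clear_value s t
  have hs1 : 1 ≤ s := by exact_mod_cast h14.trans hs'
  subst hεt
  have p20 : 0 < t ^ 20 := by positivity
  refine ⟨inv_le_one_of_one_le₀ (one_le_pow₀ ht1), s, hs1, ?_, ?_, ?_, ?_⟩
  · rw [mul_assoc, mul_comm, inv_mul_eq_div, div_mul_eq_mul_div, div_lt_iff₀ p20]
    push_cast
    have h7 : 4 * κ < δ * t := by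
      have : 4 * κ / δ < t := by linarith
      rwa [div_lt_iff₀' hδ] at this
    have h8 : 4 * κ < δ * t ^ 6 := h7.trans_le (by gcongr)
    calc 2 * (s : ℝ) * κ ≤ 2 * (2 * t ^ 14) * κ := by gcongr
      _ = 4 * κ * t ^ 14 := by ring
      _ < δ * t ^ 6 * t ^ 14 := by gcongr
      _ = δ * t ^ 20 := by ring
  · have h8 : t ≤ t ^ 8 := le_self_pow₀ ht1 (by norm_num)
    have h9 : κ / 8 * t ≤ κ * (t ^ 20)⁻¹ * s ^ 2 / 8 := by
      have : t ^ 8 ≤ (t ^ 20)⁻¹ * s ^ 2 := by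
        rw [inv_mul_eq_div, le_div_iff₀ p20]
        calc t ^ 8 * t ^ 20 = (t ^ 14) ^ 2 := by ring
          _ ≤ _ := by gcongr
      calc κ / 8 * t ≤ κ / 8 * ((t ^ 20)⁻¹ * s ^ 2) := by gcongr; exact h8.trans this
        _ = _ := by ring
    have h10 := hT₁ (κ / 8 * t) (by
      rw [div_le_iff₀' (by positivity)] at hT2
      exact hT2.trans (by gcongr))
    rw [lt_div_iff₀ hC, mul_pow, mul_assoc, mul_assoc] at h10
    have h11 := (mul_lt_iff_lt_one_right (by positivity)).1 h10
    calc C / (t ^ 20)⁻¹ ^ 3 * Real.exp (-(κ * (t ^ 20)⁻¹ * s ^ 2 / 8))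
        ≤ C / (t ^ 20)⁻¹ ^ 3 * Real.exp (-(κ / 8 * t)) := by gcongr
      _ = t ^ 60 * (Real.exp (-(κ / 8 * t)) * C) := by field_simp
      _ < 1 := h11
  · rw [e15]
    push_cast
    calc 16 * (2 * (s : ℝ) + 4) ≤ 16 * (2 * (2 * t ^ 14) + 4 * t ^ 14) := by gcongr; linarith
      _ = 128 * t ^ 14 := by ring
      _ ≤ 8 * t * t ^ 14 := by gcongr; linarith
      _ = 8 * t ^ 15 := by ring
  · rw [div_inv_eq_mul]
    push_cast
    have h7 : 200 ≤ c * t ^ 6 := by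
      have : 200 / c ≤ t := hT4.trans htT
      rw [div_le_iff₀' hc] at this
      exact this.trans (by gcongr)
    calc 16 * (2 * (s : ℝ) + 4) + 2 ≤ 16 * (2 * (2 * t ^ 14) + 4 * t ^ 14) + 2 * t ^ 14 := by
          gcongr <;> linarith
      _ = 130 * t ^ 14 := by ring
      _ ≤ c * t ^ 6 * t ^ 14 := by gcongr; linarith
      _ = c * t ^ 20 := by ring

/-- The width of the layer can be chosen uniformly for all sets satisfying the regularity
assumption. -/
lemma exists_layer {κ δ R c : ℝ} (hκ : 0 < κ) (hδ : 0 < δ) (hR : 0 < R) (hc : 0 < c) :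
    ∃ ε₀ : ℝ, 0 < ε₀ ∧ ∀ ε : ℝ, 0 < ε → ε ≤ ε₀ → ε ≤ 1 ∧ ∃ s : ℕ, 1 ≤ s ∧ κ * ε * (2 * s : ℕ) < δ ∧
      ((16 * (2 * s + 4) : ℕ) : ℝ) ≤ 8 * ε ^ (-(3 / 4) : ℝ) ∧
      ∀ J : Finset (ℤ × ℤ), AssumptionH R c ε ↑J → J.Nonempty ∧
        (∀ i, 16 * (2 * s + 4) + 2 ≤ (sl J i).card) ∧
        ∀ (k : ℝ) (n : ℕ) (I Z : Finset (ℤ × ℤ)), 0 < k → k < 1 → IsMin k κ ε J n I Z →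
          ∀ p, 2 * s ≤ dep J p → (p ∈ I ↔ p ∈ J) := by
  obtain ⟨ε₀, h0, h⟩ := exists_scale (C := (2 * R + 1) ^ 2 * (1 + 8 / κ)) hκ hδ hc (by positivity)
  refine ⟨ε₀, h0, fun ε hε hε0 => ?_⟩
  obtain ⟨h1, s, hs, hd, hsmall, hw, hl⟩ := h ε hε hε0
  refine ⟨h1, s, hs, hd, hw, fun J hJ => ?_⟩
  obtain ⟨hst, ⟨x, y, hball⟩, hsl⟩ := hJ
  have hne : J.Nonempty := by
    obtain ⟨p, hp⟩ := hst.connected.nonempty; exact ⟨p, hp⟩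
  refine ⟨hne, fun i => ?_, fun k n I Z hk hk' hmin p hp => ?_⟩
  · have := hl.trans (hsl i)
    rw [← coe_sl, Set.ncard_coe_finset] at this
    exact_mod_cast this
  · have hcard := card_le_of_ball hR hε h1 hball
    have e1 : ((2 * R + 1) / ε) ^ 2 = (2 * R + 1) ^ 2 / ε ^ 2 := div_pow _ _ _
    have hA : ((2 * R + 1) / ε) ^ 2 ≤ (2 * R + 1) ^ 2 / ε ^ 3 := by
      rw [e1]
      exact div_le_div_of_nonneg_left (by positivity) (by positivity)
        (pow_le_pow_of_le_one hε.le h1 (by norm_num))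
    refine hmin.mem_iff (A := (2 * R + 1) ^ 2 * (1 + 8 / κ) / ε ^ 3) hk hk' hκ hε hne hs ?_ ?_ hsmall hp
    · refine (hcard.trans hA).trans (div_le_div_of_nonneg_right ?_ (by positivity))
      exact le_mul_of_one_le_right (by positivity) (le_add_of_nonneg_right (by positivity))
    · calc 8 * (J.card : ℝ) ≤ 8 * ((2 * R + 1) / ε) ^ 2 := by gcongr
        _ = κ * ε * ((2 * R + 1) ^ 2 * (8 / κ) / ε ^ 3) := by field_simp
        _ ≤ κ * ε * ((2 * R + 1) ^ 2 * (1 + 8 / κ) / ε ^ 3) := by gcongr; linarith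

lemma exists_spin {u : Config} (hu : Admissible u) (h : IsStaircase (phaseOne u)) :
    ∃ J W : Finset (ℤ × ℤ), Disjoint J W ∧ u = spin J W := eq_spin h.finite hu

theorem card_eq_of_lt {k ζ R c : ℝ} (hk : 1 / 3 < k) (hk' : k < 1) (hζ : 0 < ζ) (hR : 0 < R)
    (hc : 0 < c) (hlt : ζ < 1 / (4 * k)) :
    ∃ ε₀ : ℝ, 0 < ε₀ ∧ ∀ ε : ℝ, 0 < ε → ε ≤ ε₀ → ε ≤ 1 ∧
      ∀ u₀ u₁ : Config, Admissible u₀ → AssumptionH R c ε (phaseOne u₀) →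
        IsMinimizer ε k ζ 2 u₀ u₁ → (surfactant u₁).ncard = (surfactant u₀).ncard := by
  have hκ : 4 * k < 1 / ζ := by
    rw [lt_div_iff₀ (by linarith)] at hlt ⊢; linarith
  obtain ⟨ε₀, h0, h⟩ := exists_layer (κ := 1 / ζ) (δ := min 1 (6 * k - 2)) (by positivity)
    (lt_min one_pos (by linarith)) hR hc
  refine ⟨ε₀, h0, fun ε hε hε0 => ⟨(h ε hε hε0).1, fun u₀ u₁ hu₀ hH hmin => ?_⟩⟩
  obtain ⟨h1, s, hs, hd, -, hJ⟩ := h ε hε hε0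
  obtain ⟨J, W, hJW, rfl⟩ := exists_spin hu₀ hH.1
  rw [phaseOne_spin] at hH
  obtain ⟨hne, hsl, hdeep⟩ := hJ J hH
  obtain ⟨I, Z, rfl, hI⟩ := hmin.exists_isMin hε hk' hζ hne hJW
  have hdp := hdeep k _ I Z (by linarith) hk' hI
  obtain ⟨p, hp, hpd⟩ := hH.1.exists_deep (D := 2 * s) (by omega) fun i => by have := hsl i; omega
  rw [surfactant_spin hJW, surfactant_spin hI.1, Set.ncard_coe_finset, Set.ncard_coe_finset]
  refine le_antisymm (not_lt.1 fun hn => ?_) (hI.le_card hk hk' hκ.le hε hne hdp (by omega)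
    (hd.trans_le (min_le_right _ _)) ⟨p, (hdp p hpd).2 hp⟩)
  obtain ⟨z, hz⟩ := Finset.card_pos.1 (Nat.zero_lt_of_lt hn)
  exact hκ.ne' (hI.nb_eq_two hk hk' hκ.le hε hne hdp (by omega) (hd.trans_le (min_le_left _ _)) hn hz).2.2

theorem isQuasiOctagon_of_eq {k ζ R c μ : ℝ} (hk : 1 / 3 < k) (hk' : k < 1) (hζ : 0 < ζ)
    (hR : 0 < R) (hc : 0 < c) (heq : ζ = 1 / (4 * k)) (hμ : μ < 1 / 4) :
    ∃ ε₀ : ℝ, 0 < ε₀ ∧ ∀ ε : ℝ, 0 < ε → ε ≤ ε₀ → ∀ u₀ : Config, Admissible u₀ →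
      AssumptionH R c ε (phaseOne u₀) → IsQuasiOctagon (phaseOne u₀) →
      ((surfactant u₀).ncard : ℝ) + 8 * ε ^ (μ - 1) < ((outerBdry (phaseOne u₀)).ncard : ℝ) →
      ∀ u₁ : Config, IsMinimizer ε k ζ 2 u₀ u₁ →
        IsQuasiOctagon (phaseOne u₁) ∧ (surfactant u₀).ncard ≤ (surfactant u₁).ncard ∧
        (∃ v : Config, IsMinimizer ε k ζ 2 u₀ v ∧
          (surfactant v).ncard = (surfactant u₀).ncard ∧ phaseOne v = phaseOne u₁) ∧
        (outerCorners (phaseOne u₀) ⊆ surfactant u₀ →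
          (surfactant u₁).ncard = (surfactant u₀).ncard) := by
  have hk0 : 0 < k := by linarith
  have hκ : 1 / ζ = 4 * k := by rw [heq, one_div_one_div]
  obtain ⟨ε₀, h0, h⟩ := exists_layer (κ := 4 * k) (δ := min 1 (6 * k - 2)) (by positivity)
    (lt_min one_pos (by linarith)) hR hc
  refine ⟨ε₀, h0, fun ε hε hε0 u₀ hu₀ hH hq hsat u₁ hmin => ?_⟩
  obtain ⟨h1, s, hs, hd, hw, hJ⟩ := h ε hε hε0
  obtain ⟨J, W, hJW, rfl⟩ := exists_spin hu₀ hH.1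
  rw [phaseOne_spin] at hH hq hsat ⊢
  obtain ⟨hne, hsl, hdeep⟩ := hJ J hH
  obtain ⟨I, Z, rfl, hI⟩ := hmin.exists_isMin hε hk' hζ hne hJW
  have hI0 := hI
  rw [hκ] at hI
  have hdp := hdeep k _ I Z hk0 hk' hI
  have hd1 := hd.trans_le (min_le_left _ _)
  obtain ⟨p, hp, hpd⟩ := hH.1.exists_deep (D := 2 * s) (by omega) fun i => by have := hsl i; omega
  have hcard := hI.le_card hk hk' le_rfl hε hne hdp (by omega) (hd.trans_le (min_le_right _ _))
    ⟨p, (hdp p hpd).2 hp⟩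
  have hsat' : W.card + 16 * (2 * s + 2 + 2) ≤ (obd J).card := by
    rw [surfactant_spin hJW, ← coe_obd, Set.ncard_coe_finset, Set.ncard_coe_finset] at hsat
    have : ε ^ (-(3 / 4) : ℝ) ≤ ε ^ (μ - 1) := Real.rpow_le_rpow_of_exponent_ge hε h1 (by linarith)
    have h2 : ((W.card + 16 * (2 * s + 4) : ℕ) : ℝ) ≤ ((obd J).card : ℝ) := by
      rw [Nat.cast_add]; linarith
    exact_mod_cast h2
  obtain ⟨F, X₁, Y₂, X₃, Y₄, hF, rfl⟩ := hq.exists_mid (E := 2 * s + 2 + 2) (by omega) hsl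
  have hsub : ∀ Z' ⊆ Z, W.card ≤ Z'.card → IsMin k (4 * k) ε F.fin W.card I Z' :=
    fun Z' hZ' hn => hI.subset hk hk' hε hne hdp (by omega) hd1 hZ' hn
  have hcore : ∀ x y, F.Core (2 * s + 2) x y → (x, y) ∈ I := fun x y hc => by
    have h2 := hc.le_dep (by omega)
    exact (hdp _ (by omega)).2 (Frame.mem_fin.2 (hc.mem (by omega)))
  have hcore' : ∀ x y, F.Core (2 * s + 2 + 2) x y → (x, y) ∈ I := fun x y hc =>
    hcore x y (hc.mono (by omega))
  obtain ⟨Z', hZ', hn'⟩ := Finset.exists_subset_card_eq hcard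
  have hmin' := hsub Z' hZ' hn'.ge
  obtain ⟨hst, hIF⟩ := hF.isStaircase_of_isMin hk hk' hε (by omega) hcore hmin' hn' hsat'
  rw [phaseOne_spin, surfactant_spin hJW, surfactant_spin hI.1, Set.ncard_coe_finset,
    Set.ncard_coe_finset]
  refine ⟨hF.isQuasiOctagon_of_isMin hk hk' hε hst hcore' hIF hmin' hn' hsat', hcard,
    ⟨spin I Z', ?_, ?_, phaseOne_spin I Z'⟩, fun hcor => ?_⟩
  · exact hmin.of_fn_le hε hk' hζ hne hJW hI.1 hmin'.1 (hκ ▸ hmin'.2 I Z hI.1)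
  · rw [surfactant_spin hmin'.1, Set.ncard_coe_finset, hn']
  · refine le_antisymm (not_lt.1 fun hn => ?_) hcard
    have hZ : Z ⊆ ocr I := fun z hz => mem_ocr_of_nb hst (fun hzI => Finset.disjoint_left.1 hI.1 hzI hz)
      (hI.nb_eq_two hk hk' le_rfl hε hne hdp (by omega) hd1 hn hz).1
    have hZW : Z ⊆ W := fun z hz => Finset.mem_coe.1 (hcor (hq.staircase.ocr_subset_outerCorners
      (hF.subset_ocr_of_isMin hk hk' hε hst hcore' hIF hsub hn hZ hz)))
    exact absurd (Finset.card_le_card hZW) (by omega)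

end Surfactant

theorem proposition4p3 (k ζ R c : ℝ) (hk : 1 / 3 < k) (hk' : k < 1) (hζ : 0 < ζ)
    (hR : 0 < R) (hc : 0 < c) :
    (ζ < 1 / (4 * k) →
      ∃ ε₀ : ℝ, 0 < ε₀ ∧ ∀ ε : ℝ, 0 < ε → ε ≤ ε₀ →
        ∀ u₀ u₁ : Surfactant.Config, Surfactant.Admissible u₀ →
          Surfactant.AssumptionH R c ε (Surfactant.phaseOne u₀) →
          Surfactant.IsMinimizer ε k ζ 2 u₀ u₁ →
            (Surfactant.surfactant u₁).ncard = (Surfactant.surfactant u₀).ncard ∧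
            ∀ γ : ℝ, 0 < γ → γ < 2 → Surfactant.IsMinimizer ε k ζ γ u₀ u₁) ∧
    (ζ = 1 / (4 * k) →
      ∀ μ : ℝ, μ < 1 / 4 →
      ∃ ε₀ : ℝ, 0 < ε₀ ∧ ∀ ε : ℝ, 0 < ε → ε ≤ ε₀ →
        ∀ u₀ : Surfactant.Config, Surfactant.Admissible u₀ →
          Surfactant.AssumptionH R c ε (Surfactant.phaseOne u₀) →
          Surfactant.IsQuasiOctagon (Surfactant.phaseOne u₀) →
          ((Surfactant.surfactant u₀).ncard : ℝ) + 8 * ε ^ (μ - 1) <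
            ((Surfactant.outerBdry (Surfactant.phaseOne u₀)).ncard : ℝ) →
          ∀ u₁ : Surfactant.Config, Surfactant.IsMinimizer ε k ζ 2 u₀ u₁ →
            Surfactant.IsQuasiOctagon (Surfactant.phaseOne u₁) ∧
            (Surfactant.surfactant u₀).ncard ≤ (Surfactant.surfactant u₁).ncard ∧
            (∃ v : Surfactant.Config, Surfactant.IsMinimizer ε k ζ 2 u₀ v ∧
              (Surfactant.surfactant v).ncard = (Surfactant.surfactant u₀).ncard ∧
              Surfactant.phaseOne v = Surfactant.phaseOne u₁) ∧
            (Surfactant.outerCorners (Surfactant.phaseOne u₀) ⊆ Surfactant.surfactant u₀ →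
              (Surfactant.surfactant u₁).ncard = (Surfactant.surfactant u₀).ncard)) := by
  refine ⟨fun hlt => ?_, fun heq μ hμ => Surfactant.isQuasiOctagon_of_eq hk hk' hζ hR hc heq hμ⟩
  obtain ⟨ε₀, h0, h⟩ := Surfactant.card_eq_of_lt hk hk' hζ hR hc hlt
  refine ⟨ε₀, h0, fun ε hε hε0 u₀ u₁ hu₀ hH hu => ?_⟩
  have hcard := (h ε hε hε0).2 u₀ u₁ hu₀ hH hu
  exact ⟨hcard, fun γ _ hγ => hu.of_exponent hε (h ε hε hε0).1 hγ hcard⟩
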